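/- Let $\Bbbk$ be a commutative ring, $k\in\mathbb Z$, and let $F_1,\dots,F_n$ be Frobenius $\Bbbk$-algebras with symmetric trace: each $F_i$ is free over $\Bbbk$ with a finite basis $B_i$, and carries a $\Bbbk$-linear map $\operatorname{tr}_i\colon F_i\to\Bbbk$ with $\operatorname{tr}_i(fg)=\operatorname{tr}_i(gf)$ such that $f\mapsto\operatorname{tr}_i(f\,\cdot\,)$ is a bijection $F_i\to\operatorname{Hom}_\Bbbk(F_i,\Bbbk)$. Let $F=F_1\oplus\dots\oplus F_n$ (componentwise product) with trace $\operatorname{tr}(f_1,\dots,f_n)=\sum_i\operatorname{tr}_i(f_i)$ and basis $B=B_1\cup\dots\cup B_n$, and let $e_i\in F$ be the unit of $F_i$. For a Frobenius algebra $F$ with symmetric trace and finite basis $B$, let $\{b^\vee\}_{b\in B}$ be the left dual basis, $\operatorname{tr}(a^\vee b)=\delta_{a,b}$. The Frobenius Heisenberg category $\mathcal{H}eis_{F,k}$ is the strict $\Bbbk$-linear monoidal category with generating objects $Q_+,Q_-$ and generating morphisms $x\colon Q_+\to Q_+$, $s\colon Q_+Q_+\to Q_+Q_+$, $c\colon\mathbb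 1\to Q_-Q_+$, $d\colon Q_+Q_-\to\mathbb 1$, $\beta(f)\colon Q_+\to Q_+$ ($f\in F$), subject to the following relations (we write $1$ for the identities of $Q_\pm$): (1) $f\mapsto\beta(f)$ is a homomorphism of $\Bbbk$-algebras $F\to\operatorname{End}(Q_+)$; $s^2=\mathrm{id}$; $(s\otimes1)(1\otimes s)(s\otimes1)=(1\otimes s)(s\otimes1)(1\otimes s)$; $x\,\beta(f)=\beta(f)\,x$; $s\,(\beta(f)\otimes1)=(1\otimes\beta(f))\,s$; $(x\otimes1)\,s-s\,(1\otimes x)=\sum_{b\in B}\beta(b^\vee)\otimes\beta(b)$; (2) $(d\otimes1)(1\otimes c)=\mathrm{id}_{Q_+}$ and $(1\otimes d)(c\otimes1)=\mathrm{id}_{Q_-}$; (3) with $t=(1\otimes1\otimes d)(1\otimes s\otimes1)(c\otimes1\otimes1)\colon Q_+Q_-\to Q_-Q_+$, the following matrix of morphisms is invertible in the additive envelope (that is, the entries of a two-sided inverse are adjoined as further generators): if $k\ge0$, the column $Q_+Q_-\to Q_-Q_+\oplus\mathbb 1^{\oplus k|B|}$ with entries $t$ and $d\,(x^r\beta(b^\vee)\otimes1)$,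 $0\le r<k$, $b\in B$; if $k<0$, the row $Q_+Q_-\oplus\mathbb 1^{\oplus(-k)|B|}\to Q_-Q_+$ with entries $t$ and $(1\otimes x^r\beta(b^\vee))\,c$, $0\le r<-k$, $b\in B$. For $f\in F$ put $\beta'(f)=(1\otimes d)(1\otimes\beta(f)\otimes1)(c\otimes1)\colon Q_-\to Q_-$. For $F=F_1\oplus\dots\oplus F_n$, let $PK(\mathcal{H}eis_{F,k})$ be the partial Karoubi envelope with respect to $\mathcal I=\{\beta(e_1),\dots,\beta(e_n),\beta'(e_1),\dots,\beta'(e_n)\}$, i.e. the full subcategory of the Karoubi envelope of $\mathcal{H}eis_{F,k}$ on the objects $(D_1\otimes\dots\otimes D_m,\ \epsilon_1\otimes\dots\otimes \epsilon_m)$ with $m\ge0$ and $\epsilon_j\colon D_j\to D_j$ in $\mathcal I$ (for $m=0$: $(\mathbb 1,\mathrm{id}_{\mathbb 1})$). Let $\mathcal{H}eis_{F_1,k}\otimes\dots\otimes\mathcal{H}eis_{F_n,k}$ be the category whose objects are the tuples $(X_1,\dots,X_n)$, $X_i\in\mathcal{H}eis_{F_i,k}$, whose morphisms $(X_i)\to(Y_i)$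 are the elements of $\bigotimes_{i}\operatorname{Hom}_{\mathcal{H}eis_{F_i,k}}(X_i,Y_i)$ (tensor product over $\Bbbk$), and whose composition is the bilinear extension of the componentwise composition of simple tensors. Then the $\Bbbk$-linear categories $PK(\mathcal{H}eis_{F,k})$ and $\mathcal{H}eis_{F_1,k}\otimes\dots\otimes\mathcal{H}eis_{F_n,k}$ are equivalent: there is a $\Bbbk$-linear equivalence of categories between them. -/

import Mathlib

open CategoryTheory

universe u v w

namespace FrobHeis

/-! ### Strict linear monoidal categories by generators and relations

The objects are the words in an alphabet `S` (tensor product is concatenation, the unit object is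
the empty word).  Morphisms are formal expressions in the generators, modulo the smallest
congruence that contains the laws of a strict `R`-linear monoidal category and the given
relations. -/

section Presentation

variable (R : Type u) {S : Type} (G : List S → List S → Type v)

/-- Formal morphism expressions in the generators `G`. `comp f g` is "first `f`, then `g`". -/
inductive Tm : List S → List S → Type (max u v)
  | gen {a b : List S} (g : G a b) : Tm a b
  | id (a : List S) : Tm a a
  | comp {a b c : List S} (f : Tm a b) (g : Tm b c) : Tm a c
  | tensor {a b c d : List S} (f : Tm a b) (g : Tm c d) : Tm (a ++ c) (b ++ d)
  | zero (a b : List S) : Tm a b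
  | add {a b : List S} (f g : Tm a b) : Tm a b
  | smul {a b : List S} (r : R) (f : Tm a b) : Tm a b

namespace Tm

variable {R G}

/-- Transport along equalities of words. -/
def cast {a b a' b' : List S} (ha : a = a') (hb : b = b') (f : Tm R G a b) : Tm R G a' b' :=
  ha ▸ hb ▸ f

/-- A formal finite sum; its class does not depend on the order of the summands. -/
noncomputable def sum {κ : Type w} [Fintype κ] {a b : List S} (f : κ → Tm R G a b) : Tm R G a b :=
  (Finset.univ.toList.map f).foldr add (zero a b)

/-- The `m`-th power of a formal endomorphism. -/
def pow {a : List S} (f : Tm R G a a) : ℕ → Tm R G a a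
  | 0 => id a
  | m + 1 => comp (pow f m) f

end Tm

variable {R G} [CommRing R]

/-- The congruence generated by the laws of strict `R`-linear monoidal categories and the
relations `E`. -/
inductive Cong (E : ∀ a b : List S, Tm R G a b → Tm R G a b → Prop) :
    ∀ a b : List S, Tm R G a b → Tm R G a b → Prop
  -- the imposed relations
  | rel {a b} {f g : Tm R G a b} : E a b f g → Cong E a b f g
  -- equivalence relation
  | refl {a b} (f : Tm R G a b) : Cong E a b f f
  | symm {a b} {f g : Tm R G a b} : Cong E a b f g → Cong E a b g f
  | trans {a b} {f g h : Tm R G a b} : Cong E a b f g → Cong E a b g h → Cong E a b f h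
  -- compatibility with the operations
  | congr_comp {a b c} {f f' : Tm R G a b} {g g' : Tm R G b c} :
      Cong E a b f f' → Cong E b c g g' → Cong E a c (f.comp g) (f'.comp g')
  | congr_tensor {a b c d} {f f' : Tm R G a b} {g g' : Tm R G c d} :
      Cong E a b f f' → Cong E c d g g' →
        Cong E (a ++ c) (b ++ d) (f.tensor g) (f'.tensor g')
  | congr_add {a b} {f f' g g' : Tm R G a b} :
      Cong E a b f f' → Cong E a b g g' → Cong E a b (f.add g) (f'.add g')
  | congr_smul {a b} (r : R) {f f' : Tm R G a b} :
      Cong E a b f f' → Cong E a b (f.smul r) (f'.smul r)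
  -- `R`-module laws
  | add_assoc {a b} (f g h : Tm R G a b) :
      Cong E a b ((f.add g).add h) (f.add (g.add h))
  | add_comm {a b} (f g : Tm R G a b) : Cong E a b (f.add g) (g.add f)
  | zero_add {a b} (f : Tm R G a b) : Cong E a b ((Tm.zero a b).add f) f
  | one_smul {a b} (f : Tm R G a b) : Cong E a b (f.smul 1) f
  | mul_smul {a b} (r s : R) (f : Tm R G a b) :
      Cong E a b (f.smul (r * s)) ((f.smul s).smul r)
  | smul_add {a b} (r : R) (f g : Tm R G a b) :
      Cong E a b ((f.add g).smul r) ((f.smul r).add (g.smul r))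
  | add_smul {a b} (r s : R) (f : Tm R G a b) :
      Cong E a b (f.smul (r + s)) ((f.smul r).add (f.smul s))
  | zero_smul {a b} (f : Tm R G a b) : Cong E a b (f.smul 0) (Tm.zero a b)
  -- category laws
  | id_comp {a b} (f : Tm R G a b) : Cong E a b ((Tm.id a).comp f) f
  | comp_id {a b} (f : Tm R G a b) : Cong E a b (f.comp (Tm.id b)) f
  | comp_assoc {a b c d} (f : Tm R G a b) (g : Tm R G b c) (h : Tm R G c d) :
      Cong E a d ((f.comp g).comp h) (f.comp (g.comp h))
  -- composition is bilinear
  | add_comp {a b c} (f f' : Tm R G a b) (g : Tm R G b c) :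
      Cong E a c ((f.add f').comp g) ((f.comp g).add (f'.comp g))
  | comp_add {a b c} (f : Tm R G a b) (g g' : Tm R G b c) :
      Cong E a c (f.comp (g.add g')) ((f.comp g).add (f.comp g'))
  | smul_comp {a b c} (r : R) (f : Tm R G a b) (g : Tm R G b c) :
      Cong E a c ((f.smul r).comp g) ((f.comp g).smul r)
  | comp_smul {a b c} (r : R) (f : Tm R G a b) (g : Tm R G b c) :
      Cong E a c (f.comp (g.smul r)) ((f.comp g).smul r)
  -- the tensor product is a bilinear bifunctor
  | tensor_id (a b : List S) :
      Cong E (a ++ b) (a ++ b) ((Tm.id a).tensor (Tm.id b)) (Tm.id (a ++ b))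
  | tensor_comp {a b c a' b' c'} (f : Tm R G a b) (g : Tm R G b c)
      (f' : Tm R G a' b') (g' : Tm R G b' c') :
      Cong E (a ++ a') (c ++ c') ((f.comp g).tensor (f'.comp g'))
        ((f.tensor f').comp (g.tensor g'))
  | add_tensor {a b c d} (f f' : Tm R G a b) (g : Tm R G c d) :
      Cong E (a ++ c) (b ++ d) ((f.add f').tensor g) ((f.tensor g).add (f'.tensor g))
  | tensor_add {a b c d} (f : Tm R G a b) (g g' : Tm R G c d) :
      Cong E (a ++ c) (b ++ d) (f.tensor (g.add g')) ((f.tensor g).add (f.tensor g'))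
  | smul_tensor {a b c d} (r : R) (f : Tm R G a b) (g : Tm R G c d) :
      Cong E (a ++ c) (b ++ d) ((f.smul r).tensor g) ((f.tensor g).smul r)
  | tensor_smul {a b c d} (r : R) (f : Tm R G a b) (g : Tm R G c d) :
      Cong E (a ++ c) (b ++ d) (f.tensor (g.smul r)) ((f.tensor g).smul r)
  -- strict associativity and unitality of the tensor product
  | tensor_assoc {a b c d a' b'} (f : Tm R G a b) (g : Tm R G c d) (h : Tm R G a' b') :
      Cong E (a ++ (c ++ a')) (b ++ (d ++ b'))
        (((f.tensor g).tensor h).cast (List.append_assoc a c a') (List.append_assoc b d b'))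
        (f.tensor (g.tensor h))
  | one_tensor {a b} (f : Tm R G a b) : Cong E a b ((Tm.id []).tensor f) f
  | tensor_one {a b} (f : Tm R G a b) :
      Cong E a b ((f.tensor (Tm.id [])).cast (List.append_nil a) (List.append_nil b)) f

variable (E : ∀ a b : List S, Tm R G a b → Tm R G a b → Prop)

/-- The congruence as a setoid. -/
@[reducible] def congSetoid (a b : List S) : Setoid (Tm R G a b) :=
  ⟨Cong E a b, Cong.refl, Cong.symm, Cong.trans⟩

/-- Objects of the presented strict monoidal category: words in the generating objects. -/
structure Pres {R : Type u} {S : Type} {G : List S → List S → Type v} [CommRing R]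
    (E : ∀ a b : List S, Tm R G a b → Tm R G a b → Prop) where
  /-- the underlying word -/
  word : List S

namespace Pres

variable {E}

/-- Morphisms of the presented category. -/
def Hom (X Y : Pres E) : Type (max u v) := _root_.Quotient (congSetoid E X.word Y.word)

/-- The morphism represented by an expression. -/
def homMk {a b : List S} (f : Tm R G a b) : Hom (E := E) ⟨a⟩ ⟨b⟩ := _root_.Quotient.mk _ f

instance : Category (Pres E) where
  Hom := Hom
  id X := _root_.Quotient.mk _ (Tm.id X.word)
  comp f g := _root_.Quotient.map₂ Tm.comp (fun _ _ h _ _ h' => Cong.congr_comp h h') f g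
  id_comp f := _root_.Quotient.inductionOn f fun f => _root_.Quotient.sound (Cong.id_comp f)
  comp_id f := _root_.Quotient.inductionOn f fun f => _root_.Quotient.sound (Cong.comp_id f)
  assoc f g h := _root_.Quotient.inductionOn₃ f g h fun f g h => _root_.Quotient.sound (Cong.comp_assoc f g h)

instance (X Y : Pres E) : Add (X ⟶ Y) where
  add f g := _root_.Quotient.map₂ Tm.add (fun _ _ h _ _ h' => Cong.congr_add h h') f g

instance (X Y : Pres E) : Zero (X ⟶ Y) where
  zero := _root_.Quotient.mk _ (Tm.zero X.word Y.word)

instance (X Y : Pres E) : Neg (X ⟶ Y) where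
  neg f := _root_.Quotient.map (Tm.smul (-1)) (fun _ _ h => Cong.congr_smul _ h) f

instance (X Y : Pres E) : AddCommGroup (X ⟶ Y) where
  add_assoc f g h := _root_.Quotient.inductionOn₃ f g h fun f g h => _root_.Quotient.sound (Cong.add_assoc f g h)
  zero_add f := _root_.Quotient.inductionOn f fun f => _root_.Quotient.sound (Cong.zero_add f)
  add_zero f := _root_.Quotient.inductionOn f fun f =>
    _root_.Quotient.sound ((Cong.add_comm _ _).trans (Cong.zero_add f))
  add_comm f g := _root_.Quotient.inductionOn₂ f g fun f g => _root_.Quotient.sound (Cong.add_comm f g)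
  neg_add_cancel f := _root_.Quotient.inductionOn f fun f => _root_.Quotient.sound <| by
    refine Cong.trans (Cong.congr_add (Cong.refl _) (Cong.symm (Cong.one_smul f))) ?_
    refine Cong.trans (Cong.symm (Cong.add_smul (-1) 1 f)) ?_
    rw [neg_add_cancel]
    exact Cong.zero_smul f
  nsmul := nsmulRec
  zsmul := zsmulRec

instance (X Y : Pres E) : Module R (X ⟶ Y) where
  smul r f := _root_.Quotient.map (Tm.smul r) (fun _ _ h => Cong.congr_smul _ h) f
  one_smul f := _root_.Quotient.inductionOn f fun f => _root_.Quotient.sound (Cong.one_smul f)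
  mul_smul r s f := _root_.Quotient.inductionOn f fun f => _root_.Quotient.sound (Cong.mul_smul r s f)
  smul_zero r := _root_.Quotient.sound <|
    (Cong.congr_smul r (Cong.symm (Cong.zero_smul (Tm.zero X.word Y.word)))).trans <|
      (Cong.symm (Cong.mul_smul r 0 _)).trans <| by rw [mul_zero]; exact Cong.zero_smul _
  smul_add r f g := _root_.Quotient.inductionOn₂ f g fun f g => _root_.Quotient.sound (Cong.smul_add r f g)
  add_smul r s f := _root_.Quotient.inductionOn f fun f => _root_.Quotient.sound (Cong.add_smul r s f)
  zero_smul f := _root_.Quotient.inductionOn f fun f => _root_.Quotient.sound (Cong.zero_smul f)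

instance : Preadditive (Pres E) where
  homGroup _ _ := inferInstance
  add_comp _ _ _ f f' g := _root_.Quotient.inductionOn₃ f f' g fun f f' g =>
    _root_.Quotient.sound (Cong.add_comp f f' g)
  comp_add _ _ _ f g g' := _root_.Quotient.inductionOn₃ f g g' fun f g g' =>
    _root_.Quotient.sound (Cong.comp_add f g g')

instance : Linear R (Pres E) where
  homModule _ _ := inferInstance
  smul_comp _ _ _ r f g := _root_.Quotient.inductionOn₂ f g fun f g =>
    _root_.Quotient.sound (Cong.smul_comp r f g)
  comp_smul _ _ _ f r g := _root_.Quotient.inductionOn₂ f g fun f g =>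
    _root_.Quotient.sound (Cong.comp_smul r f g)

/-- The unit object. -/
def one : Pres E := ⟨[]⟩

/-- Tensor product of objects. -/
def tensorObj (X Y : Pres E) : Pres E := ⟨X.word ++ Y.word⟩

/-- Tensor product of morphisms. -/
def tensorHom {X Y X' Y' : Pres E} (f : X ⟶ Y) (g : X' ⟶ Y') :
    tensorObj X X' ⟶ tensorObj Y Y' :=
  _root_.Quotient.map₂ Tm.tensor (fun _ _ h _ _ h' => Cong.congr_tensor h h') f g

lemma tensorHom_comp {X Y Z X' Y' Z' : Pres E} (f : X ⟶ Y) (g : Y ⟶ Z) (f' : X' ⟶ Y')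
    (g' : Y' ⟶ Z') :
    tensorHom (f ≫ g) (f' ≫ g') = tensorHom f f' ≫ tensorHom g g' :=
  _root_.Quotient.inductionOn₂ f g fun f g => _root_.Quotient.inductionOn₂ f' g' fun f' g' =>
    _root_.Quotient.sound (Cong.tensor_comp f g f' g')

end Pres

end Presentation

/-! ### The partial Karoubi envelope -/

section PartialKaroubi

open Idempotents

/-- The Karoubi envelope of an `R`-linear category is `R`-linear. -/
instance karoubiLinear {R : Type u} [CommRing R] {C : Type w} [Category.{v} C] [Preadditive C]
    [Linear R C] : Linear R (Karoubi C) where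
  homModule P Q :=
    { smul := fun r f => ⟨r • f.f, by
        simpa only [Linear.smul_comp, Linear.comp_smul] using congrArg (r • ·) f.comm⟩
      one_smul := fun f => Karoubi.hom_ext _ _ (one_smul R f.f)
      mul_smul := fun r s f => Karoubi.hom_ext _ _ (mul_smul r s f.f)
      smul_zero := fun r => Karoubi.hom_ext _ _ (smul_zero r)
      smul_add := fun r f g => Karoubi.hom_ext _ _ (smul_add r f.f g.f)
      add_smul := fun r s f => Karoubi.hom_ext _ _ (add_smul r s f.f)
      zero_smul := fun f => Karoubi.hom_ext _ _ (zero_smul R f.f) }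
  smul_comp _ _ _ r f g := Karoubi.hom_ext _ _ (Linear.smul_comp _ _ _ r f.f g.f)
  comp_smul _ _ _ f r g := Karoubi.hom_ext _ _ (Linear.comp_smul _ _ _ f.f r g.f)

variable {R : Type u} [CommRing R] {S : Type} {G : List S → List S → Type v}
  {E : ∀ a b : List S, Tm R G a b → Tm R G a b → Prop}

/-- `(D, e) ⊗ (D', e') = (D ⊗ D', e ⊗ e')` in the Karoubi envelope. -/
def karoubiTensor (P Q : Karoubi (Pres E)) : Karoubi (Pres E) where
  X := P.X.tensorObj Q.X
  p := Pres.tensorHom P.p Q.p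
  idem := by rw [← Pres.tensorHom_comp, P.idem, Q.idem]

/-- For a collection `I` of idempotents: the objects `(D₁ ⊗ ⋯ ⊗ Dₘ, e₁ ⊗ ⋯ ⊗ eₘ)`, `m ≥ 0`, of the
Karoubi envelope, where `eᵢ : Dᵢ ⟶ Dᵢ` belongs to `I`. -/
inductive IsPartialKaroubi (I : ∀ D : Pres E, (D ⟶ D) → Prop) : Karoubi (Pres E) → Prop
  | one : IsPartialKaroubi I ⟨Pres.one, 𝟙 _, Category.comp_id _⟩
  | tensor (P Q : Karoubi (Pres E)) :
      I P.X P.p → IsPartialKaroubi I Q → IsPartialKaroubi I (karoubiTensor P Q)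

/-- The partial Karoubi envelope with respect to `I`: the full subcategory of the Karoubi envelope
on the objects above. -/
abbrev PartialKaroubi (I : ∀ D : Pres E, (D ⟶ D) → Prop) :=
  ObjectProperty.FullSubcategory (IsPartialKaroubi I)

end PartialKaroubi

/-! ### Tensor products of linear categories -/

section TensorProduct

open scoped TensorProduct

/-- The tensor product `C₁ ⊗ ⋯ ⊗ Cₙ`: objects are tuples of objects. -/
structure TensorCat (R : Type u) {n : ℕ} (C : Fin n → Type w) where
  /-- the components of a tuple -/
  obj : ∀ i, C i

variable {R : Type u} [CommRing R] {n : ℕ} {C : Fin n → Type w}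
  [∀ i, Category.{v} (C i)] [∀ i, Preadditive (C i)] [∀ i, Linear R (C i)]

namespace TensorCat

/-- Morphisms are the tensor products of the modules of morphisms. -/
abbrev Hom (X Y : TensorCat R C) := ⨂[R] i, (X.obj i ⟶ Y.obj i)

/-- Composition, `(⨂ fᵢ, ⨂ gᵢ) ↦ ⨂ (fᵢ ≫ gᵢ)`, extended bilinearly. -/
noncomputable def compL (X Y Z : TensorCat R C) : Hom X Y →ₗ[R] Hom Y Z →ₗ[R] Hom X Z :=
  PiTensorProduct.map₂ fun i => Linear.comp (S := R) (X.obj i) (Y.obj i) (Z.obj i)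

lemma compL_tprod {X Y Z : TensorCat R C} (f : ∀ i, X.obj i ⟶ Y.obj i)
    (g : ∀ i, Y.obj i ⟶ Z.obj i) :
    compL X Y Z (PiTensorProduct.tprod R f) (PiTensorProduct.tprod R g) =
      PiTensorProduct.tprod R fun i => f i ≫ g i := by
  simp [compL, PiTensorProduct.map₂_tprod_tprod]

noncomputable instance : Category (TensorCat R C) where
  Hom := Hom
  id X := PiTensorProduct.tprod R fun i => 𝟙 (X.obj i)
  comp {X Y Z} f g := compL X Y Z f g
  id_comp {X Y} f := by
    induction f using PiTensorProduct.induction_on with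
    | smul_tprod r f => rw [map_smul, compL_tprod]; simp
    | add f g hf hg => rw [map_add, hf, hg]
  comp_id {X Y} f := by
    induction f using PiTensorProduct.induction_on with
    | smul_tprod r f => rw [map_smul, LinearMap.smul_apply, compL_tprod]; simp
    | add f g hf hg => rw [map_add, LinearMap.add_apply, hf, hg]
  assoc {X Y Z W} f g h := by
    induction f using PiTensorProduct.induction_on with
    | add f f' hf hf' => simp only [map_add, LinearMap.add_apply, hf, hf']
    | smul_tprod r f =>
      induction g using PiTensorProduct.induction_on with
      | add g g' hg hg' => simp only [map_add, LinearMap.add_apply, hg, hg']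
      | smul_tprod s g =>
        induction h using PiTensorProduct.induction_on with
        | add h h' hh hh' => simp only [map_add, hh, hh']
        | smul_tprod t h =>
          simp only [map_smul, LinearMap.smul_apply, compL_tprod, Category.assoc]

noncomputable instance (X Y : TensorCat R C) : AddCommGroup (X ⟶ Y) :=
  inferInstanceAs (AddCommGroup (Hom X Y))

noncomputable instance (X Y : TensorCat R C) : Module R (X ⟶ Y) :=
  inferInstanceAs (Module R (Hom X Y))

noncomputable instance : Preadditive (TensorCat R C) where
  homGroup _ _ := inferInstance
  add_comp X Y Z f f' g := by
    change compL X Y Z (f + f') g = compL X Y Z f g + compL X Y Z f' g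
    rw [map_add, LinearMap.add_apply]
  comp_add X Y Z f g g' := map_add (compL X Y Z f) g g'

noncomputable instance : Linear R (TensorCat R C) where
  homModule _ _ := inferInstance
  smul_comp X Y Z r f g := by
    change compL X Y Z (r • f) g = r • compL X Y Z f g
    rw [map_smul, LinearMap.smul_apply]
  comp_smul X Y Z f r g := map_smul (compL X Y Z f) r g

end TensorCat

end TensorProduct

/-! ### Frobenius algebras with symmetric trace -/

section Frobenius

/-- A Frobenius algebra structure with symmetric trace on `F`: a linear form `tr` with
`tr (f g) = tr (g f)` such that `f ↦ tr (f · -)` is a bijection from `F` to its dual module. -/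
structure SymmFrobenius (R : Type u) (F : Type v) [CommRing R] [Ring F] [Algebra R F] where
  /-- the trace -/
  tr : F →ₗ[R] R
  tr_mul_comm : ∀ f g, tr (f * g) = tr (g * f)
  bijective : Function.Bijective fun f : F => (tr ∘ₗ LinearMap.mulLeft R f : Module.Dual R F)

variable {R : Type u} [CommRing R]

/-- The left dual basis: the unique elements with `tr (dual b i * b j) = δ i j`. -/
noncomputable def SymmFrobenius.dual {F : Type v} [Ring F] [Algebra R F] (φ : SymmFrobenius R F)
    {ι : Type w} (b : Module.Basis ι R F) (i : ι) : F :=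
  (φ.bijective.surjective (b.coord i)).choose

lemma SymmFrobenius.tr_dual_mul {F : Type v} [Ring F] [Algebra R F] (φ : SymmFrobenius R F)
    {ι : Type w} (b : Module.Basis ι R F) (i j : ι) :
    φ.tr (φ.dual b i * b j) = b.coord i (b j) :=
  LinearMap.congr_fun (φ.bijective.surjective (b.coord i)).choose_spec (b j)

/-- The direct sum `F₁ ⊕ ⋯ ⊕ Fₙ` with trace `(f₁, …, fₙ) ↦ ∑ trᵢ fᵢ`. -/
def SymmFrobenius.directSum {n : ℕ} {F : Fin n → Type v} [∀ i, Ring (F i)] [∀ i, Algebra R (F i)]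
    (φ : ∀ i, SymmFrobenius R (F i)) : SymmFrobenius R (∀ i, F i) where
  tr := ∑ i, (φ i).tr ∘ₗ LinearMap.proj i
  tr_mul_comm f g := by simp [fun i => (φ i).tr_mul_comm (f i) (g i)]
  bijective := by
    constructor
    · intro f g h
      funext i
      refine (φ i).bijective.injective (LinearMap.ext fun x => ?_)
      have := LinearMap.congr_fun h (Pi.single i x)
      have key : ∀ f : ∀ i, F i, (∑ j, (φ j).tr (f j * Pi.single i x j)) = (φ i).tr (f i * x) := by
        intro f
        rw [Finset.sum_eq_single i (fun j _ hj => by simp [hj]) (by simp), Pi.single_eq_same]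
      simpa [key] using this
    · intro l
      choose f hf using fun i => (φ i).bijective.surjective (l ∘ₗ LinearMap.single R F i)
      refine ⟨f, LinearMap.ext fun x => ?_⟩
      have h : ∀ i, (φ i).tr (f i * x i) = l (Pi.single i (x i)) := fun i =>
        LinearMap.congr_fun (hf i) (x i)
      simp only [LinearMap.comp_apply, LinearMap.sum_apply, LinearMap.proj_apply,
        LinearMap.mulLeft_apply, Pi.mul_apply, h]
      rw [← map_sum, Finset.univ_sum_single]

end Frobenius

/-! ### The Frobenius Heisenberg category -/

section Heisenberg

/-- The generating objects `Q₊` (`up`) and `Q₋` (`down`). -/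
inductive Strand : Type
  | up
  | down

open Strand

/-- The generating morphisms.  Besides the dot `x`, the upward crossing `s`, the right cup `c`, the
right cap `d` and the tokens, there are the entries of the two-sided inverse required by the
inversion relation: the left crossing `leftCross`, the decorated left cups (present if `k > 0`) and the
decorated left caps (present if `k < 0`). -/
inductive HeisGen (F : Type v) (ι : Type w) (k : ℤ) : List Strand → List Strand → Type (max v w)
  | x : HeisGen F ι k [up] [up]
  | s : HeisGen F ι k [up, up] [up, up]
  | c : HeisGen F ι k [] [down, up]
  | d : HeisGen F ι k [up, down] []
  | token (f : F) : HeisGen F ι k [up] [up]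
  | leftCross : HeisGen F ι k [down, up] [up, down]
  | leftCup (r : Fin k.toNat) (b : ι) : HeisGen F ι k [] [up, down]
  | leftCap (r : Fin (-k).toNat) (b : ι) : HeisGen F ι k [down, up] []

namespace HeisTm

variable (R : Type u) {F : Type v} (ι : Type w) (k : ℤ)

/-- Formal morphism expressions of the Heisenberg category. -/
abbrev T (F : Type v) (ι : Type w) (k : ℤ) (a b : List Strand) := Tm R (HeisGen F ι k) a b

/-- the dot -/
abbrev x : T R F ι k [up] [up] := .gen .x
/-- the upward crossing -/
abbrev s : T R F ι k [up, up] [up, up] := .gen .s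
/-- the right cup -/
abbrev c : T R F ι k [] [down, up] := .gen .c
/-- the right cap -/
abbrev d : T R F ι k [up, down] [] := .gen .d
/-- the token `β_f` on an upward strand -/
abbrev token (f : F) : T R F ι k [up] [up] := .gen (.token f)
/-- the left crossing -/
abbrev leftCross : T R F ι k [down, up] [up, down] := .gen .leftCross
/-- the decorated left cups -/
abbrev leftCup (r : Fin k.toNat) (b : ι) : T R F ι k [] [up, down] := .gen (.leftCup r b)
/-- the decorated left caps -/
abbrev leftCap (r : Fin (-k).toNat) (b : ι) : T R F ι k [down, up] [] := .gen (.leftCap r b)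
/-- the identity of `Q₊` -/
abbrev idUp : T R F ι k [up] [up] := .id [up]
/-- the identity of `Q₋` -/
abbrev idDown : T R F ι k [down] [down] := .id [down]

/-- The right crossing `t : Q₊Q₋ → Q₋Q₊`, obtained from `s` by rotation with `c` and `d`:
`Q₊Q₋ → (Q₋Q₊)Q₊Q₋ → Q₋(Q₊Q₊)Q₋ → Q₋Q₊(Q₊Q₋) → Q₋Q₊`. -/
def t : T R F ι k [up, down] [down, up] :=
  ((c R ι k).tensor (.id [up, down])).comp
    ((((idDown R ι k).tensor (s R ι k)).tensor (idDown R ι k)).comp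
      ((Tm.id [down, up]).tensor (d R ι k)))

/-- The token `β'_f` on a downward strand, obtained from `β_f` by rotation with `c` and `d`. -/
def downToken (f : F) : T R F ι k [down] [down] :=
  ((c R ι k).tensor (idDown R ι k)).comp
    ((((idDown R ι k).tensor (token R ι k f)).tensor (idDown R ι k)).comp
      ((idDown R ι k).tensor (d R ι k)))

/-- The right cap with a token `f` and `r` dots on its left leg. -/
def rightCap (r : ℕ) (f : F) : T R F ι k [up, down] [] :=
  (((token R ι k f).comp ((x R ι k).pow r)).tensor (idDown R ι k)).comp (d R ι k)

/-- The right cup with a token `f` and `r` dots on its right leg. -/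
def rightCup (r : ℕ) (f : F) : T R F ι k [] [down, up] :=
  (c R ι k).comp ((idDown R ι k).tensor ((token R ι k f).comp ((x R ι k).pow r)))

end HeisTm

variable {R : Type u} [CommRing R] {F : Type v} [Ring F] [Algebra R F] {ι : Type w} [Fintype ι]

open HeisTm in
/-- The defining relations of the Frobenius Heisenberg category of the Frobenius algebra `F` with
trace `φ.tr` and basis `b`, of central charge `k`. -/
inductive HeisRel (φ : SymmFrobenius R F) (b : Module.Basis ι R F) (k : ℤ) :
    ∀ a a' : List Strand, T R F ι k a a' → T R F ι k a a' → Prop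
  -- `f ↦ β_f` is a homomorphism of `R`-algebras
  | token_one : HeisRel φ b k _ _ (token R ι k 1) (idUp R ι k)
  | token_mul (f g : F) : HeisRel φ b k _ _
      (token R ι k (f * g)) ((token R ι k g).comp (token R ι k f))
  | token_add (f g : F) : HeisRel φ b k _ _
      (token R ι k (f + g)) ((token R ι k f).add (token R ι k g))
  | token_smul (r : R) (f : F) : HeisRel φ b k _ _
      (token R ι k (r • f)) ((token R ι k f).smul r)
  -- the other affine wreath product algebra relations
  | braid : HeisRel φ b k [up, up, up] [up, up, up]
      (((s R ι k).tensor (idUp R ι k)).comp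
        (((idUp R ι k).tensor (s R ι k)).comp ((s R ι k).tensor (idUp R ι k))))
      (((idUp R ι k).tensor (s R ι k)).comp
        (((s R ι k).tensor (idUp R ι k)).comp ((idUp R ι k).tensor (s R ι k))))
  | double_cross : HeisRel φ b k _ _ ((s R ι k).comp (s R ι k)) (.id [up, up])
  | dot_token (f : F) : HeisRel φ b k _ _
      ((x R ι k).comp (token R ι k f)) ((token R ι k f).comp (x R ι k))
  | token_slide (f : F) : HeisRel φ b k _ _
      (((token R ι k f).tensor (idUp R ι k)).comp (s R ι k))
      ((s R ι k).comp ((idUp R ι k).tensor (token R ι k f)))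
  | dot_slide : HeisRel φ b k _ _
      ((s R ι k).comp ((x R ι k).tensor (idUp R ι k)))
      ((((idUp R ι k).tensor (x R ι k)).comp (s R ι k)).add
        (.sum fun i : ι => (token R ι k (φ.dual b i)).tensor (token R ι k (b i))))
  -- the right adjunction relations
  | adj_up : HeisRel φ b k [up] [up]
      (((idUp R ι k).tensor (c R ι k)).comp ((d R ι k).tensor (idUp R ι k))) (idUp R ι k)
  | adj_down : HeisRel φ b k [down] [down]
      (((c R ι k).tensor (idDown R ι k)).comp ((idDown R ι k).tensor (d R ι k))) (idDown R ι k)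
  -- the inversion relation: if `k ≥ 0`, the matrix `[t, rightCap r (b i)ᵛ]ᵀ` has the two-sided
  -- inverse `[leftCross, leftCup r i]`; if `k < 0`, the matrix `[t, rightCup r (b i)ᵛ]` has the two-sided
  -- inverse `[leftCross, leftCap r i]ᵀ` (one of the two index sets of `r` is always empty)
  | inv_up_down : HeisRel φ b k _ _
      (((t R ι k).comp (leftCross R ι k)).add
        (.sum fun p : Fin k.toNat × ι =>
          (rightCap R ι k p.1 (φ.dual b p.2)).comp (leftCup R ι k p.1 p.2)))
      (.id [up, down])
  | inv_down_up : HeisRel φ b k _ _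
      (((leftCross R ι k).comp (t R ι k)).add
        (.sum fun p : Fin (-k).toNat × ι =>
          (leftCap R ι k p.1 p.2).comp (rightCup R ι k p.1 (φ.dual b p.2))))
      (.id [down, up])
  | leftCross_rightCap (r : Fin k.toNat) (i : ι) : HeisRel φ b k _ _
      ((leftCross R ι k).comp (rightCap R ι k r (φ.dual b i))) (.zero _ _)
  | leftCup_t (r : Fin k.toNat) (i : ι) : HeisRel φ b k _ _
      ((leftCup R ι k r i).comp (t R ι k)) (.zero _ _)
  | leftCup_rightCap (r : Fin k.toNat) (i : ι) : HeisRel φ b k _ _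
      ((leftCup R ι k r i).comp (rightCap R ι k r (φ.dual b i))) (.id [])
  | leftCup_rightCap_ne (r r' : Fin k.toNat) (i i' : ι) : (r, i) ≠ (r', i') → HeisRel φ b k _ _
      ((leftCup R ι k r i).comp (rightCap R ι k r' (φ.dual b i'))) (.zero _ _)
  | t_leftCap (r : Fin (-k).toNat) (i : ι) : HeisRel φ b k _ _
      ((t R ι k).comp (leftCap R ι k r i)) (.zero _ _)
  | rightCup_leftCross (r : Fin (-k).toNat) (i : ι) : HeisRel φ b k _ _
      ((rightCup R ι k r (φ.dual b i)).comp (leftCross R ι k)) (.zero _ _)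
  | rightCup_leftCap (r : Fin (-k).toNat) (i : ι) : HeisRel φ b k _ _
      ((rightCup R ι k r (φ.dual b i)).comp (leftCap R ι k r i)) (.id [])
  | rightCup_leftCap_ne (r r' : Fin (-k).toNat) (i i' : ι) : (r, i) ≠ (r', i') →
      HeisRel φ b k _ _
      ((rightCup R ι k r (φ.dual b i)).comp (leftCap R ι k r' i')) (.zero _ _)

/-- The Frobenius Heisenberg category `Heis_{F,k}`. -/
abbrev Heis (φ : SymmFrobenius R F) (b : Module.Basis ι R F) (k : ℤ) := Pres (HeisRel φ b k)

end Heisenberg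

/-! ### The direct sum case -/

section Sum

open Strand

variable {R : Type u} [CommRing R] {n : ℕ} {F : Fin n → Type v} [∀ i, Ring (F i)]
  [∀ i, Algebra R (F i)] {ι : Fin n → Type w} [∀ i, Fintype (ι i)]

/-- `Heis_{F,k}` for `F = F₁ ⊕ ⋯ ⊕ Fₙ` with the basis `B₁ ∪ ⋯ ∪ Bₙ`. -/
abbrev HeisSum (φ : ∀ i, SymmFrobenius R (F i)) (b : ∀ i, Module.Basis (ι i) R (F i)) (k : ℤ) :=
  Heis (SymmFrobenius.directSum φ) (Pi.basis b) k

/-- The idempotents `β(eᵢ) : Q₊ → Q₊` and `β'(eᵢ) : Q₋ → Q₋`, where `eᵢ` is the unit of `Fᵢ`. -/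
inductive ColorIdempotent (φ : ∀ i, SymmFrobenius R (F i)) (b : ∀ i, Module.Basis (ι i) R (F i))
    (k : ℤ) : ∀ D : HeisSum φ b k, (D ⟶ D) → Prop
  | up (i : Fin n) : ColorIdempotent φ b k ⟨[up]⟩
      (Pres.homMk (HeisTm.token R (Σ i, ι i) k (Pi.single i 1 : ∀ i, F i)))
  | down (i : Fin n) : ColorIdempotent φ b k ⟨[down]⟩
      (Pres.homMk (HeisTm.downToken R (Σ i, ι i) k (Pi.single i 1 : ∀ i, F i)))

/-- The partial Karoubi envelope of `Heis_{F,k}` with respect to the idempotents `β(eᵢ)`,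
`β'(eᵢ)`. -/
abbrev PKHeis (φ : ∀ i, SymmFrobenius R (F i)) (b : ∀ i, Module.Basis (ι i) R (F i)) (k : ℤ) :=
  PartialKaroubi (ColorIdempotent φ b k)

end Sum

end FrobHeis

namespace FrobHeis

/-! ### Total algebras

A strict linear monoidal category whose objects are the words in an alphabet has a total algebra,
the direct sum of its morphism modules.  Its ring multiplication is the tensor product, and it
carries the vertical composition `⊙` (zero on morphisms that are not composable).  Working there
turns the strict associativity of the tensor product into an honest equation. -/

/-! Call the index of a summand of F a colour. The units e_i are orthogonal idempotents with sum 1,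
so β(e_i) and β'(e_i) split every strand into coloured strands, and the objects of the partial
Karoubi envelope are exactly the words of coloured strands. Tokens slide through crossings and along
right cups and caps. Hence dots and tokens preserve the colour, right cups and caps join strands of
one colour, and crossings carry the colours along the strands. The entries of the inverse matrix in
the inversion relation are not given by formulas, but they respect colours as well, because the
inverse of a matrix that intertwines given morphisms intertwines them too (`cross_intertwine`,
`cup_intertwine`, `cap_intertwine`). So the diagrams of colour i satisfy the relations of
Heis_{F_i,k} (`HeisData.colorData`).

For two different colours all correction terms disappear: the two tokens in the dot slide relation
have one common colour, and so do the two ends of each decorated cup or cap in the inversion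
relation. Dots therefore pass freely through such crossings, and the crossings are invertible, in
all four orientations after rotation (`cross_cross`). Consequently every diagram of one colour
slides through any strand of another colour (`color_slides`).

The functor `sortFunctor` sends a tuple of words to the coloured word sorted by colour, and a pure
tensor of morphisms to their juxtaposition. It is an equivalence for three reasons.

Essential surjectivity: invertible crossings of differently coloured strands sort any coloured word
(`exists_sorted_iso`).

Fullness: a morphism between coloured words is a combination of diagrams in coloured generators
(`colorGen_eval`). Conjugation with the isomorphism that pulls all strands of colour m to the left
turns such a diagram into a sum of products f ⊗ q, with f of colour m and q free of it
(`ColorGen.split`). This is compatible with tensor products because q slides through strands of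
colour m. On sorted words that isomorphism is the identity, and an induction over the colours splits
the morphism completely (`ColorGen.mem_span`).

Faithfulness: no bases of morphism modules are needed. The shuffle product of the categories
Heis_{F_i,k} has coloured words as objects and, as morphisms, tensor products over the colours of
the morphisms between the monochromatic subwords. Crossings of different colours are tensor products
of identities there. Coloured generators together with such crossings add up to a solution of the
relations of Heis_{F,k} (`ColorFamily.toHeisData`), which gives a map from Heis_{F,k} to the shuffle
product. Composed with the sorting map it becomes the evident identification
(`lift_prod_colorEval`), so the sorting map is injective (`sortM_injective`).

All computations take place in total algebras, where coloured strands are elements rather than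
objects and where the interchange law only needs one pair of factors with matching lengths. -/

/-- The data of a strict linear monoidal category with objects the words in `S`. -/
structure WordData (R : Type u) [CommRing R] (S : Type) where
  /-- the modules of morphisms -/
  H : List S → List S → Type v
  [grp : ∀ a b, AddCommGroup (H a b)]
  [mod : ∀ a b, Module R (H a b)]
  /-- identities -/
  idm : ∀ a, H a a
  /-- composition -/
  comp : ∀ {a b c}, H a b →ₗ[R] H b c →ₗ[R] H a c
  /-- tensor product -/
  tens : ∀ {a b c d}, H a b →ₗ[R] H c d →ₗ[R] H (a ++ c) (b ++ d)

attribute [instance] WordData.grp WordData.mod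

namespace WordData

variable {R : Type u} [CommRing R] {S : Type}

/-- The total module. -/
def Total (D : WordData.{u, v} R S) : Type _ :=
  DirectSum (List S × List S) fun p => D.H p.1 p.2

variable (D : WordData.{u, v} R S)

noncomputable instance : AddCommGroup D.Total :=
  inferInstanceAs (AddCommGroup (DirectSum (List S × List S) fun p => D.H p.1 p.2))

noncomputable instance : Module R D.Total :=
  inferInstanceAs (Module R (DirectSum (List S × List S) fun p => D.H p.1 p.2))

variable {D}

open scoped Classical in
/-- The inclusion of a module of morphisms. -/
noncomputable def ofH {a b : List S} : D.H a b →ₗ[R] D.Total :=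
  DirectSum.lof R (List S × List S) (fun p => D.H p.1 p.2) (a, b)

/-- The projection to a module of morphisms. -/
noncomputable def proj (a b : List S) : D.Total →ₗ[R] D.H a b :=
  DirectSum.component R (List S × List S) (fun p => D.H p.1 p.2) (a, b)

@[simp]
lemma proj_ofH {a b : List S} (f : D.H a b) : proj a b (ofH f : D.Total) = f := by
  classical
  unfold proj ofH
  exact DirectSum.component.lof_self R (M := fun p : List S × List S => D.H p.1 p.2) (a, b) f

lemma ofH_injective {a b : List S} : Function.Injective (ofH : D.H a b → D.Total) :=
  Function.LeftInverse.injective (g := proj a b) proj_ofH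

lemma total_induction {P : D.Total → Prop} (h0 : P 0) (hof : ∀ {a b} (f : D.H a b), P (ofH f))
    (hadd : ∀ f g, P f → P g → P (f + g)) (f : D.Total) : P f := by
  classical
  refine DirectSum.induction_on f h0 ?_ hadd
  rintro ⟨a, b⟩ x
  exact hof (a := a) (b := b) x

open scoped Classical in
/-- A linear map out of the total module, from its restrictions. -/
noncomputable def desc {M : Type*} [AddCommGroup M] [Module R M]
    (φ : ∀ a b, D.H a b →ₗ[R] M) : D.Total →ₗ[R] M :=
  DirectSum.toModule R (List S × List S) M fun p => φ p.1 p.2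

@[simp]
lemma desc_ofH {M : Type*} [AddCommGroup M] [Module R M]
    (φ : ∀ a b, D.H a b →ₗ[R] M) {a b : List S} (f : D.H a b) : desc φ (ofH f) = φ a b f := by
  classical
  exact DirectSum.toModule_lof R (M := fun p : List S × List S => D.H p.1 p.2)
    (a, b) f

/-- Composition, as a map to the total module, along an equality of the middle words. -/
noncomputable def compOf {a b c d : List S} (h : b = c) : D.H a b →ₗ[R] D.H c d →ₗ[R] D.Total :=
  match h with
  | rfl => D.comp.compr₂ ofH

open scoped Classical in
/-- Vertical composition as a bilinear map. -/
noncomputable def vcompL : D.Total →ₗ[R] D.Total →ₗ[R] D.Total :=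
  desc fun _ b => LinearMap.flip <| desc fun c _ =>
    if h : b = c then LinearMap.flip (compOf h) else 0

/-- The tensor product as a bilinear map. -/
noncomputable def tensL : D.Total →ₗ[R] D.Total →ₗ[R] D.Total :=
  desc fun _ _ => LinearMap.flip <| desc fun _ _ => LinearMap.flip (D.tens.compr₂ ofH)

/-- Vertical composition: first `f`, then `g`. -/
noncomputable def vcomp (f g : D.Total) : D.Total := vcompL f g

/-- Vertical composition: first `f`, then `g`. -/
infixr:68 "⊙" => vcomp

lemma ofH_vcomp {a b c : List S} (f : D.H a b) (g : D.H b c) :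
    (ofH f : D.Total) ⊙ ofH g = ofH (D.comp f g) := by
  simp [vcomp, vcompL, compOf]

lemma ofH_vcomp_ne {a b c d : List S} (h : b ≠ c) (f : D.H a b) (g : D.H c d) :
    (ofH f : D.Total) ⊙ ofH g = 0 := by
  simp [vcomp, vcompL, h]

lemma tensL_ofH {a b c d : List S} (f : D.H a b) (g : D.H c d) :
    tensL (ofH f : D.Total) (ofH g) = ofH (D.tens f g) := by
  simp [tensL]

@[simp] lemma add_vcomp (f g h : D.Total) : (f + g) ⊙ h = f ⊙ h + g ⊙ h := by simp [vcomp]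
@[simp] lemma vcomp_add (f g h : D.Total) : f ⊙ (g + h) = f ⊙ g + f ⊙ h := by simp [vcomp]
@[simp] lemma zero_vcomp (f : D.Total) : 0 ⊙ f = 0 := by simp [vcomp]
@[simp] lemma vcomp_zero (f : D.Total) : f ⊙ 0 = 0 := by simp [vcomp]
@[simp] lemma smul_vcomp (r : R) (f g : D.Total) : (r • f) ⊙ g = r • (f ⊙ g) := by simp [vcomp]
@[simp] lemma vcomp_smul (r : R) (f g : D.Total) : f ⊙ (r • g) = r • (f ⊙ g) := by simp [vcomp]
lemma sum_vcomp {κ : Type*} (s : Finset κ) (f : κ → D.Total) (g : D.Total) :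
    (∑ i ∈ s, f i) ⊙ g = ∑ i ∈ s, f i ⊙ g := by simp [vcomp, LinearMap.sum_apply]
lemma vcomp_sum {κ : Type*} (s : Finset κ) (f : D.Total) (g : κ → D.Total) :
    f ⊙ (∑ i ∈ s, g i) = ∑ i ∈ s, f ⊙ g i := by simp [vcomp]

variable (D) in
/-- The laws of strict linear monoidal categories. -/
class Lawful : Prop where
  id_comp : ∀ {a b} (f : D.H a b), D.comp (D.idm a) f = f
  comp_id : ∀ {a b} (f : D.H a b), D.comp f (D.idm b) = f
  comp_assoc : ∀ {a b c d} (f : D.H a b) (g : D.H b c) (h : D.H c d),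
    D.comp (D.comp f g) h = D.comp f (D.comp g h)
  tens_id : ∀ a b, D.tens (D.idm a) (D.idm b) = D.idm (a ++ b)
  tens_comp : ∀ {a b c a' b' c'} (f : D.H a b) (g : D.H b c) (f' : D.H a' b') (g' : D.H b' c'),
    D.tens (D.comp f g) (D.comp f' g') = D.comp (D.tens f f') (D.tens g g')
  -- The two sides lie in modules over words that are equal but not definitionally so. Comparing
  -- them in the total algebra avoids transport, here and in `tens_one`.
  tens_assoc : ∀ {a b c d a' b'} (f : D.H a b) (g : D.H c d) (h : D.H a' b'),
    (ofH (D.tens (D.tens f g) h) : D.Total) = ofH (D.tens f (D.tens g h))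
  one_tens : ∀ {a b} (f : D.H a b), D.tens (D.idm []) f = f
  tens_one : ∀ {a b} (f : D.H a b), (ofH (D.tens f (D.idm [])) : D.Total) = ofH f

variable [Lawful D]

lemma vcomp_assoc (f g h : D.Total) : (f ⊙ g) ⊙ h = f ⊙ g ⊙ h := by
  induction f using total_induction with
  | h0 => simp
  | hadd f f' hf hf' => simp [hf, hf']
  | @hof a b f =>
  induction g using total_induction with
  | h0 => simp
  | hadd f f' hf hf' => simp [hf, hf']
  | @hof c d g =>
  induction h using total_induction with
  | h0 => simp
  | hadd f f' hf hf' => simp [hf, hf']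
  | @hof a' b' h =>
  by_cases h1 : b = c
  · subst h1
    by_cases h2 : d = a'
    · subst h2
      simp only [ofH_vcomp, Lawful.comp_assoc]
    · simp only [ofH_vcomp, ofH_vcomp_ne h2, vcomp_zero]
  · rw [ofH_vcomp_ne h1]
    by_cases h2 : d = a'
    · subst h2
      simp only [ofH_vcomp, ofH_vcomp_ne h1, zero_vcomp]
    · simp only [ofH_vcomp_ne h2, vcomp_zero, zero_vcomp]

noncomputable instance : Ring D.Total where
  __ := (inferInstance : AddCommGroup D.Total)
  mul f g := tensL f g
  one := ofH (D.idm [])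
  left_distrib f g h := map_add (tensL f) g h
  right_distrib f g h := LinearMap.map_add₂ tensL f g h
  zero_mul f := LinearMap.map_zero₂ tensL f
  mul_zero f := map_zero (tensL f)
  mul_assoc f g h := by
    change tensL (tensL f g) h = tensL f (tensL g h)
    induction f using total_induction with
    | h0 => simp
    | hadd f f' hf hf' => simp [hf, hf']
    | hof f =>
    induction g using total_induction with
    | h0 => simp
    | hadd f f' hf hf' => simp [hf, hf']
    | hof g =>
    induction h using total_induction with
    | h0 => simp
    | hadd f f' hf hf' => simp [hf, hf']
    | hof h => simp only [tensL_ofH, Lawful.tens_assoc]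
  one_mul f := by
    change tensL (ofH (D.idm [])) f = f
    induction f using total_induction with
    | h0 => simp
    | hadd f f' hf hf' => simp [hf, hf']
    | hof f => exact (tensL_ofH _ _).trans (congrArg ofH (Lawful.one_tens f))
  mul_one f := by
    change tensL f (ofH (D.idm [])) = f
    induction f using total_induction with
    | h0 => simp
    | hadd f f' hf hf' => simp [hf, hf']
    | hof f => rw [tensL_ofH, Lawful.tens_one]

noncomputable instance : Algebra R D.Total :=
  Algebra.ofModule (fun r f g => LinearMap.map_smul₂ tensL r f g)
    (fun r f g => map_smul (tensL f) r g)

lemma ofH_mul {a b c d : List S} (f : D.H a b) (g : D.H c d) :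
    (ofH f : D.Total) * ofH g = ofH (D.tens f g) := tensL_ofH f g

variable (D) in
/-- The identity of a word as an element of the total algebra. -/
noncomputable def idw (a : List S) : D.Total := ofH (D.idm a)

lemma idw_append (a b : List S) : D.idw (a ++ b) = D.idw a * D.idw b := by
  rw [idw, idw, idw, ofH_mul, Lawful.tens_id]

lemma idw_vcomp_ofH {a b : List S} (f : D.H a b) : D.idw a ⊙ ofH f = ofH f := by
  rw [idw, ofH_vcomp, Lawful.id_comp]

lemma ofH_vcomp_idw {a b : List S} (f : D.H a b) : ofH f ⊙ D.idw b = ofH f := by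
  rw [idw, ofH_vcomp, Lawful.comp_id]

lemma idw_vcomp_self (a : List S) : D.idw a ⊙ D.idw a = D.idw a := idw_vcomp_ofH _

lemma idw_vcomp_ne {a b : List S} (h : a ≠ b) : D.idw a ⊙ D.idw b = 0 := ofH_vcomp_ne h _ _

/-- Composing with two identities kills every homogeneous component except the one from `a` to `b`.
-/
lemma exists_ofH {a b : List S} {f : D.Total} (ha : D.idw a ⊙ f = f) (hb : f ⊙ D.idw b = f) :
    ∃ g : D.H a b, ofH g = f := by
  rw [← ha, ← hb]
  clear ha hb
  induction f using total_induction with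
  | h0 => exact ⟨0, by simp⟩
  | hadd f g hf hg =>
    obtain ⟨f', hf⟩ := hf
    obtain ⟨g', hg⟩ := hg
    exact ⟨f' + g', by simp [hf, hg]⟩
  | @hof c d f =>
    by_cases h1 : a = c
    · subst h1
      by_cases h2 : d = b
      · subst h2
        exact ⟨f, by simp [ofH_vcomp_idw, idw_vcomp_ofH]⟩
      · exact ⟨0, by rw [idw, idw, ofH_vcomp_ne h2]; simp⟩
    · by_cases h2 : d = b
      · subst h2
        exact ⟨0, by rw [ofH_vcomp_idw, idw, ofH_vcomp_ne h1]; simp⟩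
      · exact ⟨0, by rw [idw, idw, ofH_vcomp_ne h2]; simp⟩

/-! #### Sizes and the interchange law -/

/-- `Sz f p q`: the element `f` is a sum of morphisms from words of length `p` to words of
length `q`. -/
class Sz (f : D.Total) (p q : outParam ℕ) : Prop where
  mem : f ∈ Submodule.span R
    {g : D.Total | ∃ (a b : List S) (h : D.H a b), a.length = p ∧ b.length = q ∧ g = ofH h}

lemma sz_ofH {a b : List S} (f : D.H a b) : Sz (ofH f : D.Total) a.length b.length :=
  ⟨Submodule.subset_span ⟨a, b, f, rfl, rfl, rfl⟩⟩

instance sz_idw (a : List S) : Sz (D.idw a) a.length a.length := sz_ofH _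

instance sz_one : Sz (1 : D.Total) 0 0 := sz_ofH (D.idm [])

lemma Sz.cast {f : D.Total} {p q p' q' : ℕ} (h : Sz f p q) (hp : p = p') (hq : q = q') :
    Sz f p' q' := by subst hp hq; exact h

lemma sz_zero (p q : ℕ) : Sz (0 : D.Total) p q := ⟨zero_mem _⟩

lemma Sz.add {f g : D.Total} {p q : ℕ} (hf : Sz f p q) (hg : Sz g p q) : Sz (f + g) p q :=
  ⟨add_mem hf.mem hg.mem⟩

lemma Sz.smul {f : D.Total} {p q : ℕ} (r : R) (hf : Sz f p q) : Sz (r • f) p q :=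
  ⟨Submodule.smul_mem _ r hf.mem⟩

lemma Sz.sum {κ : Type*} (s : Finset κ) {f : κ → D.Total} {p q : ℕ} (hf : ∀ i, Sz (f i) p q) :
    Sz (∑ i ∈ s, f i) p q :=
  ⟨Submodule.sum_mem _ fun i _ => (hf i).mem⟩

lemma Sz.induction {p q : ℕ} {P : D.Total → Prop} (h0 : P 0)
    (hof : ∀ {a b} (f : D.H a b), a.length = p → b.length = q → P (ofH f))
    (hadd : ∀ f g, P f → P g → P (f + g)) {f : D.Total} (hf : Sz f p q) : P f := by
  -- `P` is not assumed to be stable under scalars. The scalar is carried through the induction and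
  -- absorbed into the morphism at the generators.
  have key : ∀ f ∈ Submodule.span R {g : D.Total | ∃ (a b : List S) (h : D.H a b),
      a.length = p ∧ b.length = q ∧ g = ofH h}, ∀ r : R, P (r • f) := by
    intro f hf
    induction hf using Submodule.span_induction with
    | mem x hx =>
      obtain ⟨a, b, h, ha, hb, rfl⟩ := hx
      intro r
      rw [← map_smul]
      exact hof _ ha hb
    | zero => intro r; rwa [smul_zero]
    | add x y _ _ hx hy => intro r; rw [smul_add]; exact hadd _ _ (hx r) (hy r)
    | smul a x _ hx => intro r; rw [smul_smul]; exact hx _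
  simpa using key f hf.mem 1

instance Sz.mul {f g : D.Total} {p q p' q' : ℕ} [hf : Sz f p q] [hg : Sz g p' q'] :
    Sz (f * g) (p + p') (q + q') := by
  refine Sz.induction (P := fun f => Sz (f * g) (p + p') (q + q')) ?_ ?_ ?_ hf
  · rw [zero_mul]; exact sz_zero _ _
  · intro a b f ha hb
    refine Sz.induction (P := fun g => Sz (ofH f * g) (p + p') (q + q')) ?_ ?_ ?_ hg
    · rw [mul_zero]; exact sz_zero _ _
    · intro c d g hc hd
      rw [ofH_mul]
      exact (sz_ofH _).cast (by simp [ha, hc]) (by simp [hb, hd])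
    · intro f g hf hg; rw [mul_add]; exact hf.add hg
  · intro f g hf hg; rw [add_mul]; exact hf.add hg

/-- Equality of sizes, to be found by unification. -/
class SizeEq (p q : ℕ) : Prop where
  eq : p = q

instance (p : ℕ) : SizeEq p p := ⟨rfl⟩

instance Sz.vcomp {f g : D.Total} {p q q' r : ℕ} [hf : Sz f p q] [hg : Sz g q' r]
    [hq : SizeEq q q'] : Sz (f ⊙ g) p r := by
  obtain rfl := hq.eq
  refine Sz.induction (P := fun f => Sz (f ⊙ g) p r) ?_ ?_ ?_ hf
  · rw [zero_vcomp]; exact sz_zero _ _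
  · intro a b f ha hb
    refine Sz.induction (P := fun g => Sz (ofH f ⊙ g) p r) ?_ ?_ ?_ hg
    · rw [vcomp_zero]; exact sz_zero _ _
    · intro c d g hc hd
      by_cases h : b = c
      · subst h
        rw [ofH_vcomp]
        exact (sz_ofH _).cast (by simp [ha]) (by simp [hd])
      · rw [ofH_vcomp_ne h]; exact sz_zero _ _
    · intro f g hf hg; rw [vcomp_add]; exact hf.add hg
  · intro f g hf hg; rw [add_vcomp]; exact hf.add hg

/-- If the middle words do not match factor by factor, the right side is zero, and `h` makes the
left side zero too. Without `h`, the concatenations could agree although the factors do not. -/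
lemma interchange_of_eq {a b c d a' b' c' d' : List S} (f : D.H a b) (g : D.H c d) (f' : D.H a' b')
    (g' : D.H c' d') (h : b ++ b' = c ++ c' → b = c ∧ b' = c') :
    ((ofH f : D.Total) * ofH f') ⊙ (ofH g * ofH g') = (ofH f ⊙ ofH g) * (ofH f' ⊙ ofH g') := by
  by_cases h' : b = c ∧ b' = c'
  · obtain ⟨rfl, rfl⟩ := h'
    simp only [ofH_mul, ofH_vcomp, Lawful.tens_comp]
  · rw [ofH_mul, ofH_mul, ofH_vcomp_ne (fun e => h' (h e))]
    rcases not_and_or.mp h' with h1 | h1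
    · rw [ofH_vcomp_ne h1, zero_mul]
    · rw [ofH_vcomp_ne h1, mul_zero]

/-- The interchange law, when the left factors have matching sizes. -/
lemma interchange_left {f g : D.Total} {p q r : ℕ} (hf : Sz f p q) (hg : Sz g q r)
    (f' g' : D.Total) : (f * f') ⊙ (g * g') = (f ⊙ g) * (f' ⊙ g') := by
  refine Sz.induction (P := fun f => (f * f') ⊙ (g * g') = (f ⊙ g) * (f' ⊙ g'))
    (by simp) ?_ (fun _ _ h h' => by simp [add_mul, h, h']) hf
  intro a b f ha hb
  refine Sz.induction (P := fun g => (ofH f * f') ⊙ (g * g') = (ofH f ⊙ g) * (f' ⊙ g'))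
    (by simp) ?_ (fun _ _ h h' => by simp [add_mul, h, h']) hg
  intro c d g hc hd
  induction f' using total_induction with
  | h0 => simp
  | hadd _ _ h h' => simp [mul_add, h, h']
  | hof f' =>
  induction g' using total_induction with
  | h0 => simp
  | hadd _ _ h h' => simp [mul_add, h, h']
  | hof g' =>
    -- A concatenation splits uniquely once the length of the left part is fixed.
    exact interchange_of_eq _ _ _ _ fun e => List.append_inj e (hb.trans hc.symm)

/-- The interchange law, when the right factors have matching sizes. -/
lemma interchange_right {f' g' : D.Total} {p q r : ℕ} (hf : Sz f' p q) (hg : Sz g' q r)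
    (f g : D.Total) : (f * f') ⊙ (g * g') = (f ⊙ g) * (f' ⊙ g') := by
  refine Sz.induction (P := fun f' => (f * f') ⊙ (g * g') = (f ⊙ g) * (f' ⊙ g'))
    (by simp) ?_ (fun _ _ h h' => by simp [mul_add, h, h']) hf
  intro a' b' f' ha hb
  refine Sz.induction (P := fun g' => (f * ofH f') ⊙ (g * g') = (f ⊙ g) * (ofH f' ⊙ g'))
    (by simp) ?_ (fun _ _ h h' => by simp [mul_add, h, h']) hg
  intro c d g' hc hd
  induction f using total_induction with
  | h0 => simp
  | hadd _ _ h h' => simp [add_mul, h, h']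
  | hof f =>
  induction g using total_induction with
  | h0 => simp
  | hadd _ _ h h' => simp [add_mul, h, h']
  | hof g =>
    exact interchange_of_eq _ _ _ _ fun e => List.append_inj' e (hb.trans hc.symm)

end WordData

end FrobHeis

namespace FrobHeis

open WordData

/-! ### The total algebra of a presented category -/

section PresentedTotal

variable {R : Type u} [CommRing R] {S : Type} {G : List S → List S → Type v}

/-- A presented category, as a strict linear monoidal category on words. -/
noncomputable def presData (E : ∀ a b : List S, Tm R G a b → Tm R G a b → Prop) :
    WordData R S where
  H a b := (⟨a⟩ : Pres E) ⟶ ⟨b⟩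
  idm a := 𝟙 (⟨a⟩ : Pres E)
  comp {a b c} := Linear.comp (S := R) (⟨a⟩ : Pres E) ⟨b⟩ ⟨c⟩
  tens {a b c d} := LinearMap.mk₂ R
    (fun (f : (⟨a⟩ : Pres E) ⟶ ⟨b⟩) (g : (⟨c⟩ : Pres E) ⟶ ⟨d⟩) => Pres.tensorHom f g)
    (fun f f' g => Quotient.inductionOn₃ f f' g fun f f' g =>
      Quotient.sound (Cong.add_tensor f f' g))
    (fun r f g => Quotient.inductionOn₂ f g fun f g => Quotient.sound (Cong.smul_tensor r f g))
    (fun f g g' => Quotient.inductionOn₃ f g g' fun f g g' =>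
      Quotient.sound (Cong.tensor_add f g g'))
    (fun r f g => Quotient.inductionOn₂ f g fun f g => Quotient.sound (Cong.tensor_smul r f g))

variable {E : ∀ a b : List S, Tm R G a b → Tm R G a b → Prop}

variable (E) in
/-- The morphism represented by an expression. -/
def mkH {a b : List S} (f : Tm R G a b) : (presData E).H a b := Pres.homMk f

variable (E) in
/-- The element of the total algebra represented by an expression. -/
noncomputable def inc {a b : List S} (f : Tm R G a b) : (presData E).Total :=
  ofH (mkH E f)

lemma exists_homMk {a b : List S} (f : (presData E).H a b) :
    ∃ f' : Tm R G a b, f = mkH E f' :=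
  Quotient.inductionOn (motive := fun f : (presData E).H a b =>
    ∃ f' : Tm R G a b, f = mkH E f') f fun f => ⟨f, rfl⟩

lemma inc_eq_of_cong {a b : List S} {f g : Tm R G a b} (h : Cong E a b f g) : inc E f = inc E g :=
  congrArg (ofH (D := presData E)) (Quotient.sound (s := congSetoid E a b) h)

lemma inc_cast {a b a' b' : List S} (ha : a = a') (hb : b = b') (f : Tm R G a b) :
    inc E (f.cast ha hb) = inc E f := by
  subst ha hb; rfl

instance : Lawful (presData E) where
  id_comp {a b} f := Category.id_comp (X := (⟨a⟩ : Pres E)) (Y := ⟨b⟩) f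
  comp_id {a b} f := Category.comp_id (X := (⟨a⟩ : Pres E)) (Y := ⟨b⟩) f
  comp_assoc {a b c d} f g h :=
    Category.assoc (W := (⟨a⟩ : Pres E)) (X := ⟨b⟩) (Y := ⟨c⟩) (Z := ⟨d⟩) f g h
  tens_id a b := Quotient.sound (Cong.tensor_id a b)
  tens_comp f g f' g' := Pres.tensorHom_comp f g f' g'
  tens_assoc f g h := by
    obtain ⟨f, rfl⟩ := exists_homMk f
    obtain ⟨g, rfl⟩ := exists_homMk g
    obtain ⟨h, rfl⟩ := exists_homMk h
    exact (inc_cast _ _ _).symm.trans (inc_eq_of_cong (Cong.tensor_assoc f g h))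
  one_tens f := by
    obtain ⟨f, rfl⟩ := exists_homMk f
    exact Quotient.sound (Cong.one_tensor f)
  tens_one f := by
    obtain ⟨f, rfl⟩ := exists_homMk f
    exact (inc_cast _ _ _).symm.trans (inc_eq_of_cong (Cong.tensor_one f))

lemma inc_id (a : List S) : inc E (Tm.id a) = (presData E).idw a := rfl

lemma inc_comp {a b c : List S} (f : Tm R G a b) (g : Tm R G b c) :
    inc E (f.comp g) = inc E f ⊙ inc E g :=
  (ofH_vcomp (mkH E f) (mkH E g)).symm

lemma inc_tensor {a b c d : List S} (f : Tm R G a b) (g : Tm R G c d) :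
    inc E (f.tensor g) = inc E f * inc E g :=
  (ofH_mul (mkH E f) (mkH E g)).symm

lemma inc_add {a b : List S} (f g : Tm R G a b) : inc E (f.add g) = inc E f + inc E g :=
  map_add (ofH (D := presData E) (a := a) (b := b)) (mkH E f) (mkH E g)

lemma inc_smul {a b : List S} (r : R) (f : Tm R G a b) : inc E (f.smul r) = r • inc E f :=
  map_smul (ofH (D := presData E) (a := a) (b := b)) r (mkH E f)

lemma inc_zero (a b : List S) : inc E (Tm.zero a b) = 0 :=
  map_zero (ofH (D := presData E) (a := a) (b := b))

lemma inc_sum {κ : Type w} [Fintype κ] {a b : List S} (f : κ → Tm R G a b) :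
    inc E (Tm.sum f) = ∑ i, inc E (f i) := by
  rw [Tm.sum, ← Finset.sum_map_toList]
  induction (Finset.univ : Finset κ).toList with
  | nil => exact inc_zero a b
  | cons i l ih =>
    simp only [List.map_cons, List.foldr_cons, List.sum_cons] at ih ⊢
    rw [inc_add, ih]

lemma sz_inc {a b : List S} (f : Tm R G a b) : Sz (inc E f) a.length b.length := sz_ofH _

lemma idw_vcomp_inc {a b : List S} (f : Tm R G a b) : (presData E).idw a ⊙ inc E f = inc E f :=
  idw_vcomp_ofH (D := presData E) _

lemma inc_vcomp_idw {a b : List S} (f : Tm R G a b) : inc E f ⊙ (presData E).idw b = inc E f :=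
  ofH_vcomp_idw (D := presData E) _

lemma inc_rel {a b : List S} {f g : Tm R G a b} (h : E a b f g) : inc E f = inc E g :=
  inc_eq_of_cong (Cong.rel h)

end PresentedTotal

/-! ### Interpretation of formal expressions -/

section Interpretation

variable {R : Type u} [CommRing R] {S S' : Type}

/-- The tensor product of the elements that interpret the letters of a word. -/
def objW {A : Type*} [Monoid A] (obj : S → A) (a : List S) : A := (a.map obj).prod

@[simp] lemma objW_nil {A : Type*} [Monoid A] (obj : S → A) : objW obj [] = 1 := rfl

@[simp] lemma objW_cons {A : Type*} [Monoid A] (obj : S → A) (s : S) (a : List S) :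
    objW obj (s :: a) = obj s * objW obj a := by simp [objW]

lemma objW_append {A : Type*} [Monoid A] (obj : S → A) (a b : List S) :
    objW obj (a ++ b) = objW obj a * objW obj b := by simp [objW]

/-- An interpretation of the generators `G` in a total algebra; the letters go to idempotents. -/
structure Interp (R : Type u) [CommRing R] (G : List S → List S → Type v)
    (D : WordData.{u, w} R S') [Lawful D] where
  /-- the value of a letter -/
  obj : S → D.Total
  /-- the value of a generator -/
  gen : ∀ {a b : List S}, G a b → D.Total
  sz_obj : ∀ s, Sz (obj s) 1 1
  obj_idem : ∀ s, obj s ⊙ obj s = obj s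
  sz_gen : ∀ {a b : List S} (g : G a b), Sz (gen g) a.length b.length
  obj_gen : ∀ {a b : List S} (g : G a b), objW obj a ⊙ gen g = gen g
  gen_obj : ∀ {a b : List S} (g : G a b), gen g ⊙ objW obj b = gen g

lemma sz_objW {D : WordData.{u, w} R S'} [Lawful D] {obj : S → D.Total}
    (h : ∀ s, Sz (obj s) 1 1) (a : List S) : Sz (objW obj a) a.length a.length := by
  induction a with
  | nil => exact sz_one
  | cons s a ih =>
    have := h s
    rw [objW_cons]
    exact (Sz.mul (f := obj s) (g := objW obj a)).cast (by simp [add_comm]) (by simp [add_comm])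

lemma one_vcomp_one {D : WordData.{u, w} R S'} [Lawful D] : (1 : D.Total) ⊙ 1 = 1 :=
  idw_vcomp_self (D := D) []

lemma objW_idem {D : WordData.{u, w} R S'} [Lawful D] {obj : S → D.Total}
    (h : ∀ s, Sz (obj s) 1 1) (hi : ∀ s, obj s ⊙ obj s = obj s) (a : List S) :
    objW obj a ⊙ objW obj a = objW obj a := by
  induction a with
  | nil => exact one_vcomp_one
  | cons s a ih => rw [objW_cons, interchange_left (h s) (h s), hi, ih]

namespace Interp

variable {G : List S → List S → Type v} {D : WordData.{u, w} R S'} [Lawful D]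
  (I : Interp R G D)

/-- The value of an expression. -/
noncomputable def eval : ∀ {a b : List S}, Tm R G a b → D.Total
  | _, _, .gen g => I.gen g
  | _, _, .id a => objW I.obj a
  | _, _, .comp f g => eval f ⊙ eval g
  | _, _, .tensor f g => eval f * eval g
  | _, _, .zero _ _ => 0
  | _, _, .add f g => eval f + eval g
  | _, _, .smul r f => r • eval f

lemma sz_eval {a b : List S} (f : Tm R G a b) : Sz (I.eval f) a.length b.length := by
  induction f with
  | gen g => exact I.sz_gen g
  | id a => exact sz_objW I.sz_obj a
  | comp f g hf hg => exact Sz.vcomp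
  | tensor f g hf hg => exact Sz.mul.cast (by simp) (by simp)
  | zero a b => exact sz_zero _ _
  | add f g hf hg => exact hf.add hg
  | smul r f hf => exact hf.smul r

lemma obj_eval {a b : List S} (f : Tm R G a b) : objW I.obj a ⊙ I.eval f = I.eval f := by
  induction f with
  | gen g => exact I.obj_gen g
  | id a => exact objW_idem I.sz_obj I.obj_idem a
  | comp f g hf hg => simp only [eval]; rw [← vcomp_assoc, hf]
  | tensor f g hf hg =>
    simp only [eval]
    rw [objW_append, interchange_left (sz_objW I.sz_obj _) (I.sz_eval f), hf, hg]
  | zero a b => simp [eval]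
  | add f g hf hg => simp [eval, hf, hg]
  | smul r f hf => simp [eval, hf]

lemma eval_obj {a b : List S} (f : Tm R G a b) : I.eval f ⊙ objW I.obj b = I.eval f := by
  induction f with
  | gen g => exact I.gen_obj g
  | id a => exact objW_idem I.sz_obj I.obj_idem a
  | comp f g hf hg => simp only [eval]; rw [vcomp_assoc, hg]
  | tensor f g hf hg =>
    simp only [eval]
    rw [objW_append, interchange_left (I.sz_eval f) (sz_objW I.sz_obj _), hf, hg]
  | zero a b => simp [eval]
  | add f g hf hg => simp [eval, hf, hg]
  | smul r f hf => simp [eval, hf]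

lemma eval_cast {a b a' b' : List S} (ha : a = a') (hb : b = b') (f : Tm R G a b) :
    I.eval (f.cast ha hb) = I.eval f := by
  subst ha hb; rfl

lemma eval_sum {κ : Type*} [Fintype κ] {a b : List S} (f : κ → Tm R G a b) :
    I.eval (Tm.sum f) = ∑ i, I.eval (f i) := by
  rw [Tm.sum, ← Finset.sum_map_toList]
  induction (Finset.univ : Finset κ).toList with
  | nil => rfl
  | cons i l ih =>
    simp only [List.map_cons, List.foldr_cons, List.sum_cons] at ih ⊢
    rw [eval, ih]

/-- An interpretation that satisfies the relations respects the generated congruence. -/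
lemma eval_eq_of_cong {E : ∀ a b : List S, Tm R G a b → Tm R G a b → Prop}
    (hE : ∀ {a b : List S} {f g : Tm R G a b}, E a b f g → I.eval f = I.eval g)
    {a b : List S} {f g : Tm R G a b} (h : Cong E a b f g) : I.eval f = I.eval g := by
  induction h with
  | rel h => exact hE h
  | refl => rfl
  | symm _ ih => exact ih.symm
  | trans _ _ ih ih' => exact ih.trans ih'
  | congr_comp _ _ ih ih' => simp only [eval, ih, ih']
  | congr_tensor _ _ ih ih' => simp only [eval, ih, ih']
  | congr_add _ _ ih ih' => simp only [eval, ih, ih']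
  | congr_smul r _ ih => simp only [eval, ih]
  | add_assoc => simp only [eval, add_assoc]
  | add_comm => simp only [eval, add_comm]
  | zero_add => simp only [eval, zero_add]
  | one_smul => simp only [eval, one_smul]
  | mul_smul => simp only [eval, mul_smul]
  | smul_add => simp only [eval, smul_add]
  | add_smul => simp only [eval, add_smul]
  | zero_smul => simp only [eval, zero_smul]
  | id_comp f => exact I.obj_eval f
  | comp_id f => exact I.eval_obj f
  | comp_assoc => simp only [eval, vcomp_assoc]
  | add_comp => simp only [eval, add_vcomp]
  | comp_add => simp only [eval, vcomp_add]
  | smul_comp => simp only [eval, smul_vcomp]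
  | comp_smul => simp only [eval, vcomp_smul]
  | tensor_id a b => simp only [eval, objW_append]
  | tensor_comp f g f' g' =>
    simp only [eval]
    rw [interchange_left (I.sz_eval f) (I.sz_eval g)]
  | add_tensor => simp only [eval, add_mul]
  | tensor_add => simp only [eval, mul_add]
  | smul_tensor => simp only [eval, smul_mul_assoc]
  | tensor_smul => simp only [eval, mul_smul_comm]
  | tensor_assoc => rw [eval_cast]; simp only [eval, mul_assoc]
  | one_tensor => simp only [eval, objW_nil, one_mul]
  | tensor_one => rw [eval_cast]; simp only [eval, objW_nil, mul_one]

section Lift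

variable {E : ∀ a b : List S, Tm R G a b → Tm R G a b → Prop}
    (hE : ∀ {a b : List S} {f g : Tm R G a b}, E a b f g → I.eval f = I.eval g)

/-- The linear map on morphisms of the presented category. -/
noncomputable def liftHom (a b : List S) : (presData E).H a b →ₗ[R] D.Total where
  toFun f := Quotient.lift (s := congSetoid E a b) I.eval (fun _ _ h => I.eval_eq_of_cong hE h) f
  map_add' f g := by
    obtain ⟨f, rfl⟩ := exists_homMk f
    obtain ⟨g, rfl⟩ := exists_homMk g
    rfl
  map_smul' r f := by
    obtain ⟨f, rfl⟩ := exists_homMk f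
    rfl

/-- The linear map on the total algebra of the presented category. -/
noncomputable def lift : (presData E).Total →ₗ[R] D.Total := desc (I.liftHom hE)

lemma lift_inc {a b : List S} (f : Tm R G a b) : I.lift hE (inc E f) = I.eval f := by
  rw [lift, inc, desc_ofH]; rfl

lemma lift_idw (a : List S) : I.lift hE ((presData E).idw a) = objW I.obj a := I.lift_inc hE (.id a)

lemma lift_mul (f g : (presData E).Total) : I.lift hE (f * g) = I.lift hE f * I.lift hE g := by
  induction f using total_induction with
  | h0 => simp
  | hadd _ _ h h' => simp [add_mul, h, h']
  | hof f =>
  induction g using total_induction with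
  | h0 => simp
  | hadd _ _ h h' => simp [mul_add, h, h']
  | hof g =>
  obtain ⟨f, rfl⟩ := exists_homMk f
  obtain ⟨g, rfl⟩ := exists_homMk g
  change I.lift hE (inc E f * inc E g) = I.lift hE (inc E f) * I.lift hE (inc E g)
  rw [← inc_tensor, lift_inc, lift_inc, lift_inc]; rfl

/-- Two elements that are not composable have composite zero, but their images need not, since the
values of different letters are not assumed to be orthogonal. A common middle word is therefore
required. -/
lemma lift_vcomp {f g : (presData E).Total} {b : List S} (hf : f ⊙ (presData E).idw b = f)
    (hg : (presData E).idw b ⊙ g = g) : I.lift hE (f ⊙ g) = I.lift hE f ⊙ I.lift hE g := by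
  rw [← hf, ← hg]
  clear hf hg
  induction f using total_induction with
  | h0 => simp
  | hadd _ _ h h' => simp [h, h']
  | @hof a c f =>
  induction g using total_induction with
  | h0 => simp
  | hadd _ _ h h' => simp only [vcomp_add, map_add, h, h']
  | @hof a' c' g =>
  by_cases h1 : c = b
  · subst h1
    by_cases h2 : c = a'
    · subst h2
      obtain ⟨f, rfl⟩ := exists_homMk f
      obtain ⟨g, rfl⟩ := exists_homMk g
      rw [ofH_vcomp_idw, idw_vcomp_ofH]
      change I.lift hE (inc E f ⊙ inc E g) = I.lift hE (inc E f) ⊙ I.lift hE (inc E g)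
      rw [← inc_comp, lift_inc, lift_inc, lift_inc]; rfl
    · rw [idw, ofH_vcomp_ne h2]; simp
  · rw [idw, ofH_vcomp_ne h1]; simp

end Lift

end Interp

end Interpretation

end FrobHeis

namespace FrobHeis

open WordData

/-! ### Heisenberg data in a total algebra -/

section Interchange

variable {R : Type u} [CommRing R] {S : Type} {D : WordData.{u, v} R S} [Lawful D]

/-- A version of the interchange law for rewriting: instance search computes the sizes, and `SizeEq`
matches them up to definitional equality. -/
lemma icl {f g : D.Total} {p q q' r : ℕ} [hf : Sz f p q] [hg : Sz g q' r] [hq : SizeEq q q']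
    (f' g' : D.Total) : (f * f') ⊙ (g * g') = (f ⊙ g) * (f' ⊙ g') := by
  obtain rfl := hq.eq
  exact interchange_left hf hg f' g'

lemma icr {f' g' : D.Total} {p q q' r : ℕ} [hf : Sz f' p q] [hg : Sz g' q' r] [hq : SizeEq q q']
    (f g : D.Total) : (f * f') ⊙ (g * g') = (f ⊙ g) * (f' ⊙ g') := by
  obtain rfl := hq.eq
  exact interchange_right hf hg f g

lemma one_vcomp {f : D.Total} {p q : ℕ} [hf : Sz f p q] [hp : SizeEq p 0] : 1 ⊙ f = f := by
  obtain rfl := hp.eq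
  refine Sz.induction (P := fun f => 1 ⊙ f = f) (by simp) ?_ (fun _ _ h h' => by simp [h, h']) hf
  intro a b f ha _
  obtain rfl := List.length_eq_zero_iff.mp ha
  exact idw_vcomp_ofH f

lemma vcomp_one {f : D.Total} {p q : ℕ} [hf : Sz f p q] [hq : SizeEq q 0] : f ⊙ 1 = f := by
  obtain rfl := hq.eq
  refine Sz.induction (P := fun f => f ⊙ 1 = f) (by simp) ?_ (fun _ _ h h' => by simp [h, h']) hf
  intro a b f _ hb
  obtain rfl := List.length_eq_zero_iff.mp hb
  exact ofH_vcomp_idw f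

/-- Interchange with `g` read as `1 * g`: a cup next to a diagram may be created earlier or later.
The three variants below treat cups on the right and caps. -/
lemma vcomp_mul_left (f : D.Total) {p q : ℕ} [Sz f p q] [hp : SizeEq p 0] (g g' : D.Total) :
    g ⊙ (f * g') = f * (g ⊙ g') := by
  obtain rfl := hp.eq
  conv_lhs => rw [← one_mul g]
  rw [icl, one_vcomp]

lemma vcomp_mul_right (f : D.Total) {p q : ℕ} [Sz f p q] [hp : SizeEq p 0] (g g' : D.Total) :
    g ⊙ (g' * f) = (g ⊙ g') * f := by
  obtain rfl := hp.eq
  conv_lhs => rw [← mul_one g]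
  rw [icr, one_vcomp]

lemma mul_vcomp_left (f : D.Total) {p q : ℕ} [Sz f p q] [hq : SizeEq q 0] (g g' : D.Total) :
    (f * g) ⊙ g' = f * (g ⊙ g') := by
  obtain rfl := hq.eq
  conv_lhs => rw [← one_mul g']
  rw [icl, vcomp_one]

lemma mul_vcomp_right (f : D.Total) {p q : ℕ} [Sz f p q] [hq : SizeEq q 0] (g g' : D.Total) :
    (g * f) ⊙ g' = (g ⊙ g') * f := by
  obtain rfl := hq.eq
  conv_lhs => rw [← mul_one g']
  rw [icr, vcomp_one]

end Interchange

section HeisData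

variable {R : Type u} [CommRing R] {F : Type v} {ι : Type w} {S' : Type}

/-- Elements of a total algebra to which the generators of a Heisenberg category may be sent. -/
structure HeisPre (F : Type v) (ι : Type w) (k : ℤ) (A : Type*) where
  /-- the value of `Q₊` -/
  U : A
  /-- the value of `Q₋` -/
  V : A
  /-- the dot -/
  x : A
  /-- the upward crossing -/
  s : A
  /-- the right cup -/
  c : A
  /-- the right cap -/
  d : A
  /-- the tokens -/
  tok : F → A
  /-- the left crossing -/
  L : A
  /-- the left cups -/
  lcup : Fin k.toNat → ι → A
  /-- the left caps -/
  lcap : Fin (-k).toNat → ι → A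

namespace HeisPre

variable {k : ℤ} {D : WordData.{u} R S'} [Lawful D] (h : HeisPre F ι k D.Total)

/-- The right crossing. -/
noncomputable def t : D.Total := (h.c * (h.U * h.V)) ⊙ (h.V * h.s * h.V) ⊙ (h.V * h.U * h.d)

/-- Powers of the dot. -/
noncomputable def xpow : ℕ → D.Total
  | 0 => h.U
  | m + 1 => xpow m ⊙ h.x

/-- The downward tokens. -/
noncomputable def vtok (f : F) : D.Total :=
  (h.c * h.V) ⊙ (h.V * h.tok f * h.V) ⊙ (h.V * h.d)

/-- The decorated right caps. -/
noncomputable def rcap (r : ℕ) (f : F) : D.Total := ((h.tok f ⊙ h.xpow r) * h.V) ⊙ h.d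

/-- The decorated right cups. -/
noncomputable def rcup (r : ℕ) (f : F) : D.Total := h.c ⊙ (h.V * (h.tok f ⊙ h.xpow r))

end HeisPre

variable [Ring F] [Algebra R F] [Fintype ι]

/-- Elements of a total algebra that satisfy the relations of a Heisenberg category. -/
structure HeisData (φ : SymmFrobenius R F) (b : Module.Basis ι R F) (k : ℤ)
    (D : WordData.{u} R S') [Lawful D] extends HeisPre F ι k D.Total where
  szU : Sz U 1 1
  szV : Sz V 1 1
  szx : Sz x 1 1
  szs : Sz s 2 2
  szc : Sz c 0 2
  szd : Sz d 2 0
  sztok : ∀ f, Sz (tok f) 1 1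
  szL : Sz L 2 2
  szlcup : ∀ r i, Sz (lcup r i) 0 2
  szlcap : ∀ r i, Sz (lcap r i) 2 0
  -- `U` and `V` are only idempotents, not identities of words, so that the summands cut out by the
  -- colour idempotents are an instance as well.
  U_U : U ⊙ U = U
  V_V : V ⊙ V = V
  U_x : U ⊙ x = x
  x_U : x ⊙ U = x
  UU_s : (U * U) ⊙ s = s
  s_UU : s ⊙ (U * U) = s
  c_VU : c ⊙ (V * U) = c
  UV_d : (U * V) ⊙ d = d
  U_tok : ∀ f, U ⊙ tok f = tok f
  tok_U : ∀ f, tok f ⊙ U = tok f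
  VU_L : (V * U) ⊙ L = L
  L_UV : L ⊙ (U * V) = L
  lcup_UV : ∀ r i, lcup r i ⊙ (U * V) = lcup r i
  VU_lcap : ∀ r i, (V * U) ⊙ lcap r i = lcap r i
  tok_one : tok 1 = U
  tok_mul : ∀ f g, tok (f * g) = tok g ⊙ tok f
  tok_add : ∀ f g, tok (f + g) = tok f + tok g
  tok_smul : ∀ (r : R) f, tok (r • f) = r • tok f
  braid : (s * U) ⊙ (U * s) ⊙ (s * U) = (U * s) ⊙ (s * U) ⊙ (U * s)
  s_s : s ⊙ s = U * U
  x_tok : ∀ f, x ⊙ tok f = tok f ⊙ x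
  tok_s : ∀ f, (tok f * U) ⊙ s = s ⊙ (U * tok f)
  s_x : s ⊙ (x * U) = (U * x) ⊙ s + ∑ i, tok (φ.dual b i) * tok (b i)
  adj_up : (U * c) ⊙ (d * U) = U
  adj_down : (c * V) ⊙ (V * d) = V
  t_L : toHeisPre.t ⊙ L +
    ∑ p : Fin k.toNat × ι, toHeisPre.rcap p.1 (φ.dual b p.2) ⊙ lcup p.1 p.2 = U * V
  L_t : L ⊙ toHeisPre.t +
    ∑ p : Fin (-k).toNat × ι, lcap p.1 p.2 ⊙ toHeisPre.rcup p.1 (φ.dual b p.2) = V * U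
  L_rcap : ∀ (r : Fin k.toNat) i, L ⊙ toHeisPre.rcap r (φ.dual b i) = 0
  lcup_t : ∀ r i, lcup r i ⊙ toHeisPre.t = 0
  lcup_rcap : ∀ (r : Fin k.toNat) i, lcup r i ⊙ toHeisPre.rcap r (φ.dual b i) = 1
  lcup_rcap_ne : ∀ (r r' : Fin k.toNat) (i i' : ι), (r, i) ≠ (r', i') →
    lcup r i ⊙ toHeisPre.rcap r' (φ.dual b i') = 0
  t_lcap : ∀ r i, toHeisPre.t ⊙ lcap r i = 0
  rcup_L : ∀ (r : Fin (-k).toNat) i, toHeisPre.rcup r (φ.dual b i) ⊙ L = 0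
  rcup_lcap : ∀ (r : Fin (-k).toNat) i, toHeisPre.rcup r (φ.dual b i) ⊙ lcap r i = 1
  rcup_lcap_ne : ∀ (r r' : Fin (-k).toNat) (i i' : ι), (r, i) ≠ (r', i') →
    toHeisPre.rcup r (φ.dual b i) ⊙ lcap r' i' = 0

attribute [instance] HeisData.szU HeisData.szV HeisData.szx HeisData.szs HeisData.szc
  HeisData.szd HeisData.sztok HeisData.szL HeisData.szlcup HeisData.szlcap

/-- The images of the generators of a Heisenberg category. -/
noncomputable def HeisPre.gen {k : ℤ} {A : Type*} (h : HeisPre F ι k A) :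
    ∀ {a a' : List Strand}, HeisGen F ι k a a' → A
  | _, _, .x => h.x
  | _, _, .s => h.s
  | _, _, .c => h.c
  | _, _, .d => h.d
  | _, _, .token f => h.tok f
  | _, _, .leftCross => h.L
  | _, _, .leftCup r i => h.lcup r i
  | _, _, .leftCap r i => h.lcap r i

/-- The values of the letters. -/
def HeisPre.obj {k : ℤ} {A : Type*} (h : HeisPre F ι k A) : Strand → A
  | .up => h.U
  | .down => h.V

namespace HeisData

variable {φ : SymmFrobenius R F} {b : Module.Basis ι R F} {k : ℤ} {D : WordData.{u} R S'}
  [Lawful D] (h : HeisData φ b k D)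

/-- Heisenberg data as an interpretation of the generators. -/
noncomputable def interp : Interp R (HeisGen F ι k) D where
  obj := h.obj
  gen := h.gen
  sz_obj | .up => h.szU | .down => h.szV
  obj_idem | .up => h.U_U | .down => h.V_V
  sz_gen
    | .x => h.szx
    | .s => h.szs
    | .c => h.szc
    | .d => h.szd
    | .token f => h.sztok f
    | .leftCross => h.szL
    | .leftCup r i => h.szlcup r i
    | .leftCap r i => h.szlcap r i
  obj_gen g := by
    cases g <;>
      simp [HeisPre.gen, HeisPre.obj, h.U_x, h.UU_s, h.UV_d, h.U_tok, h.VU_L, h.VU_lcap, one_vcomp]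
  gen_obj g := by
    cases g <;>
      simp [HeisPre.gen, HeisPre.obj, h.x_U, h.s_UU, h.c_VU, h.tok_U, h.L_UV, h.lcup_UV, vcomp_one]

lemma eval_t : h.interp.eval (HeisTm.t R ι k) = h.t := by
  simp [HeisTm.t, Interp.eval, HeisPre.t, interp, HeisPre.gen, HeisPre.obj]

lemma eval_pow (m : ℕ) : h.interp.eval ((HeisTm.x R ι k).pow m) = h.xpow m := by
  induction m with
  | zero => simp [Tm.pow, Interp.eval, HeisPre.xpow, interp, HeisPre.obj]
  | succ m ih => rw [Tm.pow, Interp.eval, ih]; rfl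

lemma eval_rcap (r : ℕ) (f : F) : h.interp.eval (HeisTm.rightCap R ι k r f) = h.rcap r f := by
  simp only [HeisTm.rightCap, Interp.eval, eval_pow]
  simp [HeisPre.rcap, interp, HeisPre.gen, HeisPre.obj]

lemma eval_rcup (r : ℕ) (f : F) : h.interp.eval (HeisTm.rightCup R ι k r f) = h.rcup r f := by
  simp only [HeisTm.rightCup, Interp.eval, eval_pow]
  simp [HeisPre.rcup, interp, HeisPre.gen, HeisPre.obj]

lemma eval_rel {a a' : List Strand} {f g : Tm R (HeisGen F ι k) a a'}
    (hr : HeisRel φ b k a a' f g) : h.interp.eval f = h.interp.eval g := by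
  have hobj : h.interp.obj = h.obj := rfl
  have hgen : ∀ {a a' : List Strand} (g : HeisGen F ι k a a'), h.interp.gen g = h.gen g :=
    fun _ => rfl
  cases hr <;>
    simp only [Interp.eval, Interp.eval_sum, eval_t, eval_rcap, eval_rcup, hobj, hgen,
      HeisPre.gen, HeisPre.obj, objW_cons, objW_nil, mul_one]
  case token_one => exact h.tok_one
  case token_mul => exact h.tok_mul _ _
  case token_add => exact h.tok_add _ _
  case token_smul => exact h.tok_smul _ _
  case braid => exact h.braid
  case double_cross => exact h.s_s
  case dot_token => exact h.x_tok _
  case token_slide => exact h.tok_s _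
  case dot_slide => exact h.s_x
  case adj_up => exact h.adj_up
  case adj_down => exact h.adj_down
  case inv_up_down => exact h.t_L
  case inv_down_up => exact h.L_t
  case leftCross_rightCap => exact h.L_rcap _ _
  case leftCup_t => exact h.lcup_t _ _
  case leftCup_rightCap => exact h.lcup_rcap _ _
  case leftCup_rightCap_ne hne => exact h.lcup_rcap_ne _ _ _ _ hne
  case t_leftCap => exact h.t_lcap _ _
  case rightCup_leftCross => exact h.rcup_L _ _
  case rightCup_leftCap => exact h.rcup_lcap _ _
  case rightCup_leftCap_ne hne => exact h.rcup_lcap_ne _ _ _ _ hne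

/-- The linear map from the total algebra of the Heisenberg category. -/
noncomputable def lift : (presData (HeisRel φ b k)).Total →ₗ[R] D.Total :=
  h.interp.lift h.eval_rel

end HeisData

variable (φ : SymmFrobenius R F) (b : Module.Basis ι R F) (k : ℤ)

open HeisTm in
/-- The generators of the Heisenberg category. -/
noncomputable def univPre : HeisPre F ι k (presData (HeisRel φ b k)).Total where
  U := (presData (HeisRel φ b k)).idw [.up]
  V := (presData (HeisRel φ b k)).idw [.down]
  x := inc _ (x R ι k)
  s := inc _ (s R ι k)
  c := inc _ (c R ι k)
  d := inc _ (d R ι k)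
  tok f := inc _ (token R ι k f)
  L := inc _ (leftCross R ι k)
  lcup r i := inc _ (leftCup R ι k r i)
  lcap r i := inc _ (leftCap R ι k r i)

lemma idw_two (D : WordData.{u} R S') [Lawful D] (a a' : S') :
    D.idw [a, a'] = D.idw [a] * D.idw [a'] := D.idw_append [a] [a']

lemma inc_t : inc (HeisRel φ b k) (HeisTm.t R ι k) = (univPre φ b k).t := by
  simp only [HeisTm.t, inc_comp, inc_tensor, inc_id, HeisPre.t, univPre, idw_two]

lemma inc_pow (m : ℕ) :
    inc (HeisRel φ b k) ((HeisTm.x R ι k).pow m) = (univPre φ b k).xpow m := by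
  induction m with
  | zero => rfl
  | succ m ih => rw [Tm.pow, inc_comp, ih]; rfl

lemma inc_rcap (r : ℕ) (f : F) :
    inc (HeisRel φ b k) (HeisTm.rightCap R ι k r f) = (univPre φ b k).rcap r f := by
  simp only [HeisTm.rightCap, inc_comp, inc_tensor, inc_id, inc_pow, HeisPre.rcap]; rfl

lemma inc_rcup (r : ℕ) (f : F) :
    inc (HeisRel φ b k) (HeisTm.rightCup R ι k r f) = (univPre φ b k).rcup r f := by
  simp only [HeisTm.rightCup, inc_comp, inc_tensor, inc_id, inc_pow, HeisPre.rcup]; rfl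

lemma inc_downToken (f : F) :
    inc (HeisRel φ b k) (HeisTm.downToken R ι k f) = (univPre φ b k).vtok f := by
  simp only [HeisTm.downToken, inc_comp, inc_tensor, inc_id, HeisPre.vtok]; rfl

open HeisTm in
/-- The Heisenberg data of the Heisenberg category itself. -/
noncomputable def univ : HeisData φ b k (presData (HeisRel φ b k)) where
  toHeisPre := univPre φ b k
  szU := sz_idw _
  szV := sz_idw _
  szx := sz_inc _
  szs := sz_inc _
  szc := sz_inc _
  szd := sz_inc _
  sztok _ := sz_inc _
  szL := sz_inc _
  szlcup _ _ := sz_inc _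
  szlcap _ _ := sz_inc _
  U_U := idw_vcomp_self _
  V_V := idw_vcomp_self _
  U_x := idw_vcomp_inc _
  x_U := inc_vcomp_idw _
  UU_s := by
    have e := idw_vcomp_inc (E := HeisRel φ b k) (s R ι k)
    simp only [idw_two] at e
    exact e
  s_UU := by
    have e := inc_vcomp_idw (E := HeisRel φ b k) (s R ι k)
    simp only [idw_two] at e
    exact e
  c_VU := by
    have e := inc_vcomp_idw (E := HeisRel φ b k) (c R ι k)
    simp only [idw_two] at e
    exact e
  UV_d := by
    have e := idw_vcomp_inc (E := HeisRel φ b k) (d R ι k)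
    simp only [idw_two] at e
    exact e
  U_tok _ := idw_vcomp_inc _
  tok_U _ := inc_vcomp_idw _
  VU_L := by
    have e := idw_vcomp_inc (E := HeisRel φ b k) (leftCross R ι k)
    simp only [idw_two] at e
    exact e
  L_UV := by
    have e := inc_vcomp_idw (E := HeisRel φ b k) (leftCross R ι k)
    simp only [idw_two] at e
    exact e
  lcup_UV r i := by
    have e := inc_vcomp_idw (E := HeisRel φ b k) (leftCup R ι k r i)
    simp only [idw_two] at e
    exact e
  VU_lcap r i := by
    have e := idw_vcomp_inc (E := HeisRel φ b k) (leftCap R ι k r i)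
    simp only [idw_two] at e
    exact e
  tok_one := inc_rel .token_one
  tok_mul f g := by
    have e := inc_rel (HeisRel.token_mul (φ := φ) (b := b) (k := k) f g)
    simp only [inc_comp] at e
    exact e
  tok_add f g := by
    have e := inc_rel (HeisRel.token_add (φ := φ) (b := b) (k := k) f g)
    simp only [inc_add] at e
    exact e
  tok_smul r f := by
    have e := inc_rel (HeisRel.token_smul (φ := φ) (b := b) (k := k) r f)
    simp only [inc_smul] at e
    exact e
  braid := by
    have e := inc_rel (HeisRel.braid (φ := φ) (b := b) (k := k))
    simp only [inc_comp, inc_tensor] at e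
    exact e
  s_s := by
    have e := inc_rel (HeisRel.double_cross (φ := φ) (b := b) (k := k))
    simp only [inc_comp, inc_id, idw_two] at e
    exact e
  x_tok f := by
    have e := inc_rel (HeisRel.dot_token (φ := φ) (b := b) (k := k) f)
    simp only [inc_comp] at e
    exact e
  tok_s f := by
    have e := inc_rel (HeisRel.token_slide (φ := φ) (b := b) (k := k) f)
    simp only [inc_comp, inc_tensor] at e
    exact e
  s_x := by
    have e := inc_rel (HeisRel.dot_slide (φ := φ) (b := b) (k := k))
    simp only [inc_comp, inc_tensor, inc_add, inc_sum] at e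
    exact e
  adj_up := by
    have e := inc_rel (HeisRel.adj_up (φ := φ) (b := b) (k := k))
    simp only [inc_comp, inc_tensor] at e
    exact e
  adj_down := by
    have e := inc_rel (HeisRel.adj_down (φ := φ) (b := b) (k := k))
    simp only [inc_comp, inc_tensor] at e
    exact e
  t_L := by
    have e := inc_rel (HeisRel.inv_up_down (φ := φ) (b := b) (k := k))
    simp only [inc_comp, inc_add, inc_sum, inc_t, inc_rcap, inc_id, idw_two] at e
    exact e
  L_t := by
    have e := inc_rel (HeisRel.inv_down_up (φ := φ) (b := b) (k := k))
    simp only [inc_comp, inc_add, inc_sum, inc_t, inc_rcup, inc_id, idw_two] at e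
    exact e
  L_rcap r i := by
    have e := inc_rel (HeisRel.leftCross_rightCap (φ := φ) (b := b) (k := k) r i)
    simp only [inc_comp, inc_zero, inc_rcap] at e
    exact e
  lcup_t r i := by
    have e := inc_rel (HeisRel.leftCup_t (φ := φ) (b := b) (k := k) r i)
    simp only [inc_comp, inc_zero, inc_t] at e
    exact e
  lcup_rcap r i := by
    have e := inc_rel (HeisRel.leftCup_rightCap (φ := φ) (b := b) (k := k) r i)
    simp only [inc_comp, inc_id, inc_rcap] at e
    exact e
  lcup_rcap_ne r r' i i' hne := by
    have e := inc_rel (HeisRel.leftCup_rightCap_ne (φ := φ) (b := b) (k := k) r r' i i' hne)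
    simp only [inc_comp, inc_zero, inc_rcap] at e
    exact e
  t_lcap r i := by
    have e := inc_rel (HeisRel.t_leftCap (φ := φ) (b := b) (k := k) r i)
    simp only [inc_comp, inc_zero, inc_t] at e
    exact e
  rcup_L r i := by
    have e := inc_rel (HeisRel.rightCup_leftCross (φ := φ) (b := b) (k := k) r i)
    simp only [inc_comp, inc_zero, inc_rcup] at e
    exact e
  rcup_lcap r i := by
    have e := inc_rel (HeisRel.rightCup_leftCap (φ := φ) (b := b) (k := k) r i)
    simp only [inc_comp, inc_id, inc_rcup] at e
    exact e
  rcup_lcap_ne r r' i i' hne := by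
    have e := inc_rel (HeisRel.rightCup_leftCap_ne (φ := φ) (b := b) (k := k) r r' i i' hne)
    simp only [inc_comp, inc_zero, inc_rcup] at e
    exact e

end HeisData

end FrobHeis

namespace FrobHeis

open WordData

/-! ### Sliding tokens along cups, caps and crossings -/

section

variable {R : Type u} [CommRing R] {S : Type} {D : WordData.{u, v} R S} [Lawful D]

lemma mul_regroup {A : Type*} [Semigroup A] (a b c d : A) : a * (b * c) * d = a * b * (c * d) := by
  simp only [mul_assoc]

lemma vcomp_congr_assoc {f g f' g' : D.Total} (e : f ⊙ g = f' ⊙ g') (z : D.Total) :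
    f ⊙ g ⊙ z = f' ⊙ g' ⊙ z := by
  rw [← vcomp_assoc, e, vcomp_assoc]

end

namespace HeisData

variable {R : Type u} [CommRing R] {F : Type v} {ι : Type w} {S' : Type} [Ring F] [Algebra R F]
  [Fintype ι] {φ : SymmFrobenius R F} {b : Module.Basis ι R F} {k : ℤ} {D : WordData.{u} R S'}
  [Lawful D] (h : HeisData φ b k D)

instance sz_t : Sz h.t 2 2 := by unfold HeisPre.t; infer_instance

instance sz_vtok (f : F) : Sz (h.vtok f) 1 1 := by unfold HeisPre.vtok; infer_instance

instance sz_xpow (m : ℕ) : Sz (h.xpow m) 1 1 := by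
  induction m with
  | zero => exact h.szU
  | succ m ih => unfold HeisPre.xpow; infer_instance

instance sz_rcap (r : ℕ) (f : F) : Sz (h.rcap r f) 2 0 := by unfold HeisPre.rcap; infer_instance

instance sz_rcup (r : ℕ) (f : F) : Sz (h.rcup r f) 0 2 := by unfold HeisPre.rcup; infer_instance

lemma UU_UU : (h.U * h.U) ⊙ (h.U * h.U) = h.U * h.U := by rw [icl, h.U_U]

lemma V_vtok (f : F) : h.V ⊙ h.vtok f = h.vtok f := by
  rw [HeisPre.vtok, ← vcomp_assoc, vcomp_mul_left h.c, h.V_V]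

lemma vtok_V (f : F) : h.vtok f ⊙ h.V = h.vtok f := by
  rw [HeisPre.vtok, vcomp_assoc, vcomp_assoc, mul_vcomp_right h.d, h.V_V]

lemma xpow_U (m : ℕ) : h.xpow m ⊙ h.U = h.xpow m := by
  cases m with
  | zero => exact h.U_U
  | succ m => rw [HeisPre.xpow, vcomp_assoc, h.x_U]

lemma xpow_tok (m : ℕ) (f : F) : h.xpow m ⊙ h.tok f = h.tok f ⊙ h.xpow m := by
  induction m with
  | zero => rw [HeisPre.xpow, h.U_tok, h.tok_U]
  | succ m ih => rw [HeisPre.xpow, vcomp_assoc, h.x_tok, ← vcomp_assoc, ih, vcomp_assoc]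

lemma UV_rcap (r : ℕ) (f : F) : (h.U * h.V) ⊙ h.rcap r f = h.rcap r f := by
  rw [HeisPre.rcap, ← vcomp_assoc, icl, ← vcomp_assoc, h.U_tok, h.V_V]

lemma rcup_VU (r : ℕ) (f : F) : h.rcup r f ⊙ (h.V * h.U) = h.rcup r f := by
  rw [HeisPre.rcup, vcomp_assoc, icl, vcomp_assoc, h.xpow_U, h.V_V]

lemma tok_zero : h.tok 0 = 0 := by
  have := h.tok_smul 0 0
  rwa [zero_smul, zero_smul] at this

lemma tok_sum {κ : Type*} (s : Finset κ) (f : κ → F) :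
    h.tok (∑ i ∈ s, f i) = ∑ i ∈ s, h.tok (f i) :=
  map_sum (⟨⟨h.tok, h.tok_zero⟩, h.tok_add⟩ : F →+ D.Total) f s

/-- Conjugating the relation `tok_s` by the involution `s` gives the slide over the other strand. -/
lemma s_tok (f : F) : (h.U * h.tok f) ⊙ h.s = h.s ⊙ (h.tok f * h.U) := by
  calc (h.U * h.tok f) ⊙ h.s = (h.s ⊙ h.s) ⊙ (h.U * h.tok f) ⊙ h.s := by
        rw [h.s_s, ← vcomp_assoc, icl, h.U_U, h.U_tok]
    _ = h.s ⊙ (h.s ⊙ (h.U * h.tok f)) ⊙ h.s := by simp only [vcomp_assoc]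
    _ = h.s ⊙ (h.tok f * h.U) ⊙ (h.s ⊙ h.s) := by rw [← h.tok_s]; simp only [vcomp_assoc]
    _ = h.s ⊙ (h.tok f * h.U) := by rw [h.s_s, icl, h.U_U, h.tok_U]

/-- A token may be moved across the right cup. -/
lemma c_vtok (f : F) : h.c ⊙ (h.vtok f * h.U) = h.c ⊙ (h.V * h.tok f) := by
  have e1 : h.vtok f * h.U =
      (h.c * (h.V * h.U)) ⊙ (h.V * h.tok f * (h.V * h.U)) ⊙ (h.V * (h.d * h.U)) := by
    have : h.vtok f * h.U = ((h.c * h.V) * h.U) ⊙ ((h.V * h.tok f * h.V) * h.U) ⊙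
        ((h.V * h.d) * h.U) := by
      rw [icr, icr, ← HeisPre.vtok, h.U_U, h.U_U]
    simpa only [mul_assoc] using this
  have e2 : h.c ⊙ (h.c * (h.V * h.U)) = h.c ⊙ (h.V * h.U * h.c) := by
    rw [vcomp_mul_left h.c, vcomp_mul_right h.c, h.c_VU]
  have e3 : (h.V * h.U * h.c) ⊙ (h.V * h.tok f * (h.V * h.U)) =
      (h.V * h.tok f) ⊙ (h.V * h.U * h.c) := by
    rw [icl, icl, h.c_VU, vcomp_mul_right h.c, icl, h.tok_U, h.U_tok]
  have e4 : (h.V * h.U * h.c) ⊙ (h.V * (h.d * h.U)) = h.V * h.U := by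
    rw [mul_assoc, icl, h.adj_up, h.V_V]
  rw [e1, vcomp_congr_assoc e2, vcomp_congr_assoc e3, e4, icl, h.V_V, h.tok_U]

/-- A token may be moved across the right cap. -/
lemma vtok_d (f : F) : (h.U * h.vtok f) ⊙ h.d = (h.tok f * h.V) ⊙ h.d := by
  have e1 : h.U * h.vtok f =
      (h.U * h.c * h.V) ⊙ (h.U * h.V * (h.tok f * h.V)) ⊙ (h.U * h.V * h.d) := by
    have : h.U * h.vtok f = (h.U * (h.c * h.V)) ⊙ (h.U * (h.V * h.tok f * h.V)) ⊙
        (h.U * (h.V * h.d)) := by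
      rw [icl, icl, ← HeisPre.vtok, h.U_U, h.U_U]
    simpa only [mul_assoc] using this
  have e2 : (h.U * h.V * h.d) ⊙ h.d = (h.d * (h.U * h.V)) ⊙ h.d := by
    rw [mul_vcomp_right h.d, mul_vcomp_left h.d, h.UV_d]
  have e3 : (h.U * h.V * (h.tok f * h.V)) ⊙ (h.d * (h.U * h.V)) =
      (h.d * (h.U * h.V)) ⊙ (h.tok f * h.V) := by
    rw [icl, icl, mul_vcomp_left h.d, icl, h.UV_d, h.tok_U, h.U_tok, h.V_V]
  have e4 : (h.U * h.c * h.V) ⊙ (h.d * (h.U * h.V)) = h.U * h.V := by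
    rw [← mul_assoc, icl, h.adj_up, h.V_V]
  rw [e1, vcomp_assoc, vcomp_assoc, e2, vcomp_congr_assoc e3, ← vcomp_assoc, e4, ← vcomp_assoc,
    icl, h.U_tok, h.V_V]

/-- Rotation reverses the order, which cancels the reversal in `tok_mul`. The first token slides
under the cup of the second one, past it, and is absorbed at the cap by `vtok_d`. -/
lemma vtok_mul (f g : F) : h.vtok f ⊙ h.vtok g = h.vtok (f * g) := by
  have e1 : h.vtok f ⊙ (h.c * h.V) = (h.c * h.V) ⊙ (h.V * h.U * h.vtok f) := by
    rw [vcomp_mul_left h.c, icl, h.c_VU, h.V_vtok, h.vtok_V]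
  have e2 : (h.V * h.U * h.vtok f) ⊙ (h.V * h.tok g * h.V) =
      (h.V * h.tok g * h.V) ⊙ (h.V * (h.U * h.vtok f)) := by
    rw [← mul_assoc, icl, icl, icl, icl, h.U_tok, h.tok_U, h.V_vtok, h.vtok_V]
  have e3 : (h.V * (h.U * h.vtok f)) ⊙ (h.V * h.d) = (h.V * h.tok f * h.V) ⊙ (h.V * h.d) := by
    rw [mul_assoc, icl, icl, h.vtok_d]
  conv_lhs => rw [HeisPre.vtok.eq_def h.toHeisPre g]
  rw [vcomp_congr_assoc e1, vcomp_congr_assoc e2, e3, HeisPre.vtok, h.tok_mul,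
    ← vcomp_assoc (h.V * h.tok g * h.V) (h.V * h.tok f * h.V),
    icl (f := h.V * h.tok g) (g := h.V * h.tok f), icl (f := h.V) (g := h.V), h.V_V]

lemma vtok_one : h.vtok 1 = h.V := by
  rw [HeisPre.vtok, h.tok_one, mul_assoc, icl, h.V_V, h.UV_d, h.adj_down]

lemma vtok_add (f g : F) : h.vtok (f + g) = h.vtok f + h.vtok g := by
  simp only [HeisPre.vtok, h.tok_add, mul_add, add_mul, add_vcomp, vcomp_add]

lemma vtok_zero : h.vtok 0 = 0 := by
  simp [HeisPre.vtok, h.tok_zero]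

lemma vtok_sum {κ : Type*} (s : Finset κ) (f : κ → F) :
    h.vtok (∑ i ∈ s, f i) = ∑ i ∈ s, h.vtok (f i) :=
  map_sum (⟨⟨h.vtok, h.vtok_zero⟩, h.vtok_add⟩ : F →+ D.Total) f s

lemma tok_t (f : F) : (h.tok f * h.V) ⊙ h.t = h.t ⊙ (h.V * h.tok f) := by
  have e1 : (h.tok f * h.V) ⊙ (h.c * (h.U * h.V)) =
      (h.c * (h.U * h.V)) ⊙ (h.V * (h.U * h.tok f) * h.V) := by
    rw [vcomp_mul_left h.c, icl, mul_regroup, icl, icl, h.c_VU, h.tok_U,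
      h.U_tok]
  have e2 : (h.V * (h.U * h.tok f) * h.V) ⊙ (h.V * h.s * h.V) =
      (h.V * h.s * h.V) ⊙ (h.V * (h.tok f * h.U) * h.V) := by
    rw [icl, icl, icl, icl, h.s_tok]
  have e3 : (h.V * (h.tok f * h.U) * h.V) ⊙ (h.V * h.U * h.d) =
      (h.V * h.U * h.d) ⊙ (h.V * h.tok f) := by
    rw [mul_regroup, icl, icl, h.UV_d, mul_vcomp_right h.d, icl, h.tok_U,
      h.U_tok]
  rw [HeisPre.t, vcomp_congr_assoc e1, vcomp_congr_assoc e2, e3]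
  simp only [vcomp_assoc]

/-- The downward token travels along its strand: at the cap it becomes an upward token (`e3`),
passes the upward crossing (`e4`) and turns down again at the cup (`e5`). The other equations move
it past distant parts of the diagram. -/
lemma vtok_t (f : F) : (h.U * h.vtok f) ⊙ h.t = h.t ⊙ (h.vtok f * h.U) := by
  have e1 : (h.U * h.vtok f) ⊙ (h.c * (h.U * h.V)) =
      (h.c * (h.U * h.V)) ⊙ (h.V * (h.U * h.U) * h.vtok f) := by
    rw [vcomp_mul_left h.c, icl, mul_regroup, icl, icl, h.c_VU, h.V_vtok,
      h.vtok_V]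
  have e2 : (h.V * (h.U * h.U) * h.vtok f) ⊙ (h.V * h.s * h.V) =
      (h.V * h.s * h.V) ⊙ (h.V * (h.U * h.U) * h.vtok f) := by
    rw [icl, icl, icl, icl, h.V_vtok, h.vtok_V, h.s_UU, h.UU_s]
  have e3 : (h.V * (h.U * h.U) * h.vtok f) ⊙ (h.V * h.U * h.d) =
      (h.V * (h.U * h.tok f) * h.V) ⊙ (h.V * h.U * h.d) := by
    rw [mul_regroup, icl, icl, h.vtok_d, mul_regroup, icl, icl]
  have e4 : (h.V * h.s * h.V) ⊙ (h.V * (h.U * h.tok f) * h.V) =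
      (h.V * (h.tok f * h.U) * h.V) ⊙ (h.V * h.s * h.V) := by
    rw [icl, icl, icl, icl, h.tok_s]
  have e5 : (h.c * (h.U * h.V)) ⊙ (h.V * (h.tok f * h.U) * h.V) =
      (h.c * (h.U * h.V)) ⊙ (h.vtok f * (h.U * h.U) * h.V) := by
    rw [mul_regroup, icl, ← h.c_vtok, mul_regroup, icl, icl, icl]
  have e6 : (h.vtok f * (h.U * h.U) * h.V) ⊙ (h.V * h.s * h.V) =
      (h.V * h.s * h.V) ⊙ (h.vtok f * (h.U * h.U) * h.V) := by
    rw [icl, icl, icl, icl, h.V_vtok, h.vtok_V, h.s_UU, h.UU_s]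
  have e7 : (h.vtok f * (h.U * h.U) * h.V) ⊙ (h.V * h.U * h.d) =
      (h.V * h.U * h.d) ⊙ (h.vtok f * h.U) := by
    rw [mul_regroup, icl, icl, h.UV_d, mul_vcomp_right h.d, icl,
      h.V_vtok, h.vtok_V]
  rw [HeisPre.t, vcomp_congr_assoc e1, vcomp_congr_assoc e2, e3, vcomp_congr_assoc e4,
    vcomp_congr_assoc e5, vcomp_congr_assoc e6, e7]
  simp only [vcomp_assoc]

end HeisData

end FrobHeis

namespace FrobHeis

open WordData

/-! ### Intertwiners and the inversion relation -/

section Intertwine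

variable {R : Type u} [CommRing R] {S : Type} {D : WordData.{u, v} R S} [Lawful D]
  {κ κ' : Type*} [Fintype κ] [Fintype κ'] {t₁ L₁ t₂ L₂ P Q A B : D.Total}
  {cap₁ cap₂ cup₁ cup₂ N : κ → D.Total} {lcap₁ lcap₂ rcup₁ rcup₂ N' : κ' → D.Total}

/-- For invertible t₁, t₂ this is L₁P = L₁Pt₂L₂ = L₁t₁QL₂ = QL₂. The cap and cup terms of the two
inverse matrices are moved through by `hcap` and `hcup` and vanish by `h₁` and `h₂`. It is used with
colour idempotents as `P`, `Q`, where `N`, `N'` are 0 or 1, and with the slides of a strand, where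
`N`, `N'` are the identity of that strand. -/
lemma cross_intertwine (hB : L₁ ⊙ t₁ + ∑ p, lcap₁ p ⊙ rcup₁ p = B) (hBQ : B ⊙ Q = Q)
    (hA : t₂ ⊙ L₂ + ∑ p, cap₂ p ⊙ cup₂ p = A) (hPA : P ⊙ A = P) (ht : t₁ ⊙ Q = P ⊙ t₂)
    (hcap : ∀ p, cap₁ p ⊙ N p = P ⊙ cap₂ p) (hcup : ∀ p, rcup₁ p ⊙ Q = N' p ⊙ rcup₂ p)
    (h₁ : ∀ p, L₁ ⊙ cap₁ p = 0) (h₂ : ∀ p, rcup₂ p ⊙ L₂ = 0) : L₁ ⊙ P = Q ⊙ L₂ := by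
  have e1 : Q ⊙ L₂ = L₁ ⊙ P ⊙ t₂ ⊙ L₂ := by
    conv_lhs => rw [← hBQ, ← hB]
    rw [vcomp_assoc, add_vcomp, sum_vcomp, vcomp_assoc, vcomp_congr_assoc ht,
      Finset.sum_eq_zero, add_zero]
    intro p _
    rw [vcomp_assoc, vcomp_congr_assoc (hcup p), h₂, vcomp_zero, vcomp_zero]
  rw [e1]
  conv_lhs => rw [← hPA, ← hA]
  rw [vcomp_add, vcomp_add, vcomp_sum, vcomp_sum, Finset.sum_eq_zero, add_zero]
  intro p _
  rw [← vcomp_congr_assoc (hcap p), ← vcomp_assoc, h₁, zero_vcomp]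

/-- The same argument for the other rows of the inverse matrix. Here `I` stands for the identity of
the unit object, possibly tensored with a strand. -/
lemma cup_intertwine [DecidableEq κ] {I : D.Total} (hA : t₂ ⊙ L₂ + ∑ p, cap₂ p ⊙ cup₂ p = A)
    (hPA : P ⊙ A = P) (ht : t₁ ⊙ Q = P ⊙ t₂) (hcap : ∀ p, cap₁ p ⊙ N p = P ⊙ cap₂ p)
    (h₁ : ∀ p, cup₁ p ⊙ t₁ = 0) (h₂ : ∀ p q, cup₁ p ⊙ cap₁ q = if p = q then I else 0)
    (hI : ∀ p, I ⊙ N p = N p) (p : κ) : cup₁ p ⊙ P = N p ⊙ cup₂ p := by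
  conv_lhs => rw [← hPA, ← hA]
  rw [vcomp_add, vcomp_add, ← vcomp_congr_assoc ht, ← vcomp_assoc, h₁, zero_vcomp, zero_add,
    vcomp_sum, vcomp_sum, Finset.sum_eq_single p]
  · rw [← vcomp_congr_assoc (hcap p), ← vcomp_assoc, h₂, if_pos rfl, ← vcomp_assoc, hI]
  · intro q _ hq
    rw [← vcomp_congr_assoc (hcap q), ← vcomp_assoc, h₂, if_neg hq.symm, zero_vcomp]
  · simp

/-- The mirror image of `cup_intertwine`, for the columns that occur when the central charge is
negative. -/
lemma cap_intertwine [DecidableEq κ'] {I : D.Total} (hB : L₁ ⊙ t₁ + ∑ p, lcap₁ p ⊙ rcup₁ p = B)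
    (hBQ : B ⊙ Q = Q) (ht : t₁ ⊙ Q = P ⊙ t₂) (hcup : ∀ p, rcup₁ p ⊙ Q = N' p ⊙ rcup₂ p)
    (h₁ : ∀ p, t₂ ⊙ lcap₂ p = 0) (h₂ : ∀ p q, rcup₂ p ⊙ lcap₂ q = if p = q then I else 0)
    (hI : ∀ p, N' p ⊙ I = N' p) (p : κ') : lcap₁ p ⊙ N' p = Q ⊙ lcap₂ p := by
  conv_rhs => rw [← hBQ, ← hB]
  rw [vcomp_assoc, add_vcomp, vcomp_assoc, vcomp_congr_assoc ht, h₁, vcomp_zero, vcomp_zero,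
    zero_add, sum_vcomp, Finset.sum_eq_single p]
  · rw [vcomp_assoc, vcomp_congr_assoc (hcup p), h₂, if_pos rfl, hI]
  · intro q _ hq
    rw [vcomp_assoc, vcomp_congr_assoc (hcup q), h₂, if_neg hq, vcomp_zero, vcomp_zero]
  · simp

end Intertwine

/-! ### Colours -/

section DirectSum

variable {R : Type u} [CommRing R] {n : ℕ} {F : Fin n → Type v} [∀ i, Ring (F i)]
  [∀ i, Algebra R (F i)] {ι : Fin n → Type w}

/-- Dual basis elements are determined by their pairings with the basis, and different summands are
orthogonal for the trace of the direct sum. -/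
lemma dual_directSum (φ : ∀ i, SymmFrobenius R (F i)) (b : ∀ i, Module.Basis (ι i) R (F i))
    (i : Fin n) (j : ι i) :
    (SymmFrobenius.directSum φ).dual (Pi.basis b) ⟨i, j⟩ = Pi.single i ((φ i).dual (b i) j) := by
  classical
  refine (SymmFrobenius.directSum φ).bijective.injective ((Pi.basis b).ext ?_)
  rintro ⟨i', j'⟩
  change (SymmFrobenius.directSum φ).tr (_ * _) = (SymmFrobenius.directSum φ).tr (_ * _)
  rw [SymmFrobenius.tr_dual_mul, Module.Basis.coord_apply, Module.Basis.repr_self]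
  simp only [SymmFrobenius.directSum, LinearMap.sum_apply, LinearMap.comp_apply,
    LinearMap.proj_apply, Pi.basis_apply, Pi.mul_apply]
  rw [Finset.sum_eq_single i (fun l _ hl => by simp [hl]) (by simp), Pi.single_eq_same]
  by_cases hi : i = i'
  · subst hi
    rw [Pi.single_eq_same, SymmFrobenius.tr_dual_mul, Module.Basis.coord_apply,
      Module.Basis.repr_self, Finsupp.single_apply, Finsupp.single_apply]
    by_cases hj : j' = j
    · subst hj; simp
    · rw [if_neg hj, if_neg (by simpa using hj)]
  · rw [Pi.single_eq_of_ne hi, mul_zero, map_zero, Finsupp.single_apply, if_neg]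
    rintro ⟨⟩
    exact hi rfl

end DirectSum

namespace HeisData

variable {R : Type u} [CommRing R] {n : ℕ} {F : Fin n → Type v} [∀ i, Ring (F i)]
  [∀ i, Algebra R (F i)] {ι : Fin n → Type w} [∀ i, Fintype (ι i)]
  {φ : ∀ i, SymmFrobenius R (F i)} {b : ∀ i, Module.Basis (ι i) R (F i)} {k : ℤ} {S' : Type}
  {D : WordData.{u} R S'} [Lawful D] (h : HeisData (SymmFrobenius.directSum φ) (Pi.basis b) k D)

/-- The identity of the `i`-coloured upward strand. -/
noncomputable def u (i : Fin n) : D.Total := h.tok (Pi.single i 1)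

/-- The identity of the `i`-coloured downward strand. -/
noncomputable def v (i : Fin n) : D.Total := h.vtok (Pi.single i 1)

instance sz_u (i : Fin n) : Sz (h.u i) 1 1 := h.sztok _
instance sz_v (i : Fin n) : Sz (h.v i) 1 1 := h.sz_vtok _

lemma single_one_mul (i : Fin n) (f : ∀ i, F i) : Pi.single i 1 * f = Pi.single i (f i) := by
  funext j
  by_cases hj : j = i
  · subst hj; simp
  · simp [hj]

lemma mul_single_one (i : Fin n) (f : ∀ i, F i) : f * Pi.single i 1 = Pi.single i (f i) := by
  funext j
  by_cases hj : j = i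
  · subst hj; simp
  · simp [hj]

lemma u_tok (i : Fin n) (f : ∀ i, F i) : h.u i ⊙ h.tok f = h.tok (Pi.single i (f i)) := by
  rw [u, ← h.tok_mul, mul_single_one]

lemma tok_u (i : Fin n) (f : ∀ i, F i) : h.tok f ⊙ h.u i = h.tok (Pi.single i (f i)) := by
  rw [u, ← h.tok_mul, single_one_mul]

lemma u_self (i : Fin n) : h.u i ⊙ h.u i = h.u i := by
  rw [u, ← h.tok_mul, mul_single_one, Pi.single_eq_same]

lemma u_ne {i j : Fin n} (hij : i ≠ j) : h.u i ⊙ h.u j = 0 := by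
  conv_lhs => rw [u.eq_def h j]
  rw [h.u_tok, Pi.single_eq_of_ne hij, Pi.single_zero, h.tok_zero]

lemma v_self (i : Fin n) : h.v i ⊙ h.v i = h.v i := by
  rw [v, h.vtok_mul, mul_single_one, Pi.single_eq_same]

lemma v_ne {i j : Fin n} (hij : i ≠ j) : h.v i ⊙ h.v j = 0 := by
  rw [v, v, h.vtok_mul, mul_single_one, Pi.single_eq_of_ne hij.symm, Pi.single_zero, h.vtok_zero]

lemma sum_u : ∑ i, h.u i = h.U := by
  rw [← h.tok_one, ← Finset.univ_sum_single (1 : ∀ i, F i), h.tok_sum]; rfl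

lemma sum_v : ∑ i, h.v i = h.V := by
  rw [← h.vtok_one, ← Finset.univ_sum_single (1 : ∀ i, F i), h.vtok_sum]; rfl

lemma U_u (i : Fin n) : h.U ⊙ h.u i = h.u i := h.U_tok _
lemma u_U (i : Fin n) : h.u i ⊙ h.U = h.u i := h.tok_U _
lemma V_v (i : Fin n) : h.V ⊙ h.v i = h.v i := h.V_vtok _
lemma v_V (i : Fin n) : h.v i ⊙ h.V = h.v i := h.vtok_V _

lemma u_x (i : Fin n) : h.u i ⊙ h.x = h.x ⊙ h.u i := (h.x_tok _).symm

lemma u_xpow (i : Fin n) (m : ℕ) : h.u i ⊙ h.xpow m = h.xpow m ⊙ h.u i := (h.xpow_tok m _).symm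

/-- Token slides applied to e_i and e_j: the colours follow the strands through the crossing. -/
lemma uu_s (i j : Fin n) : (h.u i * h.u j) ⊙ h.s = h.s ⊙ (h.u j * h.u i) := by
  have e : h.u i * h.u j = (h.u i * h.U) ⊙ (h.U * h.u j) := by rw [icl, h.U_u, h.u_U]
  have e' : h.u j * h.u i = (h.u j * h.U) ⊙ (h.U * h.u i) := by rw [icl, h.U_u, h.u_U]
  have e'' : (h.u j * h.U) ⊙ (h.U * h.u i) = (h.U * h.u i) ⊙ (h.u j * h.U) := by
    rw [icl, icl, h.U_u, h.u_U, h.U_u, h.u_U]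
  rw [e, e', e'', vcomp_assoc, u, u, h.s_tok, ← vcomp_assoc, h.tok_s, vcomp_assoc]

lemma c_v (i : Fin n) : h.c ⊙ (h.v i * h.U) = h.c ⊙ (h.V * h.u i) := h.c_vtok _

lemma v_d (i : Fin n) : (h.U * h.v i) ⊙ h.d = (h.u i * h.V) ⊙ h.d := h.vtok_d _

lemma c_vu (i : Fin n) : h.c ⊙ (h.v i * h.u i) = h.c ⊙ (h.V * h.u i) := by
  have e : h.v i * h.u i = (h.v i * h.U) ⊙ (h.V * h.u i) := by rw [icl, h.U_u, h.v_V]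
  rw [e, ← vcomp_assoc, c_v, vcomp_assoc, icl, h.V_V, h.u_self]

/-- Moving one idempotent across the cup puts both on the same leg, where e_i e_j = 0. -/
lemma c_vu_ne {i j : Fin n} (hij : i ≠ j) : h.c ⊙ (h.v i * h.u j) = 0 := by
  have e : h.v i * h.u j = (h.v i * h.U) ⊙ (h.V * h.u j) := by rw [icl, h.U_u, h.v_V]
  rw [e, ← vcomp_assoc, c_v, vcomp_assoc, icl, h.V_V, h.u_ne hij, mul_zero, vcomp_zero]

lemma uv_d (i : Fin n) : (h.u i * h.v i) ⊙ h.d = (h.U * h.v i) ⊙ h.d := by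
  have e : h.u i * h.v i = (h.u i * h.V) ⊙ (h.U * h.v i) := by rw [icl, h.u_U, h.V_v]
  rw [e, vcomp_assoc, v_d, ← vcomp_assoc, icl, h.V_V, h.u_self]

lemma uv_d_ne {i j : Fin n} (hij : i ≠ j) : (h.u i * h.v j) ⊙ h.d = 0 := by
  have e : h.u i * h.v j = (h.u i * h.V) ⊙ (h.U * h.v j) := by rw [icl, h.u_U, h.V_v]
  rw [e, vcomp_assoc, v_d, ← vcomp_assoc, icl, h.V_V, h.u_ne hij, zero_mul, zero_vcomp]

lemma uv_t (i j : Fin n) : (h.u i * h.v j) ⊙ h.t = h.t ⊙ (h.v j * h.u i) := by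
  have e : h.u i * h.v j = (h.u i * h.V) ⊙ (h.U * h.v j) := by rw [icl, h.u_U, h.V_v]
  have e' : h.v j * h.u i = (h.V * h.u i) ⊙ (h.v j * h.U) := by rw [icl, h.V_v, h.u_U]
  rw [e, e', vcomp_assoc, v, h.vtok_t, ← vcomp_assoc, u, h.tok_t, vcomp_assoc]

lemma uv_rcap (i j : Fin n) (r : ℕ) (f : ∀ i, F i) :
    (h.u i * h.v j) ⊙ h.rcap r f = if i = j then h.rcap r (Pi.single i (f i)) else 0 := by
  have e : (h.u i * h.v j) ⊙ (h.tok f ⊙ h.xpow r) * h.V =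
      ((h.tok f ⊙ h.xpow r) * h.V) ⊙ (h.u i * h.v j) := by
    rw [icl, icl, h.v_V, h.V_v, vcomp_assoc, ← u_xpow, ← vcomp_assoc, ← vcomp_assoc, h.u_tok,
      h.tok_u]
  rw [HeisPre.rcap, ← vcomp_assoc, e, vcomp_assoc]
  split_ifs with hij
  · subst hij
    rw [uv_d, v_d, ← vcomp_assoc, icl, h.V_V, vcomp_assoc, ← u_xpow, ← vcomp_assoc, h.tok_u]; rfl
  · rw [h.uv_d_ne hij, vcomp_zero]

lemma rcup_vu (i j : Fin n) (r : ℕ) (f : ∀ i, F i) :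
    h.rcup r f ⊙ (h.v i * h.u j) = if i = j then h.rcup r (Pi.single i (f i)) else 0 := by
  have e : (h.V * (h.tok f ⊙ h.xpow r)) ⊙ (h.v i * h.u j) =
      (h.v i * h.u j) ⊙ (h.V * (h.tok f ⊙ h.xpow r)) := by
    rw [icl, icl, h.v_V, h.V_v, vcomp_assoc, ← u_xpow, ← vcomp_assoc, ← vcomp_assoc, h.u_tok,
      h.tok_u]
  rw [HeisPre.rcup, vcomp_assoc, e, ← vcomp_assoc]
  split_ifs with hij
  · subst hij
    rw [c_vu, vcomp_assoc, icl, h.V_V, ← vcomp_assoc, h.u_tok]; rfl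
  · rw [h.c_vu_ne hij, zero_vcomp]

/-- A token from F_l forces colour l on both legs. As the dual basis of F is the union of those of
the F_l, every decorated cap of the inversion relation has a single colour. -/
lemma rcap_single (i j l : Fin n) (r : ℕ) (f : F l) :
    (h.u i * h.v j) ⊙ h.rcap r (Pi.single l f) =
      if i = l ∧ j = l then h.rcap r (Pi.single l f) else 0 := by
  rw [uv_rcap]
  by_cases hij : i = j
  · subst hij
    by_cases hil : i = l
    · subst hil; simp
    · simp only [hil, if_true, and_self, if_false, ne_eq, not_false_eq_true, Pi.single_eq_of_ne,
        Pi.single_zero]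
      simp [HeisPre.rcap, h.tok_zero]
  · rw [if_neg hij, if_neg]
    rintro ⟨rfl, rfl⟩
    exact hij rfl

lemma rcup_single (i j l : Fin n) (r : ℕ) (f : F l) :
    h.rcup r (Pi.single l f) ⊙ (h.v i * h.u j) =
      if i = l ∧ j = l then h.rcup r (Pi.single l f) else 0 := by
  rw [rcup_vu]
  by_cases hij : i = j
  · subst hij
    by_cases hil : i = l
    · subst hil; simp
    · simp only [hil, if_true, and_self, if_false, ne_eq, not_false_eq_true, Pi.single_eq_of_ne,
        Pi.single_zero]
      simp [HeisPre.rcup, h.tok_zero]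
  · rw [if_neg hij, if_neg]
    rintro ⟨rfl, rfl⟩
    exact hij rfl

lemma uv_UV (i j : Fin n) : (h.u i * h.v j) ⊙ (h.U * h.V) = h.u i * h.v j := by
  rw [icl, h.u_U, h.v_V]

lemma VU_vu (i j : Fin n) : (h.V * h.U) ⊙ (h.v i * h.u j) = h.v i * h.u j := by
  rw [icl, h.U_u, h.V_v]

open scoped Classical in
-- The right crossing and the decorated cups and caps respect the colour idempotents, hence so does
-- the inverse matrix. `N` and `N'` are the indicators of the colour of a decorated cap or cup.
lemma vu_L (i j : Fin n) : (h.v i * h.u j) ⊙ h.L = h.L ⊙ (h.u j * h.v i) := by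
  refine (cross_intertwine (N := fun p => if j = p.2.1 ∧ i = p.2.1 then 1 else 0)
    (N' := fun p => if i = p.2.1 ∧ j = p.2.1 then 1 else 0)
    h.L_t (h.VU_vu i j) h.t_L (h.uv_UV j i) (h.uv_t j i).symm ?_ ?_
    (fun p => h.L_rcap p.1 p.2) (fun p => h.rcup_L p.1 p.2)).symm
  · rintro ⟨r, l, m⟩
    rw [dual_directSum, rcap_single]
    split_ifs
    · exact vcomp_one
    · exact vcomp_zero _
  · rintro ⟨r, l, m⟩
    rw [dual_directSum, rcup_single]
    split_ifs
    · exact one_vcomp.symm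
    · exact (zero_vcomp _).symm

open scoped Classical in
-- The left cup is an entry of the inverse matrix, so it inherits its colour from the decorated
-- right cap with the same index.
lemma lcup_uv (i j : Fin n) (r : Fin k.toNat) (l : Fin n) (m : ι l) :
    h.lcup r ⟨l, m⟩ ⊙ (h.u i * h.v j) = if i = l ∧ j = l then h.lcup r ⟨l, m⟩ else 0 := by
  have := cup_intertwine (N := fun p : Fin k.toNat × (Σ i, ι i) =>
      if i = p.2.1 ∧ j = p.2.1 then (1 : D.Total) else 0)
    (cup₁ := fun p => h.lcup p.1 p.2) (I := 1)
    (cap₁ := fun p => h.rcap p.1 ((SymmFrobenius.directSum φ).dual (Pi.basis b) p.2))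
    h.t_L (h.uv_UV i j) (h.uv_t i j).symm ?_ (fun p => h.lcup_t p.1 p.2) ?_ ?_ (r, ⟨l, m⟩)
  · refine this.trans ?_
    dsimp only
    split_ifs
    · exact one_vcomp
    · exact zero_vcomp _
  · rintro ⟨r, l, m⟩
    rw [dual_directSum, rcap_single]
    split_ifs
    · exact vcomp_one
    · exact vcomp_zero _
  · intro p q
    split_ifs with hpq
    · rw [← hpq]; exact h.lcup_rcap _ _
    · exact h.lcup_rcap_ne _ _ _ _ hpq
  · intro p
    split_ifs
    · exact one_vcomp
    · exact vcomp_zero _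

open scoped Classical in
lemma vu_lcap (i j : Fin n) (r : Fin (-k).toNat) (l : Fin n) (m : ι l) :
    (h.v i * h.u j) ⊙ h.lcap r ⟨l, m⟩ = if i = l ∧ j = l then h.lcap r ⟨l, m⟩ else 0 := by
  have := cap_intertwine (N' := fun p : Fin (-k).toNat × (Σ i, ι i) =>
      if i = p.2.1 ∧ j = p.2.1 then (1 : D.Total) else 0)
    (lcap₂ := fun p => h.lcap p.1 p.2) (I := 1)
    (rcup₂ := fun p => h.rcup p.1 ((SymmFrobenius.directSum φ).dual (Pi.basis b) p.2))
    h.L_t (h.VU_vu i j) (h.uv_t j i).symm ?_ (fun p => h.t_lcap p.1 p.2) ?_ ?_ (r, ⟨l, m⟩)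
  · refine this.symm.trans ?_
    dsimp only
    split_ifs
    · exact vcomp_one
    · exact vcomp_zero _
  · rintro ⟨r, l, m⟩
    rw [dual_directSum, rcup_single]
    split_ifs
    · exact one_vcomp.symm
    · exact (zero_vcomp _).symm
  · intro p q
    split_ifs with hpq
    · rw [← hpq]; exact h.rcup_lcap _ _
    · exact h.rcup_lcap_ne _ _ _ _ hpq
  · intro p
    split_ifs
    · exact one_vcomp
    · exact zero_vcomp _

/-- The coloured upward crossing. -/
noncomputable def cs (i j : Fin n) : D.Total := (h.u i * h.u j) ⊙ h.s
/-- The coloured right cup. -/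
noncomputable def cc (i : Fin n) : D.Total := h.c ⊙ (h.v i * h.u i)
/-- The coloured right cap. -/
noncomputable def cd (i : Fin n) : D.Total := (h.u i * h.v i) ⊙ h.d
/-- The coloured right crossing. -/
noncomputable def ct (i j : Fin n) : D.Total := (h.u i * h.v j) ⊙ h.t

instance sz_cs (i j : Fin n) : Sz (h.cs i j) 2 2 := by unfold cs; infer_instance
instance sz_cc (i : Fin n) : Sz (h.cc i) 0 2 := by unfold cc; infer_instance
instance sz_cd (i : Fin n) : Sz (h.cd i) 2 0 := by unfold cd; infer_instance
instance sz_ct (i j : Fin n) : Sz (h.ct i j) 2 2 := by unfold ct; infer_instance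

/-- Two descriptions of the coloured right crossing: cutting `t` by idempotents, and rotating the
coloured upward crossing. In the second one, the idempotents inside the diagram slide along their
strands to the source, where they merge. -/
lemma ct_eq (i j : Fin n) : h.ct i j =
    (h.cc j * (h.u i * h.v j)) ⊙ (h.v j * h.cs j i * h.v j) ⊙ (h.v j * h.u i * h.cd j) := by
  have a1 : h.cc j * (h.u i * h.v j) =
      (h.c * (h.U * h.V)) ⊙ (h.v j * (h.u j * h.u i) * h.v j) := by
    rw [mul_regroup, icl, icl, h.U_u, h.V_v, cc]
  have a2 : h.v j * h.cs j i * h.v j =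
      (h.v j * (h.u j * h.u i) * h.v j) ⊙ (h.V * h.s * h.V) := by
    rw [icl, icl, h.v_V, cs]
  have a3 : h.v j * h.u i * h.cd j =
      (h.v j * (h.u i * h.u j) * h.v j) ⊙ (h.V * h.U * h.d) := by
    rw [mul_regroup, icl, icl, h.v_V, h.u_U, cd]
  have a4 : (h.v j * (h.u j * h.u i) * h.v j) ⊙ (h.v j * (h.u j * h.u i) * h.v j) =
      h.v j * (h.u j * h.u i) * h.v j := by
    rw [icl, icl, icl, h.v_self, h.u_self, h.u_self]
  have a5 : (h.V * h.s * h.V) ⊙ (h.v j * (h.u i * h.u j) * h.v j) =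
      (h.v j * (h.u j * h.u i) * h.v j) ⊙ (h.V * h.s * h.V) := by
    rw [icl, icl, icl, icl, h.v_V, h.V_v, uu_s]
  have a6 : (h.c * (h.U * h.V)) ⊙ (h.v j * (h.u j * h.u i) * h.v j) =
      (h.c * (h.U * h.V)) ⊙ (h.V * (h.u j * h.u i) * h.v j) := by
    rw [mul_regroup, mul_regroup, icl, icl, c_vu, icl, icl]
  have a7 : (h.V * (h.u j * h.u i) * h.v j) ⊙ (h.V * h.s * h.V) =
      (h.V * h.s * h.V) ⊙ (h.V * (h.u i * h.u j) * h.v j) := by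
    rw [icl, icl, icl, icl, h.v_V, h.V_v, uu_s]
  have a8 : (h.V * (h.u i * h.u j) * h.v j) ⊙ (h.V * h.U * h.d) =
      (h.V * (h.u i * h.U) * h.v j) ⊙ (h.V * h.U * h.d) := by
    rw [mul_regroup, mul_regroup, icl, icl, uv_d, icl, icl]
  have a9 : (h.V * h.s * h.V) ⊙ (h.V * (h.u i * h.U) * h.v j) =
      (h.V * (h.U * h.u i) * h.v j) ⊙ (h.V * h.s * h.V) := by
    rw [icl, icl, icl, icl, h.v_V, h.V_v, u, h.s_tok]
  have a10 : (h.c * (h.U * h.V)) ⊙ (h.V * (h.U * h.u i) * h.v j) =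
      (h.u i * h.v j) ⊙ (h.c * (h.U * h.V)) := by
    rw [mul_regroup, icl, icl, h.c_VU, vcomp_mul_left h.c, icl, h.U_u, h.V_v, h.u_U, h.v_V]
  have a4' : ∀ z, (h.v j * (h.u j * h.u i) * h.v j) ⊙ (h.v j * (h.u j * h.u i) * h.v j) ⊙ z =
      (h.v j * (h.u j * h.u i) * h.v j) ⊙ z := fun z => by rw [← vcomp_assoc, a4]
  rw [a1, a2, a3]
  simp only [vcomp_assoc]
  rw [a4', vcomp_congr_assoc a5, a4', vcomp_congr_assoc a6, vcomp_congr_assoc a7, a8,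
    vcomp_congr_assoc a9, vcomp_congr_assoc a10]
  rfl

end HeisData

end FrobHeis

namespace FrobHeis

open WordData

/-! ### Relations between coloured generators -/

namespace HeisData

variable {R : Type u} [CommRing R] {n : ℕ} {F : Fin n → Type v} [∀ i, Ring (F i)]
  [∀ i, Algebra R (F i)] {ι : Fin n → Type w} [∀ i, Fintype (ι i)]
  {φ : ∀ i, SymmFrobenius R (F i)} {b : ∀ i, Module.Basis (ι i) R (F i)} {k : ℤ} {S' : Type}
  {D : WordData.{u} R S'} [Lawful D] (h : HeisData (SymmFrobenius.directSum φ) (Pi.basis b) k D)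

/-- The coloured left crossing. -/
noncomputable def cL (i j : Fin n) : D.Total := (h.v i * h.u j) ⊙ h.L

instance sz_cL (i j : Fin n) : Sz (h.cL i j) 2 2 := by unfold cL; infer_instance

lemma uu_self (i j : Fin n) : (h.u i * h.u j) ⊙ (h.u i * h.u j) = h.u i * h.u j := by
  rw [icl, h.u_self, h.u_self]
lemma uv_self (i j : Fin n) : (h.u i * h.v j) ⊙ (h.u i * h.v j) = h.u i * h.v j := by
  rw [icl, h.u_self, h.v_self]
lemma vu_self (i j : Fin n) : (h.v i * h.u j) ⊙ (h.v i * h.u j) = h.v i * h.u j := by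
  rw [icl, h.u_self, h.v_self]

lemma uu_cs (i j : Fin n) : (h.u i * h.u j) ⊙ h.cs i j = h.cs i j := by
  rw [cs, ← vcomp_assoc, uu_self]
lemma cs_uu (i j : Fin n) : h.cs i j ⊙ (h.u j * h.u i) = h.cs i j := by
  rw [cs, uu_s, vcomp_assoc, uu_self]
lemma cc_vu (i : Fin n) : h.cc i ⊙ (h.v i * h.u i) = h.cc i := by
  rw [cc, vcomp_assoc, vu_self]
lemma uv_cd (i : Fin n) : (h.u i * h.v i) ⊙ h.cd i = h.cd i := by
  rw [cd, ← vcomp_assoc, uv_self]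
lemma uv_ct (i j : Fin n) : (h.u i * h.v j) ⊙ h.ct i j = h.ct i j := by
  rw [ct, ← vcomp_assoc, uv_self]
lemma ct_vu (i j : Fin n) : h.ct i j ⊙ (h.v j * h.u i) = h.ct i j := by
  rw [ct, uv_t, vcomp_assoc, vu_self]
lemma vu_cL (i j : Fin n) : (h.v i * h.u j) ⊙ h.cL i j = h.cL i j := by
  rw [cL, ← vcomp_assoc, vu_self]
lemma cL_uv (i j : Fin n) : h.cL i j ⊙ (h.u j * h.v i) = h.cL i j := by
  rw [cL, vu_L, vcomp_assoc, uv_self]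

lemma cs_cs (i j : Fin n) : h.cs i j ⊙ h.cs j i = h.u i * h.u j := by
  rw [cs, cs, vcomp_assoc, ← vcomp_assoc h.s, ← uu_s, vcomp_assoc, h.s_s, ← vcomp_assoc, uu_self,
    icl, h.u_U, h.u_U]

/-- Idempotents are pulled out of all crossings to the source, which reduces the claim to the
uncoloured braid relation with prescribed source colours. -/
lemma cs_braid (i j l : Fin n) :
    (h.cs i j * h.u l) ⊙ (h.u j * h.cs i l) ⊙ (h.cs j l * h.u i) =
      (h.u i * h.cs j l) ⊙ (h.cs i l * h.u j) ⊙ (h.u l * h.cs i j) := by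
  have idem : ∀ i j l z, (h.u i * h.u j * h.u l) ⊙ (h.u i * h.u j * h.u l) ⊙ z =
      (h.u i * h.u j * h.u l) ⊙ z := fun i j l z => by
    rw [← vcomp_assoc, icl, uu_self, u_self]
  have e1 : ∀ i j l, h.cs i j * h.u l = (h.u i * h.u j * h.u l) ⊙ (h.s * h.U) := fun i j l => by
    rw [icl, h.u_U]; rfl
  have e2 : ∀ i j l, h.u i * h.cs j l = (h.u i * h.u j * h.u l) ⊙ (h.U * h.s) := fun i j l => by
    rw [mul_assoc, icl, h.u_U]; rfl
  have c1 : ∀ i j l, (h.s * h.U) ⊙ (h.u i * h.u j * h.u l) =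
      (h.u j * h.u i * h.u l) ⊙ (h.s * h.U) := fun i j l => by
    rw [icl, icl, h.u_U, h.U_u, uu_s]
  have c2 : ∀ i j l, (h.U * h.s) ⊙ (h.u i * h.u j * h.u l) =
      (h.u i * h.u l * h.u j) ⊙ (h.U * h.s) := fun i j l => by
    rw [mul_assoc, mul_assoc, icl, icl, h.u_U, h.U_u, uu_s]
  simp only [e1, e2, vcomp_assoc]
  rw [vcomp_congr_assoc (c1 j i l), idem, vcomp_congr_assoc (c2 j l i),
    vcomp_congr_assoc (c1 j i l),
    idem, vcomp_congr_assoc (c2 i l j), idem, vcomp_congr_assoc (c1 l i j),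
    vcomp_congr_assoc (c2 i l j), idem, h.braid]

lemma tok_single_u (i : Fin n) (f : F i) :
    h.tok (Pi.single i f) ⊙ h.u i = h.tok (Pi.single i f) := by
  rw [tok_u, Pi.single_eq_same]

lemma u_tok_single_self (i : Fin n) (f : F i) :
    h.u i ⊙ h.tok (Pi.single i f) = h.tok (Pi.single i f) := by
  rw [u_tok, Pi.single_eq_same]

lemma cs_tok (i j : Fin n) (f : F i) :
    (h.tok (Pi.single i f) * h.u j) ⊙ h.cs i j = h.cs i j ⊙ (h.u j * h.tok (Pi.single i f)) := by
  have e : (h.tok (Pi.single i f) * h.u j) ⊙ (h.u i * h.u j) = h.tok (Pi.single i f) * h.u j := by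
    rw [icl, tok_single_u, u_self]
  have e' : (h.u j * h.u i) ⊙ (h.u j * h.tok (Pi.single i f)) = h.u j * h.tok (Pi.single i f) := by
    rw [icl, u_tok, u_self, Pi.single_eq_same]
  have e'' : h.tok (Pi.single i f) * h.u j = (h.tok (Pi.single i f) * h.U) ⊙ (h.U * h.u j) := by
    rw [icl, U_u, h.tok_U]
  have e₃ : h.u j * h.tok (Pi.single i f) = (h.U * h.tok (Pi.single i f)) ⊙ (h.u j * h.U) := by
    rw [icl, U_u, h.tok_U]
  rw [cs, ← vcomp_assoc, e, uu_s, vcomp_assoc, e', e'', e₃, ← vcomp_assoc, ← h.tok_s,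
    vcomp_assoc, vcomp_assoc, u, h.s_tok]

lemma u_tok_single (i l : Fin n) (f : F l) :
    h.u i ⊙ h.tok (Pi.single l f) = if i = l then h.tok (Pi.single l f) else 0 := by
  rw [u_tok]
  split_ifs with hil
  · subst hil; simp
  · rw [Pi.single_eq_of_ne hil, Pi.single_zero, tok_zero]

lemma cs_x (i j : Fin n) : h.cs i j ⊙ ((h.u j ⊙ h.x) * h.u i) =
    (h.u i * (h.u j ⊙ h.x)) ⊙ h.cs i j + ∑ p : Σ l, ι l,
      (h.u i ⊙ h.tok (Pi.single p.1 ((φ p.1).dual (b p.1) p.2))) *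
        (h.u j ⊙ h.tok (Pi.single p.1 (b p.1 p.2))) := by
  have e1 : (h.u j ⊙ h.x) * h.u i = (h.u j * h.u i) ⊙ (h.x * h.U) := by rw [icl, h.u_U]
  have e2 : (h.u i * (h.u j ⊙ h.x)) ⊙ h.cs i j = (h.u i * h.u j) ⊙ (h.U * h.x) ⊙ h.s := by
    rw [cs, ← vcomp_assoc, ← vcomp_assoc, icl, icl, u_self, u_U, vcomp_assoc, ← u_x, ← vcomp_assoc,
      u_self]
  rw [e2, e1, ← vcomp_assoc, cs_uu, cs, vcomp_assoc, h.s_x, vcomp_add, vcomp_sum]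
  congr 1
  refine Finset.sum_congr rfl fun p _ => ?_
  rw [icl, dual_directSum, Pi.basis_apply]

/-- Each correction term carries tokens of one common colour on two strands of different colours, so
one of the two factors vanishes. -/
lemma cs_x_ne {i j : Fin n} (hij : i ≠ j) : h.cs i j ⊙ ((h.u j ⊙ h.x) * h.u i) =
    (h.u i * (h.u j ⊙ h.x)) ⊙ h.cs i j := by
  rw [cs_x, Finset.sum_eq_zero, add_zero]
  rintro ⟨l, m⟩ _
  rw [u_tok_single, u_tok_single]
  by_cases hil : i = l
  · rw [if_neg (fun e : j = l => hij (hil.trans e.symm)), mul_zero]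
  · rw [if_neg hil, zero_mul]

lemma cs_x_self (i : Fin n) : h.cs i i ⊙ ((h.u i ⊙ h.x) * h.u i) =
    (h.u i * (h.u i ⊙ h.x)) ⊙ h.cs i i + ∑ m, h.tok (Pi.single i ((φ i).dual (b i) m)) *
      h.tok (Pi.single i (b i m)) := by
  rw [cs_x]
  congr 1
  rw [Fintype.sum_sigma, Finset.sum_eq_single i]
  · simp [u_tok_single]
  · intro l _ hl
    simp [u_tok_single, hl.symm]
  · simp

/-- The strand of the zigzag is connected, so all its colour idempotents slide together and only one
copy of `u i` is left after straightening. -/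
lemma c_adj_up (i : Fin n) : (h.u i * h.cc i) ⊙ (h.cd i * h.u i) = h.u i := by
  have e1 : h.u i * h.cc i = (h.U * h.c) ⊙ (h.u i * (h.V * h.u i)) := by
    rw [icl, U_u, ← c_vu]; rfl
  have e2 : h.cd i * h.u i = (h.u i * h.V * h.u i) ⊙ (h.d * h.U) := by
    rw [icl, ← v_d, ← uv_d, u_U]; rfl
  have e3 : (h.u i * (h.V * h.u i)) ⊙ (h.u i * h.V * h.u i) = h.u i * h.V * h.u i := by
    rw [← mul_assoc, icl, icl, u_self, h.V_V]
  have e4 : h.u i * h.V * h.u i = (h.u i * (h.V * h.U)) ⊙ (h.U * h.V * h.u i) := by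
    rw [← mul_assoc, icl, icl, u_U, U_u, h.V_V]
  have e5 : (h.U * h.c) ⊙ (h.u i * (h.V * h.U)) = h.u i ⊙ (h.U * h.c) := by
    rw [icl, U_u, h.c_VU, vcomp_mul_right h.c, u_U]
  have e6 : (h.U * h.V * h.u i) ⊙ (h.d * h.U) = (h.d * h.U) ⊙ h.u i := by
    rw [icl, h.UV_d, u_U, mul_vcomp_left h.d, U_u]
  rw [e1, e2, vcomp_assoc, ← vcomp_assoc (h.u i * (h.V * h.u i)), e3, e4, vcomp_assoc, e6,
    ← vcomp_assoc, e5, vcomp_assoc, ← vcomp_assoc (h.U * h.c), h.adj_up, U_u, u_self]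

lemma c_adj_down (i : Fin n) : (h.cc i * h.v i) ⊙ (h.v i * h.cd i) = h.v i := by
  have e1 : h.cc i * h.v i = (h.c * h.V) ⊙ (h.v i * h.U * h.v i) := by
    rw [icl, V_v, h.c_v, ← c_vu]; rfl
  have e2 : h.v i * h.cd i = (h.v i * (h.U * h.v i)) ⊙ (h.V * h.d) := by
    rw [icl, v_V, ← uv_d]; rfl
  have e3 : (h.v i * h.U * h.v i) ⊙ (h.v i * (h.U * h.v i)) = h.v i * h.U * h.v i := by
    rw [← mul_assoc, icl, icl, v_self, h.U_U]
  have e4 : h.v i * h.U * h.v i = (h.V * h.U * h.v i) ⊙ (h.v i * (h.U * h.V)) := by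
    rw [← mul_assoc, icl, icl, v_V, V_v, h.U_U]
  have e5 : (h.c * h.V) ⊙ (h.V * h.U * h.v i) = h.v i ⊙ (h.c * h.V) := by
    rw [icl, V_v, h.c_VU, vcomp_mul_left h.c, v_V]
  have e6 : (h.v i * (h.U * h.V)) ⊙ (h.V * h.d) = (h.V * h.d) ⊙ h.v i := by
    rw [icl, h.UV_d, v_V, mul_vcomp_right h.d, V_v]
  rw [e1, e2, vcomp_assoc, ← vcomp_assoc (h.v i * h.U * h.v i), e3, e4, vcomp_assoc, e6,
    ← vcomp_assoc, e5, vcomp_assoc, ← vcomp_assoc (h.c * h.V), h.adj_down, V_v, v_self]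

lemma ct_cL (i j : Fin n) : h.ct i j ⊙ h.cL j i +
    ∑ p : Fin k.toNat × Σ l, ι l,
      (if i = p.2.1 ∧ j = p.2.1 then h.rcap p.1 (Pi.single p.2.1 ((φ p.2.1).dual (b p.2.1) p.2.2))
        else 0) ⊙ h.lcup p.1 p.2 = h.u i * h.v j := by
  have e := congrArg (fun z => (h.u i * h.v j) ⊙ z) h.t_L
  simp only [uv_UV, vcomp_add, vcomp_sum] at e
  rw [← e, ct, cL, uv_t, vcomp_assoc, ← vcomp_assoc (h.v j * h.u i), vu_self, ← vcomp_assoc,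
    ← uv_t, vcomp_assoc]
  congr 1
  refine Finset.sum_congr rfl fun p _ => ?_
  obtain ⟨r, l, m⟩ := p
  rw [← vcomp_assoc, dual_directSum, rcap_single]

lemma cL_ct (i j : Fin n) : h.cL i j ⊙ h.ct j i +
    ∑ p : Fin (-k).toNat × Σ l, ι l, h.lcap p.1 p.2 ⊙
      (if i = p.2.1 ∧ j = p.2.1 then h.rcup p.1 (Pi.single p.2.1 ((φ p.2.1).dual (b p.2.1) p.2.2))
        else 0) = h.v i * h.u j := by
  have e := congrArg (fun z => z ⊙ (h.v i * h.u j)) h.L_t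
  simp only [VU_vu, add_vcomp, sum_vcomp] at e
  rw [← e, ct, cL, vu_L, vcomp_assoc, ← vcomp_assoc (h.u j * h.v i), uv_self, uv_t, vcomp_assoc]
  congr 1
  refine Finset.sum_congr rfl fun p _ => ?_
  obtain ⟨r, l, m⟩ := p
  rw [vcomp_assoc, dual_directSum, rcup_single]

/-- The cap and cup terms of the inversion relation have equal colours at both ends, so none
survives between strands of different colours. This, together with `cL_ct_ne`, is what makes sorting
possible. -/
lemma ct_cL_ne {i j : Fin n} (hij : i ≠ j) : h.ct i j ⊙ h.cL j i = h.u i * h.v j := by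
  rw [← ct_cL, Finset.sum_eq_zero, add_zero]
  rintro ⟨r, l, m⟩ _
  rw [if_neg, zero_vcomp]
  rintro ⟨e, e'⟩
  exact hij (e.trans e'.symm)

lemma cL_ct_ne {i j : Fin n} (hij : i ≠ j) : h.cL i j ⊙ h.ct j i = h.v i * h.u j := by
  rw [← cL_ct, Finset.sum_eq_zero, add_zero]
  rintro ⟨r, l, m⟩ _
  rw [if_neg, vcomp_zero]
  rintro ⟨e, e'⟩
  exact hij (e.trans e'.symm)

/-- The coloured generators. -/
noncomputable def colorPre (i : Fin n) : HeisPre (F i) (ι i) k D.Total where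
  U := h.u i
  V := h.v i
  x := h.u i ⊙ h.x
  s := h.cs i i
  c := h.cc i
  d := h.cd i
  tok f := h.tok (Pi.single i f)
  L := h.cL i i
  lcup r m := h.lcup r ⟨i, m⟩
  lcap r m := h.lcap r ⟨i, m⟩

lemma colorPre_t (i : Fin n) : (h.colorPre i).t = h.ct i i := (h.ct_eq i i).symm

lemma colorPre_xpow (i : Fin n) (m : ℕ) : (h.colorPre i).xpow m = h.u i ⊙ h.xpow m := by
  induction m with
  | zero => exact (h.u_U i).symm
  | succ m ih =>
    change (h.colorPre i).xpow m ⊙ h.u i ⊙ h.x = _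
    rw [ih, HeisPre.xpow, vcomp_assoc, ← vcomp_assoc (h.xpow m), ← u_xpow, vcomp_assoc,
      ← vcomp_assoc, u_self]

lemma colorPre_rcap (i : Fin n) (r : ℕ) (f : F i) :
    (h.colorPre i).rcap r f = h.rcap r (Pi.single i f) := by
  have e := h.rcap_single i i i r f
  rw [if_pos ⟨rfl, rfl⟩] at e
  have e' : (h.tok (Pi.single i f) ⊙ h.u i ⊙ h.xpow r) * h.v i =
      (h.u i * h.v i) ⊙ ((h.tok (Pi.single i f) ⊙ h.xpow r) * h.V) := by
    rw [icl, ← vcomp_assoc, tok_single_u, ← vcomp_assoc, u_tok_single_self, v_V]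
  have e'' : ((h.tok (Pi.single i f) ⊙ h.u i ⊙ h.xpow r) * h.v i) ⊙ (h.u i * h.v i) =
      (h.tok (Pi.single i f) ⊙ h.u i ⊙ h.xpow r) * h.v i := by
    rw [icl, vcomp_assoc, vcomp_assoc, ← u_xpow, ← vcomp_assoc (h.u i), u_self, v_self]
  rw [← e, HeisPre.rcap, colorPre_xpow]
  change ((h.tok (Pi.single i f) ⊙ h.u i ⊙ h.xpow r) * h.v i) ⊙ (h.u i * h.v i) ⊙ h.d =
    (h.u i * h.v i) ⊙ ((h.tok (Pi.single i f) ⊙ h.xpow r) * h.V) ⊙ h.d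
  rw [← vcomp_assoc (_ * _) (h.u i * h.v i) h.d, e'', e', vcomp_assoc]

lemma colorPre_rcup (i : Fin n) (r : ℕ) (f : F i) :
    (h.colorPre i).rcup r f = h.rcup r (Pi.single i f) := by
  have e := h.rcup_single i i i r f
  rw [if_pos ⟨rfl, rfl⟩] at e
  have e' : h.v i * (h.tok (Pi.single i f) ⊙ h.u i ⊙ h.xpow r) =
      (h.V * (h.tok (Pi.single i f) ⊙ h.xpow r)) ⊙ (h.v i * h.u i) := by
    rw [icl, vcomp_assoc, ← u_xpow, V_v]
  have e'' : (h.v i * h.u i) ⊙ (h.v i * (h.tok (Pi.single i f) ⊙ h.u i ⊙ h.xpow r)) =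
      h.v i * (h.tok (Pi.single i f) ⊙ h.u i ⊙ h.xpow r) := by
    rw [icl, ← vcomp_assoc, u_tok_single_self, v_self]
  rw [← e, HeisPre.rcup, colorPre_xpow]
  change (h.c ⊙ (h.v i * h.u i)) ⊙ (h.v i * (h.tok (Pi.single i f) ⊙ h.u i ⊙ h.xpow r)) =
    (h.c ⊙ (h.V * (h.tok (Pi.single i f) ⊙ h.xpow r))) ⊙ (h.v i * h.u i)
  rw [vcomp_assoc h.c, e'', e', vcomp_assoc h.c]

/-- Heisenberg data for a direct sum contain Heisenberg data for each summand. -/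
noncomputable def colorData (i : Fin n) : HeisData (φ i) (b i) k D where
  toHeisPre := h.colorPre i
  szU := h.sz_u i
  szV := h.sz_v i
  szx := by unfold colorPre; infer_instance
  szs := h.sz_cs i i
  szc := h.sz_cc i
  szd := h.sz_cd i
  sztok f := h.sztok _
  szL := h.sz_cL i i
  szlcup r m := h.szlcup _ _
  szlcap r m := h.szlcap _ _
  U_U := h.u_self i
  V_V := h.v_self i
  U_x := by change h.u i ⊙ h.u i ⊙ h.x = h.u i ⊙ h.x; rw [← vcomp_assoc, u_self]
  x_U := by change (h.u i ⊙ h.x) ⊙ h.u i = h.u i ⊙ h.x; rw [u_x, vcomp_assoc, u_self]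
  UU_s := h.uu_cs i i
  s_UU := h.cs_uu i i
  c_VU := h.cc_vu i
  UV_d := h.uv_cd i
  U_tok f := by
    change h.u i ⊙ h.tok (Pi.single i f) = h.tok (Pi.single i f); rw [u_tok, Pi.single_eq_same]
  tok_U f := by
    change h.tok (Pi.single i f) ⊙ h.u i = h.tok (Pi.single i f); rw [tok_u, Pi.single_eq_same]
  VU_L := h.vu_cL i i
  L_UV := h.cL_uv i i
  lcup_UV r m := by
    change h.lcup r ⟨i, m⟩ ⊙ (h.u i * h.v i) = _
    rw [lcup_uv, if_pos ⟨rfl, rfl⟩]; rfl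
  VU_lcap r m := by
    change (h.v i * h.u i) ⊙ h.lcap r ⟨i, m⟩ = _
    rw [vu_lcap, if_pos ⟨rfl, rfl⟩]; rfl
  tok_one := rfl
  tok_mul f g := by
    change h.tok (Pi.single i (f * g)) = _
    rw [Pi.single_mul, h.tok_mul]; rfl
  tok_add f g := by
    change h.tok (Pi.single i (f + g)) = _
    rw [Pi.single_add, h.tok_add]; rfl
  tok_smul r f := by
    change h.tok (Pi.single i (r • f)) = _
    rw [Pi.single_smul, h.tok_smul]; rfl
  braid := h.cs_braid i i i
  s_s := h.cs_cs i i
  x_tok f := by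
    change (h.u i ⊙ h.x) ⊙ h.tok (Pi.single i f) = h.tok (Pi.single i f) ⊙ h.u i ⊙ h.x
    rw [vcomp_assoc, h.x_tok, ← vcomp_assoc, ← vcomp_assoc, u_tok, tok_u]
  tok_s f := h.cs_tok i i f
  s_x := h.cs_x_self i
  adj_up := h.c_adj_up i
  adj_down := h.c_adj_down i
  t_L := by
    rw [colorPre_t]
    have e := h.ct_cL i i
    simp only [Fintype.sum_prod_type, Fintype.sum_sigma] at e ⊢
    refine Eq.trans ?_ e
    congr 1
    refine Finset.sum_congr rfl fun r _ => ?_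
    rw [Finset.sum_eq_single i]
    · simp only [and_self, if_true, colorPre_rcap]; rfl
    · intro l _ hl
      simp [hl.symm]
    · simp
  L_t := by
    rw [colorPre_t]
    have e := h.cL_ct i i
    simp only [Fintype.sum_prod_type, Fintype.sum_sigma] at e ⊢
    refine Eq.trans ?_ e
    congr 1
    refine Finset.sum_congr rfl fun r _ => ?_
    rw [Finset.sum_eq_single i]
    · simp only [and_self, if_true, colorPre_rcup]; rfl
    · intro l _ hl
      simp [hl.symm]
    · simp
  L_rcap r m := by
    rw [colorPre_rcap, ← dual_directSum]
    change ((h.v i * h.u i) ⊙ h.L) ⊙ _ = _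
    rw [vcomp_assoc, h.L_rcap, vcomp_zero]
  lcup_t r m := by
    rw [colorPre_t]
    change h.lcup r ⟨i, m⟩ ⊙ _ = _
    rw [ct, uv_t, ← vcomp_assoc, h.lcup_t, zero_vcomp]
  lcup_rcap r m := by
    rw [colorPre_rcap, ← dual_directSum]
    exact h.lcup_rcap r ⟨i, m⟩
  lcup_rcap_ne r r' m m' hne := by
    rw [colorPre_rcap, ← dual_directSum]
    exact h.lcup_rcap_ne r r' ⟨i, m⟩ ⟨i, m'⟩ (by simpa using hne)
  t_lcap r m := by
    rw [colorPre_t]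
    change _ ⊙ h.lcap r ⟨i, m⟩ = _
    rw [ct, vcomp_assoc, h.t_lcap, vcomp_zero]
  rcup_L r m := by
    rw [colorPre_rcup, ← dual_directSum]
    change _ ⊙ (h.v i * h.u i) ⊙ h.L = _
    rw [vu_L, ← vcomp_assoc, h.rcup_L, zero_vcomp]
  rcup_lcap r m := by
    rw [colorPre_rcup, ← dual_directSum]
    exact h.rcup_lcap r ⟨i, m⟩
  rcup_lcap_ne r r' m m' hne := by
    rw [colorPre_rcup, ← dual_directSum]
    exact h.rcup_lcap_ne r r' ⟨i, m⟩ ⟨i, m'⟩ (by simpa using hne)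

end HeisData

end FrobHeis

namespace FrobHeis

open WordData

/-! ### Systems of strands and crossings -/

/-- Idempotents `e s` in a total algebra, indexed by strand types, with a crossing for each pair. -/
structure StrandSys {R : Type u} [CommRing R] {S : Type} (D : WordData.{u, v} R S) [Lawful D]
    (C : Type) where
  /-- the identity of a strand -/
  e : C → D.Total
  /-- the crossing `s t → t s` -/
  cross : C → C → D.Total
  sz_e : ∀ s, Sz (e s) 1 1
  e_e : ∀ s, e s ⊙ e s = e s
  sz_cross : ∀ s t, Sz (cross s t) 2 2
  ee_cross : ∀ s t, (e s * e t) ⊙ cross s t = cross s t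
  cross_ee : ∀ s t, cross s t ⊙ (e t * e s) = cross s t

namespace StrandSys

variable {R : Type u} [CommRing R] {S : Type} {D : WordData.{u, v} R S} [Lawful D] {C : Type}
  (Q : StrandSys D C)

attribute [instance] sz_e sz_cross

/-- The identity of a word of strands. -/
noncomputable def E (X : List C) : D.Total := objW Q.e X

@[simp] lemma E_nil : Q.E [] = 1 := rfl
lemma E_cons (s : C) (X : List C) : Q.E (s :: X) = Q.e s * Q.E X := objW_cons _ _ _
lemma E_single (s : C) : Q.E [s] = Q.e s := by rw [E_cons, E_nil, mul_one]
lemma E_append (X Y : List C) : Q.E (X ++ Y) = Q.E X * Q.E Y := objW_append _ _ _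
lemma E_E (X : List C) : Q.E X ⊙ Q.E X = Q.E X := objW_idem Q.sz_e Q.e_e X

instance sz_E (X : List C) : Sz (Q.E X) X.length X.length := sz_objW Q.sz_e X

/-- `f` is a morphism from the word `X` to the word `Y`. -/
structure IsHom (X Y : List C) (f : D.Total) : Prop where
  sz : Sz f X.length Y.length
  left : Q.E X ⊙ f = f
  right : f ⊙ Q.E Y = f

variable {Q}

namespace IsHom

variable {X Y Z X' Y' : List C} {f g : D.Total}

lemma icl (hf : Q.IsHom X Y f) (hg : Q.IsHom Y Z g) (f' g' : D.Total) :
    (f * f') ⊙ (g * g') = (f ⊙ g) * (f' ⊙ g') :=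
  interchange_left hf.sz hg.sz f' g'

lemma icr (hf : Q.IsHom X Y f) (hg : Q.IsHom Y Z g) (f' g' : D.Total) :
    (f' * f) ⊙ (g' * g) = (f' ⊙ g') * (f ⊙ g) :=
  interchange_right hf.sz hg.sz f' g'

lemma comp (hf : Q.IsHom X Y f) (hg : Q.IsHom Y Z g) : Q.IsHom X Z (f ⊙ g) where
  sz := by have := hf.sz; have := hg.sz; infer_instance
  left := by rw [← vcomp_assoc, hf.left]
  right := by rw [vcomp_assoc, hg.right]

lemma E (X : List C) : Q.IsHom X X (Q.E X) := ⟨inferInstance, Q.E_E X, Q.E_E X⟩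

lemma mul (hf : Q.IsHom X Y f) (hg : Q.IsHom X' Y' g) :
    Q.IsHom (X ++ X') (Y ++ Y') (f * g) where
  sz := by
    have := hf.sz; have := hg.sz
    exact (Sz.mul (f := f) (g := g)).cast (by simp) (by simp)
  left := by rw [E_append, (E X).icl hf, hf.left, hg.left]
  right := by rw [E_append, hf.icl (E Y), hf.right, hg.right]

lemma zero (X Y : List C) : Q.IsHom X Y 0 := ⟨sz_zero _ _, by simp, by simp⟩

lemma add (hf : Q.IsHom X Y f) (hg : Q.IsHom X Y g) : Q.IsHom X Y (f + g) :=
  ⟨hf.sz.add hg.sz, by simp [hf.left, hg.left], by simp [hf.right, hg.right]⟩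

lemma smul (r : R) (hf : Q.IsHom X Y f) : Q.IsHom X Y (r • f) :=
  ⟨hf.sz.smul r, by simp [hf.left], by simp [hf.right]⟩

lemma e (s : C) : Q.IsHom [s] [s] (Q.e s) := by simpa only [E_single] using E (Q := Q) [s]

lemma cross (s t : C) : Q.IsHom [s, t] [t, s] (Q.cross s t) where
  sz := Q.sz_cross s t
  left := by rw [E_cons, E_single, Q.ee_cross]
  right := by rw [E_cons, E_single, Q.cross_ee]

end IsHom

variable (Q)

lemma E_mul_vcomp (X : List C) (f g : D.Total) :
    Q.E X * (f ⊙ g) = (Q.E X * f) ⊙ (Q.E X * g) := by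
  rw [(IsHom.E X).icl (IsHom.E X), E_E]

lemma vcomp_mul_E (X : List C) (f g : D.Total) :
    (f ⊙ g) * Q.E X = (f * Q.E X) ⊙ (g * Q.E X) := by
  rw [(IsHom.E X).icr (IsHom.E X), E_E]

lemma e_mul_vcomp (s : C) (f g : D.Total) :
    Q.e s * (f ⊙ g) = (Q.e s * f) ⊙ (Q.e s * g) := by
  rw [FrobHeis.icl, e_e]

lemma vcomp_mul_e (s : C) (f g : D.Total) :
    (f ⊙ g) * Q.e s = (f * Q.e s) ⊙ (g * Q.e s) := by
  rw [FrobHeis.icr, e_e]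

/-- The strand `t` moves to the right through the word `X`. -/
noncomputable def slide (t : C) : List C → D.Total
  | [] => Q.e t
  | s :: X => (Q.cross t s * Q.E X) ⊙ (Q.e s * slide t X)

/-- The strand `t` moves to the left through the word `X`. -/
noncomputable def slideL (t : C) : List C → D.Total
  | [] => Q.e t
  | s :: X => (Q.e s * slideL t X) ⊙ (Q.cross s t * Q.E X)

lemma slide_isHom (t : C) (X : List C) : Q.IsHom (t :: X) (X ++ [t]) (Q.slide t X) := by
  induction X with
  | nil => exact IsHom.e t
  | cons s X ih => exact ((IsHom.cross t s).mul (IsHom.E X)).comp ((IsHom.e s).mul ih)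

lemma slideL_isHom (t : C) (X : List C) : Q.IsHom (X ++ [t]) (t :: X) (Q.slideL t X) := by
  induction X with
  | nil => exact IsHom.e t
  | cons s X ih => exact ((IsHom.e s).mul ih).comp ((IsHom.cross s t).mul (IsHom.E X))

lemma slide_append (t : C) (X Y : List C) :
    Q.slide t (X ++ Y) = (Q.slide t X * Q.E Y) ⊙ (Q.E X * Q.slide t Y) := by
  induction X with
  | nil =>
    have e := (Q.slide_isHom t Y).left
    rw [E_cons] at e
    rw [E_nil, one_mul, List.nil_append, slide, e]
  | cons s X ih =>
    rw [List.cons_append, slide, slide, ih, E_append, e_mul_vcomp, vcomp_mul_E, vcomp_assoc, E_cons,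
      mul_assoc, mul_assoc, mul_assoc]

lemma slideL_slide {t : C} {X : List C}
    (h : ∀ s ∈ X, Q.cross s t ⊙ Q.cross t s = Q.e s * Q.e t) :
    Q.slideL t X ⊙ Q.slide t X = Q.E (X ++ [t]) := by
  induction X with
  | nil => rw [slide, slideL, List.nil_append, E_single, e_e]
  | cons s X ih =>
    have e1 : (Q.cross s t * Q.E X) ⊙ (Q.cross t s * Q.E X) = Q.e s * Q.E (t :: X) := by
      rw [FrobHeis.icl, E_E, h s (by simp), E_cons, mul_assoc]
    rw [slide, slideL, vcomp_assoc, ← vcomp_assoc (Q.cross s t * _), e1, FrobHeis.icl, Q.e_e,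
      (Q.slide_isHom t X).left, FrobHeis.icl, Q.e_e, ih fun s hs => h s (by simp [hs]),
      List.cons_append, E_cons]

lemma slide_slideL {t : C} {X : List C}
    (h : ∀ s ∈ X, Q.cross t s ⊙ Q.cross s t = Q.e t * Q.e s) :
    Q.slide t X ⊙ Q.slideL t X = Q.E (t :: X) := by
  induction X with
  | nil => rw [slide, slideL, E_single, e_e]
  | cons s X ih =>
    have e1 : (Q.e s * Q.slide t X) ⊙ (Q.e s * Q.slideL t X) = Q.e s * Q.e t * Q.E X := by
      rw [FrobHeis.icl, e_e, ih fun s hs => h s (by simp [hs]), E_cons, mul_assoc]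
    rw [slide, slideL, vcomp_assoc, ← vcomp_assoc (Q.e s * _), e1, FrobHeis.icl, Q.E_E,
      Q.ee_cross, FrobHeis.icl, E_E, h s (by simp), E_cons,
      E_cons, mul_assoc]

/-- The morphism `g : X → Y` slides through the strand `t`. -/
structure Slides (t : C) (X Y : List C) (g : D.Total) : Prop extends Q.IsHom X Y g where
  slides : (Q.e t * g) ⊙ Q.slide t Y = Q.slide t X ⊙ (g * Q.e t)

namespace Slides

variable {Q} {t : C} {X Y Z X' Y' : List C} {f g : D.Total}

lemma id (t : C) (X : List C) : Q.Slides t X X (Q.E X) where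
  toIsHom := IsHom.E X
  slides := by
    have e := (Q.slide_isHom t X).left
    have e' := (Q.slide_isHom t X).right
    rw [E_cons] at e
    rw [E_append, E_single] at e'
    rw [e, e']

lemma comp (hf : Q.Slides t X Y f) (hg : Q.Slides t Y Z g) : Q.Slides t X Z (f ⊙ g) where
  toIsHom := hf.toIsHom.comp hg.toIsHom
  slides := by
    rw [e_mul_vcomp, vcomp_mul_e, vcomp_assoc, hg.slides, ← vcomp_assoc, hf.slides, vcomp_assoc]

/-- The strand passes `X` and then `X'`, by `slide_append`; `f` is slid through the first half of
its path and `g` through the second. -/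
lemma mul (hf : Q.Slides t X Y f) (hg : Q.Slides t X' Y' g) :
    Q.Slides t (X ++ X') (Y ++ Y') (f * g) where
  toIsHom := hf.toIsHom.mul hg.toIsHom
  slides := by
    have h1 : Q.IsHom (t :: X) (t :: Y) (Q.e t * f) := (IsHom.e t).mul hf.toIsHom
    have e1 : Q.e t * (f * g) = (Q.e t * f * Q.E X') ⊙ (Q.E (t :: Y) * g) := by
      rw [h1.icl (IsHom.E (t :: Y)), h1.right, hg.left, mul_assoc]
    have e2 : (Q.E (t :: Y) * g) ⊙ (Q.slide t Y * Q.E Y') =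
        (Q.slide t Y * Q.E X') ⊙ (Q.E Y * Q.e t * g) := by
      rw [(IsHom.E _).icl (Q.slide_isHom t Y), (Q.slide_isHom t Y).icl
        ((IsHom.E Y).mul (IsHom.e t)), (Q.slide_isHom t Y).left, hg.right, hg.left]
      congr 1
      have e := (Q.slide_isHom t Y).right
      rw [E_append, E_single] at e
      exact e.symm
    have e3 : (f * Q.e t * Q.E X') ⊙ (Q.E Y * (Q.slide t X' ⊙ (g * Q.e t))) =
        (Q.E X * Q.slide t X') ⊙ (f * (g * Q.e t)) := by
      rw [mul_assoc, hf.toIsHom.icl (IsHom.E Y), (IsHom.E X).icl hf.toIsHom, hf.left, hf.right,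
        ← vcomp_assoc, ← E_cons, (Q.slide_isHom t X').left]
    rw [slide_append, slide_append, e1, vcomp_assoc, ← vcomp_assoc (Q.E (t :: Y) * g), e2,
      vcomp_assoc, mul_assoc (Q.E Y), (IsHom.E Y).icl (IsHom.E Y), hg.slides, E_E,
      ← vcomp_assoc (Q.e t * f * Q.E X'), ← vcomp_mul_E, hf.slides, vcomp_mul_E, vcomp_assoc, e3,
      vcomp_assoc, mul_assoc]

lemma zero (t : C) (X Y : List C) : Q.Slides t X Y 0 := ⟨IsHom.zero X Y, by simp⟩

lemma add (hf : Q.Slides t X Y f) (hg : Q.Slides t X Y g) : Q.Slides t X Y (f + g) :=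
  ⟨hf.toIsHom.add hg.toIsHom, by
    rw [mul_add, add_mul, add_vcomp, vcomp_add, hf.slides, hg.slides]⟩

lemma smul (r : R) (hf : Q.Slides t X Y f) : Q.Slides t X Y (r • f) :=
  ⟨hf.toIsHom.smul r, by
    rw [mul_smul_comm, smul_mul_assoc, smul_vcomp, vcomp_smul, hf.slides]⟩

/-- Sliding to the other side, when the crossings are invertible. -/
lemma slidesL (hg : Q.Slides t X Y g)
    (hX : ∀ s ∈ X, Q.cross s t ⊙ Q.cross t s = Q.e s * Q.e t)
    (hY : ∀ s ∈ Y, Q.cross t s ⊙ Q.cross s t = Q.e t * Q.e s) :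
    (g * Q.e t) ⊙ Q.slideL t Y = Q.slideL t X ⊙ (Q.e t * g) := by
  have e1 := ((hg.toIsHom).mul (IsHom.e (Q := Q) t)).left
  have e2 := ((IsHom.e (Q := Q) t).mul hg.toIsHom).right
  rw [← e1, ← Q.slideL_slide hX, vcomp_assoc, vcomp_assoc, ← vcomp_assoc (Q.slide t X),
    ← hg.slides, vcomp_assoc, Q.slide_slideL hY]
  exact congrArg _ e2

/-- Sliding from the other side, when the crossings are invertible. -/
lemma of_slidesL (hg : Q.IsHom X Y g)
    (hX : ∀ s ∈ X, Q.cross t s ⊙ Q.cross s t = Q.e t * Q.e s)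
    (hY : ∀ s ∈ Y, Q.cross s t ⊙ Q.cross t s = Q.e s * Q.e t)
    (h : (g * Q.e t) ⊙ Q.slideL t Y = Q.slideL t X ⊙ (Q.e t * g)) : Q.Slides t X Y g where
  toIsHom := hg
  slides := by
    have e1 := ((IsHom.e (Q := Q) t).mul hg).left
    have e2 := (hg.mul (IsHom.e (Q := Q) t)).right
    rw [← e1]
    change (Q.E (t :: X) ⊙ _) ⊙ _ = _
    rw [← Q.slide_slideL hX, vcomp_assoc, vcomp_assoc, ← vcomp_assoc (Q.slideL t X),
      ← h, vcomp_assoc, Q.slideL_slide hY, e2]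

end Slides

end StrandSys

end FrobHeis

namespace FrobHeis

open WordData

/-! ### Rotation of crossings -/

namespace StrandSys

variable {R : Type u} [CommRing R] {S : Type} {D : WordData.{u, v} R S} [Lawful D] {C : Type}
  (Q : StrandSys D C)

/-- A cup and a cap that make the strand `q` a dual of the strand `p`, such that the crossings with
`q` on the right are rotations of the crossings with `p` on the left. -/
structure DualPair (p q : C) where
  /-- the cup -/
  cup : D.Total
  /-- the cap -/
  cap : D.Total
  hcup : Q.IsHom [] [q, p] cup
  hcap : Q.IsHom [p, q] [] cap
  zig : (Q.e p * cup) ⊙ (cap * Q.e p) = Q.e p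
  zag : (cup * Q.e q) ⊙ (Q.e q * cap) = Q.e q
  cross_right : ∀ s, Q.cross s q =
    (cup * (Q.e s * Q.e q)) ⊙ (Q.e q * Q.cross p s * Q.e q) ⊙ (Q.e q * Q.e s * cap)

namespace DualPair

variable {Q} {p q : C} (d : Q.DualPair p q)

instance sz_cup : Sz d.cup 0 2 := d.hcup.sz
instance sz_cap : Sz d.cap 2 0 := d.hcap.sz

lemma cup_qp : d.cup ⊙ (Q.e q * Q.e p) = d.cup := by
  have e := d.hcup.right
  rwa [E_cons, E_single] at e

lemma pq_cap : (Q.e p * Q.e q) ⊙ d.cap = d.cap := by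
  have e := d.hcap.left
  rwa [E_cons, E_single] at e

/-- The rotation of a morphism `f : p X → X p`. -/
noncomputable def rot (X : List C) (f : D.Total) : D.Total :=
  (d.cup * (Q.E X * Q.e q)) ⊙ (Q.e q * f * Q.e q) ⊙ (Q.e q * Q.E X * d.cap)

variable {X Y : List C} {f g : D.Total}

lemma rot_isHom (hf : Q.IsHom (p :: X) (X ++ [p]) f) : Q.IsHom (X ++ [q]) (q :: X) (d.rot X f) := by
  have h1 : Q.IsHom (X ++ [q]) ([q] ++ (p :: X) ++ [q]) (d.cup * (Q.E X * Q.e q)) := by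
    simpa using d.hcup.mul ((IsHom.E X).mul (IsHom.e q))
  have h2 := ((IsHom.e (Q := Q) q).mul hf).mul (IsHom.e q)
  have h3 : Q.IsHom ([q] ++ (X ++ [p]) ++ [q]) (q :: X) (Q.e q * Q.E X * d.cap) := by
    simpa using ((IsHom.e (Q := Q) q).mul (IsHom.E X)).mul d.hcap
  exact h1.comp (h2.comp h3)

/-- The morphism `g` goes past the cup, through the rotated morphism by `h`, and past the cap. -/
lemma rot_natural {fX fY : D.Total} (hg : Q.IsHom X Y g)
    (h : (Q.e p * g) ⊙ fY = fX ⊙ (g * Q.e p)) :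
    (g * Q.e q) ⊙ d.rot Y fY = d.rot X fX ⊙ (Q.e q * g) := by
  have e1 : (g * Q.e q) ⊙ (d.cup * (Q.E Y * Q.e q)) =
      (d.cup * (Q.E X * Q.e q)) ⊙ (Q.e q * (Q.e p * g) * Q.e q) := by
    rw [vcomp_mul_left d.cup, hg.icl (IsHom.E Y), hg.right, Q.e_e, mul_regroup, icl, d.cup_qp,
      (IsHom.E X).icl hg, hg.left, Q.e_e]
  have e2 : (Q.e q * (g * Q.e p) * Q.e q) ⊙ (Q.e q * Q.E Y * d.cap) =
      (Q.e q * Q.E X * d.cap) ⊙ (Q.e q * g) := by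
    rw [mul_vcomp_right d.cap, mul_regroup, icr, d.pq_cap, icl, icl, hg.left, hg.right, Q.e_e]
  rw [rot, rot, ← vcomp_assoc, e1, vcomp_assoc, vcomp_assoc, vcomp_assoc, ← e2,
    ← vcomp_assoc (Q.e q * (Q.e p * g) * Q.e q), ← vcomp_mul_e, ← e_mul_vcomp, h, e_mul_vcomp,
    vcomp_mul_e, vcomp_assoc]

/-- Capping the rotated strand creates a zigzag with the cup of `rot`, and the zigzag straightens.
-/
lemma rot_cap (hf : Q.IsHom (p :: X) (X ++ [p]) f) :
    (Q.e p * d.rot X f) ⊙ (d.cap * Q.E X) = (f * Q.e q) ⊙ (Q.E X * d.cap) := by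
  have e1 : (Q.e p * (Q.e q * Q.E X * d.cap)) ⊙ (d.cap * Q.E X) = d.cap * (Q.E X * d.cap) := by
    rw [← mul_assoc, mul_vcomp_right d.cap, ← mul_assoc, icl, d.pq_cap, E_E, mul_assoc]
  have e2 : (Q.e p * (Q.e q * f * Q.e q)) ⊙ (d.cap * (Q.E X * d.cap)) =
      (d.cap * (Q.e p * (Q.E X * Q.e q))) ⊙ (f * Q.e q) ⊙ (Q.E X * d.cap) := by
    rw [mul_vcomp_left d.cap, mul_assoc, ← mul_assoc, icl, d.pq_cap, ← vcomp_assoc, ← mul_assoc,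
      ← E_cons, (IsHom.E (p :: X)).icl hf, hf.left, Q.e_e]
  have e3 : (Q.e p * (d.cup * (Q.E X * Q.e q))) ⊙ (d.cap * (Q.e p * (Q.E X * Q.e q))) =
      Q.e p * Q.E X * Q.e q := by
    rw [← mul_assoc, ← mul_assoc d.cap, icl, d.zig, icr, E_E, Q.e_e, mul_assoc]
  rw [rot, e_mul_vcomp, e_mul_vcomp, vcomp_assoc, vcomp_assoc, e1, e2, ← vcomp_assoc, e3,
    ← vcomp_assoc, ← E_cons, (IsHom.E (p :: X)).icl hf, hf.left, Q.e_e]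

lemma cup_rot (hf : Q.IsHom (p :: X) (X ++ [p]) f) :
    (Q.E X * d.cup) ⊙ (d.rot X f * Q.e p) = (d.cup * Q.E X) ⊙ (Q.e q * f) := by
  have hXp : f ⊙ (Q.E X * Q.e p) = f := by
    have e := hf.right
    rwa [E_append, E_single] at e
  have e1 : (Q.E X * d.cup) ⊙ (d.cup * (Q.E X * Q.e q) * Q.e p) = d.cup * (Q.E X * d.cup) := by
    rw [mul_assoc, vcomp_mul_left d.cup, mul_assoc, icl, d.cup_qp, E_E]
  have e2 : (d.cup * (Q.E X * d.cup)) ⊙ (Q.e q * f * Q.e q * Q.e p) =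
      (d.cup * Q.E X) ⊙ (Q.e q * f) ⊙ (Q.e q * Q.E X * Q.e p * d.cup) := by
    rw [vcomp_mul_right d.cup, mul_assoc, ← mul_assoc, icr, d.cup_qp, mul_assoc (Q.e q),
      icl (f := Q.e q),
      hXp, Q.e_e, vcomp_mul_right d.cup]
  have e3 : (Q.e q * Q.E X * Q.e p * d.cup) ⊙ (Q.e q * Q.E X * d.cap * Q.e p) =
      Q.e q * (Q.E X * Q.e p) := by
    rw [mul_assoc, mul_assoc (Q.e q * Q.E X) d.cap, icr, d.zig, icl, E_E, Q.e_e, mul_assoc]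
  rw [rot, vcomp_mul_e, vcomp_mul_e, ← vcomp_assoc, e1, ← vcomp_assoc, e2, vcomp_assoc, vcomp_assoc,
    e3, icl (f := Q.e q), hXp, Q.e_e]

/-- Rotation reverses the order in which the strand meets the blocks `X` and `Y`. A cap of one
rotation meets the cup of the other, and `rot_cap` straightens the resulting zigzag. -/
lemma rot_append {fX fY : D.Total} (hX : Q.IsHom (p :: X) (X ++ [p]) fX)
    (hY : Q.IsHom (p :: Y) (Y ++ [p]) fY) :
    d.rot (X ++ Y) ((fX * Q.E Y) ⊙ (Q.E X * fY)) =
      (Q.E X * d.rot Y fY) ⊙ (d.rot X fX * Q.E Y) := by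
  have hr := d.rot_isHom hY
  have hrl := hr.left
  have hrr := hr.right
  rw [E_append, E_single] at hrl
  rw [E_cons] at hrr
  have hXp := hX.right
  have hpX := hX.left
  rw [E_append, E_single] at hXp
  rw [E_cons] at hpX
  have e1 : (Q.E X * d.rot Y fY) ⊙ (d.cup * (Q.E X * Q.e q) * Q.E Y) =
      (d.cup * (Q.E X * (Q.E Y * Q.e q))) ⊙ (Q.e q * (Q.e p * Q.E X) * d.rot Y fY) := by
    rw [mul_assoc, vcomp_mul_left d.cup, mul_assoc, icl, E_E, hrr, mul_assoc (Q.e q),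
      mul_assoc (Q.e p),
      ← mul_assoc (Q.e q), icl, d.cup_qp, icl, E_E, hrl]
  have e2 : (Q.e q * (Q.e p * Q.E X) * d.rot Y fY) ⊙ (Q.e q * fX * Q.e q * Q.E Y) =
      (Q.e q * fX * (Q.E Y * Q.e q)) ⊙ (Q.e q * (Q.E X * Q.e p) * d.rot Y fY) := by
    rw [← E_cons, ← E_single Q p, ← E_append]
    simp only [mul_assoc]
    rw [icl (f := Q.e q), (IsHom.E _).icl hX, icl (f := Q.e q), hX.icl (IsHom.E _), hX.left,
      hX.right, hrl, hrr]
  have e3 : (Q.e q * (Q.E X * Q.e p) * d.rot Y fY) ⊙ (Q.e q * Q.E X * d.cap * Q.E Y) =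
      (Q.e q * (Q.E X * fY) * Q.e q) ⊙ (Q.e q * (Q.E X * Q.E Y) * d.cap) := by
    have e := d.rot_cap hY
    simp only [mul_assoc]
    rw [icl (f := Q.e q), icl (f := Q.E X), e, icl (f := Q.e q), icl (f := Q.E X)]
  have e4 : d.rot X fX * Q.E Y = (d.cup * (Q.E X * Q.e q) * Q.E Y) ⊙
      (Q.e q * fX * Q.e q * Q.E Y) ⊙ (Q.e q * Q.E X * d.cap * Q.E Y) := by
    rw [rot, vcomp_mul_E, vcomp_mul_E]
  rw [e4, ← vcomp_assoc, e1, vcomp_assoc, ← vcomp_assoc (Q.e q * (Q.e p * Q.E X) * _), e2,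
    vcomp_assoc, e3, rot, e_mul_vcomp, vcomp_mul_e, E_append, vcomp_assoc]
  simp only [mul_assoc]

lemma rot_nil : d.rot [] (Q.e p) = Q.e q := by
  have e : (d.cup * Q.e q) ⊙ (Q.e q * Q.e p * Q.e q) = d.cup * Q.e q := by
    rw [icl, d.cup_qp, Q.e_e]
  rw [rot, E_nil, one_mul, mul_one, ← vcomp_assoc, e, d.zag]

lemma rot_cross (s : C) : d.rot [s] (Q.cross p s) = Q.cross s q := by
  rw [rot, E_single, d.cross_right]

/-- By definition of a dual pair this holds for one letter, and `rot_append` makes both sides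
satisfy the same recursion. It translates statements about the strand `p` into statements about its
dual. -/
lemma slideL_eq_rot (X : List C) : Q.slideL q X = d.rot X (Q.slide p X) := by
  induction X with
  | nil => exact d.rot_nil.symm
  | cons s X ih =>
    have e := d.rot_append (IsHom.cross (Q := Q) p s) (Q.slide_isHom p X)
    rw [slideL, slide, ih, ← d.rot_cross, ← Q.E_single s, ← e, List.singleton_append]

/-- By `cup_rot`, the crossing of `t` with `q` becomes a crossing with `p` on the other leg of the
cup, where `h` cancels it against the second crossing. -/
lemma cup_slides {t : C} (h : Q.cross p t ⊙ Q.cross t p = Q.e p * Q.e t) :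
    Q.Slides t [] [q, p] d.cup where
  toIsHom := d.hcup
  slides := by
    have e := d.cup_rot (IsHom.cross (Q := Q) p t)
    rw [d.rot_cross, E_single] at e
    have e' : Q.slide t [q, p] = (Q.cross t q * Q.e p) ⊙ (Q.e q * Q.cross t p) := by
      rw [slide, slide, slide, E_single, E_nil, mul_one, Q.cross_ee]
    rw [e', ← vcomp_assoc, e, vcomp_assoc, icl (f := Q.e q), h, Q.e_e, ← mul_assoc,
      icl (f := d.cup),
      d.cup_qp, slide, Q.e_e, vcomp_mul_left d.cup, Q.e_e]

lemma cap_slides {t : C} (h : Q.cross t p ⊙ Q.cross p t = Q.e t * Q.e p) :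
    Q.Slides t [p, q] [] d.cap where
  toIsHom := d.hcap
  slides := by
    have e := d.rot_cap (IsHom.cross (Q := Q) p t)
    rw [d.rot_cross, E_single] at e
    have e' : Q.slide t [p, q] = (Q.cross t p * Q.e q) ⊙ (Q.e p * Q.cross t q) := by
      rw [slide, slide, slide, E_single, E_nil, mul_one, Q.cross_ee]
    rw [e', vcomp_assoc, e, ← vcomp_assoc, icl (f := Q.cross t p), h, Q.e_e, mul_assoc,
      icl (f := Q.e t), d.pq_cap, slide, Q.e_e, mul_vcomp_right d.cap, Q.e_e]

/-- The cup of `d` slides through `p'`, hence after rotation through its dual `q'`. Closing the leg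
`p` with the cap of `d` turns this into the claim, by the zigzag relation. -/
lemma cross_dual_dual (d : Q.DualPair p q) {p' q' : C} (d' : Q.DualPair p' q')
    (h : Q.cross p p' ⊙ Q.cross p' p = Q.e p * Q.e p') :
    Q.cross q' q ⊙ Q.cross q q' = Q.e q' * Q.e q := by
  have e := d'.rot_natural d.hcup (d.cup_slides h).slides
  rw [← d'.slideL_eq_rot, ← d'.slideL_eq_rot] at e
  have e' : Q.slideL q' [q, p] = (Q.e q * Q.cross p q') ⊙ (Q.cross q q' * Q.e p) := by
    rw [slideL, slideL, slideL, E_single, E_nil, mul_one, Q.ee_cross]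
  have e₂ : (Q.e q * Q.e q' * d.cap) ⊙ Q.cross q q' =
      (Q.cross q q' * (Q.e p * Q.e q)) ⊙ (Q.e q' * Q.e q * d.cap) := by
    rw [mul_vcomp_right d.cap, Q.ee_cross, icl, Q.cross_ee, d.pq_cap]
  rw [e', slideL, vcomp_mul_right d.cup, Q.e_e] at e
  rw [d.cross_right, vcomp_assoc, vcomp_assoc, e₂, ← mul_assoc (Q.cross q q'), ← mul_assoc d.cup,
    ← vcomp_assoc (Q.e q * Q.cross p q' * Q.e q), ← vcomp_mul_e, ← vcomp_assoc, ← vcomp_mul_e, e,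
    mul_assoc, mul_assoc, icl (f := Q.e q'), d.zag, Q.e_e]

/-- Rotation turns sliding rightwards through `p` into sliding leftwards through `q`; invertible
crossings turn this back into a rightward slide. -/
lemma slides_dual (d : Q.DualPair p q) (h : Q.Slides p X Y g)
    (hX : ∀ s ∈ X, Q.cross q s ⊙ Q.cross s q = Q.e q * Q.e s)
    (hY : ∀ s ∈ Y, Q.cross s q ⊙ Q.cross q s = Q.e s * Q.e q) : Q.Slides q X Y g := by
  refine Slides.of_slidesL h.toIsHom hX hY ?_
  rw [d.slideL_eq_rot, d.slideL_eq_rot]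
  exact d.rot_natural h.toIsHom h.slides

end DualPair

/-- The sliding equation for `f`, composed with the inverse `g` on both sides, is the one for `g`.
-/
lemma Slides.inv {Q : StrandSys D C} {t : C} {X Y : List C} {f g : D.Total} (hf : Q.Slides t X Y f)
    (hg : Q.IsHom Y X g) (hfg : f ⊙ g = Q.E X) (hgf : g ⊙ f = Q.E Y) : Q.Slides t Y X g where
  toIsHom := hg
  slides := by
    have e1 := (Q.slide_isHom t X).right
    have e2 := (Q.slide_isHom t Y).left
    rw [E_append, E_single, ← hfg] at e1
    rw [E_cons, ← hgf] at e2
    rw [← e1, vcomp_mul_e, ← vcomp_assoc (Q.slide t X), ← hf.slides, ← vcomp_assoc, ← vcomp_assoc,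
      ← e_mul_vcomp, e2]

end StrandSys

end FrobHeis

namespace FrobHeis

open WordData

namespace StrandSys

lemma slide_single {R : Type u} [CommRing R] {S : Type} {D : WordData.{u, v} R S} [Lawful D]
    {C : Type} (Q : StrandSys D C) (t s : C) : Q.slide t [s] = Q.cross t s := by
  rw [slide, slide, E_nil, mul_one, Q.cross_ee]

lemma slide_pair {R : Type u} [CommRing R] {S : Type} {D : WordData.{u, v} R S} [Lawful D]
    {C : Type} (Q : StrandSys D C) (t s s' : C) :
    Q.slide t [s, s'] = (Q.cross t s * Q.e s') ⊙ (Q.e s * Q.cross t s') := by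
  rw [slide, slide_single, E_single]

end StrandSys

/-! ### Sliding Heisenberg morphisms through a strand -/

namespace HeisData

section Slides

variable {R : Type u} [CommRing R] {F : Type v} [Ring F] [Algebra R F] {ι : Type w} [Fintype ι]
  {φ : SymmFrobenius R F} {b : Module.Basis ι R F} {k : ℤ} {S' : Type} {D : WordData.{u} R S'}
  [Lawful D] {h : HeisData φ b k D} {C : Type} {Q : StrandSys D C} {st : Strand → C}

lemma E_map (hst : ∀ s, Q.e (st s) = h.obj s) (a : List Strand) :
    Q.E (a.map st) = objW h.obj a := by
  induction a with
  | nil => rfl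
  | cons s a ih => rw [List.map_cons, StrandSys.E_cons, objW_cons, hst, ih]

lemma eval_isHom (hst : ∀ s, Q.e (st s) = h.obj s) {a a' : List Strand}
    (f : Tm R (HeisGen F ι k) a a') : Q.IsHom (a.map st) (a'.map st) (h.interp.eval f) where
  sz := (h.interp.sz_eval f).cast (by simp) (by simp)
  left := by rw [E_map hst]; exact h.interp.obj_eval f
  right := by rw [E_map hst]; exact h.interp.eval_obj f

/-- The right crossing and the decorated right cups and caps are composites of the five kinds of
generators assumed to slide. The remaining generators are entries of the inverse matrix and slide by
the intertwining lemmas. No crossing has to be invertible for this. -/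
lemma slides_eval (hst : ∀ s, Q.e (st s) = h.obj s) {t : C}
    (hx : Q.Slides t [st .up] [st .up] h.x) (htok : ∀ f, Q.Slides t [st .up] [st .up] (h.tok f))
    (hs : Q.Slides t [st .up, st .up] [st .up, st .up] h.s)
    (hc : Q.Slides t [] [st .down, st .up] h.c) (hd : Q.Slides t [st .up, st .down] [] h.d)
    {a a' : List Strand} (f : Tm R (HeisGen F ι k) a a') :
    Q.Slides t (a.map st) (a'.map st) (h.interp.eval f) := by
  classical
  have hU : Q.Slides t [st .up] [st .up] h.U := by
    have := StrandSys.Slides.id (Q := Q) t [st .up]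
    rwa [StrandSys.E_single, hst] at this
  have hV : Q.Slides t [st .down] [st .down] h.V := by
    have := StrandSys.Slides.id (Q := Q) t [st .down]
    rwa [StrandSys.E_single, hst] at this
  have ht : Q.Slides t [st .up, st .down] [st .down, st .up] h.t :=
    (hc.mul (hU.mul hV)).comp (((hV.mul hs).mul hV).comp ((hV.mul hU).mul hd))
  have hxp : ∀ m, Q.Slides t [st .up] [st .up] (h.xpow m) := fun m => by
    induction m with
    | zero => exact hU
    | succ m ih => exact ih.comp hx
  have hcap : ∀ r f, Q.Slides t [st .up, st .down] [] (h.rcap r f) := fun r f =>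
    (((htok f).comp (hxp r)).mul hV).comp hd
  have hcup : ∀ r f, Q.Slides t [] [st .down, st .up] (h.rcup r f) := fun r f =>
    hc.comp (hV.mul ((htok f).comp (hxp r)))
  -- The two inverse matrices compared by the slide are those with the strand `t` added on the left
  -- and with `t` added on the right.
  have hB : (Q.e t * h.L) ⊙ (Q.e t * h.t) + ∑ p : Fin (-k).toNat × ι,
      (Q.e t * h.lcap p.1 p.2) ⊙ (Q.e t * h.rcup p.1 (φ.dual b p.2)) = Q.e t * (h.V * h.U) := by
    simp only [← StrandSys.e_mul_vcomp, ← Finset.mul_sum, ← mul_add, h.L_t]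
  have hA : (h.t * Q.e t) ⊙ (h.L * Q.e t) + ∑ p : Fin k.toNat × ι,
      (h.rcap p.1 (φ.dual b p.2) * Q.e t) ⊙ (h.lcup p.1 p.2 * Q.e t) = h.U * h.V * Q.e t := by
    simp only [← StrandSys.vcomp_mul_e, ← Finset.sum_mul, ← add_mul, h.t_L]
  have hBQ : (Q.e t * (h.V * h.U)) ⊙ Q.slide t [st .down, st .up] =
      Q.slide t [st .down, st .up] := by
    have e := (Q.slide_isHom t [st .down, st .up]).left
    rwa [StrandSys.E_cons, StrandSys.E_cons, StrandSys.E_single, hst, hst] at e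
  have hPA : Q.slide t [st .up, st .down] ⊙ (h.U * h.V * Q.e t) =
      Q.slide t [st .up, st .down] := by
    have e := (Q.slide_isHom t [st .up, st .down]).right
    rwa [StrandSys.E_append, StrandSys.E_single, StrandSys.E_cons, StrandSys.E_single, hst,
      hst] at e
  have hcap' : ∀ p : Fin k.toNat × ι, (Q.e t * h.rcap p.1 (φ.dual b p.2)) ⊙ Q.e t =
      Q.slide t [st .up, st .down] ⊙ (h.rcap p.1 (φ.dual b p.2) * Q.e t) := fun p =>
    (hcap p.1 (φ.dual b p.2)).slides
  have hcup' : ∀ p : Fin (-k).toNat × ι,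
      (Q.e t * h.rcup p.1 (φ.dual b p.2)) ⊙ Q.slide t [st .down, st .up] =
        Q.e t ⊙ (h.rcup p.1 (φ.dual b p.2) * Q.e t) := fun p => (hcup p.1 (φ.dual b p.2)).slides
  have hL : (Q.e t * h.L) ⊙ Q.slide t [st .up, st .down] =
      Q.slide t [st .down, st .up] ⊙ (h.L * Q.e t) :=
    cross_intertwine (N := fun _ => Q.e t) (N' := fun _ => Q.e t) hB hBQ hA hPA ht.slides hcap'
      hcup' (fun p => by rw [← StrandSys.e_mul_vcomp, h.L_rcap, mul_zero])
      (fun p => by rw [← StrandSys.vcomp_mul_e, h.rcup_L, zero_mul])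
  have hlcup : ∀ p : Fin k.toNat × ι, (Q.e t * h.lcup p.1 p.2) ⊙ Q.slide t [st .up, st .down] =
      Q.e t ⊙ (h.lcup p.1 p.2 * Q.e t) := by
    refine cup_intertwine (N := fun _ => Q.e t) (I := Q.e t)
      (cup₁ := fun p => Q.e t * h.lcup p.1 p.2) hA hPA ht.slides hcap'
      (fun p => ?_) (fun p q => ?_) (fun _ => Q.e_e t)
    · rw [← StrandSys.e_mul_vcomp, h.lcup_t, mul_zero]
    · rw [← StrandSys.e_mul_vcomp]
      split_ifs with hpq
      · rw [hpq, h.lcup_rcap, mul_one]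
      · rw [h.lcup_rcap_ne _ _ _ _ hpq, mul_zero]
  have hlcap : ∀ p : Fin (-k).toNat × ι, (Q.e t * h.lcap p.1 p.2) ⊙ Q.e t =
      Q.slide t [st .down, st .up] ⊙ (h.lcap p.1 p.2 * Q.e t) := by
    refine cap_intertwine (N' := fun _ => Q.e t) (I := Q.e t)
      (lcap₂ := fun p => h.lcap p.1 p.2 * Q.e t) hB hBQ ht.slides hcup'
      (fun p => ?_) (fun p q => ?_) (fun _ => Q.e_e t)
    · rw [← StrandSys.vcomp_mul_e, h.t_lcap, zero_mul]
    · rw [← StrandSys.vcomp_mul_e]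
      split_ifs with hpq
      · rw [hpq, h.rcup_lcap, one_mul]
      · rw [h.rcup_lcap_ne _ _ _ _ hpq, zero_mul]
  have hgen : ∀ {a a'} (g : HeisGen F ι k a a'),
      Q.Slides t (a.map st) (a'.map st) (h.interp.eval (Tm.gen g)) := by
    intro a a' g
    refine ⟨eval_isHom hst (Tm.gen g), ?_⟩
    cases g with
    | x => exact hx.slides
    | s => exact hs.slides
    | c => exact hc.slides
    | d => exact hd.slides
    | token f => exact (htok f).slides
    | leftCross => exact hL
    | leftCup r i => exact hlcup (r, i)
    | leftCap r i => exact hlcap (r, i)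
  induction f with
  | gen g => exact hgen g
  | id a =>
    have e := StrandSys.Slides.id (Q := Q) t (a.map st)
    rwa [E_map hst] at e
  | comp f g hf hg => exact hf.comp hg
  | tensor f g hf hg => rw [List.map_append, List.map_append]; exact hf.mul hg
  | zero a b => exact StrandSys.Slides.zero _ _ _
  | add f g hf hg => exact hf.add hg
  | smul r f hf => exact hf.smul r

end Slides

/-! ### The coloured strands -/

variable {R : Type u} [CommRing R] {n : ℕ} {F : Fin n → Type v} [∀ i, Ring (F i)]
  [∀ i, Algebra R (F i)] {ι : Fin n → Type w} [∀ i, Fintype (ι i)]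
  {φ : ∀ i, SymmFrobenius R (F i)} {b : ∀ i, Module.Basis (ι i) R (F i)} {k : ℤ} {S' : Type}
  {D : WordData.{u} R S'} [Lawful D] (h : HeisData (SymmFrobenius.directSum φ) (Pi.basis b) k D)

/-- The identities of the coloured strands. -/
noncomputable def strandId : Strand × Fin n → D.Total
  | (.up, i) => h.u i
  | (.down, i) => h.v i

/-- The crossings of the coloured strands. -/
noncomputable def crossing : Strand × Fin n → Strand × Fin n → D.Total
  | (.up, i), (.up, j) => h.cs i j
  | (.up, i), (.down, j) => h.ct i j
  | (.down, i), (.up, j) => h.cL i j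
  | (.down, i), (.down, j) =>
    (h.cc j * (h.v i * h.v j)) ⊙ (h.v j * h.ct j i * h.v j) ⊙ (h.v j * h.v i * h.cd j)

/-- The system of coloured strands. -/
noncomputable def strands : StrandSys D (Strand × Fin n) where
  e := h.strandId
  cross := h.crossing
  sz_e
    | (.up, i) => h.sz_u i
    | (.down, i) => h.sz_v i
  e_e
    | (.up, i) => h.u_self i
    | (.down, i) => h.v_self i
  sz_cross
    | (.up, i), (.up, j) => h.sz_cs i j
    | (.up, i), (.down, j) => h.sz_ct i j
    | (.down, i), (.up, j) => h.sz_cL i j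
    | (.down, i), (.down, j) => by unfold crossing; infer_instance
  ee_cross
    | (.up, i), (.up, j) => h.uu_cs i j
    | (.up, i), (.down, j) => h.uv_ct i j
    | (.down, i), (.up, j) => h.vu_cL i j
    | (.down, i), (.down, j) => by
      change (h.v i * h.v j) ⊙ _ ⊙ _ = _ ⊙ _
      rw [← vcomp_assoc, vcomp_mul_left (h.cc j), icl, h.v_self, h.v_self]
  cross_ee
    | (.up, i), (.up, j) => h.cs_uu i j
    | (.up, i), (.down, j) => h.ct_vu i j
    | (.down, i), (.up, j) => h.cL_uv i j
    | (.down, i), (.down, j) => by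
      change (_ ⊙ _ ⊙ _) ⊙ (h.v j * h.v i) = _ ⊙ _ ⊙ _
      rw [vcomp_assoc, vcomp_assoc, mul_vcomp_right (h.cd j), icl (f := h.v j) (g := h.v j),
        h.v_self, h.v_self]

/-- The dual pair of strands of colour `j`. -/
noncomputable def dualPair (j : Fin n) : h.strands.DualPair (.up, j) (.down, j) where
  cup := h.cc j
  cap := h.cd j
  hcup := ⟨h.sz_cc j, by rw [StrandSys.E_nil, one_vcomp], by
    rw [StrandSys.E_cons, StrandSys.E_single]; exact h.cc_vu j⟩
  hcap := ⟨h.sz_cd j, by rw [StrandSys.E_cons, StrandSys.E_single]; exact h.uv_cd j, by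
    rw [StrandSys.E_nil, vcomp_one]⟩
  zig := h.c_adj_up j
  zag := h.c_adj_down j
  cross_right
    | (.up, i) => h.ct_eq i j
    | (.down, i) => rfl

lemma strands_e (i : Fin n) (s : Strand) : h.strands.e (s, i) = (h.colorData i).obj s := by
  cases s <;> rfl

/-- Two upward strands use s² = 1; opposite orientations use the inversion relation without
correction terms; two downward strands are the rotation of the upward case. -/
lemma cross_cross {i j : Fin n} (hij : i ≠ j) (s t : Strand) :
    h.strands.cross (s, i) (t, j) ⊙ h.strands.cross (t, j) (s, i) =
      h.strands.e (s, i) * h.strands.e (t, j) := by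
  cases s <;> cases t
  · exact h.cs_cs i j
  · exact h.ct_cL_ne hij
  · exact h.cL_ct_ne hij
  · exact (h.dualPair j).cross_dual_dual (h.dualPair i) (h.cs_cs j i)

/-- This is the coloured braid relation; the colours may coincide. -/
lemma cs_slides (i j l : Fin n) :
    h.strands.Slides (.up, l) [(.up, i), (.up, j)] [(.up, j), (.up, i)] (h.cs i j) where
  toIsHom := StrandSys.IsHom.cross (Q := h.strands) (.up, i) (.up, j)
  slides := by
    rw [StrandSys.slide_pair, StrandSys.slide_pair, vcomp_assoc]
    exact (h.cs_braid l i j).symm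

/-- By `ct_eq` the right crossing is composed of a cup, an upward crossing and a cap, all of which
slide through an upward strand. -/
lemma ct_slides (i j l : Fin n) :
    h.strands.Slides (.up, l) [(.up, i), (.down, j)] [(.down, j), (.up, i)] (h.ct i j) := by
  have hc := (h.dualPair j).cup_slides (t := (.up, l)) (h.cs_cs j l)
  have hd := (h.dualPair j).cap_slides (t := (.up, l)) (h.cs_cs l j)
  have hu : h.strands.Slides (.up, l) [(.up, i)] [(.up, i)] (h.u i) := by
    have := StrandSys.Slides.id (Q := h.strands) (.up, l) [(.up, i)]
    rwa [StrandSys.E_single] at this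
  have hv : h.strands.Slides (.up, l) [(.down, j)] [(.down, j)] (h.v j) := by
    have := StrandSys.Slides.id (Q := h.strands) (.up, l) [(.down, j)]
    rwa [StrandSys.E_single] at this
  rw [ct_eq]
  exact (hc.mul (hu.mul hv)).comp (((hv.mul (h.cs_slides j i l)).mul hv).comp ((hv.mul hu).mul hd))

lemma tok_cs (l j : Fin n) (f : F j) :
    (h.u l * h.tok (Pi.single j f)) ⊙ h.cs l j = h.cs l j ⊙ (h.tok (Pi.single j f) * h.u l) := by
  have e1 : (h.u l * h.u j) ⊙ (h.u l * h.tok (Pi.single j f)) = h.u l * h.tok (Pi.single j f) := by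
    rw [icl, u_tok_single_self, u_self]
  have e2 : (h.tok (Pi.single j f) * h.u l) ⊙ (h.u j * h.u l) = h.tok (Pi.single j f) * h.u l := by
    rw [icl, tok_single_u, u_self]
  rw [← e2, ← cs_cs h j l, ← vcomp_assoc (h.tok _ * _), h.cs_tok, vcomp_assoc, ← vcomp_assoc,
    cs_cs, ← vcomp_assoc, e1]

/-- The transport of slides from an upward strand to a downward strand of the same colour. -/
lemma slides_of_up {l : Fin n} {X Y : List (Strand × Fin n)} {g : D.Total}
    (hg : h.strands.Slides (.up, l) X Y g) (hX : ∀ s ∈ X, s.2 ≠ l) (hY : ∀ s ∈ Y, s.2 ≠ l)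
    (t : Strand) : h.strands.Slides (t, l) X Y g := by
  cases t
  · exact hg
  · exact (h.dualPair l).slides_dual hg (fun s hs => h.cross_cross (hX s hs).symm _ _)
      fun s hs => h.cross_cross (hY s hs) _ _

/-- `slides_of_up` reduces to an upward strand, and `slides_eval` to five generators: dots slide
because the colours differ, crossings by the braid relation, and the cup and cap by rotation. -/
lemma color_slides {j l : Fin n} (hjl : j ≠ l) (t : Strand) {a a' : List Strand}
    (f : Tm R (HeisGen (F j) (ι j) k) a a') :
    h.strands.Slides (t, l) (a.map (·, j)) (a'.map (·, j)) ((h.colorData j).interp.eval f) := by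
  have hU : ∀ g, h.strands.IsHom [(.up, j)] [(.up, j)] ((h.colorData j).tok g) := fun g =>
    eval_isHom (h.strands_e j) (Tm.gen (.token g))
  refine h.slides_of_up ?_ (by simp [hjl]) (by simp [hjl]) t
  refine slides_eval (h.strands_e j) ⟨eval_isHom (h.strands_e j) (Tm.gen .x), ?_⟩
    (fun g => ⟨hU g, ?_⟩) (h.cs_slides j j l) ((h.dualPair j).cup_slides (h.cs_cs j l))
    ((h.dualPair j).cap_slides (h.cs_cs l j)) f
  · rw [StrandSys.slide_single]
    exact (h.cs_x_ne hjl.symm).symm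
  · rw [StrandSys.slide_single]
    exact h.tok_cs l j g

lemma cs_slides_all {i j l : Fin n} (hil : i ≠ l) (hjl : j ≠ l) (t : Strand) :
    h.strands.Slides (t, l) [(.up, i), (.up, j)] [(.up, j), (.up, i)] (h.cs i j) :=
  h.slides_of_up (h.cs_slides i j l) (by simp [hil, hjl]) (by simp [hil, hjl]) t

/-- For different colours the left crossing is the inverse of a right crossing, so `Slides.inv`
applies. -/
lemma cL_slides_all {i j l : Fin n} (hij : i ≠ j) (hil : i ≠ l) (hjl : j ≠ l) (t : Strand) :
    h.strands.Slides (t, l) [(.down, i), (.up, j)] [(.up, j), (.down, i)] (h.cL i j) := by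
  refine h.slides_of_up ((h.ct_slides j i l).inv
    (StrandSys.IsHom.cross (Q := h.strands) (.down, i) (.up, j)) ?_ ?_)
    (by simp [hil, hjl]) (by simp [hil, hjl]) t
  · rw [StrandSys.E_cons, StrandSys.E_single]
    exact h.ct_cL_ne hij.symm
  · rw [StrandSys.E_cons, StrandSys.E_single]
    exact h.cL_ct_ne hij

end HeisData

end FrobHeis

namespace FrobHeis

open WordData

/-! ### Unshuffling words of strands -/

namespace StrandSys

variable {R : Type u} [CommRing R] {S : Type} {D : WordData.{u, v} R S} [Lawful D] {C : Type}
  (Q : StrandSys D C)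

/-- The word `X` moves to the right through the word `W`. -/
noncomputable def pass : List C → List C → D.Total
  | [], W => Q.E W
  | s :: X, W => (Q.e s * pass X W) ⊙ (Q.slide s W * Q.E X)

lemma pass_isHom (X W : List C) : Q.IsHom (X ++ W) (W ++ X) (Q.pass X W) := by
  induction X with
  | nil => rw [List.append_nil]; exact IsHom.E W
  | cons s X ih =>
    have h := ((IsHom.e (Q := Q) s).mul ih).comp
      (by simpa using (Q.slide_isHom s W).mul (IsHom.E X) :
        Q.IsHom ([s] ++ (W ++ X)) (W ++ s :: X) (Q.slide s W * Q.E X))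
    exact h

lemma pass_nil (X : List C) : Q.pass X [] = Q.E X := by
  induction X with
  | nil => rfl
  | cons s X ih => rw [pass, ih, slide, icl, E_E, Q.e_e, E_cons]

/-- `pass` is defined by recursion on the left block. This is the recursion on the right block,
needed to move a morphism of the left block through one letter of the right block at a time. -/
lemma pass_cons_right (X : List C) (t : C) (W : List C) :
    Q.pass X (t :: W) = (Q.slideL t X * Q.E W) ⊙ (Q.e t * Q.pass X W) := by
  induction X with
  | nil => rw [pass, pass, slideL, icl, E_E, Q.e_e, E_cons]
  | cons s X ih =>
    have e1 : (Q.e s * (Q.e t * Q.pass X W)) ⊙ (Q.cross s t * Q.E W * Q.E X) =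
        (Q.cross s t * Q.E X * Q.E W) ⊙ (Q.e t * (Q.e s * Q.pass X W)) := by
      have hl := (Q.pass_isHom X W).left
      have hr := (Q.pass_isHom X W).right
      rw [E_append] at hl hr
      rw [← mul_assoc (Q.e s), ← mul_assoc (Q.e t), mul_assoc (Q.cross s t),
        mul_assoc (Q.cross s t), icl (f := Q.e s * Q.e t), icl (f := Q.cross s t), hl, hr,
        Q.ee_cross, Q.cross_ee]
    rw [pass, ih, slide, slideL, pass, e_mul_vcomp, vcomp_mul_E, vcomp_mul_E, e_mul_vcomp,
      vcomp_assoc, vcomp_assoc, ← vcomp_assoc (Q.e s * (Q.e t * _)), e1, vcomp_assoc]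
    simp only [mul_assoc]

variable {Q}

lemma pass_natural_right {X W W' : List C} {p : D.Total} (hp : ∀ s ∈ X, Q.Slides s W W' p)
    (hp' : Q.IsHom W W' p) : (Q.E X * p) ⊙ Q.pass X W' = Q.pass X W ⊙ (p * Q.E X) := by
  induction X with
  | nil => rw [pass, pass, E_nil, one_mul, mul_one, hp'.right, hp'.left]
  | cons s X ih =>
    rw [pass, pass, E_cons, mul_assoc, ← vcomp_assoc, icl, Q.e_e,
      ih fun s hs => hp s (by simp [hs])]
    have e : (Q.e s * (p * Q.E X)) ⊙ (Q.slide s W' * Q.E X) =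
        (Q.slide s W * Q.E X) ⊙ (p * (Q.e s * Q.E X)) := by
      rw [← mul_assoc, ← mul_assoc, icr, (hp s (by simp)).slides, icr]
    rw [vcomp_assoc, ← e, ← vcomp_assoc, icl (f := Q.e s) (g := Q.e s), Q.e_e]

lemma pass_natural_left {X Y W : List C} {g : D.Total} (hg : Q.IsHom X Y g)
    (h : ∀ t ∈ W, (g * Q.e t) ⊙ Q.slideL t Y = Q.slideL t X ⊙ (Q.e t * g)) :
    (g * Q.E W) ⊙ Q.pass Y W = Q.pass X W ⊙ (Q.E W * g) := by
  induction W with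
  | nil => rw [pass_nil, pass_nil, E_nil, one_mul, mul_one, hg.right, hg.left]
  | cons t W ih =>
    have e : (Q.slideL t X * Q.E W) ⊙ (Q.e t * (g * Q.E W)) =
        (g * (Q.e t * Q.E W)) ⊙ (Q.slideL t Y * Q.E W) := by
      rw [← mul_assoc, ← mul_assoc, icr, icr, h t (by simp)]
    rw [pass_cons_right, pass_cons_right, E_cons, ← vcomp_assoc, ← e, vcomp_assoc, vcomp_assoc,
      icl (f := Q.e t), ih fun t ht => h t (by simp [ht]), mul_assoc, icl (f := Q.e t)]

/-- The morphism `p` is first moved past the strands of `X`, and then `g` past the strands of `W'`.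
This order explains which words occur in the hypotheses. -/
lemma pass_natural {X Y W W' : List C} {g p : D.Total} (hg : Q.IsHom X Y g) (hp : Q.IsHom W W' p)
    (h : ∀ t ∈ W', (g * Q.e t) ⊙ Q.slideL t Y = Q.slideL t X ⊙ (Q.e t * g))
    (hp' : ∀ s ∈ X, Q.Slides s W W' p) :
    (g * p) ⊙ Q.pass Y W' = Q.pass X W ⊙ (p * g) := by
  have e1 : g * p = (Q.E X * p) ⊙ (g * Q.E W') := by
    rw [(IsHom.E X).icl hg, hg.left, hp.right]
  have e2 : p * g = (p * Q.E X) ⊙ (Q.E W' * g) := by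
    rw [hp.icl (IsHom.E W'), hg.left, hp.right]
  rw [e1, e2, vcomp_assoc, pass_natural_left hg h, ← vcomp_assoc, pass_natural_right hp' hp,
    vcomp_assoc]

variable (Q) (P : C → Bool)

/-- The unshuffle of the strands in `P` to the left of the other ones. -/
noncomputable def ext : List C → D.Total
  | [] => 1
  | s :: X => bif P s then Q.e s * ext X
      else (Q.e s * ext X) ⊙ (Q.slide s (X.filter P) * Q.E (X.filter (!P ·)))

/-- The inverse of the unshuffle. -/
noncomputable def extInv : List C → D.Total
  | [] => 1
  | s :: X => bif P s then Q.e s * extInv X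
      else (Q.slideL s (X.filter P) * Q.E (X.filter (!P ·))) ⊙ (Q.e s * extInv X)

lemma ext_isHom (X : List C) : Q.IsHom X (X.filter P ++ X.filter (!P ·)) (Q.ext P X) := by
  induction X with
  | nil => exact IsHom.E []
  | cons s X ih =>
    rw [ext]
    cases hs : P s
    · have h2 := ((IsHom.e (Q := Q) s).mul ih).comp
        ((Q.slide_isHom s (X.filter P)).mul (IsHom.E (X.filter (!P ·))))
      simpa [hs] using h2
    · simpa [hs] using (IsHom.e (Q := Q) s).mul ih

lemma extInv_isHom (X : List C) : Q.IsHom (X.filter P ++ X.filter (!P ·)) X (Q.extInv P X) := by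
  induction X with
  | nil => exact IsHom.E []
  | cons s X ih =>
    rw [extInv]
    cases hs : P s
    · have h2 := ((Q.slideL_isHom s (X.filter P)).mul (IsHom.E (X.filter (!P ·)))).comp
        ((IsHom.e (Q := Q) s).mul ih)
      simpa [hs] using h2
    · simpa [hs] using (IsHom.e (Q := Q) s).mul ih

/-- The crossings of strands in `P` with strands outside `P` are invertible. -/
def InvertibleCrossings : Prop :=
  ∀ s t, P s ≠ P t → Q.cross s t ⊙ Q.cross t s = Q.e s * Q.e t

variable {P}

lemma ext_extInv (hP : Q.InvertibleCrossings P) (X : List C) :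
    Q.ext P X ⊙ Q.extInv P X = Q.E X := by
  induction X with
  | nil => exact one_vcomp_one
  | cons s X ih =>
    rw [ext, extInv]
    cases hs : P s
    · have e := Q.slide_slideL (t := s) (X := X.filter P) fun t ht =>
        hP s t (by rw [hs, (List.mem_filter.mp ht).2]; simp)
      have e' : (Q.slide s (X.filter P) * Q.E (X.filter (!P ·))) ⊙
          (Q.slideL s (X.filter P) * Q.E (X.filter (!P ·))) =
            Q.e s * Q.E (X.filter P ++ X.filter (!P ·)) := by
        rw [← vcomp_mul_E, e, E_cons, E_append, mul_assoc]
      simp only [cond_false]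
      rw [vcomp_assoc, ← vcomp_assoc (Q.slide _ _ * _), e', icl (f := Q.e s),
        (Q.extInv_isHom P X).left, icl (f := Q.e s), ih, Q.e_e, Q.e_e, E_cons]
    · simp only [cond_true]
      rw [icl, ih, Q.e_e, E_cons]

lemma extInv_ext (hP : Q.InvertibleCrossings P) (X : List C) :
    Q.extInv P X ⊙ Q.ext P X = Q.E (X.filter P ++ X.filter (!P ·)) := by
  induction X with
  | nil => exact one_vcomp_one
  | cons s X ih =>
    rw [ext, extInv]
    cases hs : P s
    · have e := Q.slideL_slide (t := s) (X := X.filter P) fun t ht =>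
        hP t s (by rw [hs, (List.mem_filter.mp ht).2]; simp)
      simp only [cond_false]
      have e' : (Q.e s * Q.E (X.filter P ++ X.filter (!P ·))) ⊙
          (Q.slide s (X.filter P) * Q.E (X.filter (!P ·))) =
            Q.slide s (X.filter P) * Q.E (X.filter (!P ·)) := by
        have e₁ := (Q.slide_isHom s (X.filter P)).left
        rw [E_cons] at e₁
        rw [E_append, ← mul_assoc, icr, E_E, e₁]
      rw [vcomp_assoc, ← vcomp_assoc (Q.e s * _), icl (f := Q.e s), ih, Q.e_e, e', ← vcomp_mul_E, e,
        ← E_append]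
      simp [hs]
    · simp only [cond_true]
      rw [icl, ih, Q.e_e, ← E_cons]
      simp [hs]

lemma ext_of_forall {X : List C} (h : ∀ s ∈ X, P s = true) : Q.ext P X = Q.E X := by
  induction X with
  | nil => rfl
  | cons s X ih =>
    rw [ext, h s (by simp), cond_true, ih fun s hs => h s (by simp [hs]), E_cons]

lemma ext_of_forall_not {X : List C} (h : ∀ s ∈ X, P s = false) : Q.ext P X = Q.E X := by
  induction X with
  | nil => rfl
  | cons s X ih =>
    have h' : ∀ s ∈ X, P s = false := fun s hs => h s (by simp [hs])
    have e1 : X.filter P = [] := List.filter_eq_nil_iff.mpr fun s hs => by simp [h' s hs]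
    have e2 : X.filter (!P ·) = X := List.filter_eq_self.mpr fun s hs => by simp [h' s hs]
    rw [ext, h s (by simp), cond_false, ih h', e1, e2, slide, icl, Q.e_e, E_E, E_cons]

/-- After unshuffling both parts, only the two middle blocks are in the wrong order, and `pass`
interchanges them. This is how far the unshuffle is from being multiplicative. -/
lemma ext_append (X X' : List C) : Q.ext P (X ++ X') = (Q.ext P X * Q.ext P X') ⊙
    (Q.E (X.filter P) * Q.pass (X.filter (!P ·)) (X'.filter P) * Q.E (X'.filter (!P ·))) := by
  induction X with
  | nil =>
    have e := (Q.ext_isHom P X').right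
    rw [E_append] at e
    rw [List.nil_append, List.filter_nil, List.filter_nil, pass, ext, E_nil, one_mul, one_mul, e]
  | cons s X ih =>
    rw [List.cons_append, ext, ext, ih]
    cases hs : P s
    · simp only [cond_false, List.filter_cons, hs, List.filter_append, Bool.not_false, if_true,
        Bool.false_eq_true, if_false]
      have he := Q.ext_isHom P X'
      generalize X.filter P = A
      generalize X.filter (!P ·) = B
      generalize X'.filter P = A' at he ⊢
      generalize X'.filter (!P ·) = B' at he ⊢
      have hl := (Q.pass_isHom B A').left
      have hr := (Q.pass_isHom B A').right
      have hs := Q.slide_isHom s A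
      have e1 : (Q.e s * (Q.E A * Q.pass B A' * Q.E B')) ⊙
          (Q.slide s A * (Q.E A' * Q.E (B ++ B'))) =
            (Q.slide s A * (Q.E B * Q.E (A' ++ B'))) ⊙
              (Q.E A * (Q.e s * Q.pass B A') * Q.E B') := by
        rw [E_append] at hl hr
        have hs' : Q.slide s A ⊙ (Q.E A * Q.e s) = Q.slide s A := by
          have e := hs.right
          rwa [E_append, E_single] at e
        rw [mul_assoc (Q.E A), ← mul_assoc (Q.e s), ← E_cons, (IsHom.E _).icl hs, hs.left,
          mul_assoc (Q.E A), mul_assoc (Q.e s), ← mul_assoc (Q.E A),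
          hs.icl ((IsHom.E A).mul (IsHom.e s)), hs', E_append, E_append, ← mul_assoc (Q.E A'),
          ← mul_assoc (Q.E B), icr, icr, hl, hr]
      have e2 : (((Q.e s * Q.ext P X) ⊙ (Q.slide s A * Q.E B)) * Q.ext P X') =
          (Q.e s * (Q.ext P X * Q.ext P X')) ⊙ (Q.slide s A * (Q.E B * Q.E (A' ++ B'))) := by
        rw [← mul_assoc, ← mul_assoc, he.icr (IsHom.E _), he.right]
      rw [e2, pass, e_mul_vcomp, vcomp_assoc, vcomp_assoc, slide_append, E_mul_vcomp, vcomp_mul_E,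
        vcomp_mul_E]
      rw [← vcomp_assoc (Q.slide s A * (Q.E B * _)), ← e1, vcomp_assoc, E_append Q B B']
      simp only [mul_assoc]
    · simp only [cond_true, List.filter_cons, hs, Bool.not_true, if_true, Bool.false_eq_true,
        if_false]
      rw [e_mul_vcomp, E_cons]
      simp only [mul_assoc]

end StrandSys

end FrobHeis

namespace FrobHeis

open WordData

/-! ### Morphisms generated by coloured generators -/

namespace HeisData

variable {R : Type u} [CommRing R] {n : ℕ} {F : Fin n → Type v} [∀ i, Ring (F i)]
  [∀ i, Algebra R (F i)] {ι : Fin n → Type w} [∀ i, Fintype (ι i)]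
  {φ : ∀ i, SymmFrobenius R (F i)} {b : ∀ i, Module.Basis (ι i) R (F i)} {k : ℤ} {S' : Type}
  {D : WordData.{u} R S'} [Lawful D] (h : HeisData (SymmFrobenius.directSum φ) (Pi.basis b) k D)

/-- The value of an expression in the generators of colour `i`. -/
noncomputable def colorEval (i : Fin n) {a a' : List Strand}
    (f : Tm R (HeisGen (F i) (ι i) k) a a') : D.Total := (h.colorData i).interp.eval f

lemma colorEval_isHom (i : Fin n) {a a' : List Strand} (f : Tm R (HeisGen (F i) (ι i) k) a a') :
    h.strands.IsHom (a.map (·, i)) (a'.map (·, i)) (h.colorEval i f) :=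
  eval_isHom (h.strands_e i) f

lemma colorEval_id (i : Fin n) (a : List Strand) :
    h.colorEval i (.id a) = h.strands.E (a.map (·, i)) := (E_map (h.strands_e i) a).symm

/-- The morphisms generated by coloured generators with colours in `P`. -/
inductive ColorGen (P : Fin n → Prop) :
    List (Strand × Fin n) → List (Strand × Fin n) → D.Total → Prop
  | color {i : Fin n} (hi : P i) {a a' : List Strand} (f : Tm R (HeisGen (F i) (ι i) k) a a') :
      ColorGen P (a.map (·, i)) (a'.map (·, i)) (h.colorEval i f)
  | up {i j : Fin n} (hi : P i) (hj : P j) (hij : i ≠ j) :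
      ColorGen P [(.up, i), (.up, j)] [(.up, j), (.up, i)] (h.cs i j)
  | left {i j : Fin n} (hi : P i) (hj : P j) (hij : i ≠ j) :
      ColorGen P [(.down, i), (.up, j)] [(.up, j), (.down, i)] (h.cL i j)
  | id {X : List (Strand × Fin n)} (hX : ∀ s ∈ X, P s.2) : ColorGen P X X (h.strands.E X)
  | comp {X Y Z : List (Strand × Fin n)} {f g : D.Total} (hf : ColorGen P X Y f)
      (hg : ColorGen P Y Z g) : ColorGen P X Z (f ⊙ g)
  | mul {X Y X' Y' : List (Strand × Fin n)} {f g : D.Total} (hf : ColorGen P X Y f)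
      (hg : ColorGen P X' Y' g) : ColorGen P (X ++ X') (Y ++ Y') (f * g)
  | zero {X Y : List (Strand × Fin n)} (hX : ∀ s ∈ X, P s.2) (hY : ∀ s ∈ Y, P s.2) :
      ColorGen P X Y 0
  | add {X Y : List (Strand × Fin n)} {f g : D.Total} (hf : ColorGen P X Y f)
      (hg : ColorGen P X Y g) : ColorGen P X Y (f + g)
  | smul {X Y : List (Strand × Fin n)} {f : D.Total} (r : R) (hf : ColorGen P X Y f) :
      ColorGen P X Y (r • f)

variable {h}

namespace ColorGen

variable {P : Fin n → Prop} {X Y : List (Strand × Fin n)} {g : D.Total}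

lemma mem (hg : h.ColorGen P X Y g) : (∀ s ∈ X, P s.2) ∧ ∀ s ∈ Y, P s.2 := by
  induction hg with
  | color hi f => constructor <;> simp +contextual [hi]
  | up hi hj hij => constructor <;> simp [hi, hj]
  | left hi hj hij => constructor <;> simp [hi, hj]
  | id hX => exact ⟨hX, hX⟩
  | comp _ _ hf hg => exact ⟨hf.1, hg.2⟩
  | mul _ _ hf hg =>
    simp only [List.mem_append]
    exact ⟨fun s hs => hs.elim (hf.1 s) (hg.1 s), fun s hs => hs.elim (hf.2 s) (hg.2 s)⟩
  | zero hX hY => exact ⟨hX, hY⟩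
  | add _ _ hf _ => exact hf
  | smul _ _ hf => exact hf

/-- Sliding is stable under all operations of a linear monoidal category, so the generators suffice;
they slide because the colour `l` does not occur in them. -/
lemma slides (hg : h.ColorGen P X Y g) {l : Fin n} (hl : ¬P l) (t : Strand) :
    h.strands.Slides (t, l) X Y g := by
  have ne : ∀ {i}, P i → i ≠ l := fun hi e => hl (e ▸ hi)
  induction hg with
  | color hi f => exact h.color_slides (ne hi) t f
  | up hi hj hij => exact h.cs_slides_all (ne hi) (ne hj) t
  | left hi hj hij => exact h.cL_slides_all hij (ne hi) (ne hj) t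
  | id hX => exact StrandSys.Slides.id _ _
  | comp _ _ hf hg => exact hf.comp hg
  | mul _ _ hf hg => exact hf.mul hg
  | zero hX hY => exact StrandSys.Slides.zero _ _ _
  | add _ _ hf hg => exact hf.add hg
  | smul r _ hf => exact hf.smul r

lemma isHom (hg : h.ColorGen P X Y g) : h.strands.IsHom X Y g := by
  induction hg with
  | color hi f => exact h.colorEval_isHom _ f
  | up hi hj hij => exact StrandSys.IsHom.cross (Q := h.strands) (.up, _) (.up, _)
  | left hi hj hij => exact StrandSys.IsHom.cross (Q := h.strands) (.down, _) (.up, _)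
  | id hX => exact StrandSys.IsHom.E _
  | comp _ _ hf hg => exact hf.comp hg
  | mul _ _ hf hg => exact hf.mul hg
  | zero hX hY => exact StrandSys.IsHom.zero _ _
  | add _ _ hf hg => exact hf.add hg
  | smul r _ hf => exact hf.smul r

lemma slidesL (hg : h.ColorGen P X Y g) {l : Fin n} (hl : ¬P l) (t : Strand) :
    (g * h.strands.e (t, l)) ⊙ h.strands.slideL (t, l) Y =
      h.strands.slideL (t, l) X ⊙ (h.strands.e (t, l) * g) :=
  (hg.slides hl t).slidesL
    (fun s hs => h.cross_cross (i := s.2) (j := l) (fun e => hl (e ▸ hg.mem.1 s hs)) s.1 t)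
    (fun s hs => h.cross_cross (i := l) (j := s.2) (fun e => hl (e ▸ hg.mem.2 s hs)) t s.1)

end ColorGen

variable (h)

/-- Strands of colour `m`. -/
def isColor (m : Fin n) (s : Strand × Fin n) : Bool := decide (s.2 = m)

lemma invertibleCrossings (m : Fin n) : h.strands.InvertibleCrossings (isColor m) := by
  rintro ⟨s, i⟩ ⟨t, j⟩ hst
  refine h.cross_cross (fun e => hst ?_) s t
  subst e; rfl

/-- The products of a morphism of colour `m` and a morphism with other colours. -/
noncomputable def splitSpan (m : Fin n) (P : Fin n → Prop) (X Y : List (Strand × Fin n)) :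
    Submodule R D.Total :=
  Submodule.span R {z | ∃ (a a' : List Strand) (f : Tm R (HeisGen (F m) (ι m) k) a a')
    (q : D.Total), X.filter (isColor m) = a.map (·, m) ∧ Y.filter (isColor m) = a'.map (·, m) ∧
      h.ColorGen P (X.filter (!isColor m ·)) (Y.filter (!isColor m ·)) q ∧ z = h.colorEval m f * q}

lemma map_color_injective (m : Fin n) :
    Function.Injective (List.map (fun s : Strand => (s, m))) :=
  List.map_injective_iff.mpr fun _ _ e => congrArg Prod.fst e

lemma splitSpan_comp {m : Fin n} {P : Fin n → Prop} {X Y Z : List (Strand × Fin n)}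
    {z z' : D.Total} (hz : z ∈ h.splitSpan m P X Y) (hz' : z' ∈ h.splitSpan m P Y Z) :
    z ⊙ z' ∈ h.splitSpan m P X Z := by
  induction hz, hz' using Submodule.span_induction₂ with
  | mem_mem z z' hz hz' =>
    obtain ⟨a, a', f, q, hX, hY, hq, rfl⟩ := hz
    obtain ⟨a₁, a₂, f', q', hY', hZ, hq', rfl⟩ := hz'
    -- Both factors determine the subword of colour `m` of the middle word, so the expressions of
    -- colour `m` are composable.
    obtain rfl := map_color_injective m (hY.symm.trans hY')
    rw [(h.colorEval_isHom m f).icl (h.colorEval_isHom m f')]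
    exact Submodule.subset_span ⟨a, a₂, f.comp f', _, hX, hZ, hq.comp hq', rfl⟩
  | zero_left y hy => rw [zero_vcomp]; exact zero_mem _
  | zero_right y hy => rw [vcomp_zero]; exact zero_mem _
  | add_left x y z _ _ _ hx hy => rw [add_vcomp]; exact add_mem hx hy
  | add_right x y z _ _ _ hx hy => rw [vcomp_add]; exact add_mem hx hy
  | smul_left r x y _ _ hx => rw [smul_vcomp]; exact Submodule.smul_mem _ r hx
  | smul_right r x y _ _ hx => rw [vcomp_smul]; exact Submodule.smul_mem _ r hx

/-- The product of f ⊗ q and f' ⊗ q' is out of order, as q stands before f'. Conjugation with the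
passage of the middle blocks interchanges them by `pass_natural`, since q avoids the colour of f'.
-/
lemma splitSpan_mul {m : Fin n} {P : Fin n → Prop} (hm : ¬P m) {X Y X' Y' : List (Strand × Fin n)}
    {z z' : D.Total} (hz : z ∈ h.splitSpan m P X Y) (hz' : z' ∈ h.splitSpan m P X' Y') :
    ∃ y ∈ h.splitSpan m P (X ++ X') (Y ++ Y'),
      (z * z') ⊙ (h.strands.E (Y.filter (isColor m)) *
        h.strands.pass (Y.filter (!isColor m ·)) (Y'.filter (isColor m)) *
        h.strands.E (Y'.filter (!isColor m ·))) =
      (h.strands.E (X.filter (isColor m)) *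
        h.strands.pass (X.filter (!isColor m ·)) (X'.filter (isColor m)) *
        h.strands.E (X'.filter (!isColor m ·))) ⊙ y := by
  induction hz, hz' using Submodule.span_induction₂ with
  | mem_mem z z' hz hz' =>
    obtain ⟨a, a', f, q, hX, hY, hq, rfl⟩ := hz
    obtain ⟨a₁, a₂, f', q', hX', hY', hq', rfl⟩ := hz'
    refine ⟨h.colorEval m f * h.colorEval m f' * (q * q'), Submodule.subset_span
      ⟨a ++ a₁, a' ++ a₂, f.tensor f', q * q', by simp [hX, hX'], by simp [hY, hY'], ?_, rfl⟩, ?_⟩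
    · rw [List.filter_append, List.filter_append]
      exact hq.mul hq'
    · have hf := h.colorEval_isHom m f
      have hf' := h.colorEval_isHom m f'
      have key : (q * h.colorEval m f') ⊙ h.strands.pass (Y.filter (!isColor m ·))
            (Y'.filter (isColor m)) =
          h.strands.pass (X.filter (!isColor m ·)) (X'.filter (isColor m)) ⊙
            (h.colorEval m f' * q) := by
        rw [hY', hX']
        refine StrandSys.pass_natural hq.isHom hf' ?_ ?_
        · rintro ⟨t, l⟩ ht
          obtain ⟨_, _, e⟩ := List.mem_map.mp ht
          cases e
          exact hq.slidesL hm _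
        · rintro ⟨t, l⟩ ht
          refine h.color_slides ?_ t f'
          intro e
          exact hm (e ▸ hq.mem.1 _ ht)
      have hqr := hq'.isHom.right
      have hql := hq'.isHom.left
      have hfr := hf.right
      have hfl := hf.left
      rw [← mul_regroup, ← mul_regroup (h.colorEval m f) (h.colorEval m f'), hX, hY,
        hq'.isHom.icr (StrandSys.IsHom.E _), (StrandSys.IsHom.E _).icr hq'.isHom,
        hf.icl (StrandSys.IsHom.E _), (StrandSys.IsHom.E _).icl hf, hqr, hql, hfl, hfr, key]
  | zero_left y hy => exact ⟨0, zero_mem _, by simp⟩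
  | zero_right y hy => exact ⟨0, zero_mem _, by simp⟩
  | add_left x y z _ _ _ hx hy =>
    obtain ⟨w, hw, e⟩ := hx
    obtain ⟨w', hw', e'⟩ := hy
    exact ⟨w + w', add_mem hw hw', by rw [add_mul, add_vcomp, vcomp_add, e, e']⟩
  | add_right x y z _ _ _ hx hy =>
    obtain ⟨w, hw, e⟩ := hx
    obtain ⟨w', hw', e'⟩ := hy
    exact ⟨w + w', add_mem hw hw', by rw [mul_add, add_vcomp, vcomp_add, e, e']⟩
  | smul_left r x y _ _ hx =>
    obtain ⟨w, hw, e⟩ := hx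
    exact ⟨r • w, Submodule.smul_mem _ r hw, by rw [smul_mul_assoc, smul_vcomp, vcomp_smul, e]⟩
  | smul_right r x y _ _ hx =>
    obtain ⟨w, hw, e⟩ := hx
    exact ⟨r • w, Submodule.smul_mem _ r hw, by rw [mul_smul_comm, smul_vcomp, vcomp_smul, e]⟩

end HeisData

end FrobHeis

namespace FrobHeis

open WordData

/-! ### Separating one colour in a morphism -/

namespace StrandSys

variable {R : Type u} [CommRing R] {S : Type} {D : WordData.{u, v} R S} [Lawful D] {C : Type}
  (Q : StrandSys D C) {P : C → Bool}

lemma ext_pair_left {s : C} (hs : P s = true) (t : C) : Q.ext P [s, t] = Q.E [s, t] := by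
  rw [ext, hs, cond_true, E_cons]
  cases ht : P t
  · rw [Q.ext_of_forall_not (by simp [ht])]
  · rw [Q.ext_of_forall (by simp [ht])]

lemma ext_pair_swap {s t : C} (hs : P s = false) (ht : P t = true) :
    Q.ext P [s, t] = Q.cross s t := by
  rw [ext, hs, cond_false, Q.ext_of_forall (by simp [ht])]
  simp only [List.filter_cons, ht, List.filter_nil, if_true, Bool.not_true, Bool.false_eq_true,
    if_false]
  rw [E_nil, mul_one, slide_single, E_single, Q.ee_cross]

end StrandSys

namespace HeisData

variable {R : Type u} [CommRing R] {n : ℕ} {F : Fin n → Type v} [∀ i, Ring (F i)]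
  [∀ i, Algebra R (F i)] {ι : Fin n → Type w} [∀ i, Fintype (ι i)]
  {φ : ∀ i, SymmFrobenius R (F i)} {b : ∀ i, Module.Basis (ι i) R (F i)} {k : ℤ} {S' : Type}
  {D : WordData.{u} R S'} [Lawful D] {h : HeisData (SymmFrobenius.directSum φ) (Pi.basis b) k D}

section Filter

variable {m : Fin n} {X : List (Strand × Fin n)}

lemma filter_isColor_of_forall (hX : ∀ s ∈ X, s.2 = m) : X.filter (isColor m) = X :=
  List.filter_eq_self.mpr fun s hs => by simp [isColor, hX s hs]

lemma filter_not_isColor_of_forall (hX : ∀ s ∈ X, s.2 = m) : X.filter (!isColor m ·) = [] :=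
  List.filter_eq_nil_iff.mpr fun s hs => by simp [isColor, hX s hs]

lemma filter_isColor_of_forall_ne (hX : ∀ s ∈ X, s.2 ≠ m) : X.filter (isColor m) = [] :=
  List.filter_eq_nil_iff.mpr fun s hs => by simp [isColor, hX s hs]

lemma filter_not_isColor_of_forall_ne (hX : ∀ s ∈ X, s.2 ≠ m) : X.filter (!isColor m ·) = X :=
  List.filter_eq_self.mpr fun s hs => by simp [isColor, hX s hs]

lemma filter_isColor_eq (X : List (Strand × Fin n)) :
    X.filter (isColor m) = ((X.filter (isColor m)).map Prod.fst).map (·, m) := by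
  rw [List.map_map]
  conv_lhs => rw [← List.map_id (X.filter (isColor m))]
  refine List.map_congr_left fun s hs => ?_
  have := (List.mem_filter.mp hs).2
  simp only [isColor, decide_eq_true_eq] at this
  exact Prod.ext rfl this

end Filter

lemma colorEval_nil (m : Fin n) : h.colorEval m (.id []) = 1 := rfl

lemma splitSpan_isHom {m : Fin n} {P : Fin n → Prop} {X Y : List (Strand × Fin n)} {z : D.Total}
    (hz : z ∈ h.splitSpan m P X Y) :
    h.strands.IsHom (X.filter (isColor m) ++ X.filter (!isColor m ·))
      (Y.filter (isColor m) ++ Y.filter (!isColor m ·)) z := by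
  induction hz using Submodule.span_induction with
  | mem z hz =>
    obtain ⟨a, a', f, q, hX, hY, hq, rfl⟩ := hz
    rw [hX, hY]
    exact (h.colorEval_isHom m f).mul hq.isHom
  | zero => exact StrandSys.IsHom.zero _ _
  | add _ _ _ _ hx hy => exact hx.add hy
  | smul r _ _ hx => exact hx.smul r

/-- Without strands of colour `m` both unshuffles are identities, and the factor of colour `m` is
the identity of the empty word. -/
lemma split_of_ne {P : Fin n → Prop} {m : Fin n} {X Y : List (Strand × Fin n)} {g : D.Total}
    (hm : ¬P m) (hg : h.ColorGen P X Y g) :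
    ∃ z ∈ h.splitSpan m P X Y,
      g ⊙ h.strands.ext (isColor m) Y = h.strands.ext (isColor m) X ⊙ z := by
  have hX : ∀ s ∈ X, s.2 ≠ m := fun s hs e => hm (e ▸ hg.mem.1 s hs)
  have hY : ∀ s ∈ Y, s.2 ≠ m := fun s hs e => hm (e ▸ hg.mem.2 s hs)
  refine ⟨g, Submodule.subset_span ⟨[], [], .id [], g, filter_isColor_of_forall_ne hX,
    filter_isColor_of_forall_ne hY, ?_, by rw [colorEval_nil, one_mul]⟩, ?_⟩
  · rwa [filter_not_isColor_of_forall_ne hX, filter_not_isColor_of_forall_ne hY]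
  · rw [StrandSys.ext_of_forall_not _ (by simpa [isColor] using hY),
      StrandSys.ext_of_forall_not _ (by simpa [isColor] using hX), hg.isHom.left, hg.isHom.right]

/-- A crossing with exactly one strand of colour `m` is itself an unshuffle or the inverse of one,
so it becomes an identity after conjugation. -/
lemma split_cross {P : Fin n → Prop} {m i j : Fin n} (hi : P i) (hj : P j) (hij : i ≠ j)
    (h' : i = m ∨ j = m) (s t : Strand) :
    ∃ z ∈ h.splitSpan m (fun i => P i ∧ i ≠ m) [(s, i), (t, j)] [(t, j), (s, i)],
      h.strands.cross (s, i) (t, j) ⊙ h.strands.ext (isColor m) [(t, j), (s, i)] =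
        h.strands.ext (isColor m) [(s, i), (t, j)] ⊙ z := by
  have hc := StrandSys.IsHom.cross (Q := h.strands) (s, i) (t, j)
  rcases h' with rfl | rfl
  · have e1 : isColor i (t, j) = false := by simp [isColor, hij.symm]
    have e2 : isColor i (s, i) = true := by simp [isColor]
    refine ⟨h.strands.E [(s, i), (t, j)], Submodule.subset_span ⟨[s], [s], .id [s],
      h.strands.E [(t, j)], by simp [e1, e2], by simp [e1, e2], ?_, ?_⟩, ?_⟩
    · simp only [List.filter_cons, e1, e2, List.filter_nil, Bool.not_true, Bool.not_false, if_true,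
        Bool.false_eq_true, if_false]
      exact .id (by simp [hj, hij.symm])
    · rw [colorEval_id, ← StrandSys.E_append]; rfl
    · rw [StrandSys.ext_pair_swap _ e1 e2, StrandSys.ext_pair_left _ e2, StrandSys.E_E,
        h.cross_cross hij, StrandSys.E_cons, StrandSys.E_single]
  · have e1 : isColor j (s, i) = false := by simp [isColor, hij]
    have e2 : isColor j (t, j) = true := by simp [isColor]
    refine ⟨h.strands.E [(t, j), (s, i)], Submodule.subset_span ⟨[t], [t], .id [t],
      h.strands.E [(s, i)], by simp [e1, e2], by simp [e1, e2], ?_, ?_⟩, ?_⟩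
    · simp only [List.filter_cons, e1, e2, List.filter_nil, Bool.not_true, Bool.not_false, if_true,
        Bool.false_eq_true, if_false]
      exact .id (by simp [hi, hij])
    · rw [colorEval_id, ← StrandSys.E_append]; rfl
    · rw [StrandSys.ext_pair_swap _ e1 e2, StrandSys.ext_pair_left _ e2]

/-- Induction over the diagram. Composites are immediate, because the unshuffle of the middle word
cancels; tensor products combine `ext_append` and `splitSpan_mul`. -/
lemma ColorGen.split {P : Fin n → Prop} {X Y : List (Strand × Fin n)} {g : D.Total}
    (hg : h.ColorGen P X Y g) (m : Fin n) :
    ∃ z ∈ h.splitSpan m (fun i => P i ∧ i ≠ m) X Y,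
      g ⊙ h.strands.ext (isColor m) Y = h.strands.ext (isColor m) X ⊙ z := by
  have hm : ¬(fun i => P i ∧ i ≠ m) m := fun e => e.2 rfl
  induction hg with
  | @color i hi a a' f =>
    by_cases him : i = m
    · subst him
      have h1 : ∀ a : List Strand, ∀ s ∈ a.map (·, i), s.2 = i := by simp
      refine ⟨h.colorEval i f, Submodule.subset_span ⟨a, a', f, 1,
        filter_isColor_of_forall (h1 _), filter_isColor_of_forall (h1 _), ?_,
        (mul_one _).symm⟩, ?_⟩
      · rw [filter_not_isColor_of_forall (h1 _), filter_not_isColor_of_forall (h1 _)]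
        exact .id (by simp)
      · rw [StrandSys.ext_of_forall _ (by simp [isColor]),
          StrandSys.ext_of_forall _ (by simp [isColor]), (h.colorEval_isHom i f).left,
          (h.colorEval_isHom i f).right]
    · exact split_of_ne hm (.color ⟨hi, him⟩ f)
  | @up i j hi hj hij =>
    by_cases h' : i = m ∨ j = m
    · exact split_cross hi hj hij h' .up .up
    · push Not at h'
      exact split_of_ne hm (.up ⟨hi, h'.1⟩ ⟨hj, h'.2⟩ hij)
  | @left i j hi hj hij =>
    by_cases h' : i = m ∨ j = m
    · exact split_cross hi hj hij h' .down .up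
    · push Not at h'
      exact split_of_ne hm (.left ⟨hi, h'.1⟩ ⟨hj, h'.2⟩ hij)
  | @id X hX =>
    have hx := h.strands.ext_isHom (isColor m) X
    refine ⟨h.strands.E (X.filter (isColor m) ++ X.filter (!isColor m ·)), Submodule.subset_span
      ⟨_, _, .id _, h.strands.E (X.filter (!isColor m ·)), filter_isColor_eq X, filter_isColor_eq X,
        .id ?_, ?_⟩, ?_⟩
    · intro s hs
      have := List.mem_filter.mp hs
      exact ⟨hX s this.1, by simpa [isColor] using this.2⟩
    · rw [colorEval_id, ← filter_isColor_eq, StrandSys.E_append]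
    · rw [hx.left, hx.right]
  | comp _ _ hf hg =>
    obtain ⟨z, hz, e⟩ := hf
    obtain ⟨z', hz', e'⟩ := hg
    exact ⟨z ⊙ z', h.splitSpan_comp hz hz', by
      rw [vcomp_assoc, e', ← vcomp_assoc, e, vcomp_assoc]⟩
  | @mul X Y X' Y' f g hf₀ hg₀ hf hg =>
    obtain ⟨z, hz, e⟩ := hf
    obtain ⟨z', hz', e'⟩ := hg
    obtain ⟨y, hy, ey⟩ := h.splitSpan_mul hm hz hz'
    refine ⟨y, hy, ?_⟩
    rw [StrandSys.ext_append, StrandSys.ext_append, ← vcomp_assoc,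
      hf₀.isHom.icl (h.strands.ext_isHom _ Y), e, e',
      ← (h.strands.ext_isHom _ X).icl (splitSpan_isHom hz),
      vcomp_assoc, ey, vcomp_assoc]
  | zero hX hY => exact ⟨0, zero_mem _, by simp⟩
  | add _ _ hf hg =>
    obtain ⟨z, hz, e⟩ := hf
    obtain ⟨z', hz', e'⟩ := hg
    exact ⟨z + z', add_mem hz hz', by rw [add_vcomp, vcomp_add, e, e']⟩
  | smul r _ hf =>
    obtain ⟨z, hz, e⟩ := hf
    exact ⟨r • z, Submodule.smul_mem _ r hz, by rw [smul_vcomp, vcomp_smul, e]⟩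

/-- The word with the `i`-coloured strands `a i`, sorted by colour. -/
def sorted (L : List (Fin n)) (a : Fin n → List Strand) : List (Strand × Fin n) :=
  L.flatMap fun i => (a i).map (·, i)

lemma sorted_cons (m : Fin n) (L : List (Fin n)) (a : Fin n → List Strand) :
    sorted (m :: L) a = (a m).map (·, m) ++ sorted L a := List.flatMap_cons

lemma mem_sorted {L : List (Fin n)} {a : Fin n → List Strand} {s : Strand × Fin n}
    (hs : s ∈ sorted L a) : s.2 ∈ L := by
  obtain ⟨i, hi, hs⟩ := List.mem_flatMap.mp hs
  obtain ⟨_, _, rfl⟩ := List.mem_map.mp hs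
  exact hi

lemma filter_sorted {m : Fin n} {L : List (Fin n)} (hm : m ∉ L) (a : Fin n → List Strand) :
    (sorted (m :: L) a).filter (isColor m) = (a m).map (·, m) ∧
      (sorted (m :: L) a).filter (!isColor m ·) = sorted L a := by
  have h1 : ∀ s ∈ (a m).map (·, m), s.2 = m := by simp
  have h2 : ∀ s ∈ sorted L a, s.2 ≠ m := fun s hs e => hm (e ▸ mem_sorted hs)
  rw [sorted_cons, List.filter_append, List.filter_append, filter_isColor_of_forall h1,
    filter_not_isColor_of_forall h1, filter_isColor_of_forall_ne h2,
    filter_not_isColor_of_forall_ne h2, List.append_nil, List.nil_append]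
  exact ⟨rfl, rfl⟩

/-- The strands of the first colour already stand on the left, so the two blocks to be interchanged
include an empty one. -/
lemma ext_sorted {m : Fin n} {L : List (Fin n)} (hm : m ∉ L) (a : Fin n → List Strand) :
    h.strands.ext (isColor m) (sorted (m :: L) a) = h.strands.E (sorted (m :: L) a) := by
  have h1 : ∀ s ∈ (a m).map (·, m), s.2 = m := by simp
  have h2 : ∀ s ∈ sorted L a, s.2 ≠ m := fun s hs e => hm (e ▸ mem_sorted hs)
  rw [sorted_cons, StrandSys.ext_append, StrandSys.ext_of_forall _ (by simp [isColor]),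
    StrandSys.ext_of_forall_not _ (by simpa [isColor] using h2), filter_isColor_of_forall h1,
    filter_not_isColor_of_forall h1, filter_isColor_of_forall_ne h2,
    filter_not_isColor_of_forall_ne h2, StrandSys.pass_nil, StrandSys.E_nil, mul_one,
    StrandSys.E_append, icl, StrandSys.E_E, StrandSys.E_E]

/-- Induction over the colours. Since the unshuffle of a sorted word is trivial, `ColorGen.split`
writes the morphism itself through products of a factor of the first colour and a morphism with the
remaining colours. -/
lemma ColorGen.mem_span {L : List (Fin n)} (hL : L.Nodup) {a a' : Fin n → List Strand}
    {g : D.Total} (hg : h.ColorGen (· ∈ L) (sorted L a) (sorted L a') g) :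
    g ∈ Submodule.span R {z | ∃ f : ∀ i, Tm R (HeisGen (F i) (ι i) k) (a i) (a' i),
      z = (L.map fun i => h.colorEval i (f i)).prod} := by
  induction L generalizing g with
  | nil =>
    -- Without colours, only the empty word and the scalar multiples of its identity remain.
    have : ∀ {X Y : List (Strand × Fin n)} {g : D.Total}, h.ColorGen (· ∈ []) X Y g →
        ∃ r : R, g = r • 1 := by
      intro X Y g hg
      induction hg with
      | color hi f => exact absurd hi (by simp)
      | up hi hj hij => exact absurd hi (by simp)
      | left hi hj hij => exact absurd hi (by simp)
      | @id X hX =>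
        obtain rfl : X = [] := List.eq_nil_iff_forall_not_mem.mpr fun s hs => by simpa using hX s hs
        exact ⟨1, (one_smul R _).symm⟩
      | comp _ _ hf hg =>
        obtain ⟨r, rfl⟩ := hf
        obtain ⟨r', rfl⟩ := hg
        exact ⟨r * r', by rw [smul_vcomp, vcomp_smul, one_vcomp_one, smul_smul]⟩
      | mul _ _ hf hg =>
        obtain ⟨r, rfl⟩ := hf
        obtain ⟨r', rfl⟩ := hg
        exact ⟨r * r', by rw [smul_mul_smul_comm, one_mul]⟩
      | zero hX hY => exact ⟨0, (zero_smul R _).symm⟩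
      | add _ _ hf hg =>
        obtain ⟨r, rfl⟩ := hf
        obtain ⟨r', rfl⟩ := hg
        exact ⟨r + r', (add_smul _ _ _).symm⟩
      | smul r _ hf =>
        obtain ⟨r', rfl⟩ := hf
        exact ⟨r * r', smul_smul _ _ _⟩
    obtain ⟨r, rfl⟩ := this hg
    -- Any tuple will do here: the product over the empty list of colours is 1.
    exact Submodule.smul_mem _ r (Submodule.subset_span ⟨fun i => .zero _ _, rfl⟩)
  | cons m L ih =>
    have hm : m ∉ L := (List.nodup_cons.mp hL).1
    obtain ⟨z, hz, e⟩ := hg.split m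
    have hgz : g = z := by
      have hz' : h.strands.E (sorted (m :: L) a) ⊙ z = z := by
        have hz := (splitSpan_isHom hz).left
        rwa [(filter_sorted hm a).1, (filter_sorted hm a).2, ← sorted_cons] at hz
      rw [ext_sorted hm, ext_sorted hm, hz', hg.isHom.right] at e
      exact e
    rw [hgz]
    clear e hgz
    induction hz using Submodule.span_induction with
    | mem z hz =>
      obtain ⟨a₁, a₂, f, q, hX, hY, hq, rfl⟩ := hz
      rw [(filter_sorted hm a).1] at hX
      rw [(filter_sorted hm a').1] at hY
      rw [(filter_sorted hm a).2, (filter_sorted hm a').2] at hq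
      obtain rfl := map_color_injective m hX
      obtain rfl := map_color_injective m hY
      have hq' : h.ColorGen (· ∈ L) (sorted L a) (sorted L a') q := by
        convert hq using 2 with i
        rw [List.mem_cons]
        constructor
        · exact fun hi => ⟨.inr hi, fun e => hm (e ▸ hi)⟩
        · rintro ⟨hi | hi, hne⟩
          · exact absurd hi hne
          · exact hi
      have := ih (List.nodup_cons.mp hL).2 hq'
      clear hq hq'
      induction this using Submodule.span_induction with
      | mem q hq =>
        obtain ⟨f', rfl⟩ := hq
        -- Only the factors with colour in `L` enter the product of `f'`, and `m` is not among them,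
        -- so this entry is free to hold `f`.
        refine Submodule.subset_span ⟨Function.update f' m f, ?_⟩
        rw [List.map_cons, List.prod_cons, Function.update_self]
        congr 2
        refine List.map_congr_left fun i hi => ?_
        rw [Function.update_of_ne]
        rintro rfl
        exact hm hi
      | zero => rw [mul_zero]; exact zero_mem _
      | add _ _ _ _ hx hy => rw [mul_add]; exact add_mem hx hy
      | smul r _ _ hx => rw [mul_smul_comm]; exact Submodule.smul_mem _ r hx
    | zero => exact zero_mem _
    | add _ _ _ _ hx hy => exact add_mem hx hy
    | smul r _ _ hx => exact Submodule.smul_mem _ r hx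

end HeisData

end FrobHeis

namespace FrobHeis

open WordData

/-! ### All morphisms are generated by the coloured generators -/

lemma exists_of_map_fst_single {A B : Type*} {X : List (A × B)} {s : A}
    (hX : X.map Prod.fst = [s]) : ∃ i, X = [(s, i)] := by
  rcases X with _ | ⟨⟨a, i⟩, _ | ⟨_, _⟩⟩
  · simp at hX
  · simp only [List.map_cons, List.map_nil, List.cons.injEq, and_true] at hX
    exact ⟨i, by rw [hX]⟩
  · simp at hX

lemma exists_of_map_fst_pair {A B : Type*} {X : List (A × B)} {s t : A}
    (hX : X.map Prod.fst = [s, t]) : ∃ i j, X = [(s, i), (t, j)] := by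
  rcases X with _ | ⟨⟨a, i⟩, X⟩
  · simp at hX
  · simp only [List.map_cons, List.cons.injEq] at hX
    obtain ⟨j, rfl⟩ := exists_of_map_fst_single hX.2
    exact ⟨i, j, by rw [hX.1]⟩

namespace HeisData

variable {R : Type u} [CommRing R] {n : ℕ} {F : Fin n → Type v} [∀ i, Ring (F i)]
  [∀ i, Algebra R (F i)] {ι : Fin n → Type w} [∀ i, Fintype (ι i)]
  {φ : ∀ i, SymmFrobenius R (F i)} {b : ∀ i, Module.Basis (ι i) R (F i)} {k : ℤ} {S' : Type}
  {D : WordData.{u} R S'} [Lawful D] (h : HeisData (SymmFrobenius.directSum φ) (Pi.basis b) k D)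

lemma E_up_single (i : Fin n) : h.strands.E [(.up, i)] = h.u i := h.strands.E_single _

lemma E_pair (s t : Strand × Fin n) :
    h.strands.E [s, t] = h.strandId s * h.strandId t := by
  rw [StrandSys.E_cons, StrandSys.E_single]; rfl

lemma strandId_ne {s t : Strand} {i j : Fin n} (hst : s = t) (hij : i ≠ j) :
    h.strandId (s, i) ⊙ h.strandId (t, j) = 0 := by
  subst hst
  cases s
  · exact h.u_ne hij
  · exact h.v_ne hij

instance sz_strandId (s : Strand × Fin n) : Sz (h.strandId s) 1 1 := h.strands.sz_e s

/-- The target colours are prescribed arbitrarily. If they are not the ones dictated by the strands,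
orthogonality makes the composite zero, which also counts as generated. -/
lemma colorGen_pair_of_ne {X : List (Strand × Fin n)} {g : D.Total} {s t : Strand}
    {i j i' j' : Fin n}
    (hg : h.ColorGen (fun _ => True) X [(s, i), (t, j)] g) :
    h.ColorGen (fun _ => True) X [(s, i'), (t, j')] (g ⊙ h.strands.E [(s, i'), (t, j')]) := by
  by_cases e : i = i' ∧ j = j'
  · obtain ⟨rfl, rfl⟩ := e
    rwa [hg.isHom.right]
  · rw [← hg.isHom.right, vcomp_assoc, E_pair, E_pair, icl]
    have : (h.strandId (s, i) ⊙ h.strandId (s, i')) * (h.strandId (t, j) ⊙ h.strandId (t, j')) =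
        0 := by
      by_cases hi : i = i'
      · rw [h.strandId_ne (s := t) rfl fun hj => e ⟨hi, hj⟩, mul_zero]
      · rw [h.strandId_ne (s := s) rfl hi, zero_mul]
    rw [this, vcomp_zero]
    exact .zero (by simp) (by simp)

/-- Cutting a generator by colours gives zero, a generator of one colour, or a crossing of two
colours. -/
lemma colorGen_gen {a a' : List Strand} (g : HeisGen (∀ i, F i) (Σ i, ι i) k a a')
    {X Y : List (Strand × Fin n)} (hX : X.map Prod.fst = a) (hY : Y.map Prod.fst = a') :
    h.ColorGen (fun _ => True) X Y (h.strands.E X ⊙ h.gen g ⊙ h.strands.E Y) := by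
  cases g with
  | x =>
    obtain ⟨i, rfl⟩ := exists_of_map_fst_single hX
    obtain ⟨j, rfl⟩ := exists_of_map_fst_single hY
    rw [E_up_single, E_up_single]
    change h.ColorGen _ _ _ (h.u i ⊙ h.x ⊙ h.u j)
    rw [← u_x, ← vcomp_assoc]
    by_cases hij : i = j
    · subst hij
      rw [u_self]
      exact .color trivial (.gen .x)
    · rw [h.u_ne hij, zero_vcomp]
      exact .zero (by simp) (by simp)
  | s =>
    obtain ⟨i, j, rfl⟩ := exists_of_map_fst_pair hX
    obtain ⟨i', j', rfl⟩ := exists_of_map_fst_pair hY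
    rw [← vcomp_assoc]
    refine h.colorGen_pair_of_ne (i := j) (j := i) ?_
    rw [E_pair]
    change h.ColorGen _ _ _ (h.cs i j)
    by_cases hij : i = j
    · subst hij
      exact .color trivial (.gen .s)
    · exact .up trivial trivial hij
  | c =>
    obtain rfl := List.map_eq_nil_iff.mp hX
    obtain ⟨i, j, rfl⟩ := exists_of_map_fst_pair hY
    rw [E_pair]
    change h.ColorGen _ _ _ (1 ⊙ h.c ⊙ (h.v i * h.u j))
    rw [one_vcomp]
    by_cases hij : i = j
    · subst hij
      exact .color trivial (.gen .c)
    · rw [h.c_vu_ne hij]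
      exact .zero (by simp) (by simp)
  | d =>
    obtain rfl := List.map_eq_nil_iff.mp hY
    obtain ⟨i, j, rfl⟩ := exists_of_map_fst_pair hX
    rw [E_pair]
    change h.ColorGen _ _ _ ((h.u i * h.v j) ⊙ h.d ⊙ 1)
    rw [vcomp_one]
    by_cases hij : i = j
    · subst hij
      exact .color trivial (.gen .d)
    · rw [h.uv_d_ne hij]
      exact .zero (by simp) (by simp)
  | token f =>
    obtain ⟨i, rfl⟩ := exists_of_map_fst_single hX
    obtain ⟨j, rfl⟩ := exists_of_map_fst_single hY
    rw [E_up_single, E_up_single]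
    change h.ColorGen _ _ _ (h.u i ⊙ h.tok f ⊙ h.u j)
    rw [tok_u, u_tok]
    by_cases hij : i = j
    · subst hij
      rw [Pi.single_eq_same]
      exact .color trivial (.gen (.token (f i)))
    · rw [Pi.single_eq_of_ne hij, Pi.single_zero, tok_zero]
      exact .zero (by simp) (by simp)
  | leftCross =>
    obtain ⟨i, j, rfl⟩ := exists_of_map_fst_pair hX
    obtain ⟨i', j', rfl⟩ := exists_of_map_fst_pair hY
    rw [← vcomp_assoc]
    refine h.colorGen_pair_of_ne (i := j) (j := i) ?_
    rw [E_pair]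
    change h.ColorGen _ _ _ (h.cL i j)
    by_cases hij : i = j
    · subst hij
      exact .color trivial (.gen .leftCross)
    · exact .left trivial trivial hij
  | leftCup r p =>
    obtain rfl := List.map_eq_nil_iff.mp hX
    obtain ⟨i, j, rfl⟩ := exists_of_map_fst_pair hY
    obtain ⟨l, m⟩ := p
    rw [E_pair]
    change h.ColorGen _ _ _ (1 ⊙ h.lcup r ⟨l, m⟩ ⊙ (h.u i * h.v j))
    rw [one_vcomp, lcup_uv]
    split_ifs with e
    · obtain ⟨rfl, rfl⟩ := e
      exact .color trivial (.gen (.leftCup r m))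
    · exact .zero (by simp) (by simp)
  | leftCap r p =>
    obtain rfl := List.map_eq_nil_iff.mp hY
    obtain ⟨i, j, rfl⟩ := exists_of_map_fst_pair hX
    obtain ⟨l, m⟩ := p
    rw [E_pair]
    change h.ColorGen _ _ _ ((h.v i * h.u j) ⊙ h.lcap r ⟨l, m⟩ ⊙ 1)
    rw [vcomp_one, vu_lcap]
    split_ifs with e
    · obtain ⟨rfl, rfl⟩ := e
      exact .color trivial (.gen (.leftCap r m))
    · exact .zero (by simp) (by simp)

/-- Expanding each strand as the sum of its coloured versions writes the identity of a word as the
sum over all its colourings. -/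
lemma objW_mem_span (a : List Strand) : objW h.obj a ∈
    Submodule.span R {z | ∃ Z : List (Strand × Fin n), Z.map Prod.fst = a ∧ z = h.strands.E Z} := by
  induction a with
  | nil => exact Submodule.subset_span ⟨[], rfl, rfl⟩
  | cons s a ih =>
    have hs : h.obj s = ∑ i, h.strands.e (s, i) := by
      cases s
      · exact h.sum_u.symm
      · exact h.sum_v.symm
    rw [objW_cons, hs, Finset.sum_mul]
    refine sum_mem fun i _ => ?_
    generalize objW h.obj a = w at ih
    induction ih using Submodule.span_induction with
    | mem z hz =>
      obtain ⟨Z, rfl, rfl⟩ := hz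
      exact Submodule.subset_span ⟨(s, i) :: Z, rfl, (h.strands.E_cons _ _).symm⟩
    | zero => rw [mul_zero]; exact zero_mem _
    | add _ _ _ _ hx hy => rw [mul_add]; exact add_mem hx hy
    | smul r _ _ hx => rw [mul_smul_comm]; exact Submodule.smul_mem _ r hx

lemma E_vcomp_E_of_ne {X Y : List (Strand × Fin n)} (hXY : X.map Prod.fst = Y.map Prod.fst)
    (hne : X ≠ Y) : h.strands.E X ⊙ h.strands.E Y = 0 := by
  induction X generalizing Y with
  | nil =>
    exact absurd (List.map_eq_nil_iff.mp (hXY.symm : Y.map Prod.fst = [])).symm hne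
  | cons s X ih =>
    rcases Y with _ | ⟨t, Y⟩
    · simp at hXY
    · obtain ⟨s, i⟩ := s
      obtain ⟨t, j⟩ := t
      simp only [List.map_cons, List.cons.injEq] at hXY
      obtain ⟨rfl, hXY⟩ := hXY
      rw [StrandSys.E_cons, StrandSys.E_cons, icl]
      by_cases hij : i = j
      · subst hij
        rw [ih hXY (fun e => hne (by rw [e])), mul_zero]
      · rw [show h.strands.e (s, i) ⊙ h.strands.e (s, j) = 0 from h.strandId_ne rfl hij, zero_mul]

/-- A morphism between coloured words is first written in uncoloured generators. Inserting the
decomposition of the identity between any two of them leaves only coloured pieces. -/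
lemma colorGen_eval {a a' : List Strand}
    (f : Tm R (HeisGen (∀ i, F i) (Σ i, ι i) k) a a') {X Y : List (Strand × Fin n)}
    (hX : X.map Prod.fst = a) (hY : Y.map Prod.fst = a') :
    h.ColorGen (fun _ => True) X Y (h.strands.E X ⊙ h.interp.eval f ⊙ h.strands.E Y) := by
  induction f generalizing X Y with
  | gen g => exact h.colorGen_gen g hX hY
  | id a =>
    have e : h.interp.eval (Tm.id a) ⊙ h.strands.E Y = h.strands.E Y := by
      subst hY
      change objW h.obj _ ⊙ _ = _
      clear hX
      induction Y with
      | nil => exact one_vcomp_one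
      | cons s Y ih =>
        have hs : h.obj s.1 ⊙ h.strands.e s = h.strands.e s := by
          obtain ⟨s, i⟩ := s
          cases s
          · exact h.U_u i
          · exact h.V_v i
        have : Sz (h.obj s.1) 1 1 := h.interp.sz_obj s.1
        rw [List.map_cons, objW_cons, StrandSys.E_cons, icl, ih, hs]
    rw [e]
    by_cases hXY : X = Y
    · subst hXY
      rw [StrandSys.E_E]
      exact .id (by simp)
    · rw [h.E_vcomp_E_of_ne (hX.trans hY.symm) hXY]
      exact .zero (by simp) (by simp)
  | @comp a a' a'' f g hf hg =>
    -- The middle identity is made explicit so that it can be replaced by coloured identities, for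
    -- which the induction hypotheses hold.
    have e : h.interp.eval f = h.interp.eval f ⊙ objW h.obj a' := (h.interp.eval_obj f).symm
    rw [Interp.eval, e]
    have := h.objW_mem_span a'
    generalize objW h.obj a' = w at this
    clear e
    induction this using Submodule.span_induction with
    | mem z hz =>
      obtain ⟨Z, hZ, rfl⟩ := hz
      rw [← h.strands.E_E Z]
      have := (hf hX hZ).comp (hg hZ hY)
      simpa only [vcomp_assoc] using this
    | zero =>
      rw [vcomp_zero, zero_vcomp, zero_vcomp, vcomp_zero]
      exact .zero (by simp) (by simp)
    | add _ _ _ _ hx hy =>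
      rw [vcomp_add, add_vcomp, add_vcomp, vcomp_add]
      exact hx.add hy
    | smul r _ _ hx =>
      rw [vcomp_smul, smul_vcomp, smul_vcomp, vcomp_smul]
      exact hx.smul r
  | tensor f g hf hg =>
    obtain ⟨X₁, X₂, rfl, hX₁, hX₂⟩ := List.map_eq_append_iff.mp hX
    obtain ⟨Y₁, Y₂, rfl, hY₁, hY₂⟩ := List.map_eq_append_iff.mp hY
    have := (hf hX₁ hY₁).mul (hg hX₂ hY₂)
    have h1 := (h.interp.sz_eval f).cast (p' := X₁.length) (q' := Y₁.length)
      (by rw [← hX₁, List.length_map]) (by rw [← hY₁, List.length_map])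
    rw [StrandSys.E_append, StrandSys.E_append, Interp.eval, icl, icl]
    exact this
  | zero a a' =>
    rw [Interp.eval, zero_vcomp, vcomp_zero]
    exact .zero (by simp) (by simp)
  | add f g hf hg =>
    rw [Interp.eval, add_vcomp, vcomp_add]
    exact (hf hX hY).add (hg hX hY)
  | smul r f hf =>
    rw [Interp.eval, smul_vcomp, vcomp_smul]
    exact (hf hX hY).smul r

/-- Every word of coloured strands is isomorphic to a sorted one. -/
lemma exists_sorted_iso {L : List (Fin n)} (hL : L.Nodup) (X : List (Strand × Fin n))
    (hX : ∀ s ∈ X, s.2 ∈ L) : ∃ (a : Fin n → List Strand) (f g : D.Total),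
      h.strands.IsHom X (sorted L a) f ∧ h.strands.IsHom (sorted L a) X g ∧
      f ⊙ g = h.strands.E X ∧ g ⊙ f = h.strands.E (sorted L a) := by
  induction L generalizing X with
  | nil =>
    obtain rfl : X = [] := List.eq_nil_iff_forall_not_mem.mpr fun s hs => by simpa using hX s hs
    exact ⟨fun _ => [], 1, 1, StrandSys.IsHom.E _, StrandSys.IsHom.E _, one_vcomp_one,
      one_vcomp_one⟩
  | cons m L ih =>
    have hm : m ∉ L := (List.nodup_cons.mp hL).1
    obtain ⟨a, f, g, hf, hg, hfg, hgf⟩ := ih (List.nodup_cons.mp hL).2 (X.filter (!isColor m ·))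
      (fun s hs => by
        have h1 := List.mem_filter.mp hs
        have h2 := hX s h1.1
        simp only [isColor, Bool.not_eq_true', decide_eq_false_iff_not] at h1
        exact (List.mem_cons.mp h2).resolve_left h1.2)
    -- The tuple for the other colours comes from the induction; its entry at `m` does not matter
    -- there, so it can be set to the subword of colour `m`.
    let a' := Function.update a m ((X.filter (isColor m)).map Prod.fst)
    have ha' : sorted (m :: L) a' = X.filter (isColor m) ++ sorted L a := by
      rw [sorted_cons]
      congr 1
      · rw [show a' m = _ from Function.update_self _ _ _, ← filter_isColor_eq]
      · refine List.flatMap_congr fun i hi => ?_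
        have him : i ≠ m := fun e => hm (e ▸ hi)
        rw [show a' i = a i from Function.update_of_ne him _ _]
    have hx := h.strands.ext_isHom (isColor m) X
    have hx' := h.strands.extInv_isHom (isColor m) X
    have e1 := h.strands.ext_extInv (h.invertibleCrossings m) X
    have e2 := h.strands.extInv_ext (h.invertibleCrossings m) X
    have hE := StrandSys.IsHom.E (Q := h.strands) (X.filter (isColor m))
    refine ⟨a', h.strands.ext (isColor m) X ⊙ (h.strands.E (X.filter (isColor m)) * f),
      (h.strands.E (X.filter (isColor m)) * g) ⊙ h.strands.extInv (isColor m) X, ?_, ?_, ?_, ?_⟩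
    · rw [ha']
      exact hx.comp (hE.mul hf)
    · rw [ha']
      exact (hE.mul hg).comp hx'
    · rw [vcomp_assoc, ← vcomp_assoc (_ * f), ← StrandSys.E_mul_vcomp, hfg, ← StrandSys.E_append,
        hx'.left, e1]
    · rw [vcomp_assoc, ← vcomp_assoc (h.strands.extInv _ _), e2, StrandSys.E_append, icl,
        StrandSys.E_E, hf.left, icl, hgf, StrandSys.E_E, ha', StrandSys.E_append]

end HeisData

/-- The tautological interpretation: each generator goes to its own class. It connects statements
about evaluations with statements about morphisms of the category. -/
lemma univ_eval {R : Type u} [CommRing R] {F : Type v} [Ring F] [Algebra R F] {ι : Type w}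
    [Fintype ι] {φ : SymmFrobenius R F} {b : Module.Basis ι R F} {k : ℤ} {a a' : List Strand}
    (f : Tm R (HeisGen F ι k) a a') : (univ φ b k).interp.eval f = inc (HeisRel φ b k) f := by
  induction f with
  | gen g => cases g <;> rfl
  | id a =>
    rw [inc_id]
    change objW (univ φ b k).obj a = _
    induction a with
    | nil => rfl
    | cons s a ih =>
      rw [objW_cons, ih, ← List.singleton_append, idw_append]
      cases s <;> rfl
  | comp f g hf hg => rw [Interp.eval, hf, hg, inc_comp]
  | tensor f g hf hg => rw [Interp.eval, hf, hg, inc_tensor]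
  | zero a b => rw [inc_zero]; rfl
  | add f g hf hg => rw [Interp.eval, hf, hg, inc_add]
  | smul r f hf => rw [Interp.eval, hf, inc_smul]

end FrobHeis

namespace FrobHeis

open WordData

/-! ### Heisenberg data for a direct sum from coloured data -/

section Orthogonal

variable {R : Type u} [CommRing R] {S : Type} {D : WordData.{u, v} R S} [Lawful D]
  {κ : Type*} [Fintype κ] {e A : κ → D.Total}

lemma vcomp_sum_single (he : ∀ p q, p ≠ q → e p ⊙ e q = 0) (hA : ∀ p, e p ⊙ A p = A p) (p : κ) :
    e p ⊙ ∑ q, A q = A p := by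
  classical
  rw [vcomp_sum, Finset.sum_eq_single p, hA]
  · intro q _ hq
    rw [← hA q, ← vcomp_assoc, he p q hq.symm, zero_vcomp]
  · simp

lemma sum_vcomp_single (he : ∀ p q, p ≠ q → e p ⊙ e q = 0) (hA : ∀ p, A p ⊙ e p = A p) (p : κ) :
    (∑ q, A q) ⊙ e p = A p := by
  classical
  rw [sum_vcomp, Finset.sum_eq_single p, hA]
  · intro q _ hq
    rw [← hA q, vcomp_assoc, he q p hq, vcomp_zero]
  · simp

/-- The idempotents decompose the source, so an identity between sums of coloured generators may be
checked for each colouring of the source separately. -/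
lemma eq_of_forall_vcomp {E X Y : D.Total} (hE : ∑ p, e p = E) (hX : E ⊙ X = X) (hY : E ⊙ Y = Y)
    (h : ∀ p, e p ⊙ X = e p ⊙ Y) : X = Y := by
  rw [← hX, ← hY, ← hE, sum_vcomp, sum_vcomp]
  exact Finset.sum_congr rfl fun p _ => h p

end Orthogonal

/-- Heisenberg data for the summands of a direct sum, with crossings of strands of different
colours. -/
structure ColorFamily {R : Type u} [CommRing R] {n : ℕ} {F : Fin n → Type v} [∀ i, Ring (F i)]
    [∀ i, Algebra R (F i)] {ι : Fin n → Type w} [∀ i, Fintype (ι i)]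
    (φ : ∀ i, SymmFrobenius R (F i)) (b : ∀ i, Module.Basis (ι i) R (F i)) (k : ℤ) {S' : Type}
    (D : WordData.{u} R S') [Lawful D] where
  /-- the data of each colour -/
  h : ∀ i, HeisData (φ i) (b i) k D
  /-- the upward crossings -/
  cs : Fin n → Fin n → D.Total
  /-- the left crossings -/
  cL : Fin n → Fin n → D.Total
  U_ne : ∀ i j, i ≠ j → (h i).U ⊙ (h j).U = 0
  V_ne : ∀ i j, i ≠ j → (h i).V ⊙ (h j).V = 0
  cs_self : ∀ i, cs i i = (h i).s
  cL_self : ∀ i, cL i i = (h i).L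
  sz_cs : ∀ i j, Sz (cs i j) 2 2
  sz_cL : ∀ i j, Sz (cL i j) 2 2
  uu_cs : ∀ i j, ((h i).U * (h j).U) ⊙ cs i j = cs i j
  cs_uu : ∀ i j, cs i j ⊙ ((h j).U * (h i).U) = cs i j
  vu_cL : ∀ i j, ((h i).V * (h j).U) ⊙ cL i j = cL i j
  cL_uv : ∀ i j, cL i j ⊙ ((h j).U * (h i).V) = cL i j
  cs_cs : ∀ i j, cs i j ⊙ cs j i = (h i).U * (h j).U
  braid : ∀ i j l, (cs i j * (h l).U) ⊙ ((h j).U * cs i l) ⊙ (cs j l * (h i).U) =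
    ((h i).U * cs j l) ⊙ (cs i l * (h j).U) ⊙ ((h l).U * cs i j)
  tok_cs : ∀ i j f, ((h i).tok f * (h j).U) ⊙ cs i j = cs i j ⊙ ((h j).U * (h i).tok f)
  cs_x : ∀ i j, i ≠ j → cs i j ⊙ ((h j).x * (h i).U) = ((h i).U * (h j).x) ⊙ cs i j
  ct_cL : ∀ i j, i ≠ j → (((h j).c * ((h i).U * (h j).V)) ⊙ ((h j).V * cs j i * (h j).V) ⊙
    ((h j).V * (h i).U * (h j).d)) ⊙ cL j i = (h i).U * (h j).V
  cL_ct : ∀ i j, i ≠ j → cL j i ⊙ (((h j).c * ((h i).U * (h j).V)) ⊙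
    ((h j).V * cs j i * (h j).V) ⊙ ((h j).V * (h i).U * (h j).d)) = (h j).V * (h i).U

namespace ColorFamily

variable {R : Type u} [CommRing R] {n : ℕ} {F : Fin n → Type v} [∀ i, Ring (F i)]
  [∀ i, Algebra R (F i)] {ι : Fin n → Type w} [∀ i, Fintype (ι i)]
  {φ : ∀ i, SymmFrobenius R (F i)} {b : ∀ i, Module.Basis (ι i) R (F i)} {k : ℤ} {S' : Type}
  {D : WordData.{u} R S'} [Lawful D] (c : ColorFamily φ b k D)

attribute [instance] sz_cs sz_cL

/-- The sums of the coloured generators. -/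
noncomputable def pre : HeisPre (∀ i, F i) (Σ i, ι i) k D.Total where
  U := ∑ i, (c.h i).U
  V := ∑ i, (c.h i).V
  x := ∑ i, (c.h i).x
  s := ∑ p : Fin n × Fin n, c.cs p.1 p.2
  c := ∑ i, (c.h i).c
  d := ∑ i, (c.h i).d
  tok f := ∑ i, (c.h i).tok (f i)
  L := ∑ p : Fin n × Fin n, c.cL p.1 p.2
  lcup r p := (c.h p.1).lcup r p.2
  lcap r p := (c.h p.1).lcap r p.2

instance szU : Sz c.pre.U 1 1 :=
  Sz.sum Finset.univ (f := fun i => (c.h i).U) fun i => (c.h i).szU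
instance szV : Sz c.pre.V 1 1 :=
  Sz.sum Finset.univ (f := fun i => (c.h i).V) fun i => (c.h i).szV
instance szx : Sz c.pre.x 1 1 :=
  Sz.sum Finset.univ (f := fun i => (c.h i).x) fun i => (c.h i).szx
instance szs : Sz c.pre.s 2 2 :=
  Sz.sum Finset.univ (f := fun p : Fin n × Fin n => c.cs p.1 p.2) fun p => c.sz_cs p.1 p.2
instance szc : Sz c.pre.c 0 2 :=
  Sz.sum Finset.univ (f := fun i => (c.h i).c) fun i => (c.h i).szc
instance szd : Sz c.pre.d 2 0 :=
  Sz.sum Finset.univ (f := fun i => (c.h i).d) fun i => (c.h i).szd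
instance sztok (f : ∀ i, F i) : Sz (c.pre.tok f) 1 1 :=
  Sz.sum Finset.univ (f := fun i => (c.h i).tok (f i)) fun i => (c.h i).sztok (f i)
instance szL : Sz c.pre.L 2 2 :=
  Sz.sum Finset.univ (f := fun p : Fin n × Fin n => c.cL p.1 p.2) fun p => c.sz_cL p.1 p.2

variable (i j l : Fin n)

lemma UU_ne {p q : Fin n × Fin n} (hpq : p ≠ q) :
    ((c.h p.1).U * (c.h p.2).U) ⊙ ((c.h q.1).U * (c.h q.2).U) = 0 := by
  rw [icl]
  by_cases h1 : p.1 = q.1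
  · rw [c.U_ne p.2 q.2 fun h2 => hpq (Prod.ext h1 h2), mul_zero]
  · rw [c.U_ne _ _ h1, zero_mul]

lemma UV_ne {p q : Fin n × Fin n} (hpq : p ≠ q) :
    ((c.h p.1).U * (c.h p.2).V) ⊙ ((c.h q.1).U * (c.h q.2).V) = 0 := by
  rw [icl]
  by_cases h1 : p.1 = q.1
  · rw [c.V_ne p.2 q.2 fun h2 => hpq (Prod.ext h1 h2), mul_zero]
  · rw [c.U_ne _ _ h1, zero_mul]

lemma VU_ne {p q : Fin n × Fin n} (hpq : p ≠ q) :
    ((c.h p.1).V * (c.h p.2).U) ⊙ ((c.h q.1).V * (c.h q.2).U) = 0 := by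
  rw [icl]
  by_cases h1 : p.1 = q.1
  · rw [c.U_ne p.2 q.2 fun h2 => hpq (Prod.ext h1 h2), mul_zero]
  · rw [c.V_ne _ _ h1, zero_mul]

lemma u_U : (c.h i).U ⊙ c.pre.U = (c.h i).U := vcomp_sum_single c.U_ne (fun i => (c.h i).U_U) i
lemma U_u : c.pre.U ⊙ (c.h i).U = (c.h i).U := sum_vcomp_single c.U_ne (fun i => (c.h i).U_U) i
lemma v_V : (c.h i).V ⊙ c.pre.V = (c.h i).V := vcomp_sum_single c.V_ne (fun i => (c.h i).V_V) i
lemma V_v : c.pre.V ⊙ (c.h i).V = (c.h i).V := sum_vcomp_single c.V_ne (fun i => (c.h i).V_V) i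
lemma u_x : (c.h i).U ⊙ c.pre.x = (c.h i).x := vcomp_sum_single c.U_ne (fun i => (c.h i).U_x) i
lemma x_u : c.pre.x ⊙ (c.h i).U = (c.h i).x := sum_vcomp_single c.U_ne (fun i => (c.h i).x_U) i
lemma u_tok (f : ∀ i, F i) : (c.h i).U ⊙ c.pre.tok f = (c.h i).tok (f i) :=
  vcomp_sum_single c.U_ne (fun i => (c.h i).U_tok (f i)) i
lemma tok_u (f : ∀ i, F i) : c.pre.tok f ⊙ (c.h i).U = (c.h i).tok (f i) :=
  sum_vcomp_single c.U_ne (fun i => (c.h i).tok_U (f i)) i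
lemma uu_s : ((c.h i).U * (c.h j).U) ⊙ c.pre.s = c.cs i j :=
  vcomp_sum_single (e := fun p : Fin n × Fin n => (c.h p.1).U * (c.h p.2).U)
    (fun _ _ => c.UU_ne) (fun p => c.uu_cs p.1 p.2) (i, j)
lemma s_uu : c.pre.s ⊙ ((c.h j).U * (c.h i).U) = c.cs i j :=
  sum_vcomp_single (e := fun p : Fin n × Fin n => (c.h p.2).U * (c.h p.1).U)
    (fun _ _ hpq => c.UU_ne (p := (_, _)) (q := (_, _)) fun e => hpq (Prod.swap_injective e))
    (fun p => c.cs_uu p.1 p.2) (i, j)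
lemma vu_L : ((c.h i).V * (c.h j).U) ⊙ c.pre.L = c.cL i j :=
  vcomp_sum_single (e := fun p : Fin n × Fin n => (c.h p.1).V * (c.h p.2).U)
    (fun _ _ => c.VU_ne) (fun p => c.vu_cL p.1 p.2) (i, j)
lemma L_uv : c.pre.L ⊙ ((c.h j).U * (c.h i).V) = c.cL i j :=
  sum_vcomp_single (e := fun p : Fin n × Fin n => (c.h p.2).U * (c.h p.1).V)
    (fun _ _ hpq => c.UV_ne (p := (_, _)) (q := (_, _)) fun e => hpq (Prod.swap_injective e))
    (fun p => c.cL_uv p.1 p.2) (i, j)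

lemma c_vu : c.pre.c ⊙ ((c.h i).V * (c.h i).U) = (c.h i).c :=
  sum_vcomp_single (e := fun i => (c.h i).V * (c.h i).U)
    (fun i j hij => c.VU_ne (p := (i, i)) (q := (j, j)) fun e => hij (congrArg Prod.fst e))
    (fun i => (c.h i).c_VU) i

lemma uv_d : ((c.h i).U * (c.h i).V) ⊙ c.pre.d = (c.h i).d :=
  vcomp_sum_single (e := fun i => (c.h i).U * (c.h i).V)
    (fun i j hij => c.UV_ne (p := (i, i)) (q := (j, j)) fun e => hij (congrArg Prod.fst e))
    (fun i => (c.h i).UV_d) i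

variable {i j} in
lemma uv_d_ne (hij : i ≠ j) : ((c.h i).U * (c.h j).V) ⊙ c.pre.d = 0 := by
  change _ ⊙ ∑ i, (c.h i).d = 0
  rw [vcomp_sum, Finset.sum_eq_zero]
  intro l _
  rw [← (c.h l).UV_d, ← vcomp_assoc, c.UV_ne (p := (i, j)) (q := (l, l)), zero_vcomp]
  rintro ⟨⟩
  exact hij rfl

lemma uV_d : ((c.h i).U * c.pre.V) ⊙ c.pre.d = (c.h i).d := by
  change ((c.h i).U * ∑ j, (c.h j).V) ⊙ c.pre.d = _
  rw [Finset.mul_sum, sum_vcomp, Finset.sum_eq_single i, uv_d]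
  · intro j _ hj
    exact c.uv_d_ne hj.symm
  · simp

variable {i j} in
lemma c_vu_ne (hij : i ≠ j) : c.pre.c ⊙ ((c.h i).V * (c.h j).U) = 0 := by
  change (∑ i, (c.h i).c) ⊙ _ = 0
  rw [sum_vcomp, Finset.sum_eq_zero]
  intro l _
  rw [← (c.h l).c_VU, vcomp_assoc, c.VU_ne (p := (l, l)) (q := (i, j)), vcomp_zero]
  rintro ⟨⟩
  exact hij rfl

lemma c_Vu : c.pre.c ⊙ (c.pre.V * (c.h i).U) = (c.h i).c := by
  change c.pre.c ⊙ ((∑ j, (c.h j).V) * (c.h i).U) = _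
  rw [Finset.sum_mul, vcomp_sum, Finset.sum_eq_single i, c_vu]
  · intro j _ hj
    exact c.c_vu_ne hj
  · simp

lemma sum_UU : ∑ p : Fin n × Fin n, (c.h p.1).U * (c.h p.2).U = c.pre.U * c.pre.U := by
  rw [Fintype.sum_prod_type, pre, Finset.sum_mul_sum]

lemma sum_UV : ∑ p : Fin n × Fin n, (c.h p.1).U * (c.h p.2).V = c.pre.U * c.pre.V := by
  rw [Fintype.sum_prod_type, pre, Finset.sum_mul_sum]

lemma sum_VU : ∑ p : Fin n × Fin n, (c.h p.1).V * (c.h p.2).U = c.pre.V * c.pre.U := by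
  rw [Fintype.sum_prod_type, pre, Finset.sum_mul_sum]

lemma U_U : c.pre.U ⊙ c.pre.U = c.pre.U := by
  conv_lhs => rw [pre, sum_vcomp]
  exact Finset.sum_congr rfl fun i _ => c.u_U i

lemma V_V : c.pre.V ⊙ c.pre.V = c.pre.V := by
  conv_lhs => rw [pre, sum_vcomp]
  exact Finset.sum_congr rfl fun i _ => c.v_V i

/-- The coloured right crossing. -/
noncomputable def ct : D.Total := ((c.h j).c * ((c.h i).U * (c.h j).V)) ⊙
  ((c.h j).V * c.cs j i * (c.h j).V) ⊙ ((c.h j).V * (c.h i).U * (c.h j).d)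

lemma ct_self : c.ct i i = (c.h i).t := by rw [ct, c.cs_self]; rfl

lemma ct_vu : c.ct i j ⊙ ((c.h j).V * (c.h i).U) = c.ct i j := by
  rw [ct, vcomp_assoc, vcomp_assoc, mul_vcomp_right (c.h j).d, icl (f := (c.h j).V), (c.h i).U_U,
    (c.h j).V_V]

/-- The rotated crossing contains a sum over the colour of its cup. The cap at the end connects this
strand to the outer strand of colour `j`, so only the cup of colour `j` survives. -/
lemma uv_t : ((c.h i).U * (c.h j).V) ⊙ c.pre.t = c.ct i j := by
  have e1 : ((c.h i).U * (c.h j).V) ⊙ (c.pre.c * (c.pre.U * c.pre.V)) =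
      ∑ l, (c.h l).c * ((c.h i).U * (c.h j).V) := by
    rw [vcomp_mul_left c.pre.c, icl, u_U, v_V, pre, Finset.sum_mul]
  have e2 : ∀ l, ((c.h l).c * ((c.h i).U * (c.h j).V)) ⊙ (c.pre.V * c.pre.s * c.pre.V) =
      ((c.h l).c * ((c.h i).U * (c.h j).V)) ⊙ ((c.h l).V * c.cs l i * (c.h j).V) := fun l => by
    have e3 : (c.h l).c * ((c.h i).U * (c.h j).V) = ((c.h l).c * ((c.h i).U * (c.h j).V)) ⊙
        ((c.h l).V * ((c.h l).U * (c.h i).U) * (c.h j).V) := by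
      rw [mul_regroup, icl (f := (c.h l).c), (c.h l).c_VU, icl, (c.h i).U_U, (c.h j).V_V]
    conv_lhs => rw [e3]
    rw [vcomp_assoc, icl (f := (c.h l).V * _), icl (f := (c.h l).V), uu_s, v_V, v_V]
  have e4 : ∀ l, ((c.h l).V * c.cs l i * (c.h j).V) ⊙ (c.pre.V * c.pre.U * c.pre.d) =
      if l = j then ((c.h j).V * c.cs j i * (c.h j).V) ⊙ ((c.h j).V * (c.h i).U * (c.h j).d)
        else 0 := fun l => by
    have e5 : (c.h l).V * c.cs l i * (c.h j).V = ((c.h l).V * c.cs l i * (c.h j).V) ⊙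
        ((c.h l).V * (c.h i).U * ((c.h l).U * (c.h j).V)) := by
      rw [← mul_regroup, icl (f := (c.h l).V * _), icl (f := (c.h l).V), c.cs_uu, (c.h l).V_V,
        (c.h j).V_V]
    conv_lhs => rw [e5]
    rw [vcomp_assoc, icl (f := (c.h l).V * _), icl (f := (c.h l).V), u_U, v_V]
    split_ifs with hl
    · subst hl
      rw [uv_d]
    · rw [c.uv_d_ne hl, mul_zero, vcomp_zero]
  rw [HeisPre.t, ← vcomp_assoc, e1, sum_vcomp, Finset.sum_eq_single j]
  · rw [← vcomp_assoc, e2, vcomp_assoc, e4, if_pos rfl, ct]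
  · intro l _ hl
    rw [← vcomp_assoc, e2, vcomp_assoc, e4, if_neg hl, vcomp_zero]
  · simp

lemma UV_t : (c.pre.U * c.pre.V) ⊙ c.pre.t = c.pre.t := by
  rw [HeisPre.t, ← vcomp_assoc, vcomp_mul_left c.pre.c, icl, U_U, V_V]

lemma sum_ct : ∑ p : Fin n × Fin n, c.ct p.1 p.2 = c.pre.t := by
  rw [← UV_t, ← sum_UV, sum_vcomp]
  exact Finset.sum_congr rfl fun p _ => (c.uv_t p.1 p.2).symm

lemma t_vu : c.pre.t ⊙ ((c.h j).V * (c.h i).U) = c.ct i j := by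
  rw [← sum_ct]
  exact sum_vcomp_single (e := fun p : Fin n × Fin n => (c.h p.2).V * (c.h p.1).U)
    (fun _ _ hpq => c.VU_ne (p := (_, _)) (q := (_, _)) fun e => hpq (Prod.swap_injective e))
    (fun p => c.ct_vu p.1 p.2) (i, j)

lemma u_xpow (m : ℕ) : (c.h i).U ⊙ c.pre.xpow m = (c.h i).xpow m := by
  induction m with
  | zero => exact c.u_U i
  | succ m ih =>
    rw [HeisPre.xpow, ← vcomp_assoc, ih, ← (c.h i).xpow_U, vcomp_assoc, u_x]; rfl

lemma U_tok (f : ∀ i, F i) : c.pre.U ⊙ c.pre.tok f = c.pre.tok f := by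
  conv_lhs => rw [pre, sum_vcomp]
  exact Finset.sum_congr rfl fun i _ => c.u_tok i f

variable {i} in
lemma tok_single (f : F i) : c.pre.tok (Pi.single i f) = (c.h i).tok f := by
  change ∑ j, (c.h j).tok (Pi.single i f j) = _
  rw [Finset.sum_eq_single i, Pi.single_eq_same]
  · intro j _ hj
    rw [Pi.single_eq_of_ne hj, (c.h j).tok_zero]
  · simp

lemma tok_xpow_single (f : F i) (m : ℕ) :
    c.pre.tok (Pi.single i f) ⊙ c.pre.xpow m = (c.h i).tok f ⊙ (c.h i).xpow m := by
  rw [tok_single, ← (c.h i).tok_U, vcomp_assoc, u_xpow, (c.h i).tok_U]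

/-- The single token fixes the colour of the left leg, and the sum of caps forces it on the right
leg, leaving the decorated cap of that colour. -/
lemma rcap_single (r : ℕ) (f : F i) : c.pre.rcap r (Pi.single i f) = (c.h i).rcap r f := by
  have e1 : ∀ V', ((c.h i).tok f ⊙ (c.h i).xpow r) * (V' ⊙ c.pre.V) =
      (((c.h i).tok f ⊙ (c.h i).xpow r) * V') ⊙ ((c.h i).U * c.pre.V) := fun V' => by
    rw [icl, vcomp_assoc, (c.h i).xpow_U]
  have e2 : ((c.h i).tok f ⊙ (c.h i).xpow r) * c.pre.V =
      (((c.h i).tok f ⊙ (c.h i).xpow r) * c.pre.V) ⊙ ((c.h i).U * c.pre.V) := by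
    rw [← e1, V_V]
  have e3 : (((c.h i).tok f ⊙ (c.h i).xpow r) * c.pre.V) ⊙ ((c.h i).U * (c.h i).V) =
      ((c.h i).tok f ⊙ (c.h i).xpow r) * (c.h i).V := by
    rw [icl, V_v, vcomp_assoc, (c.h i).xpow_U]
  rw [HeisPre.rcap, tok_xpow_single, e2, vcomp_assoc, uV_d, ← (c.h i).UV_d, ← vcomp_assoc, e3]
  rfl

lemma rcup_single (r : ℕ) (f : F i) : c.pre.rcup r (Pi.single i f) = (c.h i).rcup r f := by
  have e2 : c.pre.V * ((c.h i).tok f ⊙ (c.h i).xpow r) =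
      (c.pre.V * (c.h i).U) ⊙ (c.pre.V * ((c.h i).tok f ⊙ (c.h i).xpow r)) := by
    rw [icl (f := c.pre.V), V_V, ← vcomp_assoc, (c.h i).U_tok]
  have e3 : ((c.h i).V * (c.h i).U) ⊙ (c.pre.V * ((c.h i).tok f ⊙ (c.h i).xpow r)) =
      (c.h i).V * ((c.h i).tok f ⊙ (c.h i).xpow r) := by
    rw [icl, v_V, ← vcomp_assoc, (c.h i).U_tok]
  rw [HeisPre.rcup, tok_xpow_single, e2, ← vcomp_assoc, c_Vu, ← (c.h i).c_VU, vcomp_assoc, e3]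
  rfl

end ColorFamily

end FrobHeis

namespace FrobHeis

open WordData

/-! ### The relations for the sums of coloured generators -/

namespace ColorFamily

variable {R : Type u} [CommRing R] {n : ℕ} {F : Fin n → Type v} [∀ i, Ring (F i)]
  [∀ i, Algebra R (F i)] {ι : Fin n → Type w} [∀ i, Fintype (ι i)]
  {φ : ∀ i, SymmFrobenius R (F i)} {b : ∀ i, Module.Basis (ι i) R (F i)} {k : ℤ} {S' : Type}
  {D : WordData.{u} R S'} [Lawful D] (c : ColorFamily φ b k D) (i j l : Fin n)

lemma sum_U : ∑ i, (c.h i).U = c.pre.U := rfl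
lemma sum_V : ∑ i, (c.h i).V = c.pre.V := rfl

lemma UU_s : (c.pre.U * c.pre.U) ⊙ c.pre.s = c.pre.s := by
  rw [← sum_UU, sum_vcomp]
  exact Finset.sum_congr rfl fun p _ => c.uu_s p.1 p.2

lemma cs_s : c.cs i j ⊙ c.pre.s = (c.h i).U * (c.h j).U := by
  rw [← c.cs_uu, vcomp_assoc, uu_s, c.cs_cs i j]

lemma s_s : c.pre.s ⊙ c.pre.s = c.pre.U * c.pre.U := by
  refine eq_of_forall_vcomp c.sum_UU (by rw [← vcomp_assoc, UU_s]) (by rw [icl, U_U]) fun p => ?_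
  rw [← vcomp_assoc, uu_s, cs_s, icl, u_U, u_U]

lemma tok_s (f : ∀ i, F i) :
    (c.pre.tok f * c.pre.U) ⊙ c.pre.s = c.pre.s ⊙ (c.pre.U * c.pre.tok f) := by
  refine eq_of_forall_vcomp c.sum_UU (by rw [← vcomp_assoc, icl, U_U, U_tok])
    (by rw [← vcomp_assoc, UU_s]) fun p => ?_
  have e1 : (c.h p.1).tok (f p.1) * (c.h p.2).U =
      ((c.h p.1).tok (f p.1) * (c.h p.2).U) ⊙ ((c.h p.1).U * (c.h p.2).U) := by
    rw [icl, (c.h _).tok_U, (c.h _).U_U]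
  rw [← vcomp_assoc, icl, u_tok, u_U, e1, vcomp_assoc, uu_s, c.tok_cs, ← vcomp_assoc, uu_s,
    ← c.cs_uu, vcomp_assoc, vcomp_assoc, icl, icl, u_U, u_tok, (c.h _).U_U, (c.h _).U_tok]

lemma s_x : c.pre.s ⊙ (c.pre.x * c.pre.U) = (c.pre.U * c.pre.x) ⊙ c.pre.s +
    ∑ p, c.pre.tok ((SymmFrobenius.directSum φ).dual (Pi.basis b) p) *
      c.pre.tok (Pi.basis b p) := by
  have hx : c.pre.U ⊙ c.pre.x = c.pre.x := by
    rw [← sum_U, sum_vcomp]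
    exact Finset.sum_congr rfl fun i _ => c.u_x i
  have hsum : ∑ p, c.pre.tok ((SymmFrobenius.directSum φ).dual (Pi.basis b) p) *
      c.pre.tok (Pi.basis b p) =
      ∑ l, ∑ m, (c.h l).tok ((φ l).dual (b l) m) * (c.h l).tok (b l m) := by
    rw [Fintype.sum_sigma]
    refine Finset.sum_congr rfl fun l _ => Finset.sum_congr rfl fun m _ => ?_
    rw [dual_directSum, Pi.basis_apply, tok_single, tok_single]
  refine eq_of_forall_vcomp c.sum_UU (by rw [← vcomp_assoc, UU_s])
    (by
      rw [vcomp_add, ← vcomp_assoc, icl, U_U, hx, vcomp_sum]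
      congr 1
      exact Finset.sum_congr rfl fun p _ => by rw [icl, U_tok, U_tok]) fun p => ?_
  obtain ⟨i, j⟩ := p
  have e1 : (c.h i).U * (c.h j).x =
      ((c.h i).U * (c.h j).x) ⊙ ((c.h i).U * (c.h j).U) := by
    rw [icl, (c.h _).x_U, (c.h _).U_U]
  have e2 : ((c.h i).U * (c.h j).U) ⊙ c.pre.s ⊙ (c.pre.x * c.pre.U) =
      c.cs i j ⊙ ((c.h j).x * (c.h i).U) := by
    rw [← vcomp_assoc, uu_s, ← c.cs_uu, vcomp_assoc, vcomp_assoc, icl, icl, u_x, u_U,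
      (c.h _).U_U, (c.h _).U_x]
  have e3 : ((c.h i).U * (c.h j).U) ⊙ (c.pre.U * c.pre.x) ⊙ c.pre.s =
      ((c.h i).U * (c.h j).x) ⊙ c.cs i j := by
    rw [← vcomp_assoc, icl, u_U, u_x, e1, vcomp_assoc, uu_s, ← e1]
  have e4 : ∀ l m, ((c.h i).U * (c.h j).U) ⊙
      ((c.h l).tok ((φ l).dual (b l) m) * (c.h l).tok (b l m)) =
      ((c.h i).U * (c.h j).U) ⊙ ((c.h l).U * (c.h l).U) ⊙
        ((c.h l).tok ((φ l).dual (b l) m) * (c.h l).tok (b l m)) := fun l m => by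
    rw [icl (f := (c.h l).U), (c.h l).U_tok, (c.h l).U_tok]
  rw [hsum, vcomp_add, e2, e3]
  -- For equal colours the tokens of that colour remain and give the dot slide relation of one
  -- summand; for different colours all token terms vanish and `cs_x` remains.
  by_cases hij : i = j
  · subst hij
    rw [vcomp_sum, Finset.sum_eq_single i, c.cs_self, (c.h i).s_x, vcomp_sum]
    · congr 1
      exact Finset.sum_congr rfl fun m _ => by rw [icl, (c.h i).U_tok, (c.h i).U_tok]
    · intro l _ hl
      rw [vcomp_sum]
      refine Finset.sum_eq_zero fun m _ => ?_
      rw [e4, ← vcomp_assoc, c.UU_ne (p := (i, i)) (q := (l, l)), zero_vcomp]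
      rintro ⟨⟩
      exact hl rfl
    · simp
  · rw [c.cs_x i j hij, vcomp_sum, Finset.sum_eq_zero, add_zero]
    intro l _
    rw [vcomp_sum]
    refine Finset.sum_eq_zero fun m _ => ?_
    rw [e4, ← vcomp_assoc, c.UU_ne (p := (i, j)) (q := (l, l)), zero_vcomp]
    rintro ⟨⟩
    exact hij rfl

lemma sum_UUU : ∑ p : Fin n × Fin n × Fin n, (c.h p.1).U * ((c.h p.2.1).U * (c.h p.2.2).U) =
    c.pre.U * (c.pre.U * c.pre.U) := by
  rw [← sum_UU, ← sum_U, Finset.sum_mul_sum, Fintype.sum_prod_type]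

lemma uuu_sU : ((c.h i).U * ((c.h j).U * (c.h l).U)) ⊙ (c.pre.s * c.pre.U) =
    c.cs i j * (c.h l).U := by
  rw [← mul_assoc, icl (f := (c.h i).U * (c.h j).U), uu_s, u_U]

lemma uuu_Us : ((c.h i).U * ((c.h j).U * (c.h l).U)) ⊙ (c.pre.U * c.pre.s) =
    (c.h i).U * c.cs j l := by
  rw [icl, uu_s, u_U]

lemma cs_mul_u : c.cs i j * (c.h l).U =
    (c.cs i j * (c.h l).U) ⊙ ((c.h j).U * ((c.h i).U * (c.h l).U)) := by
  rw [← mul_assoc, icl (f := c.cs i j), c.cs_uu, (c.h l).U_U]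

lemma u_mul_cs : (c.h l).U * c.cs i j =
    ((c.h l).U * c.cs i j) ⊙ ((c.h l).U * ((c.h j).U * (c.h i).U)) := by
  rw [icl, c.cs_uu, (c.h l).U_U]

/-- After fixing the colours at the source, each factor in turn contributes exactly one coloured
crossing, and the coloured braid relation applies. -/
lemma braid_sum : (c.pre.s * c.pre.U) ⊙ (c.pre.U * c.pre.s) ⊙ (c.pre.s * c.pre.U) =
    (c.pre.U * c.pre.s) ⊙ (c.pre.s * c.pre.U) ⊙ (c.pre.U * c.pre.s) := by
  refine eq_of_forall_vcomp c.sum_UUU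
    (by rw [← vcomp_assoc, ← mul_assoc, icl (f := c.pre.U * _), UU_s, U_U])
    (by rw [← vcomp_assoc, icl, UU_s, U_U]) fun p => ?_
  obtain ⟨i, j, l⟩ := p
  dsimp only
  rw [← vcomp_assoc, uuu_sU, cs_mul_u, vcomp_assoc, ← vcomp_assoc ((c.h j).U * _), uuu_Us,
    u_mul_cs, vcomp_assoc ((c.h j).U * _), uuu_sU]
  rw [← vcomp_assoc _ (c.pre.U * c.pre.s), uuu_Us, c.u_mul_cs j l i, vcomp_assoc,
    ← vcomp_assoc ((c.h i).U * ((c.h l).U * _)), uuu_sU,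
    c.cs_mul_u i l j, vcomp_assoc (c.cs i l * _), uuu_Us]
  rw [c.braid]

lemma adj_up : (c.pre.U * c.pre.c) ⊙ (c.pre.d * c.pre.U) = c.pre.U := by
  refine eq_of_forall_vcomp c.sum_U
    (by rw [← vcomp_assoc, vcomp_mul_right c.pre.c, U_U]) c.U_U fun i => ?_
  have e : ∀ l, ((c.h i).U * (c.h l).c) ⊙ (c.pre.d * c.pre.U) =
      ((c.h i).U * (c.h l).c) ⊙ ((((c.h i).U * (c.h l).V) ⊙ c.pre.d) * (c.h l).U) := fun l => by
    have e1 : (c.h i).U * (c.h l).c =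
        ((c.h i).U * (c.h l).c) ⊙ ((c.h i).U * (c.h l).V * (c.h l).U) := by
      rw [mul_assoc, icl, (c.h l).c_VU, (c.h i).U_U]
    conv_lhs => rw [e1]
    rw [vcomp_assoc, icl (f := (c.h i).U * _), u_U]
  rw [← vcomp_assoc, vcomp_mul_right c.pre.c, u_U]
  change ((c.h i).U * ∑ l, (c.h l).c) ⊙ _ = _
  rw [Finset.mul_sum, sum_vcomp, Finset.sum_eq_single i, e, uv_d, (c.h i).adj_up]
  · intro l _ hl
    rw [e, c.uv_d_ne hl.symm, zero_mul, vcomp_zero]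
  · simp

lemma adj_down : (c.pre.c * c.pre.V) ⊙ (c.pre.V * c.pre.d) = c.pre.V := by
  refine eq_of_forall_vcomp c.sum_V
    (by rw [← vcomp_assoc, vcomp_mul_left c.pre.c, V_V]) c.V_V fun i => ?_
  have e : ∀ l, ((c.h l).c * (c.h i).V) ⊙ (c.pre.V * c.pre.d) =
      ((c.h l).c * (c.h i).V) ⊙ ((c.h l).V * (((c.h l).U * (c.h i).V) ⊙ c.pre.d)) := fun l => by
    have e1 : (c.h l).c * (c.h i).V =
        ((c.h l).c * (c.h i).V) ⊙ ((c.h l).V * ((c.h l).U * (c.h i).V)) := by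
      rw [← mul_assoc, icl, (c.h l).c_VU, (c.h i).V_V]
    conv_lhs => rw [e1]
    rw [vcomp_assoc, icl (f := (c.h l).V), v_V]
  rw [← vcomp_assoc, vcomp_mul_left c.pre.c, v_V]
  change ((∑ l, (c.h l).c) * (c.h i).V) ⊙ _ = _
  rw [Finset.sum_mul, sum_vcomp, Finset.sum_eq_single i, e, uv_d, (c.h i).adj_down]
  · intro l _ hl
    rw [e, c.uv_d_ne hl, mul_zero, vcomp_zero]
  · simp

/-- Places the terms with one colour on the diagonal, so that the inversion relation can be compared
for each pair of colours. -/
lemma sum_diag (f : Fin n → D.Total) :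
    ∑ i, f i = ∑ p : Fin n × Fin n, if p.1 = p.2 then f p.1 else 0 := by
  rw [Fintype.sum_prod_type]
  exact Finset.sum_congr rfl fun i _ => by simp

/-- The pair (i, i) contributes the inversion relation of one summand, with its cups and caps; a
pair of different colours contributes invertibility of the crossing, without correction. -/
lemma t_L : c.pre.t ⊙ c.pre.L + ∑ p : Fin k.toNat × (Σ i, ι i),
    c.pre.rcap p.1 ((SymmFrobenius.directSum φ).dual (Pi.basis b) p.2) ⊙ c.pre.lcup p.1 p.2 =
      c.pre.U * c.pre.V := by
  have e : ∑ p : Fin k.toNat × (Σ i, ι i),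
      c.pre.rcap p.1 ((SymmFrobenius.directSum φ).dual (Pi.basis b) p.2) ⊙ c.pre.lcup p.1 p.2 =
      ∑ l, ∑ q : Fin k.toNat × ι l, (c.h l).rcap q.1 ((φ l).dual (b l) q.2) ⊙
        (c.h l).lcup q.1 q.2 := by
    simp_rw [Fintype.sum_prod_type, Fintype.sum_sigma, dual_directSum, rcap_single]
    exact Finset.sum_comm
  rw [e, sum_diag, ← sum_ct, sum_vcomp, ← Finset.sum_add_distrib, ← sum_UV]
  refine Finset.sum_congr rfl fun p _ => ?_
  obtain ⟨i, j⟩ := p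
  dsimp only
  rw [← ct_vu, vcomp_assoc, vu_L]
  by_cases hij : i = j
  · subst hij
    rw [if_pos rfl, c.cL_self, ct_self, (c.h i).t_L]
  · rw [if_neg hij, add_zero]
    exact c.ct_cL i j hij

lemma L_t : c.pre.L ⊙ c.pre.t + ∑ p : Fin (-k).toNat × (Σ i, ι i),
    c.pre.lcap p.1 p.2 ⊙ c.pre.rcup p.1 ((SymmFrobenius.directSum φ).dual (Pi.basis b) p.2) =
      c.pre.V * c.pre.U := by
  have e : ∑ p : Fin (-k).toNat × (Σ i, ι i),
      c.pre.lcap p.1 p.2 ⊙ c.pre.rcup p.1 ((SymmFrobenius.directSum φ).dual (Pi.basis b) p.2) =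
      ∑ l, ∑ q : Fin (-k).toNat × ι l, (c.h l).lcap q.1 q.2 ⊙
        (c.h l).rcup q.1 ((φ l).dual (b l) q.2) := by
    simp_rw [Fintype.sum_prod_type, Fintype.sum_sigma, dual_directSum, rcup_single]
    exact Finset.sum_comm
  have hL : c.pre.L = ∑ p : Fin n × Fin n, c.cL p.1 p.2 := rfl
  rw [e, sum_diag, hL, sum_vcomp, ← Finset.sum_add_distrib, ← sum_VU]
  refine Finset.sum_congr rfl fun p _ => ?_
  obtain ⟨i, j⟩ := p
  dsimp only
  rw [← c.cL_uv, vcomp_assoc, uv_t]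
  by_cases hij : i = j
  · subst hij
    rw [if_pos rfl, c.cL_self, ct_self, (c.h i).L_t]
  · rw [if_neg hij, add_zero]
    exact c.cL_ct j i fun h => hij h.symm

/-- Coloured data assemble to Heisenberg data of the direct sum. -/
noncomputable def toHeisData : HeisData (SymmFrobenius.directSum φ) (Pi.basis b) k D where
  toHeisPre := c.pre
  szU := c.szU
  szV := c.szV
  szx := c.szx
  szs := c.szs
  szc := c.szc
  szd := c.szd
  sztok := c.sztok
  szL := c.szL
  szlcup r p := (c.h p.1).szlcup r p.2
  szlcap r p := (c.h p.1).szlcap r p.2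
  U_U := c.U_U
  V_V := c.V_V
  U_x := by
    rw [← sum_U, sum_vcomp]
    exact Finset.sum_congr rfl fun i _ => c.u_x i
  x_U := by
    rw [← sum_U, vcomp_sum]
    exact Finset.sum_congr rfl fun i _ => c.x_u i
  UU_s := c.UU_s
  s_UU := by
    rw [← sum_UU, vcomp_sum]
    refine (Equiv.sum_comp (Equiv.prodComm (Fin n) (Fin n)) _).symm.trans ?_
    exact Finset.sum_congr rfl fun p _ => c.s_uu p.1 p.2
  c_VU := by
    have e : c.pre.V * c.pre.U = ∑ i, c.pre.V * (c.h i).U := by rw [← sum_U, Finset.mul_sum]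
    rw [e, vcomp_sum]
    exact Finset.sum_congr rfl fun i _ => c.c_Vu i
  UV_d := by
    have e : c.pre.U * c.pre.V = ∑ i, (c.h i).U * c.pre.V := by rw [← sum_U, Finset.sum_mul]
    rw [e, sum_vcomp]
    exact Finset.sum_congr rfl fun i _ => c.uV_d i
  U_tok := c.U_tok
  tok_U f := by
    rw [← sum_U, vcomp_sum]
    exact Finset.sum_congr rfl fun i _ => c.tok_u i f
  VU_L := by
    rw [← sum_VU, sum_vcomp]
    exact Finset.sum_congr rfl fun p _ => c.vu_L p.1 p.2
  L_UV := by
    rw [← sum_UV, vcomp_sum]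
    refine (Equiv.sum_comp (Equiv.prodComm (Fin n) (Fin n)) _).symm.trans ?_
    exact Finset.sum_congr rfl fun p _ => c.L_uv p.1 p.2
  lcup_UV r p := by
    change (c.h p.1).lcup r p.2 ⊙ _ = (c.h p.1).lcup r p.2
    rw [← (c.h p.1).lcup_UV, vcomp_assoc, icl, u_U, v_V]
  VU_lcap r p := by
    change _ ⊙ (c.h p.1).lcap r p.2 = (c.h p.1).lcap r p.2
    rw [← (c.h p.1).VU_lcap, ← vcomp_assoc, icl, U_u, V_v]
  tok_one := by
    change ∑ i, (c.h i).tok 1 = ∑ i, (c.h i).U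
    exact Finset.sum_congr rfl fun i _ => (c.h i).tok_one
  tok_mul f g := by
    have e : c.pre.tok g = ∑ i, (c.h i).tok (g i) := rfl
    rw [e, sum_vcomp]
    change ∑ i, (c.h i).tok (f i * g i) = _
    refine Finset.sum_congr rfl fun i _ => ?_
    rw [← (c.h i).tok_U (g i), vcomp_assoc, u_tok, (c.h i).tok_mul]
  tok_add f g := by
    change ∑ i, (c.h i).tok (f i + g i) = ∑ i, (c.h i).tok (f i) + ∑ i, (c.h i).tok (g i)
    rw [← Finset.sum_add_distrib]
    exact Finset.sum_congr rfl fun i _ => (c.h i).tok_add _ _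
  tok_smul r f := by
    change ∑ i, (c.h i).tok (r • f i) = r • ∑ i, (c.h i).tok (f i)
    rw [Finset.smul_sum]
    exact Finset.sum_congr rfl fun i _ => (c.h i).tok_smul _ _
  braid := c.braid_sum
  s_s := c.s_s
  x_tok f := by
    have e : c.pre.tok f = ∑ i, (c.h i).tok (f i) := rfl
    rw [e, vcomp_sum, sum_vcomp]
    refine Finset.sum_congr rfl fun i _ => ?_
    rw [← (c.h i).U_tok, ← vcomp_assoc, x_u, (c.h i).x_tok, (c.h i).U_tok]
    conv_rhs => rw [← (c.h i).tok_U, vcomp_assoc, u_x]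
  tok_s := c.tok_s
  s_x := c.s_x
  adj_up := c.adj_up
  adj_down := c.adj_down
  t_L := c.t_L
  L_t := c.L_t
  L_rcap r p := by
    rw [dual_directSum, rcap_single, ← (c.h p.1).UV_rcap, ← vcomp_assoc, L_uv, c.cL_self,
      (c.h p.1).L_rcap]
  lcup_t r p := by
    change (c.h p.1).lcup r p.2 ⊙ _ = _
    rw [← (c.h p.1).lcup_UV, vcomp_assoc, uv_t, ct_self, (c.h p.1).lcup_t]
  lcup_rcap r p := by
    rw [dual_directSum, rcap_single]
    exact (c.h p.1).lcup_rcap r p.2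
  lcup_rcap_ne r r' p p' hne := by
    obtain ⟨l, m⟩ := p
    obtain ⟨l', m'⟩ := p'
    change (c.h l).lcup r m ⊙ _ = _
    rw [dual_directSum, rcap_single]
    by_cases hl : l = l'
    · subst hl
      exact (c.h l).lcup_rcap_ne r r' m m' fun e => hne (by
        rw [Prod.ext_iff] at e ⊢
        exact ⟨e.1, congrArg (Sigma.mk l) e.2⟩)
    -- Indices of different colours: the composite contains the orthogonal idempotents of the two
    -- colours.
    · rw [← (c.h l).lcup_UV, ← (c.h l').UV_rcap, vcomp_assoc,
        ← vcomp_assoc _ ((c.h l').U * _), c.UV_ne (p := (l, l)) (q := (l', l')), zero_vcomp,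
        vcomp_zero]
      exact fun e => hl (congrArg Prod.fst e)
  t_lcap r p := by
    change _ ⊙ (c.h p.1).lcap r p.2 = _
    rw [← (c.h p.1).VU_lcap, ← vcomp_assoc, t_vu, ct_self, (c.h p.1).t_lcap]
  rcup_L r p := by
    rw [dual_directSum, rcup_single, ← (c.h p.1).rcup_VU, vcomp_assoc, vu_L, c.cL_self,
      (c.h p.1).rcup_L]
  rcup_lcap r p := by
    rw [dual_directSum, rcup_single]
    exact (c.h p.1).rcup_lcap r p.2
  rcup_lcap_ne r r' p p' hne := by
    obtain ⟨l, m⟩ := p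
    obtain ⟨l', m'⟩ := p'
    change _ ⊙ (c.h l').lcap r' m' = _
    rw [dual_directSum, rcup_single]
    by_cases hl : l = l'
    · subst hl
      exact (c.h l).rcup_lcap_ne r r' m m' fun e => hne (by
        rw [Prod.ext_iff] at e ⊢
        exact ⟨e.1, congrArg (Sigma.mk l) e.2⟩)
    · rw [← (c.h l).rcup_VU, ← (c.h l').VU_lcap, vcomp_assoc,
        ← vcomp_assoc _ ((c.h l').V * _), c.VU_ne (p := (l, l)) (q := (l', l')), zero_vcomp,
        vcomp_zero]
      exact fun e => hl (congrArg Prod.fst e)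

end ColorFamily

end FrobHeis

namespace FrobHeis

open WordData

/-! ### The shuffle product of strict linear monoidal categories on words -/

section Shuffle

open scoped TensorProduct

variable {R : Type u} [CommRing R]

/-- The elements of the total algebra that come from morphisms between given words. -/
def WordData.IsH {S : Type} {D : WordData.{u, v} R S} (a b : List S) (f : D.Total) : Prop :=
  ∃ f' : D.H a b, ofH f' = f

lemma WordData.isH_ofH {S : Type} {D : WordData.{u, v} R S} {a b : List S} (f : D.H a b) :
    IsH a b (ofH f : D.Total) := ⟨f, rfl⟩

lemma WordData.IsH.ofH_proj {S : Type} {D : WordData.{u, v} R S} {a b : List S} {f : D.Total}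
    (hf : IsH a b f) : ofH (proj a b f) = f := by
  obtain ⟨f, rfl⟩ := hf
  rw [proj_ofH]

section

variable {S : Type} {D : WordData.{u, v} R S}

lemma WordData.IsH.vcomp {a b c : List S} {f g : D.Total} (hf : IsH a b f) (hg : IsH b c g) :
    IsH a c (f ⊙ g) := by
  obtain ⟨f, rfl⟩ := hf
  obtain ⟨g, rfl⟩ := hg
  exact ⟨_, (ofH_vcomp f g).symm⟩

lemma WordData.isH_idw (a : List S) : IsH a a (D.idw a) := isH_ofH _

variable [Lawful D]

lemma WordData.IsH.mul {a b a' b' : List S} {f g : D.Total} (hf : IsH a b f) (hg : IsH a' b' g) :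
    IsH (a ++ a') (b ++ b') (f * g) := by
  obtain ⟨f, rfl⟩ := hf
  obtain ⟨g, rfl⟩ := hg
  exact ⟨_, (ofH_mul f g).symm⟩

lemma WordData.isH_one : IsH [] [] (1 : D.Total) := isH_ofH (D.idm [])

end

variable {n : ℕ}

/-- The subword of the letters of colour `i`. -/
def part {T : Type} (i : Fin n) : List (T × Fin n) → List T
  | [] => []
  | s :: X => if s.2 = i then s.1 :: part i X else part i X

variable {T : Type}

@[simp] lemma part_nil (i : Fin n) : part i ([] : List (T × Fin n)) = [] := rfl

@[simp] lemma part_cons (i : Fin n) (s : T × Fin n) (X : List (T × Fin n)) :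
    part i (s :: X) = if s.2 = i then s.1 :: part i X else part i X := rfl

lemma part_append (i : Fin n) (X Y : List (T × Fin n)) :
    part i (X ++ Y) = part i X ++ part i Y := by
  induction X with
  | nil => rfl
  | cons s X ih =>
    rw [List.cons_append, part_cons, part_cons, ih]
    split_ifs <;> rfl

lemma part_map_self (i : Fin n) (a : List T) : part i (a.map (·, i)) = a := by
  induction a with
  | nil => rfl
  | cons s a ih => simp [ih]

lemma part_map_ne {i j : Fin n} (hij : i ≠ j) (a : List T) : part j (a.map (·, i)) = [] := by
  induction a with
  | nil => rfl
  | cons s a ih => simp [hij, ih]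

variable (A : Fin n → WordData.{u, v} R T) [∀ i, Lawful (A i)]

/-- The tensor product of two morphisms between subwords. -/
noncomputable def partTens (i : Fin n) (X Y X' Y' : List (T × Fin n)) :
    (A i).H (part i X) (part i Y) →ₗ[R] (A i).H (part i X') (part i Y') →ₗ[R]
      (A i).H (part i (X ++ X')) (part i (Y ++ Y')) :=
  (((tensL (D := A i)).compl₂ ofH) ∘ₗ ofH).compr₂ (proj _ _)

lemma ofH_partTens (i : Fin n) {X Y X' Y' : List (T × Fin n)} (f : (A i).H (part i X) (part i Y))
    (g : (A i).H (part i X') (part i Y')) :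
    (ofH (partTens A i X Y X' Y' f g) : (A i).Total) = ofH f * ofH g := by
  change ofH (proj _ _ (ofH f * ofH g : (A i).Total)) = _
  refine IsH.ofH_proj ?_
  rw [part_append, part_append]
  exact (isH_ofH f).mul (isH_ofH g)

/-- The shuffle product: words in coloured letters, with the tensor products of the modules of
morphisms between the subwords of each colour. -/
noncomputable def shuffle : WordData R (T × Fin n) where
  H X Y := ⨂[R] i, (A i).H (part i X) (part i Y)
  idm X := PiTensorProduct.tprod R fun i => (A i).idm (part i X)
  comp := PiTensorProduct.map₂ fun i => (A i).comp
  tens {X Y X' Y'} := PiTensorProduct.map₂ fun i => partTens A i X Y X' Y'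

variable {A}

/-- The multilinear map that sends a tuple of morphisms to their tensor product. -/
noncomputable def tupleM (X Y : List (T × Fin n)) :
    MultilinearMap R (fun i => (A i).Total) (shuffle A).Total :=
  ((ofH (D := shuffle A) (a := X) (b := Y)).compMultilinearMap
    (PiTensorProduct.tprod R (s := fun i => (A i).H (part i X) (part i Y)))).compLinearMap
      fun i => proj (part i X) (part i Y)

/-- Moves pure tensors to tuples of elements of the total algebras, where associativity of products
and equalities of words can be used by rewriting. -/
lemma ofH_tprod {X Y : List (T × Fin n)} (f : ∀ i, (A i).H (part i X) (part i Y)) :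
    (ofH (D := shuffle A) (PiTensorProduct.tprod R f) : (shuffle A).Total) =
      tupleM X Y fun i => ofH (f i) := by
  change _ = ofH (D := shuffle A) (PiTensorProduct.tprod R fun i => proj (part i X) (part i Y)
    (ofH (f i) : (A i).Total))
  simp only [proj_ofH]

lemma shuffle_comp_tprod {X Y Z : List (T × Fin n)} (f : ∀ i, (A i).H (part i X) (part i Y))
    (g : ∀ i, (A i).H (part i Y) (part i Z)) :
    (shuffle A).comp (a := X) (b := Y) (c := Z) (PiTensorProduct.tprod R f)
      (PiTensorProduct.tprod R g) = PiTensorProduct.tprod R fun i => (A i).comp (f i) (g i) :=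
  PiTensorProduct.map₂_tprod_tprod _ _ _

lemma shuffle_tens_tprod {X Y X' Y' : List (T × Fin n)} (f : ∀ i, (A i).H (part i X) (part i Y))
    (g : ∀ i, (A i).H (part i X') (part i Y')) :
    (shuffle A).tens (a := X) (b := Y) (c := X') (d := Y') (PiTensorProduct.tprod R f)
      (PiTensorProduct.tprod R g) =
      PiTensorProduct.tprod R fun i => partTens A i X Y X' Y' (f i) (g i) :=
  PiTensorProduct.map₂_tprod_tprod _ _ _

lemma shuffle_induction {X Y : List (T × Fin n)} {P : (shuffle A).H X Y → Prop}
    (h : ∀ f : ∀ i, (A i).H (part i X) (part i Y), P (PiTensorProduct.tprod R f))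
    (hs : ∀ (r : R) f, P f → P (r • f))
    (ha : ∀ f g, P f → P g → P (f + g)) (f : (shuffle A).H X Y) : P f :=
  PiTensorProduct.induction_on (motive := P) f (fun r f => hs r _ (h f)) fun f g => ha f g

instance : Lawful (shuffle A) where
  id_comp f := by
    induction f using shuffle_induction with
    | h f =>
      refine (shuffle_comp_tprod _ _).trans ?_
      simp only [Lawful.id_comp]; rfl
    | hs r f h => rw [map_smul, h]
    | ha f g hf hg => rw [map_add, hf, hg]
  comp_id f := by
    induction f using shuffle_induction with
    | h f =>
      refine (shuffle_comp_tprod _ _).trans ?_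
      simp only [Lawful.comp_id]; rfl
    | hs r f h => rw [map_smul, LinearMap.smul_apply, h]
    | ha f g hf hg => rw [map_add, LinearMap.add_apply, hf, hg]
  comp_assoc f g h := by
    induction f using shuffle_induction with
    | hs r f h => simp only [map_smul, LinearMap.smul_apply, h]
    | ha f g hf hg => simp only [map_add, LinearMap.add_apply, hf, hg]
    | h f =>
    induction g using shuffle_induction with
    | hs r f h => simp only [map_smul, LinearMap.smul_apply, h]
    | ha f g hf hg => simp only [map_add, LinearMap.add_apply, hf, hg]
    | h g =>
    induction h using shuffle_induction with
    | hs r f h => simp only [map_smul, h]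
    | ha f g hf hg => simp only [map_add, hf, hg]
    | h h => simp only [shuffle_comp_tprod, Lawful.comp_assoc]; rfl
  tens_id X Y := by
    refine (shuffle_tens_tprod _ _).trans ?_
    refine congrArg (PiTensorProduct.tprod R) (funext fun i => ofH_injective ?_)
    rw [ofH_partTens, ofH_mul, Lawful.tens_id, part_append]
  tens_comp f g f' g' := by
    induction f using shuffle_induction with
    | hs r f h => simp only [map_smul, LinearMap.smul_apply, h]
    | ha f g hf hg => simp only [map_add, LinearMap.add_apply, hf, hg]
    | h f =>
    induction g using shuffle_induction with
    | hs r f h => simp only [map_smul, LinearMap.smul_apply, h]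
    | ha f g hf hg => simp only [map_add, LinearMap.add_apply, hf, hg]
    | h g =>
    induction f' using shuffle_induction with
    | hs r f h => simp only [map_smul, LinearMap.smul_apply, h]
    | ha f g hf hg => simp only [map_add, LinearMap.add_apply, hf, hg]
    | h f' =>
    induction g' using shuffle_induction with
    | hs r f h => simp only [map_smul, h]
    | ha f g hf hg => simp only [map_add, hf, hg]
    | h g' =>
      simp only [shuffle_comp_tprod, shuffle_tens_tprod]
      refine congrArg (PiTensorProduct.tprod R) (funext fun i => ofH_injective ?_)
      rw [ofH_partTens, ← ofH_vcomp, ← ofH_vcomp, ← ofH_vcomp, ofH_partTens, ofH_partTens,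
        interchange_of_eq _ _ _ _ fun _ => ⟨rfl, rfl⟩]
  tens_assoc f g h := by
    induction f using shuffle_induction with
    | hs r f h => simp only [map_smul, LinearMap.smul_apply, h]
    | ha f g hf hg => simp only [map_add, LinearMap.add_apply, hf, hg]
    | h f =>
    induction g using shuffle_induction with
    | hs r f h => simp only [map_smul, LinearMap.smul_apply, h]
    | ha f g hf hg => simp only [map_add, LinearMap.add_apply, hf, hg]
    | h g =>
    induction h using shuffle_induction with
    | hs r f h => simp only [map_smul, h]
    | ha f g hf hg => simp only [map_add, hf, hg]
    | h h =>
      simp only [shuffle_tens_tprod, ofH_tprod, ofH_partTens, mul_assoc, List.append_assoc]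
  one_tens f := by
    induction f using shuffle_induction with
    | h f =>
      refine (shuffle_tens_tprod _ _).trans ?_
      refine congrArg (PiTensorProduct.tprod R) (funext fun i => ofH_injective ?_)
      rw [ofH_partTens]
      exact one_mul _
    | hs r f h => rw [map_smul, h]
    | ha f g hf hg => rw [map_add, hf, hg]
  tens_one {X Y} f := by
    induction f using shuffle_induction with
    | h f =>
      have e := shuffle_tens_tprod (A := A) (X' := []) (Y' := []) f fun i => (A i).idm []
      refine (congrArg ofH e).trans ?_
      simp only [ofH_tprod, List.append_nil]
      exact congrArg (tupleM X Y) (funext fun i =>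
        (ofH_partTens A i (X' := []) (Y' := []) _ _).trans (mul_one _))
    | hs r f h => rw [map_smul, LinearMap.smul_apply, map_smul, h, map_smul]
    | ha f g hf hg => rw [map_add, LinearMap.add_apply, map_add, hf, hg, map_add]

/-- `IsTuple X Y g z`: the tuple `g` consists of morphisms between the subwords of `X` and of `Y`,
and `z` is their tensor product. -/
def IsTuple (X Y : List (T × Fin n)) (g : ∀ i, (A i).Total) (z : (shuffle A).Total) : Prop :=
  (∀ i, IsH (part i X) (part i Y) (g i)) ∧ z = tupleM X Y g

namespace IsTuple

variable {X Y Z X' Y' : List (T × Fin n)} {g g' : ∀ i, (A i).Total} {z z' : (shuffle A).Total}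

lemma isH (h : IsTuple X Y g z) : IsH X Y z :=
  ⟨_, h.2.symm⟩

lemma vcomp (h : IsTuple X Y g z) (h' : IsTuple Y Z g' z') :
    IsTuple X Z (fun i => g i ⊙ g' i) (z ⊙ z') := by
  refine ⟨fun i => (h.1 i).vcomp (h'.1 i), ?_⟩
  obtain ⟨hg, rfl⟩ := h
  obtain ⟨hg', rfl⟩ := h'
  choose f hf using hg
  choose f' hf' using hg'
  obtain rfl : (fun i => ofH (f i)) = g := funext hf
  obtain rfl : (fun i => ofH (f' i)) = g' := funext hf'
  rw [← ofH_tprod, ← ofH_tprod]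
  refine (ofH_vcomp (D := shuffle A) _ _).trans ?_
  rw [shuffle_comp_tprod, ofH_tprod]
  simp only [ofH_vcomp]

lemma mul (h : IsTuple X Y g z) (h' : IsTuple X' Y' g' z') :
    IsTuple (X ++ X') (Y ++ Y') (fun i => g i * g' i) (z * z') := by
  refine ⟨fun i => by rw [part_append, part_append]; exact (h.1 i).mul (h'.1 i), ?_⟩
  obtain ⟨hg, rfl⟩ := h
  obtain ⟨hg', rfl⟩ := h'
  choose f hf using hg
  choose f' hf' using hg'
  obtain rfl : (fun i => ofH (f i)) = g := funext hf
  obtain rfl : (fun i => ofH (f' i)) = g' := funext hf'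
  rw [← ofH_tprod, ← ofH_tprod]
  refine (ofH_mul (D := shuffle A) _ _).trans ?_
  rw [shuffle_tens_tprod, ofH_tprod]
  simp only [ofH_partTens]

lemma ext (h : IsTuple X Y g z) (h' : IsTuple X Y g' z') (e : ∀ i, g i = g' i) : z = z' := by
  obtain rfl : g = g' := funext e
  exact h.2.trans h'.2.symm

lemma congr (h : IsTuple X Y g z) (e : ∀ i, g' i = g i) : IsTuple X Y g' z := by
  obtain rfl : g' = g := funext e
  exact h

lemma idw (X : List (T × Fin n)) :
    IsTuple X X (fun i => (A i).idw (part i X)) ((shuffle A).idw X) :=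
  ⟨fun _ => isH_idw _, ofH_tprod _⟩

lemma sz (h : IsTuple X Y g z) : Sz z X.length Y.length := by
  rw [h.2]; exact sz_ofH (D := shuffle A) _

end IsTuple

/-- The inclusion of a factor. -/
noncomputable def factor (i : Fin n) : (A i).Total →ₗ[R] (shuffle A).Total :=
  desc fun a a' => (tupleM (a.map (·, i)) (a'.map (·, i))).toLinearMap (fun _ => 1) i ∘ₗ ofH

lemma isTuple_factor (i : Fin n) {a a' : List T} {f : (A i).Total} (hf : IsH a a' f) :
    IsTuple (a.map (·, i)) (a'.map (·, i)) (Function.update (fun _ => 1) i f) (factor i f) := by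
  obtain ⟨f, rfl⟩ := hf
  refine ⟨fun j => ?_, desc_ofH _ f⟩
  by_cases hij : i = j
  · subst hij
    rw [Function.update_self, part_map_self, part_map_self]
    exact isH_ofH f
  · rw [Function.update_of_ne (Ne.symm hij), part_map_ne hij, part_map_ne hij]
    exact isH_one

lemma factor_mul (i : Fin n) (f g : (A i).Total) : factor i (f * g) = factor i f * factor i g := by
  induction f using total_induction with
  | h0 => simp
  | hadd _ _ h h' => simp [add_mul, h, h']
  | hof f =>
  induction g using total_induction with
  | h0 => simp
  | hadd _ _ h h' => simp [mul_add, h, h']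
  | hof g =>
    have e := (isTuple_factor i (isH_ofH f)).mul (isTuple_factor i (isH_ofH g))
    rw [← List.map_append, ← List.map_append] at e
    refine (isTuple_factor i ((isH_ofH f).mul (isH_ofH g))).ext e fun j => ?_
    by_cases hij : i = j
    · subst hij; simp only [Function.update_self]
    · simp only [Function.update_of_ne (Ne.symm hij), mul_one]

/-- In contrast to `Interp.lift_vcomp` no middle word is prescribed: colouring the letters is
injective on words, so elements that are not composable stay so. -/
lemma factor_vcomp (i : Fin n) (f g : (A i).Total) :
    factor i (f ⊙ g) = factor i f ⊙ factor i g := by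
  induction f using total_induction with
  | h0 => simp
  | hadd _ _ h h' => simp [h, h']
  | @hof a b f =>
  induction g using total_induction with
  | h0 => simp
  | hadd _ _ h h' => simp [h, h']
  | @hof c d g =>
    have hf := isTuple_factor i (isH_ofH f)
    have hg := isTuple_factor i (isH_ofH g)
    by_cases hbc : b = c
    · subst hbc
      refine (isTuple_factor i ((isH_ofH f).vcomp (isH_ofH g))).ext (hf.vcomp hg) fun j => ?_
      by_cases hij : i = j
      · subst hij; simp only [Function.update_self]
      · simp only [Function.update_of_ne (Ne.symm hij), one_vcomp]
    · obtain ⟨f', hf'⟩ := hf.isH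
      obtain ⟨g', hg'⟩ := hg.isH
      rw [ofH_vcomp_ne hbc, map_zero, ← hf', ← hg', ofH_vcomp_ne]
      exact fun e => hbc (List.map_injective_iff.mpr (fun _ _ e => congrArg Prod.fst e) e)

lemma factor_idw (i : Fin n) (a : List T) :
    factor i ((A i).idw a) = (shuffle A).idw (a.map (·, i)) := by
  refine (isTuple_factor i (isH_idw a)).ext (IsTuple.idw _) fun j => ?_
  by_cases hij : i = j
  · subst hij; rw [Function.update_self, part_map_self]
  · rw [Function.update_of_ne (Ne.symm hij), part_map_ne hij]; rfl

lemma factor_one (i : Fin n) : factor i (1 : (A i).Total) = 1 := factor_idw i []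

lemma sz_factor (i : Fin n) {f : (A i).Total} {p q : ℕ} (hf : Sz f p q) : Sz (factor i f) p q := by
  refine Sz.induction (P := fun f => Sz (factor i f) p q) ?_ ?_ ?_ hf
  · rw [map_zero]; exact sz_zero _ _
  · intro a b f ha hb
    exact (isTuple_factor i (isH_ofH f)).sz.cast (by simpa using ha) (by simpa using hb)
  · intro f g hf hg
    rw [map_add]; exact hf.add hg

end Shuffle

end FrobHeis

namespace FrobHeis

open WordData

/-! ### Transport of Heisenberg data -/

section Transport

variable {R : Type u} [CommRing R] {S S' : Type} {D : WordData.{u} R S} [Lawful D]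
  {D' : WordData.{u} R S'} [Lawful D']

/-- Linear maps of total algebras that preserve both products and the sizes. -/
structure TotalHom (J : D.Total →ₗ[R] D'.Total) : Prop where
  map_mul : ∀ f g, J (f * g) = J f * J g
  map_vcomp : ∀ f g, J (f ⊙ g) = J f ⊙ J g
  map_one : J 1 = 1
  sz : ∀ {f : D.Total} {p q : ℕ}, Sz f p q → Sz (J f) p q

variable {F : Type v} {ι : Type w} {k : ℤ} {J : D.Total →ₗ[R] D'.Total}

/-- The images of the generators. -/
noncomputable def HeisPre.map (h : HeisPre F ι k D.Total) (J : D.Total →ₗ[R] D'.Total) :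
    HeisPre F ι k D'.Total where
  U := J h.U
  V := J h.V
  x := J h.x
  s := J h.s
  c := J h.c
  d := J h.d
  tok f := J (h.tok f)
  L := J h.L
  lcup r p := J (h.lcup r p)
  lcap r p := J (h.lcap r p)

lemma HeisPre.map_t (hJ : TotalHom J) (h : HeisPre F ι k D.Total) : (h.map J).t = J h.t := by
  simp only [HeisPre.t, HeisPre.map, hJ.map_mul, hJ.map_vcomp]

lemma HeisPre.map_xpow (hJ : TotalHom J) (h : HeisPre F ι k D.Total) (m : ℕ) :
    (h.map J).xpow m = J (h.xpow m) := by
  induction m with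
  | zero => rfl
  | succ m ih => rw [HeisPre.xpow, ih, HeisPre.xpow, hJ.map_vcomp]; rfl

lemma HeisPre.map_rcap (hJ : TotalHom J) (h : HeisPre F ι k D.Total) (r : ℕ) (f : F) :
    (h.map J).rcap r f = J (h.rcap r f) := by
  simp only [HeisPre.rcap, HeisPre.map_xpow hJ, hJ.map_mul, hJ.map_vcomp]; rfl

lemma HeisPre.map_rcup (hJ : TotalHom J) (h : HeisPre F ι k D.Total) (r : ℕ) (f : F) :
    (h.map J).rcup r f = J (h.rcup r f) := by
  simp only [HeisPre.rcup, HeisPre.map_xpow hJ, hJ.map_mul, hJ.map_vcomp]; rfl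

variable [Ring F] [Algebra R F] [Fintype ι] {φ : SymmFrobenius R F} {b : Module.Basis ι R F}

/-- The image of Heisenberg data. -/
noncomputable def HeisData.map (h : HeisData φ b k D) (hJ : TotalHom J) : HeisData φ b k D' where
  toHeisPre := h.toHeisPre.map J
  szU := hJ.sz h.szU
  szV := hJ.sz h.szV
  szx := hJ.sz h.szx
  szs := hJ.sz h.szs
  szc := hJ.sz h.szc
  szd := hJ.sz h.szd
  sztok f := hJ.sz (h.sztok f)
  szL := hJ.sz h.szL
  szlcup r p := hJ.sz (h.szlcup r p)
  szlcap r p := hJ.sz (h.szlcap r p)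
  tok_one := congrArg J h.tok_one
  U_U := (hJ.map_vcomp _ _).symm.trans (congrArg J h.U_U)
  V_V := (hJ.map_vcomp _ _).symm.trans (congrArg J h.V_V)
  U_x := (hJ.map_vcomp _ _).symm.trans (congrArg J h.U_x)
  x_U := (hJ.map_vcomp _ _).symm.trans (congrArg J h.x_U)
  UU_s := by
    have e := congrArg J h.UU_s
    simp only [hJ.map_mul, hJ.map_vcomp] at e
    exact e
  s_UU := by
    have e := congrArg J h.s_UU
    simp only [hJ.map_mul, hJ.map_vcomp] at e
    exact e
  c_VU := by
    have e := congrArg J h.c_VU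
    simp only [hJ.map_mul, hJ.map_vcomp] at e
    exact e
  UV_d := by
    have e := congrArg J h.UV_d
    simp only [hJ.map_mul, hJ.map_vcomp] at e
    exact e
  U_tok f := (hJ.map_vcomp _ _).symm.trans (congrArg J (h.U_tok f))
  tok_U f := (hJ.map_vcomp _ _).symm.trans (congrArg J (h.tok_U f))
  VU_L := by
    have e := congrArg J h.VU_L
    simp only [hJ.map_mul, hJ.map_vcomp] at e
    exact e
  L_UV := by
    have e := congrArg J h.L_UV
    simp only [hJ.map_mul, hJ.map_vcomp] at e
    exact e
  lcup_UV r p := by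
    have e := congrArg J (h.lcup_UV r p)
    simp only [hJ.map_mul, hJ.map_vcomp] at e
    exact e
  VU_lcap r p := by
    have e := congrArg J (h.VU_lcap r p)
    simp only [hJ.map_mul, hJ.map_vcomp] at e
    exact e
  tok_mul f g := by
    have e := congrArg J (h.tok_mul f g)
    simp only [hJ.map_vcomp] at e
    exact e
  tok_add f g := by
    have e := congrArg J (h.tok_add f g)
    simp only [map_add] at e
    exact e
  tok_smul r f := by
    have e := congrArg J (h.tok_smul r f)
    simp only [map_smul] at e
    exact e
  braid := by
    have e := congrArg J h.braid
    simp only [hJ.map_mul, hJ.map_vcomp] at e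
    exact e
  s_s := by
    have e := congrArg J h.s_s
    simp only [hJ.map_mul, hJ.map_vcomp] at e
    exact e
  x_tok f := by
    have e := congrArg J (h.x_tok f)
    simp only [hJ.map_vcomp] at e
    exact e
  tok_s f := by
    have e := congrArg J (h.tok_s f)
    simp only [hJ.map_mul, hJ.map_vcomp] at e
    exact e
  s_x := by
    have e := congrArg J h.s_x
    simp only [hJ.map_mul, hJ.map_vcomp, map_add, map_sum] at e
    exact e
  adj_up := by
    have e := congrArg J h.adj_up
    simp only [hJ.map_mul, hJ.map_vcomp] at e
    exact e
  adj_down := by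
    have e := congrArg J h.adj_down
    simp only [hJ.map_mul, hJ.map_vcomp] at e
    exact e
  t_L := by
    have e := congrArg J h.t_L
    simp only [hJ.map_mul, hJ.map_vcomp, map_add, map_sum,
      ← HeisPre.map_t hJ, ← HeisPre.map_rcap hJ] at e
    exact e
  L_t := by
    have e := congrArg J h.L_t
    simp only [hJ.map_mul, hJ.map_vcomp, map_add, map_sum,
      ← HeisPre.map_t hJ, ← HeisPre.map_rcup hJ] at e
    exact e
  L_rcap r p := by
    have e := congrArg J (h.L_rcap r p)
    simp only [hJ.map_vcomp, map_zero, ← HeisPre.map_rcap hJ] at e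
    exact e
  lcup_t r p := by
    have e := congrArg J (h.lcup_t r p)
    simp only [hJ.map_vcomp, map_zero, ← HeisPre.map_t hJ] at e
    exact e
  lcup_rcap r p := by
    have e := congrArg J (h.lcup_rcap r p)
    simp only [hJ.map_vcomp, hJ.map_one, ← HeisPre.map_rcap hJ] at e
    exact e
  lcup_rcap_ne r r' p p' hne := by
    have e := congrArg J (h.lcup_rcap_ne r r' p p' hne)
    simp only [hJ.map_vcomp, map_zero, ← HeisPre.map_rcap hJ] at e
    exact e
  t_lcap r p := by
    have e := congrArg J (h.t_lcap r p)
    simp only [hJ.map_vcomp, map_zero, ← HeisPre.map_t hJ] at e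
    exact e
  rcup_L r p := by
    have e := congrArg J (h.rcup_L r p)
    simp only [hJ.map_vcomp, map_zero, ← HeisPre.map_rcup hJ] at e
    exact e
  rcup_lcap r p := by
    have e := congrArg J (h.rcup_lcap r p)
    simp only [hJ.map_vcomp, hJ.map_one, ← HeisPre.map_rcup hJ] at e
    exact e
  rcup_lcap_ne r r' p p' hne := by
    have e := congrArg J (h.rcup_lcap_ne r r' p p' hne)
    simp only [hJ.map_vcomp, map_zero, ← HeisPre.map_rcup hJ] at e
    exact e

lemma HeisData.eval_map (h : HeisData φ b k D) (hJ : TotalHom J) {a a' : List Strand}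
    (f : Tm R (HeisGen F ι k) a a') : (h.map hJ).interp.eval f = J (h.interp.eval f) := by
  induction f with
  | gen g => cases g <;> rfl
  | id a =>
    induction a with
    | nil => exact hJ.map_one.symm
    | cons s a ih =>
      simp only [Interp.eval, objW_cons, hJ.map_mul] at ih ⊢
      rw [ih]
      cases s <;> rfl
  | comp f g hf hg => simp only [Interp.eval, hf, hg, hJ.map_vcomp]
  | tensor f g hf hg => simp only [Interp.eval, hf, hg, hJ.map_mul]
  | zero a b => simp only [Interp.eval, map_zero]
  | add f g hf hg => simp only [Interp.eval, hf, hg, map_add]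
  | smul r f hf => simp only [Interp.eval, hf, map_smul]

end Transport

/-! ### Heisenberg data in the shuffle product -/

section ShuffleHeis

variable {R : Type u} [CommRing R] {n : ℕ} {F : Fin n → Type v} [∀ i, Ring (F i)]
  [∀ i, Algebra R (F i)] {ι : Fin n → Type w} [∀ i, Fintype (ι i)]
  (φ : ∀ i, SymmFrobenius R (F i)) (b : ∀ i, Module.Basis (ι i) R (F i)) (k : ℤ)

lemma factor_totalHom {T : Type} (A : Fin n → WordData.{u, v} R T) [∀ i, Lawful (A i)]
    (i : Fin n) : TotalHom (factor (A := A) i) :=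
  ⟨factor_mul i, factor_vcomp i, factor_one i, sz_factor i⟩

/-- The shuffle product of the Heisenberg categories of the summands. -/
noncomputable abbrev heisShuffle : WordData R (Strand × Fin n) :=
  shuffle fun i => presData (HeisRel (φ i) (b i) k)

/-- The data of the Heisenberg category of a summand, in the shuffle product. -/
noncomputable def factorData (i : Fin n) : HeisData (φ i) (b i) k (heisShuffle φ b k) :=
  (univ (φ i) (b i) k).map (factor_totalHom (fun i => presData (HeisRel (φ i) (b i) k)) i)

/-- The components of the identity of a letter. -/
noncomputable def letterTuple (s : Strand) (i m : Fin n) :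
    (presData (HeisRel (φ m) (b m) k)).Total :=
  if i = m then (univ (φ m) (b m) k).obj s else 1

/-- The components of the upward crossings. -/
noncomputable def crossTuple (i j m : Fin n) : (presData (HeisRel (φ m) (b m) k)).Total :=
  if i = m then (if j = m then (univ (φ m) (b m) k).s else (univ (φ m) (b m) k).U)
  else if j = m then (univ (φ m) (b m) k).U else 1

/-- The components of the left crossings. -/
noncomputable def leftCrossTuple (i j m : Fin n) : (presData (HeisRel (φ m) (b m) k)).Total :=
  if i = m then (if j = m then (univ (φ m) (b m) k).L else (univ (φ m) (b m) k).V)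
  else if j = m then (univ (φ m) (b m) k).U else 1

/-- The upward crossings. -/
noncomputable def shuffleCross (i j : Fin n) : (heisShuffle φ b k).Total :=
  tupleM [(.up, i), (.up, j)] [(.up, j), (.up, i)] (crossTuple φ b k i j)

/-- The left crossings. -/
noncomputable def shuffleLeftCross (i j : Fin n) : (heisShuffle φ b k).Total :=
  tupleM [(.down, i), (.up, j)] [(.up, j), (.down, i)] (leftCrossTuple φ b k i j)

variable (i j l : Fin n)

lemma isTuple_U : IsTuple [(.up, i)] [(.up, i)] (letterTuple φ b k .up i)
    (factorData φ b k i).U := by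
  have e := isTuple_factor (A := fun i => presData (HeisRel (φ i) (b i) k)) i (isH_idw [Strand.up])
  refine ⟨fun m => ?_, e.2.trans (congrArg (tupleM _ _) (funext fun m => ?_))⟩
  · by_cases hm : i = m
    · subst hm
      simp only [letterTuple, if_true, part_cons, part_nil]
      exact isH_idw _
    · simp only [letterTuple, hm, if_false, part_cons, part_nil]
      exact isH_one
  · by_cases hm : i = m
    · subst hm
      simp only [letterTuple, if_true, Function.update_self]
      rfl
    · simp only [letterTuple, hm, if_false, Function.update_of_ne (Ne.symm hm)]

end ShuffleHeis

end FrobHeis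

namespace FrobHeis

open WordData

/-! ### The colour family in the shuffle product -/

section ShuffleHeis

variable {R : Type u} [CommRing R] {n : ℕ} {F : Fin n → Type v} [∀ i, Ring (F i)]
  [∀ i, Algebra R (F i)] {ι : Fin n → Type w} [∀ i, Fintype (ι i)]
  (φ : ∀ i, SymmFrobenius R (F i)) (b : ∀ i, Module.Basis (ι i) R (F i)) (k : ℤ) (i j l : Fin n)

lemma isTuple_V : IsTuple [(.down, i)] [(.down, i)] (letterTuple φ b k .down i)
    (factorData φ b k i).V := by
  have e := isTuple_factor (A := fun i => presData (HeisRel (φ i) (b i) k)) i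
    (isH_idw [Strand.down])
  refine ⟨fun m => ?_, e.2.trans (congrArg (tupleM _ _) (funext fun m => ?_))⟩
  · by_cases hm : i = m
    · subst hm
      simp only [letterTuple, if_true, part_cons, part_nil]
      exact isH_idw _
    · simp only [letterTuple, hm, if_false, part_cons, part_nil]
      exact isH_one
  · by_cases hm : i = m
    · subst hm
      simp only [letterTuple, if_true, Function.update_self]
      rfl
    · simp only [letterTuple, hm, if_false, Function.update_of_ne (Ne.symm hm)]

lemma isTuple_inc {a a' : List Strand} (f : Tm R (HeisGen (F i) (ι i) k) a a') :
    IsTuple (A := fun i => presData (HeisRel (φ i) (b i) k)) (a.map (·, i)) (a'.map (·, i))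
      (Function.update (fun _ => 1) i (inc (HeisRel (φ i) (b i) k) f))
      (factor (A := fun i => presData (HeisRel (φ i) (b i) k)) i (inc _ f)) :=
  isTuple_factor (A := fun i => presData (HeisRel (φ i) (b i) k)) i (isH_ofH _)

lemma isTuple_cross : IsTuple [(.up, i), (.up, j)] [(.up, j), (.up, i)] (crossTuple φ b k i j)
    (shuffleCross φ b k i j) := by
  refine ⟨fun m => ?_, rfl⟩
  by_cases hi : i = m <;> by_cases hj : j = m <;>
    simp only [crossTuple, hi, hj, if_true, if_false, part_cons, part_nil]
  · exact isH_ofH _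
  · exact isH_idw _
  · exact isH_idw _
  · exact isH_one

lemma isTuple_leftCross : IsTuple [(.down, i), (.up, j)] [(.up, j), (.down, i)]
    (leftCrossTuple φ b k i j) (shuffleLeftCross φ b k i j) := by
  refine ⟨fun m => ?_, rfl⟩
  by_cases hi : i = m <;> by_cases hj : j = m <;>
    simp only [leftCrossTuple, hi, hj, if_true, if_false, part_cons, part_nil]
  · exact isH_ofH _
  · exact isH_idw _
  · exact isH_idw _
  · exact isH_one

lemma shuffleCross_self : shuffleCross φ b k i i = (factorData φ b k i).s := by
  refine (isTuple_cross φ b k i i).ext (isTuple_inc φ b k i (HeisTm.s R (ι i) k)) fun m => ?_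
  by_cases hm : i = m
  · subst hm
    simp only [crossTuple, if_true, Function.update_self]; rfl
  · simp only [crossTuple, hm, if_false, Function.update_of_ne (Ne.symm hm)]

lemma shuffleLeftCross_self : shuffleLeftCross φ b k i i = (factorData φ b k i).L := by
  refine (isTuple_leftCross φ b k i i).ext (isTuple_inc φ b k i (HeisTm.leftCross R (ι i) k))
    fun m => ?_
  by_cases hm : i = m
  · subst hm
    simp only [leftCrossTuple, if_true, Function.update_self]; rfl
  · simp only [leftCrossTuple, hm, if_false, Function.update_of_ne (Ne.symm hm)]

/-- The coloured right crossings of different colours are mutually inverse to the left ones. -/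
lemma isTuple_rightCross (hij : i ≠ j) : IsTuple [(.up, i), (.down, j)] [(.down, j), (.up, i)]
    (fun m => letterTuple φ b k .up i m * letterTuple φ b k .down j m)
    (((factorData φ b k j).c * ((factorData φ b k i).U * (factorData φ b k j).V)) ⊙
      ((factorData φ b k j).V * shuffleCross φ b k j i * (factorData φ b k j).V) ⊙
      ((factorData φ b k j).V * (factorData φ b k i).U * (factorData φ b k j).d)) := by
  have hU := isTuple_U φ b k i
  have hV := isTuple_V φ b k j
  have hc := isTuple_inc φ b k j (HeisTm.c R (ι j) k)
  have hd := isTuple_inc φ b k j (HeisTm.d R (ι j) k)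
  have e := (hc.mul (hU.mul hV)).vcomp
    (((hV.mul (isTuple_cross φ b k j i)).mul hV).vcomp ((hV.mul hU).mul hd))
  refine e.congr fun m => ?_
  by_cases hj : j = m
  · subst hj
    simp only [letterTuple, crossTuple, hij, if_true, if_false, Function.update_self, one_mul,
      mul_one, HeisPre.obj]
    -- In the component of colour `j` the strand of colour `i` is invisible and the crossing is an
    -- identity, so the rotated diagram is the zigzag.
    have e1 : ((univ (φ j) (b j) k).V * (univ (φ j) (b j) k).U * (univ (φ j) (b j) k).V) ⊙
        ((univ (φ j) (b j) k).V * (univ (φ j) (b j) k).d) =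
        (univ (φ j) (b j) k).V * (univ (φ j) (b j) k).d := by
      rw [mul_assoc, icl, (univ _ _ _).V_V, (univ _ _ _).UV_d]
    exact (univ (φ j) (b j) k).adj_down.symm.trans (congrArg _ e1.symm)
  · by_cases hi : i = m
    · subst hi
      simp [letterTuple, crossTuple, hj, Function.update_of_ne (Ne.symm hj), HeisPre.obj,
        (univ _ _ _).U_U]
    · simp [letterTuple, crossTuple, hj, hi, Function.update_of_ne (Ne.symm hj), one_vcomp]

/-- The Heisenberg categories of the summands form a colour family in their shuffle product. -/
noncomputable def shuffleFamily : ColorFamily φ b k (heisShuffle φ b k) where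
  h := factorData φ b k
  cs := shuffleCross φ b k
  cL := shuffleLeftCross φ b k
  U_ne i j hij := by
    have e : ∀ i, (factorData φ b k i).U = (heisShuffle φ b k).idw [(.up, i)] :=
      fun i => factor_idw i _
    rw [e, e, idw_vcomp_ne]
    simpa using hij
  V_ne i j hij := by
    have e : ∀ i, (factorData φ b k i).V = (heisShuffle φ b k).idw [(.down, i)] :=
      fun i => factor_idw i _
    rw [e, e, idw_vcomp_ne]
    simpa using hij
  cs_self := shuffleCross_self φ b k
  cL_self := shuffleLeftCross_self φ b k
  sz_cs i j := (isTuple_cross φ b k i j).sz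
  sz_cL i j := (isTuple_leftCross φ b k i j).sz
  uu_cs i j := by
    refine (((isTuple_U φ b k i).mul (isTuple_U φ b k j)).vcomp (isTuple_cross φ b k i j)).ext
      (isTuple_cross φ b k i j) fun m => ?_
    by_cases hi : i = m <;> by_cases hj : j = m <;>
      simp [letterTuple, crossTuple, hi, hj, HeisPre.obj, (univ _ _ _).UU_s, (univ _ _ _).U_U,
        one_vcomp]
  cs_uu i j := by
    refine ((isTuple_cross φ b k i j).vcomp ((isTuple_U φ b k j).mul (isTuple_U φ b k i))).ext
      (isTuple_cross φ b k i j) fun m => ?_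
    by_cases hi : i = m <;> by_cases hj : j = m <;>
      simp [letterTuple, crossTuple, hi, hj, HeisPre.obj, (univ _ _ _).s_UU, (univ _ _ _).U_U,
        one_vcomp]
  vu_cL i j := by
    refine (((isTuple_V φ b k i).mul (isTuple_U φ b k j)).vcomp (isTuple_leftCross φ b k i j)).ext
      (isTuple_leftCross φ b k i j) fun m => ?_
    by_cases hi : i = m <;> by_cases hj : j = m <;>
      simp [letterTuple, leftCrossTuple, hi, hj, HeisPre.obj, (univ _ _ _).VU_L,
        (univ _ _ _).U_U, (univ _ _ _).V_V, one_vcomp]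
  cL_uv i j := by
    refine ((isTuple_leftCross φ b k i j).vcomp ((isTuple_U φ b k j).mul (isTuple_V φ b k i))).ext
      (isTuple_leftCross φ b k i j) fun m => ?_
    by_cases hi : i = m <;> by_cases hj : j = m <;>
      simp [letterTuple, leftCrossTuple, hi, hj, HeisPre.obj, (univ _ _ _).L_UV,
        (univ _ _ _).U_U, (univ _ _ _).V_V, one_vcomp]
  cs_cs i j := by
    refine ((isTuple_cross φ b k i j).vcomp (isTuple_cross φ b k j i)).ext
      ((isTuple_U φ b k i).mul (isTuple_U φ b k j)) fun m => ?_
    by_cases hi : i = m <;> by_cases hj : j = m <;>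
      simp [letterTuple, crossTuple, hi, hj, HeisPre.obj, (univ _ _ _).s_s, (univ _ _ _).U_U,
        one_vcomp]
  braid i j l := by
    have C := isTuple_cross φ b k
    have U := isTuple_U φ b k
    refine (((C i j).mul (U l)).vcomp (((U j).mul (C i l)).vcomp ((C j l).mul (U i)))).ext
      (((U i).mul (C j l)).vcomp (((C i l).mul (U j)).vcomp ((U l).mul (C i j)))) fun m => ?_
    -- Component `m` only sees the strands of colour `m`. The braid relation is needed if there are
    -- three of them; with two, both sides are a single crossing, and otherwise an identity.
    by_cases hi : i = m <;> by_cases hj : j = m <;> by_cases hl : l = m <;>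
      simp [letterTuple, crossTuple, hi, hj, hl, HeisPre.obj, (univ _ _ _).s_UU,
        (univ _ _ _).UU_s, (univ _ _ _).UU_UU, (univ _ _ _).U_U, one_vcomp, (univ _ _ _).braid]
  tok_cs i j f := by
    have hf := isTuple_inc φ b k i (HeisTm.token R (ι i) k f)
    refine ((hf.mul (isTuple_U φ b k j)).vcomp (isTuple_cross φ b k i j)).ext
      ((isTuple_cross φ b k i j).vcomp ((isTuple_U φ b k j).mul hf)) fun m => ?_
    by_cases hi : i = m
    · subst hi
      by_cases hj : j = i
      · simp only [letterTuple, crossTuple, hj, if_true, Function.update_self]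
        exact (univ (φ i) (b i) k).tok_s f
      · simp only [letterTuple, crossTuple, hj, if_true, if_false, Function.update_self, mul_one,
          one_mul]
        exact ((univ (φ i) (b i) k).tok_U f).trans ((univ (φ i) (b i) k).U_tok f).symm
    · by_cases hj : j = m <;>
        simp [letterTuple, crossTuple, hi, hj, Function.update_of_ne (Ne.symm hi), HeisPre.obj]
  cs_x i j hij := by
    have hx := isTuple_inc φ b k j (HeisTm.x R (ι j) k)
    refine ((isTuple_cross φ b k i j).vcomp (hx.mul (isTuple_U φ b k i))).ext
      (((isTuple_U φ b k i).mul hx).vcomp (isTuple_cross φ b k i j)) fun m => ?_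
    by_cases hj : j = m
    · subst hj
      simp only [letterTuple, crossTuple, hij, if_true, if_false, Function.update_self, mul_one,
        one_mul]
      exact ((univ (φ j) (b j) k).U_x).trans ((univ (φ j) (b j) k).x_U).symm
    · by_cases hi : i = m <;>
        simp [letterTuple, crossTuple, hi, hj, Function.update_of_ne (Ne.symm hj), HeisPre.obj]
  ct_cL i j hij := by
    refine ((isTuple_rightCross φ b k i j hij).vcomp (isTuple_leftCross φ b k j i)).ext
      ((isTuple_U φ b k i).mul (isTuple_V φ b k j)) fun m => ?_
    by_cases hi : i = m
    · have hj : j ≠ m := fun hj => hij (hi.trans hj.symm)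
      simp [letterTuple, leftCrossTuple, hi, hj, HeisPre.obj, (univ _ _ _).U_U]
    · by_cases hj : j = m <;>
        simp [letterTuple, leftCrossTuple, hi, hj, HeisPre.obj, (univ _ _ _).V_V, one_vcomp]
  cL_ct i j hij := by
    refine ((isTuple_leftCross φ b k j i).vcomp (isTuple_rightCross φ b k i j hij)).ext
      ((isTuple_V φ b k j).mul (isTuple_U φ b k i)) fun m => ?_
    by_cases hi : i = m
    · have hj : j ≠ m := fun hj => hij (hi.trans hj.symm)
      simp [letterTuple, leftCrossTuple, hi, hj, HeisPre.obj, (univ _ _ _).U_U]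
    · by_cases hj : j = m <;>
        simp [letterTuple, leftCrossTuple, hi, hj, HeisPre.obj, (univ _ _ _).V_V, one_vcomp]

end ShuffleHeis

end FrobHeis

namespace FrobHeis

open WordData

lemma HeisData.ext_pre {R : Type u} [CommRing R] {F : Type v} {ι : Type w} {S' : Type} [Ring F]
    [Algebra R F] [Fintype ι] {φ : SymmFrobenius R F} {b : Module.Basis ι R F} {k : ℤ}
    {D : WordData.{u} R S'} [Lawful D] {h h' : HeisData φ b k D}
    (e : h.toHeisPre = h'.toHeisPre) : h = h' := by
  cases h; cases h'; cases e; rfl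

variable {R : Type u} [CommRing R] {n : ℕ} {F : Fin n → Type v} [∀ i, Ring (F i)]
  [∀ i, Algebra R (F i)] {ι : Fin n → Type w} [∀ i, Fintype (ι i)]
  {φ : ∀ i, SymmFrobenius R (F i)} {b : ∀ i, Module.Basis (ι i) R (F i)} {k : ℤ} {S' : Type}
  {D : WordData.{u} R S'} [Lawful D]

/-! ### Recovering the coloured data from the assembled data -/

namespace ColorFamily

variable (c : ColorFamily φ b k D) (i : Fin n)

lemma u_eq : c.toHeisData.u i = (c.h i).U := (c.tok_single 1).trans (c.h i).tok_one

/-- The downward idempotent is a rotated token of colour i. Its colour cuts the summed cup and cap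
down to those of colour i, and the zigzag of this colour remains. -/
lemma v_eq : c.toHeisData.v i = (c.h i).V := by
  have e1 : (c.pre.c * c.pre.V) ⊙ (c.pre.V * (c.h i).U * c.pre.V) = (c.h i).c * c.pre.V := by
    rw [icl, c_Vu, V_V]
  have e2 : ((c.h i).c * c.pre.V) ⊙ ((c.h i).V * ((c.h i).U * c.pre.V)) =
      (c.h i).c * c.pre.V := by
    rw [← mul_assoc, icl, (c.h i).c_VU, V_V]
  have e3 : ((c.h i).V * ((c.h i).U * c.pre.V)) ⊙ (c.pre.V * c.pre.d) =
      (c.h i).V * (c.h i).d := by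
    rw [icl, v_V, uV_d]
  have e4 : (c.h i).V * (c.h i).d =
      ((c.h i).V * (c.h i).U * (c.h i).V) ⊙ ((c.h i).V * (c.h i).d) := by
    rw [mul_assoc, icl, (c.h i).V_V, (c.h i).UV_d]
  have e5 : ((c.h i).c * c.pre.V) ⊙ ((c.h i).V * (c.h i).U * (c.h i).V) =
      (c.h i).c * (c.h i).V := by
    rw [icl, (c.h i).c_VU, V_v]
  change (c.pre.c * c.pre.V) ⊙ (c.pre.V * c.pre.tok (Pi.single i 1) * c.pre.V) ⊙
    (c.pre.V * c.pre.d) = _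
  rw [c.tok_single, (c.h i).tok_one, ← vcomp_assoc, e1, ← e2, vcomp_assoc, e3, e4, ← vcomp_assoc,
    e5, (c.h i).adj_down]

/-- The coloured parts of the assembled data are the given data. -/
lemma colorData_toHeisData : c.toHeisData.colorData i = c.h i := by
  refine HeisData.ext_pre ?_
  change c.toHeisData.colorPre i = (c.h i).toHeisPre
  have hu := c.u_eq i
  have hv := c.v_eq i
  have e : ∀ p q : HeisPre (F i) (ι i) k D.Total, p.U = q.U → p.V = q.V → p.x = q.x → p.s = q.s →
      p.c = q.c → p.d = q.d → p.tok = q.tok → p.L = q.L → p.lcup = q.lcup → p.lcap = q.lcap →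
      p = q := by
    rintro ⟨⟩ ⟨⟩ ⟨⟩ ⟨⟩ ⟨⟩ ⟨⟩ ⟨⟩ ⟨⟩ ⟨⟩ ⟨⟩ ⟨⟩ ⟨⟩
    rfl
  refine e _ _ hu hv ?_ ?_ ?_ ?_ (funext fun f => c.tok_single f) ?_ rfl rfl
  · change c.toHeisData.u i ⊙ c.pre.x = _
    rw [hu, u_x]
  · change (c.toHeisData.u i * c.toHeisData.u i) ⊙ c.pre.s = _
    rw [hu, uu_s, c.cs_self]
  · change c.pre.c ⊙ (c.toHeisData.v i * c.toHeisData.u i) = _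
    rw [hu, hv, c_vu]
  · change (c.toHeisData.u i * c.toHeisData.v i) ⊙ c.pre.d = _
    rw [hu, hv, uv_d]
  · change (c.toHeisData.v i * c.toHeisData.u i) ⊙ c.pre.L = _
    rw [hu, hv, vu_L, c.cL_self]

end ColorFamily

section LiftColor

variable (φ b k) in
/-- The data of the Heisenberg category of a direct sum. -/
noncomputable abbrev univSum :
    HeisData (SymmFrobenius.directSum φ) (Pi.basis b) k
      (presData (HeisRel (SymmFrobenius.directSum φ) (Pi.basis b) k)) :=
  univ (SymmFrobenius.directSum φ) (Pi.basis b) k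

/-- Coloured idempotents lie below the identity of the uncoloured word; this supplies the common
middle word that `Interp.lift_vcomp` asks for. -/
lemma idw_vcomp_objW (i : Fin n) (a : List Strand) :
    (presData (HeisRel (SymmFrobenius.directSum φ) (Pi.basis b) k)).idw a ⊙
      objW ((univSum φ b k).colorData i).interp.obj a =
      objW ((univSum φ b k).colorData i).interp.obj a := by
  induction a with
  | nil => exact one_vcomp (f := 1)
  | cons s a ih =>
    have e : ∀ s, (presData (HeisRel (SymmFrobenius.directSum φ) (Pi.basis b) k)).idw [s] ⊙
        ((univSum φ b k).colorData i).interp.obj s =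
        ((univSum φ b k).colorData i).interp.obj s := fun s => by
      cases s
      · exact (univSum φ b k).U_u i
      · exact (univSum φ b k).V_v i
    rw [← List.singleton_append, idw_append, objW_append, interchange_left (sz_idw [s])
      (sz_objW ((univSum φ b k).colorData i).interp.sz_obj [s]), ih]
    simp only [objW_cons, objW_nil, mul_one, e]

lemma objW_vcomp_idw (i : Fin n) (a : List Strand) :
    objW ((univSum φ b k).colorData i).interp.obj a ⊙
      (presData (HeisRel (SymmFrobenius.directSum φ) (Pi.basis b) k)).idw a =
      objW ((univSum φ b k).colorData i).interp.obj a := by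
  induction a with
  | nil => exact vcomp_one (f := 1)
  | cons s a ih =>
    have e : ∀ s, ((univSum φ b k).colorData i).interp.obj s ⊙
        (presData (HeisRel (SymmFrobenius.directSum φ) (Pi.basis b) k)).idw [s] =
        ((univSum φ b k).colorData i).interp.obj s := fun s => by
      cases s
      · exact (univSum φ b k).u_U i
      · exact (univSum φ b k).v_V i
    rw [← List.singleton_append, idw_append, objW_append, interchange_left
      (sz_objW ((univSum φ b k).colorData i).interp.sz_obj [s]) (sz_idw [s]), ih]
    simp only [objW_cons, objW_nil, mul_one, e]

lemma idw_vcomp_colorEval (i : Fin n) {a a' : List Strand}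
    (f : Tm R (HeisGen (F i) (ι i) k) a a') :
    (presData (HeisRel (SymmFrobenius.directSum φ) (Pi.basis b) k)).idw a ⊙
      (univSum φ b k).colorEval i f = (univSum φ b k).colorEval i f := by
  rw [HeisData.colorEval, ← Interp.obj_eval, ← vcomp_assoc, idw_vcomp_objW]

lemma colorEval_vcomp_idw (i : Fin n) {a a' : List Strand}
    (f : Tm R (HeisGen (F i) (ι i) k) a a') :
    (univSum φ b k).colorEval i f ⊙
      (presData (HeisRel (SymmFrobenius.directSum φ) (Pi.basis b) k)).idw a' =
        (univSum φ b k).colorEval i f := by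
  rw [HeisData.colorEval, ← Interp.eval_obj, vcomp_assoc, objW_vcomp_idw]

variable (h : HeisData (SymmFrobenius.directSum φ) (Pi.basis b) k D)

lemma lift_u (i : Fin n) : h.lift ((univSum φ b k).u i) = h.u i := h.interp.lift_inc h.eval_rel _

lemma lift_v (i : Fin n) : h.lift ((univSum φ b k).v i) = h.v i := by
  change h.lift ((univPre _ _ _).vtok _) = _
  rw [← inc_downToken]
  refine (h.interp.lift_inc h.eval_rel _).trans ?_
  simp [HeisTm.downToken, Interp.eval, HeisData.v, HeisPre.vtok, HeisData.interp, HeisPre.gen,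
    HeisPre.obj]

/-- The universal map sends the coloured morphisms to the coloured morphisms. -/
lemma lift_colorEval (i : Fin n) {a a' : List Strand} (f : Tm R (HeisGen (F i) (ι i) k) a a') :
    h.lift ((univSum φ b k).colorEval i f) = h.colorEval i f := by
  induction f with
  | gen g =>
    cases g with
    | x =>
      refine (h.interp.lift_vcomp h.eval_rel (b := [.up]) ((univSum φ b k).u_U i)
        (univSum φ b k).U_x).trans ?_
      exact congrArg₂ vcomp (lift_u h i) (h.interp.lift_inc h.eval_rel _)
    | s =>
      refine (h.interp.lift_vcomp h.eval_rel (b := [.up, .up]) ?_ ?_).trans ?_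
      · rw [idw_two, icl]
        exact congrArg₂ _ ((univSum φ b k).u_U i) ((univSum φ b k).u_U i)
      · rw [idw_two]
        exact (univSum φ b k).UU_s
      · rw [Interp.lift_mul]
        exact congrArg₂ vcomp (congrArg₂ _ (lift_u h i) (lift_u h i))
          (h.interp.lift_inc h.eval_rel _)
    | c =>
      refine (h.interp.lift_vcomp h.eval_rel (b := [.down, .up]) ?_ ?_).trans ?_
      · rw [idw_two]
        exact (univSum φ b k).c_VU
      · rw [idw_two, icl]
        exact congrArg₂ _ ((univSum φ b k).V_v i) ((univSum φ b k).U_u i)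
      · rw [Interp.lift_mul]
        exact congrArg₂ vcomp (h.interp.lift_inc h.eval_rel _)
          (congrArg₂ _ (lift_v h i) (lift_u h i))
    | d =>
      refine (h.interp.lift_vcomp h.eval_rel (b := [.up, .down]) ?_ ?_).trans ?_
      · rw [idw_two, icl]
        exact congrArg₂ _ ((univSum φ b k).u_U i) ((univSum φ b k).v_V i)
      · rw [idw_two]
        exact (univSum φ b k).UV_d
      · rw [Interp.lift_mul]
        exact congrArg₂ vcomp (congrArg₂ _ (lift_u h i) (lift_v h i))
          (h.interp.lift_inc h.eval_rel _)
    | token f => exact h.interp.lift_inc h.eval_rel _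
    | leftCross =>
      refine (h.interp.lift_vcomp h.eval_rel (b := [.down, .up]) ?_ ?_).trans ?_
      · rw [idw_two, icl]
        exact congrArg₂ _ ((univSum φ b k).v_V i) ((univSum φ b k).u_U i)
      · rw [idw_two]
        exact (univSum φ b k).VU_L
      · rw [Interp.lift_mul]
        exact congrArg₂ vcomp (congrArg₂ _ (lift_v h i) (lift_u h i))
          (h.interp.lift_inc h.eval_rel _)
    | leftCup r m => exact h.interp.lift_inc h.eval_rel _
    | leftCap r m => exact h.interp.lift_inc h.eval_rel _
  | id a =>
    induction a with
    | nil => exact h.interp.lift_idw h.eval_rel []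
    | cons s a ih =>
      simp only [HeisData.colorEval, Interp.eval, objW_cons] at ih ⊢
      refine (h.interp.lift_mul h.eval_rel _ _).trans (congrArg₂ _ ?_ ih)
      cases s
      · exact lift_u h i
      · exact lift_v h i
  | comp f g hf hg =>
    refine (h.interp.lift_vcomp h.eval_rel (colorEval_vcomp_idw i f)
      (idw_vcomp_colorEval i g)).trans ?_
    exact congrArg₂ vcomp hf hg
  | tensor f g hf hg =>
    exact (h.interp.lift_mul h.eval_rel _ _).trans (congrArg₂ _ hf hg)
  | zero a a' => exact map_zero h.lift
  | add f g hf hg => exact (map_add h.lift _ _).trans (congrArg₂ _ hf hg)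
  | smul r f hf => exact (map_smul h.lift _ _).trans (congrArg _ hf)

end LiftColor

/-! ### Images of sorted products in the shuffle product -/

section Separation

open HeisData (sorted sorted_cons)

lemma colorEval_shuffle (i : Fin n) {a a' : List Strand} (f : Tm R (HeisGen (F i) (ι i) k) a a') :
    (shuffleFamily φ b k).toHeisData.colorEval i f =
      factor (A := fun i => presData (HeisRel (φ i) (b i) k)) i (inc _ f) := by
  rw [HeisData.colorEval, ColorFamily.colorData_toHeisData]
  refine (HeisData.eval_map _
    (factor_totalHom (fun i => presData (HeisRel (φ i) (b i) k)) i) f).trans ?_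
  rw [univ_eval]

/-- Each colour occurs at most once in `L`, so in component `i` at most one factor of the product
differs from 1. -/
lemma isTuple_prod {L : List (Fin n)} (hL : L.Nodup) {a a' : Fin n → List Strand}
    (f : ∀ i, Tm R (HeisGen (F i) (ι i) k) (a i) (a' i)) :
    IsTuple (A := fun i => presData (HeisRel (φ i) (b i) k)) (sorted L a) (sorted L a')
      (fun i => if i ∈ L then inc _ (f i) else 1) (L.map fun i => factor i (inc _ (f i))).prod := by
  induction L with
  | nil =>
    refine (IsTuple.idw []).congr fun i => ?_
    simp; rfl
  | cons m L ih =>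
    obtain ⟨hm, hL⟩ := List.nodup_cons.mp hL
    rw [List.map_cons, List.prod_cons, sorted_cons, sorted_cons]
    refine ((isTuple_inc φ b k m (f m)).mul (ih hL)).congr fun i => ?_
    by_cases hi : m = i
    · subst hi
      simp [hm]
    · simp [Ne.symm hi]

/-- The universal map is multiplicative and sends the diagrams of colour `i` to the i-th tensor
factor, so a sorted product becomes the pure tensor. Faithfulness rests on this. -/
lemma lift_prod_colorEval {a a' : Fin n → List Strand}
    (f : ∀ i, Tm R (HeisGen (F i) (ι i) k) (a i) (a' i)) :
    (shuffleFamily φ b k).toHeisData.lift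
      ((List.finRange n).map fun i => (univSum φ b k).colorEval i (f i)).prod =
      tupleM (A := fun i => presData (HeisRel (φ i) (b i) k)) (sorted (List.finRange n) a)
        (sorted (List.finRange n) a') fun i => inc _ (f i) := by
  have e : ∀ L : List (Fin n), (shuffleFamily φ b k).toHeisData.lift
      (L.map fun i => (univSum φ b k).colorEval i (f i)).prod =
      (L.map fun i => factor (A := fun i => presData (HeisRel (φ i) (b i) k)) i
        (inc _ (f i))).prod := fun L => by
    induction L with
    | nil => exact (shuffleFamily φ b k).toHeisData.interp.lift_idw _ []
    | cons i L ih =>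
      rw [List.map_cons, List.map_cons, List.prod_cons, List.prod_cons, ← ih, ← colorEval_shuffle,
        ← lift_colorEval (shuffleFamily φ b k).toHeisData]
      exact Interp.lift_mul _ _ _ _
  rw [e, (isTuple_prod (List.nodup_finRange n) f).2]
  simp

end Separation

end FrobHeis

namespace FrobHeis

open WordData

/-! ### The tensor product of the summands inside the Heisenberg category of the direct sum -/

section SortMap

open scoped TensorProduct
open HeisData (sorted sorted_cons)

variable {R : Type u} [CommRing R] {n : ℕ} {F : Fin n → Type v} [∀ i, Ring (F i)]
  [∀ i, Algebra R (F i)] {ι : Fin n → Type w} [∀ i, Fintype (ι i)]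
  (φ : ∀ i, SymmFrobenius R (F i)) (b : ∀ i, Module.Basis (ι i) R (F i)) (k : ℤ)

/-- Tensor products of modules of morphisms in the Heisenberg categories of the summands. -/
abbrev TensorHom (a a' : Fin n → List Strand) : Type _ :=
  ⨂[R] i, (presData (HeisRel (φ i) (b i) k)).H (a i) (a' i)

/-- Tuples of morphisms act on the sorted words. -/
noncomputable def sortM (a a' : Fin n → List Strand) : TensorHom φ b k a a' →ₗ[R]
    (presData (HeisRel (SymmFrobenius.directSum φ) (Pi.basis b) k)).Total :=
  PiTensorProduct.lift ((MultilinearMap.mkPiAlgebraFin R n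
    (presData (HeisRel (SymmFrobenius.directSum φ) (Pi.basis b) k)).Total).compLinearMap
      fun i => ((univSum φ b k).colorData i).lift ∘ₗ ofH)

variable {φ b k} {a a' a'' : Fin n → List Strand}

lemma sortM_tprod (f : ∀ i, Tm R (HeisGen (F i) (ι i) k) (a i) (a' i)) :
    sortM φ b k a a' (PiTensorProduct.tprod R fun i => mkH _ (f i)) =
      ((List.finRange n).map fun i => (univSum φ b k).colorEval i (f i)).prod := by
  rw [sortM, PiTensorProduct.lift.tprod, MultilinearMap.compLinearMap_apply,
    MultilinearMap.mkPiAlgebraFin_apply, List.ofFn_eq_map]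
  refine congrArg List.prod (List.map_congr_left fun i _ => ?_)
  exact ((univSum φ b k).colorData i).interp.lift_inc ((univSum φ b k).colorData i).eval_rel (f i)

lemma tensorHom_induction {P : TensorHom φ b k a a' → Prop}
    (h : ∀ f : ∀ i, Tm R (HeisGen (F i) (ι i) k) (a i) (a' i),
      P (PiTensorProduct.tprod R fun i => mkH _ (f i)))
    (hs : ∀ (r : R) z, P z → P (r • z)) (ha : ∀ z z', P z → P z' → P (z + z'))
    (z : TensorHom φ b k a a') : P z := by
  induction z using PiTensorProduct.induction_on with
  | smul_tprod r f =>
    choose g hg using fun i => exists_homMk (f i)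
    obtain rfl : f = fun i => mkH _ (g i) := funext hg
    exact hs r _ (h g)
  | add z z' hz hz' => exact ha z z' hz hz'

lemma isHom_prod (L : List (Fin n)) (f : ∀ i, Tm R (HeisGen (F i) (ι i) k) (a i) (a' i)) :
    (univSum φ b k).strands.IsHom (sorted L a) (sorted L a')
      (L.map fun i => (univSum φ b k).colorEval i (f i)).prod := by
  induction L with
  | nil => exact StrandSys.IsHom.E []
  | cons i L ih =>
    rw [List.map_cons, List.prod_cons, sorted_cons, sorted_cons]
    exact ((univSum φ b k).colorEval_isHom i (f i)).mul ih

lemma sortM_isHom (z : TensorHom φ b k a a') :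
    (univSum φ b k).strands.IsHom (sorted (List.finRange n) a) (sorted (List.finRange n) a')
      (sortM φ b k a a' z) := by
  induction z using tensorHom_induction with
  | h f => rw [sortM_tprod]; exact isHom_prod _ f
  | hs r z hz => rw [map_smul]; exact hz.smul r
  | ha z z' hz hz' => rw [map_add]; exact hz.add hz'

lemma prod_vcomp (L : List (Fin n)) (f : ∀ i, Tm R (HeisGen (F i) (ι i) k) (a i) (a' i))
    (g : ∀ i, Tm R (HeisGen (F i) (ι i) k) (a' i) (a'' i)) :
    (L.map fun i => (univSum φ b k).colorEval i ((f i).comp (g i))).prod =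
      (L.map fun i => (univSum φ b k).colorEval i (f i)).prod ⊙
        (L.map fun i => (univSum φ b k).colorEval i (g i)).prod := by
  induction L with
  | nil => exact (one_vcomp (f := 1)).symm
  | cons i L ih =>
    simp only [List.map_cons, List.prod_cons]
    rw [((univSum φ b k).colorEval_isHom i (f i)).icl ((univSum φ b k).colorEval_isHom i (g i)), ih]
    rfl

lemma sortM_comp (z : TensorHom φ b k a a') (z' : TensorHom φ b k a' a'') :
    sortM φ b k a a'' (PiTensorProduct.map₂
      (fun i => (presData (HeisRel (φ i) (b i) k)).comp (a := a i) (b := a' i) (c := a'' i)) z z') =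
      sortM φ b k a a' z ⊙ sortM φ b k a' a'' z' := by
  induction z using tensorHom_induction with
  | hs r z hz => simp only [map_smul, LinearMap.smul_apply, hz, smul_vcomp]
  | ha z z' hz hz' => simp only [map_add, LinearMap.add_apply, hz, hz', add_vcomp]
  | h f =>
  induction z' using tensorHom_induction with
  | hs r z hz => simp only [map_smul, hz, vcomp_smul]
  | ha z z' hz hz' => simp only [map_add, hz, hz', vcomp_add]
  | h g =>
    rw [PiTensorProduct.map₂_tprod_tprod, sortM_tprod, sortM_tprod, ← prod_vcomp]
    exact sortM_tprod fun i => (f i).comp (g i)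

lemma sortM_id (a : Fin n → List Strand) :
    sortM φ b k a a
      (PiTensorProduct.tprod R fun i => (presData (HeisRel (φ i) (b i) k)).idm (a i)) =
      (univSum φ b k).strands.E (sorted (List.finRange n) a) := by
  refine (sortM_tprod fun i => .id (a i)).trans ?_
  induction List.finRange n with
  | nil => rfl
  | cons i L ih =>
    rw [List.map_cons, List.prod_cons, sorted_cons, StrandSys.E_append, ih,
      HeisData.colorEval_id]

/-- Fullness at the level of total algebras: the morphism is generated by coloured generators, and
between sorted words these span exactly the image of `sortM`. -/
lemma exists_sortM {X Y : List Strand}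
    (hX : (sorted (List.finRange n) a).map Prod.fst = X)
    (hY : (sorted (List.finRange n) a').map Prod.fst = Y)
    (f : (presData (HeisRel (SymmFrobenius.directSum φ) (Pi.basis b) k)).H X Y)
    (hl : (univSum φ b k).strands.E (sorted (List.finRange n) a) ⊙ ofH f = ofH f)
    (hr : ofH f ⊙ (univSum φ b k).strands.E (sorted (List.finRange n) a') = ofH f) :
    ∃ z, sortM φ b k a a' z = ofH f := by
  obtain ⟨t, rfl⟩ := exists_homMk f
  have e := (univSum φ b k).colorGen_eval t hX hY
  rw [univ_eval] at e
  change _ ⊙ inc _ t = inc _ t at hl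
  change inc _ t ⊙ _ = inc _ t at hr
  rw [hr, hl] at e
  have e' : (univSum φ b k).ColorGen (· ∈ List.finRange n) (sorted (List.finRange n) a)
      (sorted (List.finRange n) a') (inc _ t) := by
    convert e using 2 with i
    simp
  have hm := e'.mem_span (List.nodup_finRange n)
  suffices h : Submodule.span R _ ≤ LinearMap.range (sortM φ b k a a') from h hm
  rw [Submodule.span_le]
  rintro _ ⟨f, rfl⟩
  exact ⟨_, sortM_tprod f⟩

lemma part_sorted (i : Fin n) {L : List (Fin n)} (hL : L.Nodup) (a : Fin n → List Strand) :
    part i (sorted L a) = if i ∈ L then a i else [] := by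
  induction L with
  | nil => rfl
  | cons m L ih =>
    obtain ⟨hm, hL⟩ := List.nodup_cons.mp hL
    rw [sorted_cons, part_append, ih hL]
    by_cases hi : m = i
    · subst hi
      simp [part_map_self, hm]
    · simp [part_map_ne hi, Ne.symm hi]

/-- The universal map to the shuffle product sends the sorted product back to the tensor it comes
from, up to replacing each word by the equal subword of the sorted word. -/
lemma sortM_injective : Function.Injective (sortM φ b k a a') := by
  let S := sorted (List.finRange n) a
  let S' := sorted (List.finRange n) a'
  have hS : ∀ i, part i S = a i := fun i => by
    rw [part_sorted i (List.nodup_finRange n), if_pos (List.mem_finRange i)]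
  have hS' : ∀ i, part i S' = a' i := fun i => by
    rw [part_sorted i (List.nodup_finRange n), if_pos (List.mem_finRange i)]
  -- The words `part i S` and `a i` are equal, but not definitionally. `p` and `q` pass between
  -- their modules of morphisms through the total algebra.
  let p : ∀ i, (presData (HeisRel (φ i) (b i) k)).H (a i) (a' i) →ₗ[R]
      (presData (HeisRel (φ i) (b i) k)).H (part i S) (part i S') := fun i => proj _ _ ∘ₗ ofH
  let q : ∀ i, (presData (HeisRel (φ i) (b i) k)).H (part i S) (part i S') →ₗ[R]
      (presData (HeisRel (φ i) (b i) k)).H (a i) (a' i) := fun i => proj _ _ ∘ₗ ofH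
  have hpq : ∀ i f, q i (p i f) = f := fun i f => by
    change proj _ _ (ofH (proj _ _ (ofH f : (presData (HeisRel (φ i) (b i) k)).Total)) :
      (presData (HeisRel (φ i) (b i) k)).Total) = f
    rw [IsH.ofH_proj (by rw [hS, hS']; exact isH_ofH f), proj_ofH]
  have hp : Function.Injective (PiTensorProduct.map p) := by
    refine Function.LeftInverse.injective (g := PiTensorProduct.map q) fun z => ?_
    rw [← LinearMap.comp_apply, ← PiTensorProduct.map_comp]
    have e : (fun i => q i ∘ₗ p i) = fun i => LinearMap.id :=
      funext fun i => LinearMap.ext (hpq i)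
    rw [e, PiTensorProduct.map_id, LinearMap.id_apply]
  have key : ∀ z, (shuffleFamily φ b k).toHeisData.lift (sortM φ b k a a' z) =
      ofH (D := heisShuffle φ b k) (a := S) (b := S') (PiTensorProduct.map p z) := fun z => by
    induction z using tensorHom_induction with
    | h f =>
      rw [sortM_tprod, lift_prod_colorEval, PiTensorProduct.map_tprod]
      rfl
    | hs r z hz => rw [map_smul, map_smul, hz, map_smul]; exact (map_smul _ _ _).symm
    | ha z z' hz hz' => rw [map_add, map_add, hz, hz', map_add]; exact (map_add _ _ _).symm
  intro z z' e
  have e' := congrArg (shuffleFamily φ b k).toHeisData.lift e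
  rw [key, key] at e'
  exact hp (ofH_injective e')

end SortMap

end FrobHeis

namespace FrobHeis

open WordData

/-! ### Karoubi envelopes and total algebras -/

section KaroubiTotal

open Idempotents

variable {R : Type u} [CommRing R] {S : Type} {G : List S → List S → Type v}
  {E : ∀ a b : List S, Tm R G a b → Tm R G a b → Prop} {P P' P'' : Karoubi (Pres E)}

variable (P) in
/-- The idempotent of an object of the Karoubi envelope as an element of the total algebra. -/
noncomputable def totalIdem : (presData E).Total :=
  ofH (D := presData E) (a := P.X.word) (b := P.X.word) P.p

/-- A morphism of the Karoubi envelope as an element of the total algebra. -/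
noncomputable def totalHom (P P' : Karoubi (Pres E)) : (P ⟶ P') →ₗ[R] (presData E).Total where
  toFun f := ofH (D := presData E) (a := P.X.word) (b := P'.X.word) f.f
  map_add' f g := map_add (ofH (D := presData E) (a := P.X.word) (b := P'.X.word)) f.f g.f
  map_smul' r f := map_smul (ofH (D := presData E) (a := P.X.word) (b := P'.X.word)) r f.f

lemma totalHom_injective : Function.Injective (totalHom P P') := fun f g e =>
  Karoubi.hom_ext f g
    (ofH_injective (D := presData E) (a := P.X.word) (b := P'.X.word) e)

lemma totalHom_comp (f : P ⟶ P') (g : P' ⟶ P'') :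
    totalHom P P'' (f ≫ g) = totalHom P P' f ⊙ totalHom P' P'' g :=
  (ofH_vcomp (D := presData E) (a := P.X.word) (b := P'.X.word) (c := P''.X.word) f.f g.f).symm

lemma totalHom_id (P : Karoubi (Pres E)) : totalHom P P (𝟙 P) = totalIdem P := rfl

lemma totalIdem_vcomp (f : P ⟶ P') : totalIdem P ⊙ totalHom P P' f = totalHom P P' f := by
  rw [← totalHom_id, ← totalHom_comp, Category.id_comp]

lemma vcomp_totalIdem (f : P ⟶ P') : totalHom P P' f ⊙ totalIdem P' = totalHom P P' f := by
  rw [← totalHom_id, ← totalHom_comp, Category.comp_id]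

lemma exists_totalHom {z : (presData E).Total} (hl : totalIdem P ⊙ z = z)
    (hr : z ⊙ totalIdem P' = z) : ∃ f : P ⟶ P', totalHom P P' f = z := by
  -- The idempotents lie below the identities of the underlying words, so invariance under them puts
  -- `z` into a single module of morphisms.
  obtain ⟨g, rfl⟩ := exists_ofH (a := P.X.word) (b := P'.X.word) (f := z)
    (by rw [← hl, ← vcomp_assoc]; exact congrArg (· ⊙ z) (idw_vcomp_ofH _))
    (by rw [← hr, vcomp_assoc]; exact congrArg (z ⊙ ·) (ofH_vcomp_idw _))
  refine ⟨⟨g, ?_⟩, rfl⟩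
  refine ofH_injective (D := presData E) (a := P.X.word) (b := P'.X.word) ?_
  have hl := (ofH_vcomp (D := presData E) (a := P.X.word) P.p g).symm.trans hl
  have hr := (ofH_vcomp (D := presData E) (c := P'.X.word) g P'.p).symm.trans hr
  have e : (presData E).comp (a := P.X.word) (b := P.X.word) (c := P'.X.word) P.p
      ((presData E).comp (a := P.X.word) (b := P'.X.word) (c := P'.X.word) g P'.p) = g := by
    rw [ofH_injective hr, ofH_injective hl]
  exact congrArg ofH e

/-- The morphism of the Karoubi envelope that is a given element of the total algebra. -/
noncomputable def homOfTotal (z : (presData E).Total) (hl : totalIdem P ⊙ z = z)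
    (hr : z ⊙ totalIdem P' = z) : P ⟶ P' := (exists_totalHom hl hr).choose

lemma totalHom_homOfTotal {z : (presData E).Total} (hl : totalIdem P ⊙ z = z)
    (hr : z ⊙ totalIdem P' = z) : totalHom P P' (homOfTotal z hl hr) = z :=
  (exists_totalHom hl hr).choose_spec

lemma totalIdem_karoubiTensor (P P' : Karoubi (Pres E)) :
    totalIdem (karoubiTensor P P') = totalIdem P * totalIdem P' :=
  (ofH_mul (D := presData E) (a := P.X.word) (b := P.X.word) (c := P'.X.word) (d := P'.X.word)
    P.p P'.p).symm

end KaroubiTotal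

/-! ### Coloured words as objects of the partial Karoubi envelope -/

section ColoredWords

open Idempotents

variable {R : Type u} [CommRing R] {n : ℕ} {F : Fin n → Type v} [∀ i, Ring (F i)]
  [∀ i, Algebra R (F i)] {ι : Fin n → Type w} [∀ i, Fintype (ι i)]
  (φ : ∀ i, SymmFrobenius R (F i)) (b : ∀ i, Module.Basis (ι i) R (F i)) (k : ℤ)

/-- The color idempotent of a coloured strand. -/
def letterIdem : ∀ s : Strand × Fin n, (⟨[s.1]⟩ : HeisSum φ b k) ⟶ ⟨[s.1]⟩
  | (.up, i) => Pres.homMk (HeisTm.token R (Σ i, ι i) k (Pi.single i 1 : ∀ i, F i))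
  | (.down, i) => Pres.homMk (HeisTm.downToken R (Σ i, ι i) k (Pi.single i 1 : ∀ i, F i))

lemma colorIdempotent_letterIdem (s : Strand × Fin n) :
    ColorIdempotent φ b k ⟨[s.1]⟩ (letterIdem φ b k s) := by
  obtain ⟨_ | _, i⟩ := s
  · exact .up i
  · exact .down i

lemma ofH_letterIdem (s : Strand × Fin n) :
    ofH (D := presData (HeisRel (SymmFrobenius.directSum φ) (Pi.basis b) k)) (a := [s.1])
      (b := [s.1]) (letterIdem φ b k s) = (univSum φ b k).strands.e s := by
  obtain ⟨_ | _, i⟩ := s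
  · rfl
  · exact inc_downToken _ _ _ _

/-- The object of the Karoubi envelope given by a coloured strand. -/
def letterObj (s : Strand × Fin n) : Karoubi (HeisSum φ b k) where
  X := ⟨[s.1]⟩
  p := letterIdem φ b k s
  idem := by
    refine ofH_injective
      (D := presData (HeisRel (SymmFrobenius.directSum φ) (Pi.basis b) k)) (a := [s.1])
      (b := [s.1]) ?_
    refine (ofH_vcomp (D := presData (HeisRel (SymmFrobenius.directSum φ) (Pi.basis b) k))
      (a := [s.1]) (b := [s.1]) (c := [s.1]) _ _).symm.trans ?_
    rw [ofH_letterIdem]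
    exact (univSum φ b k).strands.e_e s

/-- The object of the Karoubi envelope given by a coloured word. -/
def wordObj : List (Strand × Fin n) → Karoubi (HeisSum φ b k)
  | [] => ⟨Pres.one, 𝟙 _, Category.comp_id _⟩
  | s :: X => karoubiTensor (letterObj φ b k s) (wordObj X)

lemma wordObj_word (X : List (Strand × Fin n)) :
    (wordObj φ b k X).X.word = X.map Prod.fst := by
  induction X with
  | nil => rfl
  | cons s X ih => exact congrArg (s.1 :: ·) ih

lemma totalIdem_wordObj (X : List (Strand × Fin n)) :
    totalIdem (wordObj φ b k X) = (univSum φ b k).strands.E X := by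
  induction X with
  | nil => rfl
  | cons s X ih =>
    rw [wordObj, totalIdem_karoubiTensor, ih, StrandSys.E_cons]
    exact congrArg (· * _) (ofH_letterIdem φ b k s)

lemma isPartialKaroubi_wordObj (X : List (Strand × Fin n)) :
    IsPartialKaroubi (ColorIdempotent φ b k) (wordObj φ b k X) := by
  induction X with
  | nil => exact .one
  | cons s X ih => exact .tensor _ _ (colorIdempotent_letterIdem φ b k s) ih

lemma exists_letterObj {P : Karoubi (HeisSum φ b k)} (h : ColorIdempotent φ b k P.X P.p) :
    ∃ s, P = letterObj φ b k s := by
  obtain ⟨D, p, hp⟩ := P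
  change ColorIdempotent φ b k D p at h
  cases h with
  | up i => exact ⟨(.up, i), rfl⟩
  | down i => exact ⟨(.down, i), rfl⟩

/-- `wordObj` follows the recursion that defines the objects of the partial Karoubi envelope, so an
equality results and not just an isomorphism. -/
lemma exists_wordObj {P : Karoubi (HeisSum φ b k)}
    (h : IsPartialKaroubi (ColorIdempotent φ b k) P) : ∃ X, P = wordObj φ b k X := by
  induction h with
  | one => exact ⟨[], rfl⟩
  | tensor P Q hP _ ih =>
    obtain ⟨s, rfl⟩ := exists_letterObj φ b k hP
    obtain ⟨X, rfl⟩ := ih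
    exact ⟨s :: X, rfl⟩

variable {φ b k} in
/-- The morphism of the Karoubi envelope given by a morphism of coloured words. -/
noncomputable def wordHom {X Y : List (Strand × Fin n)}
    {z : (presData (HeisRel (SymmFrobenius.directSum φ) (Pi.basis b) k)).Total}
    (h : (univSum φ b k).strands.IsHom X Y z) : wordObj φ b k X ⟶ wordObj φ b k Y :=
  homOfTotal z (by rw [totalIdem_wordObj, h.left]) (by rw [totalIdem_wordObj, h.right])

variable {φ b k} in
lemma totalHom_wordHom {X Y : List (Strand × Fin n)}
    {z : (presData (HeisRel (SymmFrobenius.directSum φ) (Pi.basis b) k)).Total}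
    (h : (univSum φ b k).strands.IsHom X Y z) : totalHom _ _ (wordHom h) = z :=
  totalHom_homOfTotal _ _

variable {φ b k} in
lemma wordHom_comp_eq_id {X Y : List (Strand × Fin n)}
    {f g : (presData (HeisRel (SymmFrobenius.directSum φ) (Pi.basis b) k)).Total}
    (hf : (univSum φ b k).strands.IsHom X Y f) (hg : (univSum φ b k).strands.IsHom Y X g)
    (hfg : f ⊙ g = (univSum φ b k).strands.E X) :
    wordHom hf ≫ wordHom hg = 𝟙 (wordObj φ b k X) :=
  totalHom_injective <| by
    rw [totalHom_comp, totalHom_wordHom, totalHom_wordHom, hfg, totalHom_id, totalIdem_wordObj]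

end ColoredWords

/-! ### The equivalence -/

section Equivalence

open Idempotents
open HeisData (sorted)

variable {R : Type u} [CommRing R] {n : ℕ} {F : Fin n → Type v} [∀ i, Ring (F i)]
  [∀ i, Algebra R (F i)] {ι : Fin n → Type w} [∀ i, Fintype (ι i)]
  (φ : ∀ i, SymmFrobenius R (F i)) (b : ∀ i, Module.Basis (ι i) R (F i)) (k : ℤ)

/-- The sorted word of a tuple of words. -/
def sortedWord (A : TensorCat R fun i => Heis (φ i) (b i) k) : List (Strand × Fin n) :=
  sorted (List.finRange n) fun i => (A.obj i).word

variable {φ b k} in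
/-- `sortM`, on the morphisms of the tensor product of the categories. -/
noncomputable def sortHom (A A' : TensorCat R fun i => Heis (φ i) (b i) k) : (A ⟶ A') →ₗ[R]
    (presData (HeisRel (SymmFrobenius.directSum φ) (Pi.basis b) k)).Total :=
  sortM φ b k (fun i => (A.obj i).word) (fun i => (A'.obj i).word)

variable {φ b k} in
lemma sortHom_isHom {A A' : TensorCat R fun i => Heis (φ i) (b i) k} (z : A ⟶ A') :
    (univSum φ b k).strands.IsHom (sortedWord φ b k A) (sortedWord φ b k A') (sortHom A A' z) :=
  sortM_isHom (φ := φ) (b := b) (k := k) (a := fun i => (A.obj i).word)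
    (a' := fun i => (A'.obj i).word) z

lemma sortHom_comp {A A' A'' : TensorCat R fun i => Heis (φ i) (b i) k} (z : A ⟶ A')
    (z' : A' ⟶ A'') : sortHom A A'' (z ≫ z') = sortHom A A' z ⊙ sortHom A' A'' z' :=
  sortM_comp (φ := φ) (b := b) (k := k) (a := fun i => (A.obj i).word)
    (a' := fun i => (A'.obj i).word) (a'' := fun i => (A''.obj i).word) z z'

lemma sortHom_id (A : TensorCat R fun i => Heis (φ i) (b i) k) :
    sortHom A A (𝟙 A) = (univSum φ b k).strands.E (sortedWord φ b k A) :=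
  sortM_id (φ := φ) (b := b) (k := k) fun i => (A.obj i).word

lemma totalHom_hom_injective {P P' : PKHeis φ b k} {f g : P ⟶ P'}
    (e : totalHom P.obj P'.obj f.hom = totalHom P.obj P'.obj g.hom) : f = g :=
  ObjectProperty.hom_ext _ (totalHom_injective e)

/-- The functor that maps a tuple of words to its sorted word. -/
noncomputable def sortFunctor : TensorCat R (fun i => Heis (φ i) (b i) k) ⥤ PKHeis φ b k where
  obj A := ⟨wordObj φ b k (sortedWord φ b k A), isPartialKaroubi_wordObj φ b k _⟩
  map z := ObjectProperty.homMk (wordHom (sortHom_isHom z))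
  map_id A := totalHom_hom_injective φ b k <| by
    refine (totalHom_wordHom (sortHom_isHom (𝟙 A))).trans ((sortHom_id φ b k A).trans ?_)
    rw [← totalIdem_wordObj]; rfl
  map_comp z z' := totalHom_hom_injective φ b k <| by
    refine (totalHom_wordHom (sortHom_isHom (z ≫ z'))).trans ((sortHom_comp φ b k z z').trans ?_)
    refine Eq.trans ?_ (totalHom_comp _ _).symm
    exact congrArg₂ _ (totalHom_wordHom (sortHom_isHom z)).symm
      (totalHom_wordHom (sortHom_isHom z')).symm

lemma totalHom_sortFunctor_map {A A' : TensorCat R fun i => Heis (φ i) (b i) k} (z : A ⟶ A') :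
    totalHom _ _ ((sortFunctor φ b k).map z).hom = sortHom A A' z :=
  totalHom_wordHom (sortHom_isHom z)

instance : (sortFunctor φ b k).Additive where
  map_add {A A' z z'} := totalHom_hom_injective φ b k <| by
    rw [totalHom_sortFunctor_map, map_add, ← totalHom_sortFunctor_map, ← totalHom_sortFunctor_map]
    exact (map_add (totalHom _ _) _ _).symm

instance : (sortFunctor φ b k).Linear R where
  map_smul {A A'} z r := totalHom_hom_injective φ b k <| by
    rw [totalHom_sortFunctor_map, map_smul, ← totalHom_sortFunctor_map]
    exact (map_smul (totalHom _ _) _ _).symm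

instance : (sortFunctor φ b k).Faithful where
  map_injective {A A' z z'} e := by
    have e' : sortHom A A' z = sortHom A A' z' := by
      rw [← totalHom_sortFunctor_map, e, totalHom_sortFunctor_map]
    exact sortM_injective (φ := φ) (b := b) (k := k) (a := fun i => (A.obj i).word)
      (a' := fun i => (A'.obj i).word) e'

instance : (sortFunctor φ b k).Full where
  map_surjective {A A'} f := by
    have hl := totalIdem_vcomp f.hom
    have hr := vcomp_totalIdem f.hom
    obtain ⟨z, hz⟩ := exists_sortM (a := fun i => (A.obj i).word)
      (a' := fun i => (A'.obj i).word) (wordObj_word φ b k _).symm (wordObj_word φ b k _).symm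
      f.hom.f (by rw [← totalIdem_wordObj]; exact hl) (by rw [← totalIdem_wordObj]; exact hr)
    refine ⟨z, totalHom_hom_injective φ b k ?_⟩
    exact (totalHom_sortFunctor_map φ b k (A := A) (A' := A') z).trans hz

instance : (sortFunctor φ b k).EssSurj where
  mem_essImage P := by
    obtain ⟨P, hP⟩ := P
    obtain ⟨X, rfl⟩ := exists_wordObj φ b k hP
    -- The list of all colours is the list that defines `sortedWord`, so the sorting isomorphism
    -- ends at an object in the image of the functor.
    obtain ⟨a, f, g, hf, hg, hfg, hgf⟩ := (univSum φ b k).exists_sorted_iso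
      (List.nodup_finRange n) X fun s _ => List.mem_finRange s.2
    exact ⟨⟨fun i => ⟨a i⟩⟩, ⟨ObjectProperty.isoMk _ ⟨wordHom hg, wordHom hf,
      wordHom_comp_eq_id hg hf hgf, wordHom_comp_eq_id hf hg hfg⟩⟩⟩

end Equivalence

end FrobHeis

theorem mainTheorem1 {R : Type u} [CommRing R] {n : ℕ} {F : Fin n → Type v}
    [∀ i, Ring (F i)] [∀ i, Algebra R (F i)] {ι : Fin n → Type w} [∀ i, Fintype (ι i)]
    (φ : ∀ i, FrobHeis.SymmFrobenius R (F i)) (b : ∀ i, Module.Basis (ι i) R (F i)) (k : ℤ) :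
    ∃ e : FrobHeis.PKHeis φ b k ≌
        FrobHeis.TensorCat R (fun i => FrobHeis.Heis (φ i) (b i) k),
      e.functor.Additive ∧ e.functor.Linear R := by
  have : (FrobHeis.sortFunctor φ b k).IsEquivalence := { }
  let e := (FrobHeis.sortFunctor φ b k).asEquivalence
  have : e.functor.Additive := inferInstanceAs (FrobHeis.sortFunctor φ b k).Additive
  have : e.functor.Linear R := inferInstanceAs ((FrobHeis.sortFunctor φ b k).Linear R)
  -- The sorting functor starts at the tensor product, so the equivalence asked for is its inverse,
  -- which inherits additivity and linearity.
  exact ⟨e.symm, e.inverse_additive, e.inverseLinear R⟩
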